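/- **Setting.** Let $\gamma\in(0,1]$, $\nu\in\{0,1\}$, $T>0$, $\varepsilon_0>0$, $M_x>\sqrt2$, $M_y>\sqrt{1+\gamma^{-1/2}}$, and consider $$\dot x=\big(\gamma(y^3-y)+X(t,x,y,\varepsilon)\varepsilon\big)\varepsilon^\nu,\qquad \dot y=\big(-(x^3-x)+Y(t,x,y,\varepsilon)\varepsilon\big)\varepsilon^\nu, \tag{1}$$ where $X,Y$ are $T$-periodic in $t$ and, for $t\in\mathbb R$, $|x|<M_x$, $|y|<M_y$, $\varepsilon\in[0,\varepsilon_0)$, are continuous together with their partial derivatives in $(x,y,\varepsilon)$ up to order $3$. Put $M=\min\{\gamma(M_y^2-1)^2,(M_x^2-1)^2\}$. Let $k,l\in\{0,\pm1\}$, $(k,l)\ne(0,\pm1)$, and let $b\in\mathbb R$ satisfy * $b\in\big(0,\sqrt{1-\sqrt{1-\gamma}}\big)$ or $b\in\big(\sqrt{1+\sqrt{1-\gamma}},\sqrt{1+\sqrt{M-\gamma}}\big)$ if $k=l=0$; * $kb\in\big(1,\sqrt{1+\sqrt{1-\gamma}}\big)$ if $k=\pm1$, $l=0$; * $kb\in\big(1,\sqrt{1+\sqrt{\gamma}}\big)$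 if $k,l=\pm1$. Let $(C,S)$ be the solution of $C'=\gamma(S^3-S)$, $S'=-(C^3-C)$, $C(0)=b$, $S(0)=l$; it is periodic, and $\omega>0$ denotes its least period. For a function $v(t,\varphi)$ let $\overline v=\frac1{\omega T}\int_0^\omega\int_0^T v\,dt\,d\varphi$. Put $$\alpha=C'(S-l)-(C-k)S',\qquad p=3\gamma CS\big((S^2-1)(C-k)^2-(C^2-1)(S-l)^2\big),$$ $$q=\alpha^{-2}\big((C-k)^3(2C+k)+\gamma(S-l)^3(2S+l)\big),\qquad \beta(\varphi)=\int_0^\varphi\alpha^{-1}\big(\alpha'q-\alpha^{-1}p\big)ds,$$ $$R(t,\varphi,r)=C'\,Y(t,C+(C-k)r,S+(S-l)r,0)-S'\,X(t,C+(C-k)r,S+(S-l)r,0),\quad R^o=R|_{r=0},$$ $$\Phi^o=\alpha^{-1}\big((S-l)X(t,C,S,0)-(C-k)Y(t,C,S,0)\big),\qquad Z=\alpha^{-1}\,\partial_rR|_{r=0}-2\beta R^o+\alpha^{-1}\alpha'\Phi^o.$$ The parameter $b$ is called *admissible* if 1. $\overline{R^o}=0$; 2. if $|k|+|l|=1$,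 then $\gamma\le0.806$ and $kb\in(b^-,b^+)$, where $b^-=1.01$ for $\gamma\le0.2$, $b^-=0.2\gamma+0.97$ for $0.2\le\gamma\le0.75$, $b^-=0.6\gamma+0.67$ for $\gamma\ge0.75$, and $b^+=\sqrt{1+\sqrt{1-\gamma}}$ for $\gamma\le0.5$, $b^+=\sqrt{1+\tfrac12\sqrt{3.25-\gamma-3\gamma^2}}$ for $\gamma\ge0.5$; 3. if $\nu=0$, there are $K>0$, $\tau\ge1$ with $|mT-n\omega|>K(m+n)^{-\tau}$ for all positive integers $m,n$; 4. $L^\nu\ne0$, where $L^0=\overline Z-\overline{\,q\,\partial_\varphi g\,}$, $g$ being the solution with zero average, $T$-periodic in $t$, $\omega$-periodic and real analytic in $\varphi$, of $\partial_tg+\partial_\varphi g=R^o-\overline{R^o}$, and $L^1=\overline Z-\overline{\widehat R\,q}$, $\widehat R(\varphi)=\frac1T\int_0^TR^o\,dt-\overline{R^o}$. **Theorem 1.** Let $b$ be admissible and, if $\nu=0$, let $R^o(t,\varphi)$ be real analytic in $\varphi$ uniformly in $t$ (that is, for some $\delta>0$ it extends to a continuous function on $\mathbb R\times\{|\operatorname{Im}\varphi|<\delta\}$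 that is holomorphic in $\varphi$). Then there are $\varepsilon_1\in(0,\varepsilon_0]$ and $K_1$ such that for every $\varepsilon\in(0,\varepsilon_1)$ there is a $C^1$ function $\Upsilon(t,\varphi)$, $T$-periodic in $t$ and $\omega$-periodic in $\varphi$, with $|\Upsilon|\le K_1\varepsilon$, for which the surface $$x=C(\varphi)+\Upsilon(t,\varphi)(C(\varphi)-k),\qquad y=S(\varphi)+\Upsilon(t,\varphi)(S(\varphi)-l)\qquad(t,\varphi\in\mathbb R)$$ is invariant for system (1): through each of its points there passes a solution defined for all $t\in\mathbb R$ and contained in the surface, and each solution that meets the surface stays in it. So the surface lies within $O(\varepsilon)$ of the cylinder over the closed orbit $(C,S)$ through $(b,l)$. When $t$ is taken modulo $T$, the surface becomes a torus: $(t,\varphi)\mapsto(t,x,y)$ induces a homeomorphism of $\mathbb R/T\mathbb Z\times\mathbb R/\omega\mathbb Z$ onto it. -/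

import Mathlib

open Set Function

noncomputable section

/-- The set of phase variables and parameters `(x, y, ε)` on which the perturbation is given. -/
def perturbationDomain (Mx My ε₀ : ℝ) : Set (ℝ × ℝ × ℝ) :=
  {p | |p.1| < Mx ∧ |p.2.1| < My ∧ 0 ≤ p.2.2 ∧ p.2.2 < ε₀}

/-- `F(t, x, y, ε)` is of class `C³` in `(x, y, ε)` on the domain (one-sided in `ε` at `0`), and
`F` and its derivatives in `(x, y, ε)` up to order `3` are continuous in all variables together. -/
def IsC3InPhase (Mx My ε₀ : ℝ) (F : ℝ → ℝ → ℝ → ℝ → ℝ) : Prop :=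
  (∀ t, ContDiffOn ℝ 3 (fun p : ℝ × ℝ × ℝ => F t p.1 p.2.1 p.2.2)
      (perturbationDomain Mx My ε₀)) ∧
  ∀ j : ℕ, j ≤ 3 →
    ContinuousOn
      (fun s : ℝ × ℝ × ℝ × ℝ =>
        iteratedFDerivWithin ℝ j (fun p : ℝ × ℝ × ℝ => F s.1 p.1 p.2.1 p.2.2)
          (perturbationDomain Mx My ε₀) s.2)
      (univ ×ˢ perturbationDomain Mx My ε₀)

/-- The data of the `T`-periodic system
`x' = (γ (y³ - y) + X(t,x,y,ε) ε) ε^ν`, `y' = (-(x³ - x) + Y(t,x,y,ε) ε) ε^ν`, `ν ∈ {0, 1}`. -/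
structure PerturbedSystem where
  γ : ℝ
  ν : ℕ
  T : ℝ
  Mx : ℝ
  My : ℝ
  ε₀ : ℝ
  X : ℝ → ℝ → ℝ → ℝ → ℝ
  Y : ℝ → ℝ → ℝ → ℝ → ℝ
  γ_pos : 0 < γ
  γ_le_one : γ ≤ 1
  ν_eq : ν = 0 ∨ ν = 1
  T_pos : 0 < T
  lt_Mx : √2 < Mx
  lt_My : √(1 + (√γ)⁻¹) < My
  ε₀_pos : 0 < ε₀
  X_C3 : IsC3InPhase Mx My ε₀ X
  Y_C3 : IsC3InPhase Mx My ε₀ Y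
  X_periodic : ∀ t x y ε, (x, y, ε) ∈ perturbationDomain Mx My ε₀ → X (t + T) x y ε = X t x y ε
  Y_periodic : ∀ t x y ε, (x, y, ε) ∈ perturbationDomain Mx My ε₀ → Y (t + T) x y ε = Y t x y ε

namespace PerturbedSystem

/-- `(x, y)` solves the perturbed system with parameter `ε` on the (open) set of times `J`. -/
def IsSolutionOn (P : PerturbedSystem) (ε : ℝ) (J : Set ℝ) (x y : ℝ → ℝ) : Prop :=
  ∀ t ∈ J, |x t| < P.Mx ∧ |y t| < P.My ∧
    HasDerivAt x ((P.γ * (y t ^ 3 - y t) + P.X t (x t) (y t) ε * ε) * ε ^ P.ν) t ∧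
    HasDerivAt y ((-(x t ^ 3 - x t) + P.Y t (x t) (y t) ε * ε) * ε ^ P.ν) t

/-- Invariance of a set `M` of points `(t, x, y)`: through every point of `M` there passes a
solution defined for all times whose graph lies in `M`, and every solution whose graph meets `M`
has its whole graph in `M`. -/
def IsInvariant (P : PerturbedSystem) (ε : ℝ) (M : Set (ℝ × ℝ × ℝ)) : Prop :=
  (∀ m ∈ M, ∃ x y : ℝ → ℝ, P.IsSolutionOn ε univ x y ∧ x m.1 = m.2.1 ∧ y m.1 = m.2.2 ∧
    ∀ t, (t, x t, y t) ∈ M) ∧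
  ∀ (J : Set ℝ) (x y : ℝ → ℝ), IsOpen J → J.OrdConnected → P.IsSolutionOn ε J x y →
    ∀ t₀ ∈ J, (t₀, x t₀, y t₀) ∈ M → ∀ t ∈ J, (t, x t, y t) ∈ M

/-- `a < orbitBound` means that the level set `(x² - 1)² + γ (y² - 1)² = a` lies in the domain. -/
def orbitBound (P : PerturbedSystem) : ℝ :=
  min (P.γ * (P.My ^ 2 - 1) ^ 2) ((P.Mx ^ 2 - 1) ^ 2)

/-- The admitted shifts `(k, l)` and starting abscissas `b` of the closed orbits of the unperturbed
system: inner and outer orbits around the origin, orbits around three equilibria, and orbits around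
one equilibrium. -/
def IsOrbitParameter (P : PerturbedSystem) (k l : ℤ) (b : ℝ) : Prop :=
  (k = 0 ∧ l = 0 ∧
    (b ∈ Ioo 0 √(1 - √(1 - P.γ)) ∨
      b ∈ Ioo √(1 + √(1 - P.γ)) √(1 + √(P.orbitBound - P.γ)))) ∨
  ((k = 1 ∨ k = -1) ∧ l = 0 ∧ (k : ℝ) * b ∈ Ioo 1 √(1 + √(1 - P.γ))) ∨
  ((k = 1 ∨ k = -1) ∧ (l = 1 ∨ l = -1) ∧ (k : ℝ) * b ∈ Ioo 1 √(1 + √P.γ))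

end PerturbedSystem

/-- `(C, S)` is the solution of `C' = γ (S³ - S)`, `S' = -(C³ - C)`, `C(0) = b`, `S(0) = l`. -/
structure IsUnperturbedOrbit (γ : ℝ) (l : ℤ) (b : ℝ) (C S : ℝ → ℝ) : Prop where
  deriv_C : ∀ φ, HasDerivAt C (γ * (S φ ^ 3 - S φ)) φ
  deriv_S : ∀ φ, HasDerivAt S (-(C φ ^ 3 - C φ)) φ
  C_zero : C 0 = b
  S_zero : S 0 = l

/-- The least positive period of `φ ↦ (C φ, S φ)`. -/
def orbitPeriod (C S : ℝ → ℝ) : ℝ :=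
  sInf {w | 0 < w ∧ Periodic C w ∧ Periodic S w}

/-- Lower end of the interval for `k b` in the class `|k| + |l| = 1`. -/
def bMinus (γ : ℝ) : ℝ :=
  if γ ≤ 0.2 then 1.01 else if γ ≤ 0.75 then 0.2 * γ + 0.97 else 0.6 * γ + 0.67

/-- Upper end of the interval for `k b` in the class `|k| + |l| = 1`. -/
def bPlus (γ : ℝ) : ℝ :=
  if γ ≤ 0.5 then √(1 + √(1 - γ)) else √(1 + √(3.25 - γ - 3 * γ ^ 2) / 2)

/-- The Siegel condition on two periods. -/
def Siegel (T ω : ℝ) : Prop :=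
  ∃ K τ : ℝ, 0 < K ∧ 1 ≤ τ ∧ ∀ p q : ℕ, 0 < p → 0 < q →
    K * ((p : ℝ) + q) ^ (-τ) < |p * T - q * ω|

/-- The average of `v(t, φ)` over `[0, T] × [0, ω]`. -/
def average (T ω : ℝ) (v : ℝ → ℝ → ℝ) : ℝ :=
  1 / (ω * T) * ∫ φ in (0 : ℝ)..ω, ∫ t in (0 : ℝ)..T, v t φ

/-- The `φ`-dependent part `v̂(φ)` of the mean of `v(t, φ)` over `t`. -/
def hatPart (T ω : ℝ) (v : ℝ → ℝ → ℝ) (φ : ℝ) : ℝ :=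
  1 / T * (∫ t in (0 : ℝ)..T, v t φ) - average T ω v

/-- `v(t, φ)` is real analytic in `φ`, uniformly in `t`: it extends to a continuous function on
`ℝ × {|Im z| < δ}` that is holomorphic in `z`. -/
def IsAnalyticInAngle (v : ℝ → ℝ → ℝ) : Prop :=
  ∃ δ > 0, ∃ F : ℝ → ℂ → ℂ,
    ContinuousOn (uncurry F) (univ ×ˢ {z : ℂ | |z.im| < δ}) ∧
    (∀ t, DifferentiableOn ℂ (F t) {z : ℂ | |z.im| < δ}) ∧
    ∀ t φ : ℝ, F t φ = v t φ

/-- `g` is a two-periodic solution with zero average of `∂g/∂t + ∂g/∂φ = v`, analytic in `φ`. -/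
structure IsHomologicalSolution (T ω : ℝ) (v g : ℝ → ℝ → ℝ) : Prop where
  contDiff : ContDiff ℝ 1 (uncurry g)
  analytic : IsAnalyticInAngle g
  periodic_t : ∀ t φ, g (t + T) φ = g t φ
  periodic_φ : ∀ t φ, g t (φ + ω) = g t φ
  average_eq_zero : average T ω g = 0
  equation : ∀ t φ, deriv (fun s => g s φ) t + deriv (g t) φ = v t φ

/-- The solution of `∂g/∂t + ∂g/∂φ = v` described by `IsHomologicalSolution`; it exists and is
unique if `v` is continuous, two-periodic with zero average and analytic in `φ`, and the periods
satisfy the Siegel condition. -/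
def homologicalSolution (T ω : ℝ) (v : ℝ → ℝ → ℝ) : ℝ → ℝ → ℝ :=
  Classical.epsilon (IsHomologicalSolution T ω v)

/-- The functions attached to an orbit `(C, S)` that is observed from the point `(k, l)`. -/
def alphaFun (k l : ℤ) (C S : ℝ → ℝ) (φ : ℝ) : ℝ :=
  deriv C φ * (S φ - l) - (C φ - k) * deriv S φ

def pFun (γ : ℝ) (k l : ℤ) (C S : ℝ → ℝ) (φ : ℝ) : ℝ :=
  3 * γ * C φ * S φ * ((S φ ^ 2 - 1) * (C φ - k) ^ 2 - (C φ ^ 2 - 1) * (S φ - l) ^ 2)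

def qFun (γ : ℝ) (k l : ℤ) (C S : ℝ → ℝ) (φ : ℝ) : ℝ :=
  (alphaFun k l C S φ ^ 2)⁻¹ *
    ((C φ - k) ^ 3 * (2 * C φ + k) + γ * (S φ - l) ^ 3 * (2 * S φ + l))

def xiFun (γ : ℝ) (k l : ℤ) (C S : ℝ → ℝ) (φ : ℝ) : ℝ :=
  (alphaFun k l C S φ)⁻¹ *
    (deriv (alphaFun k l C S) φ * qFun γ k l C S φ
      - (alphaFun k l C S φ)⁻¹ * pFun γ k l C S φ)

def betaFun (γ : ℝ) (k l : ℤ) (C S : ℝ → ℝ) (φ : ℝ) : ℝ :=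
  ∫ s in (0 : ℝ)..φ, xiFun γ k l C S s

namespace PerturbedSystem

/-- `R(t, φ, r, ε) = C' Y - S' X` at the point `(t, C + (C - k) r, S + (S - l) r, ε)`. -/
def R (P : PerturbedSystem) (k l : ℤ) (C S : ℝ → ℝ) (t φ r ε : ℝ) : ℝ :=
  deriv C φ * P.Y t (C φ + (C φ - k) * r) (S φ + (S φ - l) * r) ε
    - deriv S φ * P.X t (C φ + (C φ - k) * r) (S φ + (S φ - l) * r) ε

/-- `R` at `r = ε = 0`, that is, `C' Y(t, C, S, 0) - S' X(t, C, S, 0)`. -/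
def Ro (P : PerturbedSystem) (k l : ℤ) (C S : ℝ → ℝ) (t φ : ℝ) : ℝ :=
  P.R k l C S t φ 0 0

/-- `α⁻¹ ((S - l) X(t, C, S, 0) - (C - k) Y(t, C, S, 0))`. -/
def PhiO (P : PerturbedSystem) (k l : ℤ) (C S : ℝ → ℝ) (t φ : ℝ) : ℝ :=
  (alphaFun k l C S φ)⁻¹ *
    ((S φ - l) * P.X t (C φ) (S φ) 0 - (C φ - k) * P.Y t (C φ) (S φ) 0)

/-- `Z = α⁻¹ ∂R/∂r - 2 β R + α⁻¹ α' Φ` at `r = ε = 0`. -/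
def Z (P : PerturbedSystem) (k l : ℤ) (C S : ℝ → ℝ) (t φ : ℝ) : ℝ :=
  (alphaFun k l C S φ)⁻¹ * deriv (fun r => P.R k l C S t φ r 0) 0
    - 2 * betaFun P.γ k l C S φ * P.Ro k l C S t φ
    + (alphaFun k l C S φ)⁻¹ * deriv (alphaFun k l C S) φ * P.PhiO k l C S t φ

/-- The solution `g` of `∂g/∂t + ∂g/∂φ = R° - (average of R°)`. -/
def g0 (P : PerturbedSystem) (k l : ℤ) (C S : ℝ → ℝ) : ℝ → ℝ → ℝ :=
  homologicalSolution P.T (orbitPeriod C S)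
    (fun t φ => P.Ro k l C S t φ - average P.T (orbitPeriod C S) (P.Ro k l C S))

/-- The dissipativity constant: the average of `Z - (∂g/∂φ) q` for `ν = 0`, and the average of `Z`
minus the average of `R̂° q` for `ν = 1`. -/
def L (P : PerturbedSystem) (k l : ℤ) (C S : ℝ → ℝ) : ℝ :=
  if P.ν = 0 then
    average P.T (orbitPeriod C S) (P.Z k l C S)
      - average P.T (orbitPeriod C S)
          (fun t φ => deriv (P.g0 k l C S t) φ * qFun P.γ k l C S φ)
  else
    average P.T (orbitPeriod C S) (P.Z k l C S)
      - average P.T (orbitPeriod C S)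
          (fun _ φ => hatPart P.T (orbitPeriod C S) (P.Ro k l C S) φ * qFun P.γ k l C S φ)

/-- Admissibility of the parameter `b` for the shift `(k, l)`, where `(C, S)` is the orbit through
`(b, l)`. -/
structure IsAdmissible (P : PerturbedSystem) (k l : ℤ) (b : ℝ) (C S : ℝ → ℝ) : Prop where
  parameter : P.IsOrbitParameter k l b
  generating : average P.T (orbitPeriod C S) (P.Ro k l C S) = 0
  classOne : |k| + |l| = 1 → P.γ ≤ 0.806 ∧ (k : ℝ) * b ∈ Ioo (bMinus P.γ) (bPlus P.γ)
  siegel : P.ν = 0 → Siegel P.T (orbitPeriod C S)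
  dissipative : P.L k l C S ≠ 0

end PerturbedSystem

/-- The point of the surface with coordinates `(t, φ)`, for a radial function `U(t, φ)`. -/
def surfacePoint (k l : ℤ) (C S : ℝ → ℝ) (U : ℝ → ℝ → ℝ) (t φ : ℝ) : ℝ × ℝ :=
  (C φ + U t φ * (C φ - k), S φ + U t φ * (S φ - l))

/-- The surface in the space of `(t, x, y)`. -/
def surface (k l : ℤ) (C S : ℝ → ℝ) (U : ℝ → ℝ → ℝ) : Set (ℝ × ℝ × ℝ) :=
  range fun s : ℝ × ℝ => (s.1, surfacePoint k l C S U s.1 s.2)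

/-- The surface with time factored by the period `T`. -/
def factoredSurface (T : ℝ) (k l : ℤ) (C S : ℝ → ℝ) (U : ℝ → ℝ → ℝ) :
    Set (AddCircle T × ℝ × ℝ) :=
  range fun s : ℝ × ℝ => ((s.1 : AddCircle T), surfacePoint k l C S U s.1 s.2)

end

/-! ### Global solutions of bounded Lipschitz differential equations -/

section GlobalFlow

open scoped NNReal

variable {E : Type*} [NormedAddCommGroup E] [NormedSpace ℝ E]

/-- A time-dependent vector field that is continuous, bounded and uniformly Lipschitz. -/
structure IsFlowField (G : ℝ → E → E) (K : ℝ≥0) (M : ℝ) : Prop where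
  cont : Continuous (uncurry G)
  lip : ∀ t, LipschitzWith K (G t)
  bdd : ∀ t z, ‖G t z‖ ≤ M

/-- `z` is a solution, defined for all times, of `z' = G(t, z)`. -/
def IsGlobalSol (G : ℝ → E → E) (z : ℝ → E) : Prop := ∀ t, HasDerivAt z (G t (z t)) t

variable {G : ℝ → E → E} {K : ℝ≥0} {M : ℝ}

theorem IsGlobalSol.continuous {z : ℝ → E} (hz : IsGlobalSol G z) : Continuous z :=
  continuous_iff_continuousAt.2 fun t => (hz t).continuousAt

theorem IsFlowField.sol_unique (hG : IsFlowField G K M) {z₁ z₂ : ℝ → E}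
    (h₁ : IsGlobalSol G z₁) (h₂ : IsGlobalSol G z₂) {t₀ : ℝ} (h : z₁ t₀ = z₂ t₀) : z₁ = z₂ :=
  ODE_solution_unique_univ (s := fun _ => univ) (K := K) (v := G)
    (fun t => (hG.lip t).lipschitzOnWith) (fun t => ⟨h₁ t, trivial⟩) (fun t => ⟨h₂ t, trivial⟩) h

theorem IsFlowField.exists_sol [CompleteSpace E] (hG : IsFlowField G K M) (t₀ : ℝ) (z₀ : E) :
    ∃ z : ℝ → E, z t₀ = z₀ ∧ IsGlobalSol G z := by
  have hM : 0 ≤ M := (norm_nonneg _).trans (hG.bdd 0 0)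
  have key : ∀ n : ℕ, ∃ z : ℝ → E, z t₀ = z₀ ∧
      ∀ t ∈ Ioo (t₀ - (n + 1)) (t₀ + (n + 1)), HasDerivAt z (G t (z t)) t := by
    intro n
    have hn : (0 : ℝ) < n + 1 := by positivity
    have hpl : IsPicardLindelof (tmin := t₀ - (n + 1)) (tmax := t₀ + (n + 1)) G
        ⟨t₀, by constructor <;> linarith⟩ z₀ ⟨M * (n + 1), by positivity⟩ 0 ⟨M, hM⟩ K := by
      refine ⟨fun t _ => (hG.lip t).lipschitzOnWith, fun x _ => ?_, fun t _ x _ => hG.bdd t x, ?_⟩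
      · exact (hG.cont.comp (by fun_prop : Continuous fun t : ℝ => (t, x))).continuousOn
      · simp only [sub_sub_cancel, add_sub_cancel_left, max_self, NNReal.coe_zero, sub_zero]
        exact le_rfl
    obtain ⟨z, hz0, hz⟩ := hpl.exists_eq_forall_mem_Icc_hasDerivWithinAt₀
    exact ⟨z, hz0, fun t ht => (hz t (Ioo_subset_Icc_self ht)).hasDerivAt (Icc_mem_nhds ht.1 ht.2)⟩
  choose z hz0 hz using key
  have huniq : ∀ n m : ℕ, ∀ t, |t - t₀| < n + 1 → |t - t₀| < m + 1 → z n t = z m t := by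
    intro n m t hn hm
    wlog hnm : n ≤ m generalizing n m
    · exact (this m n hm hn (le_of_not_ge hnm)).symm
    have hnm' : (n : ℝ) ≤ m := by exact_mod_cast hnm
    have hn0 : (0 : ℝ) ≤ n := by positivity
    rw [abs_lt] at hn
    refine ODE_solution_unique_of_mem_Ioo (s := fun _ => univ) (K := K) (v := G) (t₀ := t₀)
      (a := t₀ - (n + 1)) (b := t₀ + (n + 1))
      (fun t _ => (hG.lip t).lipschitzOnWith) (by constructor <;> linarith)
      (fun t ht => ⟨hz n t ht, trivial⟩)
      (fun t ht => ⟨hz m t ⟨by linarith [ht.1], by linarith [ht.2]⟩, trivial⟩)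
      ((hz0 n).trans (hz0 m).symm) ⟨by linarith, by linarith⟩
  refine ⟨fun t => z ⌈|t - t₀|⌉₊ t, ?_, fun t => ?_⟩
  · simp only [sub_self, abs_zero, Nat.ceil_zero]; exact hz0 0
  · set n := ⌈|t - t₀|⌉₊ + 1 with hn
    have h1 : |t - t₀| < n := by
      rw [hn]; push_cast; linarith [Nat.le_ceil |t - t₀|]
    have heq : (fun s => z ⌈|s - t₀|⌉₊ s) =ᶠ[nhds t] z n := by
      have : ∀ᶠ s in nhds t, |s - t₀| < n :=
        (by fun_prop : Continuous fun s : ℝ => |s - t₀|).continuousAt.eventually_lt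
          continuousAt_const h1
      filter_upwards [this] with s hs
      exact huniq _ _ s (by linarith [Nat.le_ceil |s - t₀|]) (by linarith)
    have h2 : z ⌈|t - t₀|⌉₊ t = z n t := heq.eq_of_nhds
    simp only [h2]
    refine (hz n t ?_).congr_of_eventuallyEq heq
    rw [abs_lt] at h1
    constructor <;> linarith

theorem IsFlowField.norm_sub_le (hG : IsFlowField G K M) {z : ℝ → E} (hz : IsGlobalSol G z)
    (s t : ℝ) : ‖z t - z s‖ ≤ M * |t - s| :=
  Convex.norm_image_sub_le_of_norm_hasDerivWithin_le (f := z) (f' := fun t => G t (z t)) (s := univ)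
    (fun t _ => (hz t).hasDerivWithinAt) (fun t _ => hG.bdd t _) convex_univ trivial trivial

/-- The reversed field. -/
theorem IsFlowField.reverse (hG : IsFlowField G K M) :
    IsFlowField (fun t z => -G (-t) z) K M where
  cont := (hG.cont.comp (by fun_prop : Continuous fun p : ℝ × E => (-p.1, p.2))).neg
  lip t := (hG.lip (-t)).neg
  bdd t z := by rw [norm_neg]; exact hG.bdd _ _

theorem IsGlobalSol.reverse {z : ℝ → E} (hz : IsGlobalSol G z) :
    IsGlobalSol (fun t z => -G (-t) z) (fun t => z (-t)) := fun t => by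
  have := (hz (-t)).scomp t (hasDerivAt_neg t)
  simpa [Function.comp_def] using this

theorem IsFlowField.dist_le_of_le (hG : IsFlowField G K M) {z₁ z₂ : ℝ → E}
    (h₁ : IsGlobalSol G z₁) (h₂ : IsGlobalSol G z₂) {t₀ t : ℝ} (h : t₀ ≤ t) :
    dist (z₁ t) (z₂ t) ≤ dist (z₁ t₀) (z₂ t₀) * Real.exp (K * (t - t₀)) :=
  dist_le_of_trajectories_ODE (b := t) hG.lip h₁.continuous.continuousOn
    (fun s _ => (h₁ s).hasDerivWithinAt) h₂.continuous.continuousOn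
    (fun s _ => (h₂ s).hasDerivWithinAt) le_rfl t ⟨h, le_rfl⟩

theorem IsFlowField.dist_le (hG : IsFlowField G K M) {z₁ z₂ : ℝ → E}
    (h₁ : IsGlobalSol G z₁) (h₂ : IsGlobalSol G z₂) (t₀ t : ℝ) :
    dist (z₁ t) (z₂ t) ≤ dist (z₁ t₀) (z₂ t₀) * Real.exp (K * |t - t₀|) := by
  rcases le_total t₀ t with h | h
  · rw [abs_of_nonneg (by linarith)]; exact hG.dist_le_of_le h₁ h₂ h
  · have := hG.reverse.dist_le_of_le h₁.reverse h₂.reverse (t₀ := -t₀) (t := -t) (by linarith)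
    simp only [neg_neg] at this
    rw [abs_of_nonpos (by linarith)]
    convert this using 3
    ring

end GlobalFlow


/-! ### Invariant graphs of planar systems with an expanding cone field -/

section InvariantGraph

open scoped NNReal

/-- A planar system `z' = G(t, z)`, `z = (φ, v)`, with a strip `|w| ≤ 1` and a cone field
`κ |Δψ| ≤ |Δw|`, where `Wd`, `Ψd` are the derivatives of `w`, `ψ` along solutions. In the time
direction `σ = ±1` solutions leave the strip through its two sides, differences inside the cone grow
at least with rate `a`, and those outside grow at most with rate `a' < a`. -/
structure IsConeSystem (σ : ℝ) (G : ℝ → ℝ × ℝ → ℝ × ℝ) (w ψ Wd Ψd : ℝ → ℝ × ℝ → ℝ) (K : ℝ≥0)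
    (M V V₀ κ a a' c C Λ : ℝ) : Prop where
  flow : IsFlowField G K M
  V₀_lt : V₀ < V
  a'_nonneg : 0 ≤ a'
  a'_lt : a' < a
  κ_pos : 0 < κ
  c_pos : 0 < c
  C_pos : 0 < C
  Λ_nonneg : 0 ≤ Λ
  w_cont : Continuous (uncurry w)
  hasDerivAt_w : ∀ z t, HasDerivAt z (G t (z t)) t → |(z t).2| < V →
    HasDerivAt (fun s => w s (z s)) (Wd t (z t)) t
  hasDerivAt_ψ : ∀ z t, HasDerivAt z (G t (z t)) t → |(z t).2| < V →
    HasDerivAt (fun s => ψ s (z s)) (Ψd t (z t)) t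
  strip : ∀ t z, |z.2| ≤ V → |w t z| ≤ 1 → |z.2| ≤ V₀
  cross : ∀ t, ∃ s : ℝ → ℝ, Continuous s ∧ ∀ φ, |s φ| ≤ V ∧ |w t (φ, s φ)| ≤ 1
  exit_top : ∀ t z, |z.2| ≤ V → w t z = 1 → 0 < σ * Wd t z
  exit_bot : ∀ t z, |z.2| ≤ V → w t z = -1 → σ * Wd t z < 0
  cone : ∀ t z₁ z₂, |z₁.2| < V → |z₂.2| < V → κ * |ψ t z₁ - ψ t z₂| ≤ |w t z₁ - w t z₂| →
    a * (w t z₁ - w t z₂) ^ 2 ≤ σ * ((w t z₁ - w t z₂) * (Wd t z₁ - Wd t z₂)) ∧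
      κ * |Ψd t z₁ - Ψd t z₂| ≤ a' * |w t z₁ - w t z₂|
  slow : ∀ t z₁ z₂, |z₁.2| < V → |z₂.2| < V → |w t z₁ - w t z₂| ≤ κ * |ψ t z₁ - ψ t z₂| →
    |Ψd t z₁ - Ψd t z₂| ≤ a' * |ψ t z₁ - ψ t z₂|
  norm_le : ∀ t z₁ z₂, |z₁.2| < V → |z₂.2| < V → |w t z₁ - w t z₂| ≤ κ * |ψ t z₁ - ψ t z₂| →
    ‖z₁ - z₂‖ ≤ C * |ψ t z₁ - ψ t z₂|
  w_le : ∀ t z₁ z₂, |z₁.2| < V → |z₂.2| < V → |w t z₁ - w t z₂| ≤ C * ‖z₁ - z₂‖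
  ψ_le : ∀ t z₁ z₂, |z₁.2| < V → |z₂.2| < V → |ψ t z₁ - ψ t z₂| ≤ C * ‖z₁ - z₂‖
  vertical : ∀ t z₁ z₂, |z₁.2| < V → |z₂.2| < V → z₁.1 = z₂.1 →
    κ * |ψ t z₁ - ψ t z₂| ≤ |w t z₁ - w t z₂| ∧ c * |z₁.2 - z₂.2| ≤ |w t z₁ - w t z₂|
  horizontal : ∀ t z₁ z₂, |z₁.2| < V → |z₂.2| < V →
    |w t z₁ - w t z₂| ≤ κ * |ψ t z₁ - ψ t z₂| → |z₁.2 - z₂.2| ≤ Λ * |z₁.1 - z₂.1|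
  strict : ∃ G' : ℝ → ℝ × ℝ → (ℝ × ℝ →L[ℝ] ℝ × ℝ), (∀ t z, |z.2| < V → ‖G' t z‖ ≤ K) ∧
    ∀ η > 0, ∃ d > 0, ∀ t z₀ z₁ z₂, |z₀.2| < V → |z₁.2| < V → |z₂.2| < V →
      dist z₁ z₀ < d → dist z₂ z₀ < d →
        ‖G t z₁ - G t z₂ - G' t z₀ (z₁ - z₂)‖ ≤ η * ‖z₁ - z₂‖

namespace IsConeSystem

variable {σ : ℝ} {G : ℝ → ℝ × ℝ → ℝ × ℝ} {w ψ Wd Ψd : ℝ → ℝ × ℝ → ℝ} {K : ℝ≥0}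
    {M V V₀ κ a a' c C Λ : ℝ}

/-- Reversal of time. -/
theorem reverse (h : IsConeSystem σ G w ψ Wd Ψd K M V V₀ κ a a' c C Λ) :
    IsConeSystem (-σ) (fun t z => -G (-t) z) (fun t => w (-t)) (fun t => ψ (-t))
      (fun t z => -Wd (-t) z) (fun t z => -Ψd (-t) z) K M V V₀ κ a a' c C Λ where
  flow := h.flow.reverse
  V₀_lt := h.V₀_lt
  a'_nonneg := h.a'_nonneg
  a'_lt := h.a'_lt
  κ_pos := h.κ_pos
  c_pos := h.c_pos
  C_pos := h.C_pos
  Λ_nonneg := h.Λ_nonneg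
  w_cont := h.w_cont.comp (by fun_prop : Continuous fun p : ℝ × ℝ × ℝ => (-p.1, p.2))
  hasDerivAt_w z t hz hv := by
    have hz' : HasDerivAt (fun s => z (-s)) (G (-t) (z (- -t))) (-t) := by
      have h0 : HasDerivAt z (-G (-t) (z t)) (- -t) := by rw [neg_neg]; exact hz
      have := h0.scomp (-t) (hasDerivAt_neg (-t))
      simpa [Function.comp_def] using this
    have := (h.hasDerivAt_w (fun s => z (-s)) (-t) hz' (by simpa using hv)).comp t (hasDerivAt_neg t)
    simpa [Function.comp_def] using this
  hasDerivAt_ψ z t hz hv := by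
    have hz' : HasDerivAt (fun s => z (-s)) (G (-t) (z (- -t))) (-t) := by
      have h0 : HasDerivAt z (-G (-t) (z t)) (- -t) := by rw [neg_neg]; exact hz
      have := h0.scomp (-t) (hasDerivAt_neg (-t))
      simpa [Function.comp_def] using this
    have := (h.hasDerivAt_ψ (fun s => z (-s)) (-t) hz' (by simpa using hv)).comp t (hasDerivAt_neg t)
    simpa [Function.comp_def] using this
  strip t := h.strip (-t)
  cross t := h.cross (-t)
  exit_top t z hv hw := by rw [neg_mul_neg]; exact h.exit_top (-t) z hv hw
  exit_bot t z hv hw := by rw [neg_mul_neg]; exact h.exit_bot (-t) z hv hw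
  cone t z₁ z₂ h₁ h₂ hc := by
    obtain ⟨h3, h4⟩ := h.cone (-t) z₁ z₂ h₁ h₂ hc
    refine ⟨h3.trans (le_of_eq (by ring)), ?_⟩
    rwa [← neg_sub_neg, neg_neg, neg_neg, abs_sub_comm]
  slow t z₁ z₂ h₁ h₂ hc := by
    have h3 := h.slow (-t) z₁ z₂ h₁ h₂ hc
    rwa [← neg_sub_neg, neg_neg, neg_neg, abs_sub_comm]
  norm_le t := h.norm_le (-t)
  w_le t := h.w_le (-t)
  ψ_le t := h.ψ_le (-t)
  vertical t := h.vertical (-t)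
  horizontal t := h.horizontal (-t)
  strict := by
    obtain ⟨G', hb, hs⟩ := h.strict
    refine ⟨fun t z => -G' (-t) z, fun t z hz => by rw [norm_neg]; exact hb _ _ hz, fun η hη => ?_⟩
    obtain ⟨d, hd, hs⟩ := hs η hη
    refine ⟨d, hd, fun t z₀ z₁ z₂ h0 h1 h2 h3 h4 => ?_⟩
    have := hs (-t) z₀ z₁ z₂ h0 h1 h2 h3 h4
    have e : -G (-t) z₁ - -G (-t) z₂ - (-G' (-t) z₀) (z₁ - z₂) =
        -(G (-t) z₁ - G (-t) z₂ - G' (-t) z₀ (z₁ - z₂)) := by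
      rw [neg_apply]; abel
    rw [e, norm_neg]
    exact this

theorem strip_lt (h : IsConeSystem 1 G w ψ Wd Ψd K M V V₀ κ a a' c C Λ)
    {t : ℝ} {z : ℝ × ℝ} (hv : |z.2| ≤ V) (hw : |w t z| ≤ 1) : |z.2| < V :=
  (h.strip t z hv hw).trans_lt h.V₀_lt

/-- A solution that is in the strip at some time has been there at all earlier times. -/
theorem mem_strip_of_le (h : IsConeSystem 1 G w ψ Wd Ψd K M V V₀ κ a a' c C Λ)
    {z : ℝ → ℝ × ℝ} (hz : IsGlobalSol G z) {t₁ : ℝ}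
    (h₁ : |(z t₁).2| ≤ V ∧ |w t₁ (z t₁)| ≤ 1) {t : ℝ} (ht : t ≤ t₁) :
    |(z t).2| ≤ V ∧ |w t (z t)| ≤ 1 := by
  have hzc := hz.continuous
  have hwc : Continuous fun s => w s (z s) :=
    h.w_cont.comp (by fun_prop : Continuous fun s => (s, z s))
  let A : Set ℝ := {x | |(z (t₁ - x)).2| ≤ V ∧ |w (t₁ - x) (z (t₁ - x))| ≤ 1}
  have hA : IsClosed A := by
    refine IsClosed.inter ?_ ?_
    · exact isClosed_le (by fun_prop : Continuous fun x => |(z (t₁ - x)).2|) continuous_const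
    · exact isClosed_le (hwc.comp (by fun_prop : Continuous fun x : ℝ => t₁ - x)).abs
        continuous_const
  have hev : ∀ τ, |(z τ).2| ≤ V ∧ |w τ (z τ)| ≤ 1 →
      ∀ᶠ s in nhdsWithin τ (Iio τ), |(z s).2| ≤ V ∧ |w s (z s)| ≤ 1 := by
    intro τ hτ
    have hlt := h.strip_lt hτ.1 hτ.2
    have hd := h.hasDerivAt_w z τ (hz τ) hlt
    have e1 : ∀ᶠ s in nhdsWithin τ (Iio τ), |(z s).2| ≤ V := by
      refine nhdsWithin_le_nhds ?_
      filter_upwards [(by fun_prop : Continuous fun s => |(z s).2|).continuousAt.eventually_lt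
        continuousAt_const hlt] with s hs using hs.le
    have hslope := hasDerivAt_iff_tendsto_slope.1 hd
    have hle : nhdsWithin τ (Iio τ) ≤ nhdsWithin τ {τ}ᶜ :=
      nhdsWithin_mono _ fun x hx => ne_of_lt hx
    have eup : ∀ᶠ s in nhdsWithin τ (Iio τ), w s (z s) ≤ 1 := by
      rcases lt_or_eq_of_le (abs_le.1 hτ.2).2 with hlt1 | heq
      · refine nhdsWithin_le_nhds ?_
        filter_upwards [hwc.continuousAt.eventually_lt continuousAt_const hlt1] with s hs using hs.le
      · have hp : 0 < Wd τ (z τ) := by simpa using h.exit_top τ _ hτ.1 heq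
        filter_upwards [hle (hslope.eventually (lt_mem_nhds hp)), self_mem_nhdsWithin] with s hs hs'
        rw [slope_def_field] at hs
        have hs'' : s - τ < 0 := sub_neg.2 hs'
        by_contra hcon
        rw [not_le] at hcon
        exact absurd hs (not_lt.2 (div_nonpos_of_nonneg_of_nonpos (by linarith) hs''.le))
    have edn : ∀ᶠ s in nhdsWithin τ (Iio τ), -1 ≤ w s (z s) := by
      rcases lt_or_eq_of_le (abs_le.1 hτ.2).1 with hlt1 | heq
      · refine nhdsWithin_le_nhds ?_
        filter_upwards [continuousAt_const.eventually_lt hwc.continuousAt hlt1] with s hs using hs.le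
      · have hp : Wd τ (z τ) < 0 := by simpa using h.exit_bot τ _ hτ.1 heq.symm
        filter_upwards [hle (hslope.eventually (gt_mem_nhds hp)), self_mem_nhdsWithin] with s hs hs'
        rw [slope_def_field] at hs
        have hs'' : s - τ < 0 := sub_neg.2 hs'
        by_contra hcon
        rw [not_le] at hcon
        exact absurd hs (not_lt.2 (div_nonneg_of_nonpos (by linarith) hs''.le))
    filter_upwards [e1, eup, edn] with s h1 h2 h3 using ⟨h1, abs_le.2 ⟨h3, h2⟩⟩
  have hsub : Icc 0 (t₁ - t) ⊆ A := by
    refine IsClosed.Icc_subset_of_forall_exists_gt (hA.inter isClosed_Icc) (by simpa [A] using h₁) ?_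
    intro x hx y hy
    have hcomp : Filter.Tendsto (fun s => t₁ - s) (nhdsWithin x (Ioi x))
        (nhdsWithin (t₁ - x) (Iio (t₁ - x))) := by
      refine tendsto_nhdsWithin_of_tendsto_nhds_of_eventually_within _ ?_ ?_
      · exact (by fun_prop : Continuous fun s : ℝ => t₁ - s).continuousAt.mono_left
          nhdsWithin_le_nhds
      · filter_upwards [self_mem_nhdsWithin] with s hs
        simp only [mem_Ioi, mem_Iio] at hs ⊢; linarith
    have h2 := hcomp.eventually (hev (t₁ - x) hx.1)
    obtain ⟨s, hs, hs'⟩ := (h2.and (Ioc_mem_nhdsGT hy)).exists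
    exact ⟨s, hs, hs'⟩
  have := hsub (show t₁ - t ∈ Icc 0 (t₁ - t) from ⟨by linarith, le_rfl⟩)
  simpa [A] using this

/-- Differences inside the cone stay there and grow with rate `a`. -/
theorem expand (h : IsConeSystem 1 G w ψ Wd Ψd K M V V₀ κ a a' c C Λ)
    {z₁ z₂ : ℝ → ℝ × ℝ} (h₁ : IsGlobalSol G z₁) (h₂ : IsGlobalSol G z₂) {t₀ t₁ : ℝ}
    (ht : t₀ ≤ t₁) (hv₁ : ∀ t ∈ Icc t₀ t₁, |(z₁ t).2| < V) (hv₂ : ∀ t ∈ Icc t₀ t₁, |(z₂ t).2| < V)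
    (hc : κ * |ψ t₀ (z₁ t₀) - ψ t₀ (z₂ t₀)| ≤ |w t₀ (z₁ t₀) - w t₀ (z₂ t₀)|) :
    κ * |ψ t₁ (z₁ t₁) - ψ t₁ (z₂ t₁)| ≤ |w t₁ (z₁ t₁) - w t₁ (z₂ t₁)| ∧
    |w t₀ (z₁ t₀) - w t₀ (z₂ t₀)| * Real.exp (a * (t₁ - t₀)) ≤ |w t₁ (z₁ t₁) - w t₁ (z₂ t₁)| := by
  by_cases hne : z₁ = z₂
  · subst hne; simp
  have hκ := h.κ_pos
  set dw := fun t => w t (z₁ t) - w t (z₂ t) with hdw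
  set dψ := fun t => ψ t (z₁ t) - ψ t (z₂ t) with hdψ
  set dW := fun t => Wd t (z₁ t) - Wd t (z₂ t) with hdW
  set dΨ := fun t => Ψd t (z₁ t) - Ψd t (z₂ t) with hdΨ
  have Dw : ∀ t ∈ Icc t₀ t₁, HasDerivAt dw (dW t) t := fun t ht =>
    (h.hasDerivAt_w z₁ t (h₁ t) (hv₁ t ht)).sub (h.hasDerivAt_w z₂ t (h₂ t) (hv₂ t ht))
  have Dψ : ∀ t ∈ Icc t₀ t₁, HasDerivAt dψ (dΨ t) t := fun t ht =>
    (h.hasDerivAt_ψ z₁ t (h₁ t) (hv₁ t ht)).sub (h.hasDerivAt_ψ z₂ t (h₂ t) (hv₂ t ht))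
  have hcone : ∀ t ∈ Icc t₀ t₁, κ * |dψ t| ≤ |dw t| →
      a * dw t ^ 2 ≤ dw t * dW t ∧ κ * |dΨ t| ≤ a' * |dw t| := fun t ht hh => by
    have := h.cone t (z₁ t) (z₂ t) (hv₁ t ht) (hv₂ t ht) hh
    rw [one_mul] at this
    exact this
  let f := fun t => κ ^ 2 * dψ t ^ 2 - dw t ^ 2
  have Df : ∀ t ∈ Icc t₀ t₁, HasDerivAt f
      (κ ^ 2 * (2 * dψ t * dΨ t) - 2 * dw t * dW t) t := fun t ht => by
    have h3 := (((Dψ t ht).pow 2).const_mul (κ ^ 2)).sub ((Dw t ht).pow 2)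
    refine h3.congr_deriv ?_
    simp
  have hle : ∀ ⦃t⦄, t ∈ Icc t₀ t₁ → f t ≤ 0 := by
    refine image_le_of_deriv_right_lt_deriv_boundary (B := fun _ => 0) (B' := fun _ => 0)
      (HasDerivAt.continuousOn Df) (fun t ht => (Df t (Ico_subset_Icc_self ht)).hasDerivWithinAt) ?_
      (fun _ => hasDerivAt_const _ _) ?_
    · have h4 : (κ * |dψ t₀|) ^ 2 ≤ |dw t₀| ^ 2 := by gcongr
      rw [mul_pow, sq_abs, sq_abs] at h4
      simp only [f]; linarith
    · intro t ht hft
      have ht' := Ico_subset_Icc_self ht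
      have h5 : (κ * |dψ t|) ^ 2 = |dw t| ^ 2 := by
        rw [mul_pow, sq_abs, sq_abs]; simp only [f] at hft; linarith
      have h6 : κ * |dψ t| = |dw t| :=
        (pow_left_inj₀ (by positivity) (abs_nonneg _) two_ne_zero).1 h5
      obtain ⟨h7, h8⟩ := hcone t ht' h6.le
      have hw0 : dw t ≠ 0 := by
        intro h0
        have h9 := h.norm_le t (z₁ t) (z₂ t) (hv₁ t ht') (hv₂ t ht') h6.ge
        have h10 : |ψ t (z₁ t) - ψ t (z₂ t)| = 0 := by
          rw [h0, abs_zero] at h6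
          exact (mul_eq_zero.1 h6).resolve_left hκ.ne'
        rw [h10, mul_zero, norm_le_zero_iff, sub_eq_zero] at h9
        exact hne (h.flow.sol_unique h₁ h₂ h9)
      have h11 : 0 < dw t ^ 2 := by positivity
      have h12 : κ ^ 2 * (2 * dψ t * dΨ t) ≤ 2 * a' * dw t ^ 2 := by
        calc κ ^ 2 * (2 * dψ t * dΨ t) ≤ κ ^ 2 * (2 * |dψ t| * |dΨ t|) := by
              have := le_abs_self (dψ t * dΨ t)
              rw [abs_mul] at this
              nlinarith [sq_nonneg κ]
          _ = 2 * (κ * |dψ t|) * (κ * |dΨ t|) := by ring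
          _ ≤ 2 * |dw t| * (a' * |dw t|) := by rw [h6]; gcongr
          _ = 2 * a' * dw t ^ 2 := by rw [← sq_abs (dw t)]; ring
      nlinarith [h.a'_lt]
  have hin : ∀ t ∈ Icc t₀ t₁, κ * |dψ t| ≤ |dw t| := fun t ht => by
    have := hle ht
    simp only [f] at this
    have h5 : (κ * |dψ t|) ^ 2 ≤ |dw t| ^ 2 := by
      rw [mul_pow, sq_abs, sq_abs]; linarith
    exact le_of_sq_le_sq h5 (abs_nonneg _)
  refine ⟨hin t₁ ⟨ht, le_rfl⟩, ?_⟩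
  let g := fun t => dw t ^ 2 * Real.exp (-(2 * a) * (t - t₀))
  have Dg : ∀ t ∈ Icc t₀ t₁, HasDerivAt g ((2 * dw t * dW t) * Real.exp (-(2 * a) * (t - t₀)) +
      dw t ^ 2 * (Real.exp (-(2 * a) * (t - t₀)) * (-(2 * a)))) t := fun t ht => by
    have h3 : HasDerivAt (fun t => Real.exp (-(2 * a) * (t - t₀)))
        (Real.exp (-(2 * a) * (t - t₀)) * (-(2 * a))) t := by
      have := (((hasDerivAt_id t).sub_const t₀).const_mul (-(2 * a))).exp
      simpa using this
    have := ((Dw t ht).pow 2).mul h3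
    refine this.congr_deriv ?_
    simp
  have hmono : MonotoneOn g (Icc t₀ t₁) := by
    refine monotoneOn_of_hasDerivWithinAt_nonneg (convex_Icc _ _) (HasDerivAt.continuousOn Dg)
      (fun t ht => (Dg t (interior_subset ht)).hasDerivWithinAt) fun t ht => ?_
    have ht' := interior_subset ht
    have := (hcone t ht' (hin t ht')).1
    have h4 := Real.exp_pos (-(2 * a) * (t - t₀))
    nlinarith
  have h5 := hmono ⟨le_rfl, ht⟩ ⟨ht, le_rfl⟩ ht
  simp only [g, sub_self, mul_zero, Real.exp_zero, mul_one] at h5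
  have h6 : (|dw t₀| * Real.exp (a * (t₁ - t₀))) ^ 2 ≤ |dw t₁| ^ 2 := by
    rw [mul_pow, sq_abs, sq_abs, ← Real.exp_nat_mul]
    calc dw t₀ ^ 2 * Real.exp ((2 : ℕ) * (a * (t₁ - t₀)))
        ≤ dw t₁ ^ 2 * Real.exp (-(2 * a) * (t₁ - t₀)) * Real.exp ((2 : ℕ) * (a * (t₁ - t₀))) := by
          gcongr
      _ = dw t₁ ^ 2 := by
          rw [mul_assoc, ← Real.exp_add]
          have : -(2 * a) * (t₁ - t₀) + (2 : ℕ) * (a * (t₁ - t₀)) = 0 := by push_cast; ring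
          rw [this, Real.exp_zero, mul_one]
  exact le_of_sq_le_sq h6 (abs_nonneg _)

end IsConeSystem

end InvariantGraph


section InvariantGraph

open scoped NNReal

/-- The solution is in the strip at all times. -/
def StaysInStrip (V : ℝ) (w : ℝ → ℝ × ℝ → ℝ) (z : ℝ → ℝ × ℝ) : Prop :=
  ∀ t, |(z t).2| ≤ V ∧ |w t (z t)| ≤ 1

namespace IsConeSystem

variable {G : ℝ → ℝ × ℝ → ℝ × ℝ} {w ψ Wd Ψd : ℝ → ℝ × ℝ → ℝ} {K : ℝ≥0}
    {M V V₀ κ a a' c C Λ : ℝ}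

theorem a_pos {σ : ℝ} (h : IsConeSystem σ G w ψ Wd Ψd K M V V₀ κ a a' c C Λ) : 0 < a :=
  h.a'_nonneg.trans_lt h.a'_lt

theorem stays_lt (h : IsConeSystem 1 G w ψ Wd Ψd K M V V₀ κ a a' c C Λ) {z : ℝ → ℝ × ℝ}
    (hz : StaysInStrip V w z) (t : ℝ) : |(z t).2| < V := h.strip_lt (hz t).1 (hz t).2

/-- Differences of solutions that stay in the strip are outside the cone. -/
theorem outside_cone (h : IsConeSystem 1 G w ψ Wd Ψd K M V V₀ κ a a' c C Λ)
    {z₁ z₂ : ℝ → ℝ × ℝ} (h₁ : IsGlobalSol G z₁) (h₂ : IsGlobalSol G z₂)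
    (s₁ : StaysInStrip V w z₁) (s₂ : StaysInStrip V w z₂) (t : ℝ) :
    |w t (z₁ t) - w t (z₂ t)| ≤ κ * |ψ t (z₁ t) - ψ t (z₂ t)| := by
  by_contra hcon
  rw [not_le] at hcon
  have hpos : 0 < |w t (z₁ t) - w t (z₂ t)| :=
    (mul_nonneg h.κ_pos.le (abs_nonneg _)).trans_lt hcon
  set D := |w t (z₁ t) - w t (z₂ t)| with hD
  have hb : ∀ s, |w s (z₁ s) - w s (z₂ s)| ≤ 2 := fun s =>
    (abs_sub _ _).trans (by linarith [(s₁ s).2, (s₂ s).2])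
  have hx : ∀ x : ℝ, 0 ≤ x → D * (a * x + 1) ≤ 2 := fun x hx => by
    have h3 := (h.expand h₁ h₂ (t₀ := t) (t₁ := t + x) (by linarith)
      (fun s _ => h.stays_lt s₁ s) (fun s _ => h.stays_lt s₂ s) hcon.le).2
    rw [add_sub_cancel_left] at h3
    exact ((mul_le_mul_of_nonneg_left (Real.add_one_le_exp _) hpos.le).trans h3).trans (hb _)
  have ha := h.a_pos
  have h4 := hx (2 / (D * a)) (by positivity)
  have h5 : D * (a * (2 / (D * a)) + 1) = 2 + D := by field_simp
  linarith

theorem stays_unique (h : IsConeSystem 1 G w ψ Wd Ψd K M V V₀ κ a a' c C Λ)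
    {z₁ z₂ : ℝ → ℝ × ℝ} (h₁ : IsGlobalSol G z₁) (h₂ : IsGlobalSol G z₂)
    (s₁ : StaysInStrip V w z₁) (s₂ : StaysInStrip V w z₂) {t : ℝ} (ht : (z₁ t).1 = (z₂ t).1) :
    z₁ = z₂ := by
  have h3 := h.horizontal t _ _ (h.stays_lt s₁ t) (h.stays_lt s₂ t)
    (h.outside_cone h₁ h₂ s₁ s₂ t)
  rw [ht, sub_self, abs_zero, mul_zero] at h3
  exact h.flow.sol_unique h₁ h₂ (t₀ := t)
    (Prod.ext ht (sub_eq_zero.1 (abs_nonpos_iff.1 h3)))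

theorem exists_stays (h : IsConeSystem 1 G w ψ Wd Ψd K M V V₀ κ a a' c C Λ) (t₀ φ₀ : ℝ) :
    ∃ z, IsGlobalSol G z ∧ StaysInStrip V w z ∧ (z t₀).1 = φ₀ := by
  choose F hF0 hF using fun (t : ℝ) (z : ℝ × ℝ) => h.flow.exists_sol t z
  have hFc : ∀ t s, Continuous fun z => F t z s := fun t s => by
    refine (LipschitzWith.of_dist_le_mul
      (K := ⟨Real.exp (K * |s - t|), (Real.exp_pos _).le⟩) fun x y => ?_).continuous
    have := h.flow.dist_le (hF t x) (hF t y) t s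
    rw [hF0, hF0, mul_comm] at this
    exact this
  let A : ℕ → Set ℝ := fun n => {v | |v| ≤ V ∧
    |(F t₀ (φ₀, v) (t₀ + n)).2| ≤ V ∧ |w (t₀ + n) (F t₀ (φ₀, v) (t₀ + n))| ≤ 1}
  have hcl : ∀ n, IsClosed (A n) := fun n => by
    have hc : Continuous fun v : ℝ => F t₀ (φ₀, v) (t₀ + n) :=
      (hFc _ _).comp (by fun_prop : Continuous fun v : ℝ => (φ₀, v))
    refine (isClosed_le continuous_abs continuous_const).inter (IsClosed.inter ?_ ?_)
    · exact isClosed_le (continuous_snd.comp hc).abs continuous_const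
    · exact isClosed_le (h.w_cont.comp (continuous_const.prodMk hc)).abs continuous_const
  have hne : ∀ n, (A n).Nonempty := fun n => by
    obtain ⟨s, hs, hs'⟩ := h.cross (t₀ + n)
    have hc : Continuous fun φ => (F (t₀ + n) (φ, s φ) t₀).1 :=
      continuous_fst.comp ((hFc _ _).comp (continuous_id.prodMk hs))
    have hd : ∀ φ, |(F (t₀ + n) (φ, s φ) t₀).1 - φ| ≤ M * n := fun φ => by
      have h3 := h.flow.norm_sub_le (hF (t₀ + n) (φ, s φ)) (t₀ + n) t₀
      rw [hF0] at h3
      have h4 := (norm_fst_le _).trans h3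
      simpa using h4
    have hsurj : Function.Surjective fun φ => (F (t₀ + n) (φ, s φ) t₀).1 := by
      refine hc.surjective ?_ ?_
      · refine Filter.tendsto_atTop_mono (f := fun φ => φ - M * n) (fun φ => ?_)
          (Filter.tendsto_atTop_add_const_right _ _ Filter.tendsto_id)
        linarith [(abs_le.1 (hd φ)).1]
      · refine Filter.tendsto_atBot_mono (f := fun φ => φ + M * n) (fun φ => ?_)
          (Filter.tendsto_atBot_add_const_right _ _ Filter.tendsto_id)
        linarith [(abs_le.1 (hd φ)).2]
    obtain ⟨φ, hφ⟩ := hsurj φ₀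
    have hst := h.mem_strip_of_le (hF (t₀ + n) (φ, s φ)) (t₁ := t₀ + n)
      (by rw [hF0]; exact hs' φ) (t := t₀) (by simp)
    refine ⟨(F (t₀ + n) (φ, s φ) t₀).2, hst.1, ?_⟩
    have : F t₀ (φ₀, (F (t₀ + n) (φ, s φ) t₀).2) = F (t₀ + n) (φ, s φ) := by
      refine h.flow.sol_unique (hF _ _) (hF _ _) (t₀ := t₀) ?_
      rw [hF0]
      exact Prod.ext hφ.symm rfl
    rw [this, hF0]
    exact hs' φ
  have hcomp : IsCompact (A 0) :=
    (isCompact_Icc (a := -V) (b := V)).of_isClosed_subset (hcl 0) fun v hv => abs_le.1 hv.1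
  have hanti : ∀ n, A (n + 1) ⊆ A n := fun n v hv => by
    refine ⟨hv.1, h.mem_strip_of_le (hF _ _) hv.2 ?_⟩
    push_cast; linarith
  obtain ⟨v, hv⟩ := IsCompact.nonempty_iInter_of_sequence_nonempty_isCompact_isClosed A hanti hne
    hcomp hcl
  rw [mem_iInter] at hv
  refine ⟨F t₀ (φ₀, v), hF _ _, fun t => ?_, by rw [hF0]⟩
  obtain ⟨n, hn⟩ := exists_nat_ge (t - t₀)
  exact h.mem_strip_of_le (hF _ _) (hv n).2 (by linarith)

/-- Differences of solutions that stay in the strip grow with rate at most `a'`. -/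
theorem stays_growth (h : IsConeSystem 1 G w ψ Wd Ψd K M V V₀ κ a a' c C Λ)
    {z₁ z₂ : ℝ → ℝ × ℝ} (h₁ : IsGlobalSol G z₁) (h₂ : IsGlobalSol G z₂)
    (s₁ : StaysInStrip V w z₁) (s₂ : StaysInStrip V w z₂) {t₀ t₁ : ℝ} (ht : t₀ ≤ t₁) :
    ‖z₁ t₁ - z₂ t₁‖ ≤ C * C * Real.exp (a' * (t₁ - t₀)) * ‖z₁ t₀ - z₂ t₀‖ := by
  set dψ := fun t => ψ t (z₁ t) - ψ t (z₂ t) with hdψ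
  set dΨ := fun t => Ψd t (z₁ t) - Ψd t (z₂ t) with hdΨ
  have Dψ : ∀ t, HasDerivAt dψ (dΨ t) t := fun t =>
    (h.hasDerivAt_ψ z₁ t (h₁ t) (h.stays_lt s₁ t)).sub
      (h.hasDerivAt_ψ z₂ t (h₂ t) (h.stays_lt s₂ t))
  have hb := norm_le_gronwallBound_of_norm_deriv_right_le (f := dψ) (f' := dΨ) (K := a') (ε := 0)
    (a := t₀) (b := t₁) (HasDerivAt.continuousOn fun t _ => Dψ t)
    (fun t _ => (Dψ t).hasDerivWithinAt) le_rfl (fun t _ => by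
      rw [add_zero]
      exact h.slow t _ _ (h.stays_lt s₁ t) (h.stays_lt s₂ t) (h.outside_cone h₁ h₂ s₁ s₂ t))
    t₁ ⟨ht, le_rfl⟩
  rw [gronwallBound_ε0, Real.norm_eq_abs, Real.norm_eq_abs] at hb
  have hC := h.C_pos
  calc ‖z₁ t₁ - z₂ t₁‖ ≤ C * |dψ t₁| :=
        h.norm_le t₁ _ _ (h.stays_lt s₁ _) (h.stays_lt s₂ _) (h.outside_cone h₁ h₂ s₁ s₂ _)
    _ ≤ C * (|dψ t₀| * Real.exp (a' * (t₁ - t₀))) := by gcongr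
    _ ≤ C * (C * ‖z₁ t₀ - z₂ t₀‖ * Real.exp (a' * (t₁ - t₀))) := by
        gcongr
        exact h.ψ_le t₀ _ _ (h.stays_lt s₁ _) (h.stays_lt s₂ _)
    _ = _ := by ring

theorem stays_norm_le (h : IsConeSystem 1 G w ψ Wd Ψd K M V V₀ κ a a' c C Λ)
    {z₁ z₂ : ℝ → ℝ × ℝ} (h₁ : IsGlobalSol G z₁) (h₂ : IsGlobalSol G z₂)
    (s₁ : StaysInStrip V w z₁) (s₂ : StaysInStrip V w z₂) (t : ℝ) :
    ‖z₁ t - z₂ t‖ ≤ (1 + Λ) * |(z₁ t).1 - (z₂ t).1| := by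
  have h3 := h.horizontal t _ _ (h.stays_lt s₁ t) (h.stays_lt s₂ t)
    (h.outside_cone h₁ h₂ s₁ s₂ t)
  have h4 := abs_nonneg ((z₁ t).1 - (z₂ t).1)
  have h5 := mul_nonneg h.Λ_nonneg h4
  rw [Prod.norm_def]
  refine max_le ?_ ?_ <;> simp only [Prod.fst_sub, Prod.snd_sub, Real.norm_eq_abs] <;> linarith

/-- The chords of the invariant graph over neighbouring points have nearly the same slope. -/
theorem slope_close (h : IsConeSystem 1 G w ψ Wd Ψd K M V V₀ κ a a' c C Λ) {δ : ℝ} (hδ : 0 < δ) :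
    ∃ d > 0, ∀ (t₀ : ℝ) (z₁ z₂ z₃ z₄ : ℝ → ℝ × ℝ), IsGlobalSol G z₁ → IsGlobalSol G z₂ →
      IsGlobalSol G z₃ → IsGlobalSol G z₄ → StaysInStrip V w z₁ → StaysInStrip V w z₂ →
      StaysInStrip V w z₃ → StaysInStrip V w z₄ →
      |(z₂ t₀).1 - (z₁ t₀).1| < d → |(z₃ t₀).1 - (z₁ t₀).1| < d → |(z₄ t₀).1 - (z₁ t₀).1| < d →
      (z₃ t₀).1 ≠ (z₄ t₀).1 →
      |(z₁ t₀).2 + ((z₂ t₀).1 - (z₁ t₀).1) / ((z₄ t₀).1 - (z₃ t₀).1) *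
          ((z₄ t₀).2 - (z₃ t₀).2) - (z₂ t₀).2| ≤ δ * |(z₂ t₀).1 - (z₁ t₀).1| := by
  have hC := h.C_pos
  have hc := h.c_pos
  have hΛ := h.Λ_nonneg
  set Λ' := 1 + Λ with hΛ'
  have hΛp : 0 < Λ' := by linarith
  obtain ⟨N, hN0, hN⟩ : ∃ N : ℝ, 0 ≤ N ∧
      2 * C * C * C * Λ' * Real.exp (-((a - a') * N)) ≤ c * δ / 2 := by
    have haa : 0 < a - a' := sub_pos.2 h.a'_lt
    have ht : Filter.Tendsto (fun N => 2 * C * C * C * Λ' * Real.exp (-((a - a') * N)))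
        Filter.atTop (nhds 0) := by
      have := (Real.tendsto_exp_neg_atTop_nhds_zero.comp
        (Filter.tendsto_id.const_mul_atTop haa)).const_mul (2 * C * C * C * Λ')
      simpa using this
    have h1 := ht.eventually (ge_mem_nhds (show (0:ℝ) < c * δ / 2 by positivity))
    obtain ⟨N, hN⟩ := (h1.and (Filter.eventually_ge_atTop 0)).exists
    exact ⟨N, hN.2, hN.1⟩
  set E := Real.exp ((K + 1) * N) with hE
  have hEp : 0 < E := Real.exp_pos _
  obtain ⟨G', hG', hstrict⟩ := h.strict
  set η := c * δ / (4 * C * E ^ 2 * Λ') with hη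
  have hηp : 0 < η := by positivity
  obtain ⟨d₁, hd₁, hst⟩ := hstrict η hηp
  have hVV : 0 < V - V₀ := sub_pos.2 h.V₀_lt
  have hdp : 0 < min d₁ (V - V₀) := lt_min hd₁ hVV
  refine ⟨min d₁ (V - V₀) / (E * Λ'), by positivity, ?_⟩
  intro t₀ z₁ z₂ z₃ z₄ h₁ h₂ h₃ h₄ s₁ s₂ s₃ s₄ h21 h31 h41 hne
  set Δ := |(z₂ t₀).1 - (z₁ t₀).1| with hΔ
  set l := ((z₂ t₀).1 - (z₁ t₀).1) / ((z₄ t₀).1 - (z₃ t₀).1) with hl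
  have hne' : (z₄ t₀).1 - (z₃ t₀).1 ≠ 0 := sub_ne_zero.2 hne.symm
  have hlm : l * ((z₄ t₀).1 - (z₃ t₀).1) = (z₂ t₀).1 - (z₁ t₀).1 := by rw [hl]; field_simp
  have hla : |l| * |(z₄ t₀).1 - (z₃ t₀).1| = Δ := by rw [← abs_mul, hlm]
  have hΔ0 : 0 ≤ Δ := abs_nonneg _
  obtain ⟨y, hy0, hy⟩ := h.flow.exists_sol t₀ (z₁ t₀ + l • (z₄ t₀ - z₃ t₀))
  -- distances up to the time `t₀ + N`
  have hexp : ∀ t ∈ Icc t₀ (t₀ + N), Real.exp (K * |t - t₀|) ≤ E := fun t ht => by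
    rw [hE, abs_of_nonneg (by linarith [ht.1])]
    refine Real.exp_le_exp.2 ?_
    have : t - t₀ ≤ N := by linarith [ht.2]
    have h0 : 0 ≤ t - t₀ := by linarith [ht.1]
    have hK : (0 : ℝ) ≤ K := K.2
    nlinarith
  have hdist : ∀ {x₁ x₂ : ℝ → ℝ × ℝ}, IsGlobalSol G x₁ → IsGlobalSol G x₂ → ∀ t ∈ Icc t₀ (t₀ + N),
      ‖x₁ t - x₂ t‖ ≤ ‖x₁ t₀ - x₂ t₀‖ * E := fun g₁ g₂ t ht => by
    have := h.flow.dist_le g₁ g₂ t₀ t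
    rw [dist_eq_norm, dist_eq_norm] at this
    exact this.trans (mul_le_mul_of_nonneg_left (hexp t ht) (norm_nonneg _))
  have hy1 : ‖y t₀ - z₁ t₀‖ ≤ Λ' * Δ := by
    rw [hy0, add_sub_cancel_left, norm_smul, Real.norm_eq_abs]
    calc |l| * ‖z₄ t₀ - z₃ t₀‖ ≤ |l| * (Λ' * |(z₄ t₀).1 - (z₃ t₀).1|) := by
          gcongr; exact h.stays_norm_le h₄ h₃ s₄ s₃ t₀
      _ = Λ' * Δ := by rw [← hla]; ring
  have hsmall : ∀ x, x < min d₁ (V - V₀) / (E * Λ') → Λ' * x * E < min d₁ (V - V₀) := fun x hx => by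
    rw [lt_div_iff₀ (by positivity)] at hx
    linarith [mul_comm x (E * Λ'), mul_assoc x E Λ', mul_comm (Λ' * x) E]
  have dy : ∀ t ∈ Icc t₀ (t₀ + N), ‖y t - z₁ t‖ ≤ Λ' * Δ * E := fun t ht =>
    (hdist hy h₁ t ht).trans (by gcongr)
  have dz : ∀ {x : ℝ → ℝ × ℝ}, IsGlobalSol G x → StaysInStrip V w x →
      |(x t₀).1 - (z₁ t₀).1| < min d₁ (V - V₀) / (E * Λ') → ∀ t ∈ Icc t₀ (t₀ + N),
      dist (x t) (z₁ t) < d₁ := fun {x} hx sx hx0 t ht => by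
    rw [dist_eq_norm]
    refine ((hdist hx h₁ t ht).trans ?_).trans_lt ((hsmall _ hx0).trans_le (min_le_left _ _))
    gcongr
    exact h.stays_norm_le hx h₁ sx s₁ t₀
  have vy : ∀ t ∈ Icc t₀ (t₀ + N), |(y t).2| < V := fun t ht => by
    have e1 := (norm_snd_le _).trans (dy t ht)
    have e2 := (hsmall Δ h21).trans_le (min_le_right _ _)
    have e3 := h.strip t (z₁ t) (s₁ t).1 (s₁ t).2
    have e4 : |(y t).2| ≤ |(z₁ t).2| + |(y t).2 - (z₁ t).2| := by
      have := abs_add_le (z₁ t).2 ((y t).2 - (z₁ t).2)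
      rwa [add_sub_cancel] at this
    rw [Prod.snd_sub, Real.norm_eq_abs] at e1
    linarith
  -- the two chords evolve almost in the same way
  have hgr : ‖(y (t₀ + N) - z₁ (t₀ + N)) - l • (z₄ (t₀ + N) - z₃ (t₀ + N))‖ ≤
      2 * η * E * E * Λ' * Δ := by
    have hD : ∀ t, HasDerivAt (fun t => (y t - z₁ t) - l • (z₄ t - z₃ t))
        ((G t (y t) - G t (z₁ t)) - l • (G t (z₄ t) - G t (z₃ t))) t := fun t =>
      ((hy t).sub (h₁ t)).sub (((h₄ t).sub (h₃ t)).const_smul l)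
    have hb := norm_le_gronwallBound_of_norm_deriv_right_le (K := K + 1)
      (ε := 2 * η * E * Λ' * Δ) (δ := 0) (a := t₀) (b := t₀ + N)
      (HasDerivAt.continuousOn fun t _ => hD t) (fun t _ => (hD t).hasDerivWithinAt)
      (by rw [hy0]; simp) (fun t ht => ?_) (t₀ + N) ⟨by linarith, le_rfl⟩
    · refine hb.trans ?_
      have hK : (0 : ℝ) < K + 1 := by have : (0 : ℝ) ≤ K := K.2; linarith
      simp only [gronwallBound_of_K_ne_0 hK.ne']
      rw [zero_mul, zero_add, add_sub_cancel_left, ← hE]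
      have hx : 0 ≤ 2 * η * E * Λ' * Δ := by positivity
      calc 2 * η * E * Λ' * Δ / (K + 1) * (E - 1) ≤ 2 * η * E * Λ' * Δ * E := by
            have h1 : 2 * η * E * Λ' * Δ / (K + 1) ≤ 2 * η * E * Λ' * Δ :=
              div_le_self hx (by have : (0 : ℝ) ≤ K := K.2; linarith)
            have h2 : (0 : ℝ) ≤ E - 1 := by
              have : 1 ≤ E := Real.one_le_exp (by positivity)
              linarith
            nlinarith
        _ = _ := by ring
    · have ht' := Ico_subset_Icc_self ht
      have b1 := hst t (z₁ t) (y t) (z₁ t) (h.stays_lt s₁ t) (vy t ht') (h.stays_lt s₁ t)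
        (by rw [dist_eq_norm]
            exact (dy t ht').trans_lt ((hsmall Δ h21).trans_le (min_le_left _ _)))
        (by rw [dist_self]; exact hd₁)
      have b2 := hst t (z₁ t) (z₄ t) (z₃ t) (h.stays_lt s₁ t) (h.stays_lt s₄ t) (h.stays_lt s₃ t)
        (dz h₄ s₄ h41 t ht') (dz h₃ s₃ h31 t ht')
      have b3 : |l| * ‖z₄ t - z₃ t‖ ≤ Λ' * Δ * E := by
        calc |l| * ‖z₄ t - z₃ t‖ ≤ |l| * ((Λ' * |(z₄ t₀).1 - (z₃ t₀).1|) * E) := by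
              gcongr
              refine (hdist h₄ h₃ t ht').trans ?_
              gcongr
              exact h.stays_norm_le h₄ h₃ s₄ s₃ t₀
          _ = Λ' * Δ * E := by rw [← hla]; ring
      have b4 : (G t (y t) - G t (z₁ t)) - l • (G t (z₄ t) - G t (z₃ t)) =
          G' t (z₁ t) ((y t - z₁ t) - l • (z₄ t - z₃ t)) +
          (G t (y t) - G t (z₁ t) - G' t (z₁ t) (y t - z₁ t)) -
          l • (G t (z₄ t) - G t (z₃ t) - G' t (z₁ t) (z₄ t - z₃ t)) := by
        rw [map_sub, map_smul, smul_sub l (G t (z₄ t) - G t (z₃ t))]; abel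
      rw [b4]
      refine (norm_sub_le _ _).trans ?_
      refine (add_le_add_left (norm_add_le _ _) _).trans ?_
      have b5 : ‖G' t (z₁ t) ((y t - z₁ t) - l • (z₄ t - z₃ t))‖ ≤
          (K + 1) * ‖(y t - z₁ t) - l • (z₄ t - z₃ t)‖ := by
        refine (ContinuousLinearMap.le_opNorm _ _).trans ?_
        gcongr
        linarith [hG' t (z₁ t) (h.stays_lt s₁ t)]
      have b6 : ‖G t (y t) - G t (z₁ t) - G' t (z₁ t) (y t - z₁ t)‖ ≤ η * (Λ' * Δ * E) :=
        b1.trans (by gcongr; exact dy t ht')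
      have b7 : ‖l • (G t (z₄ t) - G t (z₃ t) - G' t (z₁ t) (z₄ t - z₃ t))‖ ≤
          η * (Λ' * Δ * E) := by
        rw [norm_smul, Real.norm_eq_abs]
        calc |l| * _ ≤ |l| * (η * ‖z₄ t - z₃ t‖) := by gcongr
          _ = η * (|l| * ‖z₄ t - z₃ t‖) := by ring
          _ ≤ _ := by gcongr
      linarith
  -- the vertical gap expands
  have hN' : t₀ ≤ t₀ + N := by linarith
  have hy01 : (y t₀).1 = (z₂ t₀).1 := by
    rw [hy0]; simp only [Prod.fst_add, Prod.smul_fst, Prod.fst_sub, smul_eq_mul, hlm]; ring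
  have hy02 : (y t₀).2 = (z₁ t₀).2 + l * ((z₄ t₀).2 - (z₃ t₀).2) := by
    rw [hy0]; simp
  have hvert := h.vertical t₀ (y t₀) (z₂ t₀) (vy t₀ ⟨le_rfl, hN'⟩) (h.stays_lt s₂ t₀) hy01
  have hex := (h.expand hy h₂ hN' vy (fun t _ => h.stays_lt s₂ t) hvert.1).2
  rw [add_sub_cancel_left] at hex
  have hup : |w (t₀ + N) (y (t₀ + N)) - w (t₀ + N) (z₂ (t₀ + N))| ≤
      C * (2 * η * E * E * Λ' * Δ + 2 * (C * C * Real.exp (a' * N) * (Λ' * Δ))) := by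
    refine (h.w_le _ _ _ (vy _ ⟨hN', le_rfl⟩) (h.stays_lt s₂ _)).trans ?_
    gcongr
    have e1 : ‖z₂ (t₀ + N) - z₁ (t₀ + N)‖ ≤ C * C * Real.exp (a' * N) * (Λ' * Δ) := by
      have := h.stays_growth h₂ h₁ s₂ s₁ hN'
      rw [add_sub_cancel_left] at this
      refine this.trans ?_
      gcongr
      exact h.stays_norm_le h₂ h₁ s₂ s₁ t₀
    have e2 : ‖l • (z₄ (t₀ + N) - z₃ (t₀ + N))‖ ≤ C * C * Real.exp (a' * N) * (Λ' * Δ) := by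
      have := h.stays_growth h₄ h₃ s₄ s₃ hN'
      rw [add_sub_cancel_left] at this
      rw [norm_smul, Real.norm_eq_abs]
      calc |l| * _ ≤ |l| * (C * C * Real.exp (a' * N) * (Λ' * |(z₄ t₀).1 - (z₃ t₀).1|)) := by
            gcongr
            refine this.trans ?_
            gcongr
            exact h.stays_norm_le h₄ h₃ s₄ s₃ t₀
        _ = _ := by rw [← hla]; ring
    have e3 : y (t₀ + N) - z₂ (t₀ + N) =
        ((y (t₀ + N) - z₁ (t₀ + N)) - l • (z₄ (t₀ + N) - z₃ (t₀ + N))) +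
        l • (z₄ (t₀ + N) - z₃ (t₀ + N)) - (z₂ (t₀ + N) - z₁ (t₀ + N)) := by abel
    rw [e3]
    refine (norm_sub_le _ _).trans ((add_le_add_left (norm_add_le _ _) _).trans ?_)
    linarith
  have ha := h.a_pos
  set X := |(y t₀).2 - (z₂ t₀).2| with hX
  have hX0 : 0 ≤ X := abs_nonneg _
  have hfin : c * X ≤ c * (δ * Δ) := by
    have f1 : c * X * Real.exp (a * N) ≤
        C * (2 * η * E * E * Λ' * Δ + 2 * (C * C * Real.exp (a' * N) * (Λ' * Δ))) :=
      (mul_le_mul_of_nonneg_right hvert.2 (Real.exp_pos _).le).trans (hex.trans hup)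
    have f2 : C * (2 * η * E * E * Λ' * Δ) = c * δ / 2 * Δ := by
      rw [hη]; field_simp; ring
    have f3 : 1 ≤ Real.exp (a * N) := Real.one_le_exp (by positivity)
    have f4 : Real.exp (a' * N) = Real.exp (-((a - a') * N)) * Real.exp (a * N) := by
      rw [← Real.exp_add]; congr 1; ring
    have f5 : C * (2 * (C * C * Real.exp (a' * N) * (Λ' * Δ))) ≤
        c * δ / 2 * Δ * Real.exp (a * N) := by
      rw [f4]
      calc _ = 2 * C * C * C * Λ' * Real.exp (-((a - a') * N)) * (Δ * Real.exp (a * N)) := by ring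
        _ ≤ c * δ / 2 * (Δ * Real.exp (a * N)) := by gcongr
        _ = _ := by ring
    have f6 : c * δ / 2 * Δ ≤ c * δ / 2 * Δ * Real.exp (a * N) :=
      le_mul_of_one_le_right (by positivity) f3
    have f7 : c * X * Real.exp (a * N) ≤ c * (δ * Δ) * Real.exp (a * N) := by
      rw [mul_add] at f1; linarith
    exact le_of_mul_le_mul_right f7 (Real.exp_pos _)
  have := le_of_mul_le_mul_left hfin hc
  rwa [hX, hy02] at this

end IsConeSystem

end InvariantGraph


section InvariantGraph

open scoped NNReal Topology
open Filter Asymptotics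

/-- A family of functions whose chords over neighbouring points have nearly the same slope is
continuously differentiable, uniformly. -/
theorem exists_partial_of_slope_close {U : ℝ → ℝ → ℝ} (hU : Continuous (uncurry U))
    (hs : ∀ δ > 0, ∃ d > 0, ∀ t φ₁ φ₂ φ₃ φ₄ : ℝ, |φ₂ - φ₁| < d → |φ₃ - φ₁| < d → |φ₄ - φ₁| < d →
      φ₃ ≠ φ₄ → |U t φ₁ + (φ₂ - φ₁) / (φ₄ - φ₃) * (U t φ₄ - U t φ₃) - U t φ₂| ≤ δ * |φ₂ - φ₁|) :
    ∃ D : ℝ → ℝ → ℝ, Continuous (uncurry D) ∧ ∀ δ > 0, ∃ d > 0, ∀ t φ φ₁ φ₂ : ℝ,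
      |φ₁ - φ| < d → |φ₂ - φ| < d → |U t φ₂ - U t φ₁ - D t φ * (φ₂ - φ₁)| ≤ δ * |φ₂ - φ₁| := by
  let e : ℕ → ℝ := fun n => 1 / ((n : ℝ) + 1)
  have he : ∀ n, 0 < e n := fun n => Nat.one_div_pos_of_nat
  have het : Tendsto e atTop (𝓝 0) := tendsto_one_div_add_atTop_nhds_zero_nat
  let s : ℕ → ℝ → ℝ → ℝ := fun n t φ => (U t (φ + e n) - U t φ) / e n
  have key : ∀ δ > 0, ∃ d > 0, ∃ n₀ : ℕ, (∀ n ≥ n₀, e n < d) ∧ ∀ n ≥ n₀, ∀ t φ φ₁ φ₂ : ℝ,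
      |φ₁ - φ| < d → |φ₂ - φ| < d → |U t φ₂ - U t φ₁ - s n t φ * (φ₂ - φ₁)| ≤ δ * |φ₂ - φ₁| := by
    intro δ hδ
    obtain ⟨d, hd, hd'⟩ := hs δ hδ
    obtain ⟨n₀, hn₀⟩ := eventually_atTop.1 (het.eventually (gt_mem_nhds (half_pos hd)))
    refine ⟨d / 2, half_pos hd, n₀, hn₀, fun n hn t φ φ₁ φ₂ h1 h2 => ?_⟩
    have h3 := hn₀ n hn
    have h4 := he n
    rw [abs_lt] at h1 h2
    have := hd' t φ₁ φ₂ φ (φ + e n) (abs_lt.2 ⟨by linarith, by linarith⟩)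
      (abs_lt.2 ⟨by linarith, by linarith⟩) (abs_lt.2 ⟨by linarith, by linarith⟩)
      (by linarith [h4] : φ < φ + e n).ne
    rw [← abs_neg]
    refine le_of_eq_of_le (congrArg _ ?_) this
    simp only [s, add_sub_cancel_left]
    ring
  have hcau : ∀ δ > 0, ∃ n₀, ∀ n ≥ n₀, ∀ m ≥ n₀, ∀ t φ, |s m t φ - s n t φ| ≤ δ := by
    intro δ hδ
    obtain ⟨d, hd, n₀, hn₀, h⟩ := key δ hδ
    refine ⟨n₀, fun n hn m hm t φ => ?_⟩
    have h1 := h n hn t φ φ (φ + e m) (by simpa using hd)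
      (by rw [add_sub_cancel_left, abs_of_pos (he m)]; exact hn₀ m hm)
    rw [add_sub_cancel_left, abs_of_pos (he m)] at h1
    have h2 : U t (φ + e m) - U t φ - s n t φ * e m = (s m t φ - s n t φ) * e m := by
      simp only [s]
      rw [sub_mul (_ / e m), div_mul_cancel₀ _ (he m).ne']
    rw [h2, abs_mul, abs_of_pos (he m)] at h1
    exact le_of_mul_le_mul_right h1 (he m)
  have hlim : ∀ t φ, ∃ L, Tendsto (fun n => s n t φ) atTop (𝓝 L) := fun t φ => by
    refine cauchySeq_tendsto_of_complete (Metric.cauchySeq_iff.2 fun δ hδ => ?_)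
    obtain ⟨n₀, h⟩ := hcau (δ / 2) (half_pos hδ)
    exact ⟨n₀, fun m hm n hn => (h n hn m hm t φ).trans_lt (half_lt_self hδ)⟩
  choose D hD using hlim
  refine ⟨D, ?_, fun δ hδ => ?_⟩
  · have hunif : TendstoUniformly (fun n p => uncurry (s n) p) (uncurry D) atTop := by
      refine Metric.tendstoUniformly_iff.2 fun δ hδ => ?_
      obtain ⟨n₀, h⟩ := hcau (δ / 2) (half_pos hδ)
      filter_upwards [eventually_ge_atTop n₀] with n hn p
      refine lt_of_le_of_lt ?_ (half_lt_self hδ)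
      refine le_of_tendsto (((hD p.1 p.2).sub_const (s n p.1 p.2)).abs) ?_
      filter_upwards [eventually_ge_atTop n₀] with m hm using h n hn m hm p.1 p.2
    refine hunif.continuous (Frequently.of_forall fun n => ?_)
    have h1 : Continuous fun p : ℝ × ℝ => U p.1 (p.2 + e n) :=
      hU.comp (by fun_prop : Continuous fun p : ℝ × ℝ => (p.1, p.2 + e n))
    exact (h1.sub hU).div_const _
  · obtain ⟨d, hd, n₀, -, h⟩ := key δ hδ
    refine ⟨d, hd, fun t φ φ₁ φ₂ h1 h2 => ?_⟩
    refine le_of_tendsto ((tendsto_const_nhds.sub ((hD t φ).mul_const (φ₂ - φ₁))).abs) ?_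
    filter_upwards [eventually_ge_atTop n₀] with n hn using h n hn t φ φ₁ φ₂ h1 h2

/-- A function `U(t, φ)` that is uniformly differentiable in `φ` and whose graph is filled by
solutions of a differential equation is continuously differentiable. -/
theorem contDiff_of_invariant {G : ℝ → ℝ × ℝ → ℝ × ℝ} (hG : Continuous (uncurry G))
    {U D : ℝ → ℝ → ℝ} (hU : Continuous (uncurry U)) (hD : Continuous (uncurry D))
    (hUD : ∀ δ > 0, ∃ d > 0, ∀ t φ φ₁ φ₂ : ℝ,
      |φ₁ - φ| < d → |φ₂ - φ| < d → |U t φ₂ - U t φ₁ - D t φ * (φ₂ - φ₁)| ≤ δ * |φ₂ - φ₁|)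
    (hsol : ∀ t₀ φ₀, ∃ z, IsGlobalSol G z ∧ z t₀ = (φ₀, U t₀ φ₀) ∧ ∀ t, (z t).2 = U t (z t).1) :
    ContDiff ℝ 1 (uncurry U) := by
  let g : ℝ × ℝ → ℝ × ℝ := fun p => G p.1 (p.2, U p.1 p.2)
  have hg : Continuous g := hG.comp
    (by fun_prop : Continuous fun p : ℝ × ℝ => (p.1, (p.2, uncurry U p)))
  let L : ℝ × ℝ → (ℝ × ℝ →L[ℝ] ℝ) := fun p =>
    ((g p).2 - uncurry D p * (g p).1) • ContinuousLinearMap.fst ℝ ℝ ℝ +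
      uncurry D p • ContinuousLinearMap.snd ℝ ℝ ℝ
  have hL : Continuous L := by fun_prop
  have hderiv : ∀ p, HasFDerivAt (uncurry U) (L p) p := by
    rintro ⟨t₀, φ₀⟩
    obtain ⟨z, hz, hz0, hzU⟩ := hsol t₀ φ₀
    have hzd := hz t₀
    rw [hz0] at hzd
    have hz1 : HasDerivAt (fun s => (z s).1) (G t₀ (φ₀, U t₀ φ₀)).1 t₀ :=
      (ContinuousLinearMap.fst ℝ ℝ ℝ).hasFDerivAt.comp_hasDerivAt t₀ hzd
    have hz2 : HasDerivAt (fun s => (z s).2) (G t₀ (φ₀, U t₀ φ₀)).2 t₀ :=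
      (ContinuousLinearMap.snd ℝ ℝ ℝ).hasFDerivAt.comp_hasDerivAt t₀ hzd
    have hfst : Tendsto (fun p : ℝ × ℝ => p.1) (𝓝 (t₀, φ₀)) (𝓝 t₀) := continuous_fst.continuousAt
    have hO1 : (fun p : ℝ × ℝ => p.1 - t₀) =O[𝓝 (t₀, φ₀)] fun p => p - (t₀, φ₀) :=
      isBigO_of_le _ fun p => norm_fst_le (p - (t₀, φ₀))
    have hO2 : (fun p : ℝ × ℝ => p.2 - φ₀) =O[𝓝 (t₀, φ₀)] fun p => p - (t₀, φ₀) :=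
      isBigO_of_le _ fun p => norm_snd_le (p - (t₀, φ₀))
    have o1 := ((hasDerivAt_iff_isLittleO.1 hz1).comp_tendsto hfst).trans_isBigO hO1
    have o2 := ((hasDerivAt_iff_isLittleO.1 hz2).comp_tendsto hfst).trans_isBigO hO1
    have hO3 : (fun p : ℝ × ℝ => (z p.1).1 - φ₀) =O[𝓝 (t₀, φ₀)] fun p => p - (t₀, φ₀) := by
      have h3 := (hz1.differentiableAt.isBigO_sub).comp_tendsto hfst
      have h4 : ((fun x => (z x).1 - (z t₀).1) ∘ fun p : ℝ × ℝ => p.1) =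
          fun p : ℝ × ℝ => (z p.1).1 - φ₀ := by funext p; simp [hz0]
      rw [h4] at h3
      exact h3.trans hO1
    have hO4 : (fun p : ℝ × ℝ => p.2 - (z p.1).1) =O[𝓝 (t₀, φ₀)] fun p => p - (t₀, φ₀) := by
      have := hO2.sub hO3
      simpa using this
    have o3 : (fun p : ℝ × ℝ => U p.1 p.2 - U p.1 (z p.1).1 - D t₀ φ₀ * (p.2 - (z p.1).1))
        =o[𝓝 (t₀, φ₀)] fun p => p - (t₀, φ₀) := by
      refine IsLittleO.trans_isBigO ?_ hO4
      refine IsLittleO.of_bound fun δ hδ => ?_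
      obtain ⟨d, hd, h⟩ := hUD (δ / 2) (half_pos hδ)
      have c1 : ∀ᶠ p : ℝ × ℝ in 𝓝 (t₀, φ₀), |p.2 - φ₀| < d := by
        refine (by fun_prop : Continuous fun p : ℝ × ℝ => |p.2 - φ₀|).continuousAt.eventually_lt
          continuousAt_const ?_
        simpa using hd
      have c2 : ∀ᶠ p : ℝ × ℝ in 𝓝 (t₀, φ₀), |(z p.1).1 - φ₀| < d := by
        have hzc := hz.continuous
        refine (by fun_prop : Continuous fun p : ℝ × ℝ =>
          |(z p.1).1 - φ₀|).continuousAt.eventually_lt continuousAt_const ?_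
        simpa [hz0] using hd
      have c3 : ∀ᶠ p : ℝ × ℝ in 𝓝 (t₀, φ₀), |D p.1 φ₀ - D t₀ φ₀| < δ / 2 := by
        have hc : Continuous fun p : ℝ × ℝ => D p.1 φ₀ :=
          hD.comp (by fun_prop : Continuous fun p : ℝ × ℝ => (p.1, φ₀))
        refine (hc.sub continuous_const).abs.continuousAt.eventually_lt continuousAt_const ?_
        simpa using half_pos hδ
      filter_upwards [c1, c2, c3] with p p1 p2 p3
      have h5 := h p.1 φ₀ (z p.1).1 p.2 p2 p1
      have h6 : U p.1 p.2 - U p.1 (z p.1).1 - D t₀ φ₀ * (p.2 - (z p.1).1) =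
          (U p.1 p.2 - U p.1 (z p.1).1 - D p.1 φ₀ * (p.2 - (z p.1).1)) +
          (D p.1 φ₀ - D t₀ φ₀) * (p.2 - (z p.1).1) := by ring
      rw [h6, Real.norm_eq_abs, Real.norm_eq_abs]
      refine (abs_add_le _ _).trans ?_
      rw [abs_mul]
      have := mul_le_mul_of_nonneg_right p3.le (abs_nonneg (p.2 - (z p.1).1))
      linarith
    refine HasFDerivAt.of_isLittleO ?_
    have o4 := (o2.add o3).add (o1.const_mul_left (-(D t₀ φ₀)))
    refine o4.congr_left fun p => ?_
    have e1 : (z p.1).2 = U p.1 (z p.1).1 := hzU p.1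
    simp only [Function.comp_def, e1, hz0, smul_eq_mul,
      L, g, uncurry, add_apply, smul_apply, ContinuousLinearMap.coe_fst',
      ContinuousLinearMap.coe_snd', Prod.fst_sub, Prod.snd_sub]
    ring
  rw [contDiff_one_iff_fderiv]
  refine ⟨fun p => (hderiv p).differentiableAt, ?_⟩
  rw [show fderiv ℝ (uncurry U) = L from funext fun p => (hderiv p).fderiv]
  exact hL

namespace IsConeSystem

variable {σ : ℝ} {G : ℝ → ℝ × ℝ → ℝ × ℝ} {w ψ Wd Ψd : ℝ → ℝ × ℝ → ℝ} {K : ℝ≥0}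
    {M V V₀ κ a a' c C Λ : ℝ}

theorem exists_invariant_graph_pos (h : IsConeSystem 1 G w ψ Wd Ψd K M V V₀ κ a a' c C Λ)
    {T ω : ℝ} (hGT : ∀ t z, G (t + T) z = G t z) (hwT : ∀ t z, w (t + T) z = w t z)
    (hGω : ∀ t φ v, G t (φ + ω, v) = G t (φ, v)) (hwω : ∀ t φ v, w t (φ + ω, v) = w t (φ, v)) :
    ∃ U : ℝ → ℝ → ℝ, ContDiff ℝ 1 (uncurry U) ∧ (∀ t φ, U (t + T) φ = U t φ) ∧
      (∀ t φ, U t (φ + ω) = U t φ) ∧ (∀ t φ, |U t φ| ≤ V₀) ∧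
      ∀ t₀ φ₀, ∃ z, IsGlobalSol G z ∧ z t₀ = (φ₀, U t₀ φ₀) ∧ ∀ t, (z t).2 = U t (z t).1 := by
  choose Z hZ hZs hZ0 using h.exists_stays
  let U : ℝ → ℝ → ℝ := fun t φ => (Z t φ t).2
  have hUz : ∀ z, IsGlobalSol G z → StaysInStrip V w z → ∀ t, (z t).2 = U t (z t).1 := by
    intro z hz hs t
    have : z = Z t (z t).1 := h.stays_unique hz (hZ _ _) hs (hZs _ _) (t := t) (hZ0 _ _).symm
    change (z t).2 = (Z t (z t).1 t).2
    rw [← this]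
  have hsol : ∀ t₀ φ₀, ∃ z, IsGlobalSol G z ∧ z t₀ = (φ₀, U t₀ φ₀) ∧ ∀ t, (z t).2 = U t (z t).1 :=
    fun t₀ φ₀ => ⟨Z t₀ φ₀, hZ _ _, Prod.ext (hZ0 _ _) rfl, hUz _ (hZ _ _) (hZs _ _)⟩
  have hbd : ∀ t φ, |U t φ| ≤ V₀ := fun t φ => h.strip t _ (hZs t φ t).1 (hZs t φ t).2
  have hΛ := h.Λ_nonneg
  have hlip : ∀ t φ₁ φ₂, |U t φ₁ - U t φ₂| ≤ (1 + Λ) * |φ₁ - φ₂| := fun t φ₁ φ₂ => by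
    have := (norm_snd_le _).trans (h.stays_norm_le (hZ t φ₁) (hZ t φ₂) (hZs _ _) (hZs _ _) t)
    rwa [hZ0, hZ0] at this
  have hM : 0 ≤ M := (norm_nonneg _).trans (h.flow.bdd 0 0)
  have hcont : Continuous (uncurry U) := by
    refine continuous_iff_continuousAt.2 ?_
    rintro ⟨t₀, φ₀⟩
    have hb : ∀ p : ℝ × ℝ, |uncurry U p - U t₀ φ₀| ≤
        (1 + Λ) * (|p.2 - φ₀| + M * |p.1 - t₀|) + M * |p.1 - t₀| := by
      intro p
      have e1 := h.flow.norm_sub_le (hZ t₀ φ₀) t₀ p.1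
      have e2 := (norm_fst_le _).trans e1
      have e3 := (norm_snd_le _).trans e1
      rw [Prod.fst_sub, hZ0, Real.norm_eq_abs] at e2
      rw [Prod.snd_sub, Real.norm_eq_abs, hUz _ (hZ t₀ φ₀) (hZs _ _) p.1] at e3
      have e4 := hlip p.1 p.2 (Z t₀ φ₀ p.1).1
      have e5 : |p.2 - (Z t₀ φ₀ p.1).1| ≤ |p.2 - φ₀| + |(Z t₀ φ₀ p.1).1 - φ₀| := by
        have := abs_sub (p.2 - φ₀) ((Z t₀ φ₀ p.1).1 - φ₀)
        rwa [sub_sub_sub_cancel_right] at this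
      have e6 : |uncurry U p - U t₀ φ₀| ≤ |U p.1 p.2 - U p.1 (Z t₀ φ₀ p.1).1| +
          |U p.1 (Z t₀ φ₀ p.1).1 - U t₀ φ₀| := abs_sub_le _ _ _
      have e7 : (1 + Λ) * |p.2 - (Z t₀ φ₀ p.1).1| ≤ (1 + Λ) * (|p.2 - φ₀| + M * |p.1 - t₀|) := by
        gcongr; linarith
      have e8 : |U p.1 (Z t₀ φ₀ p.1).1 - U t₀ φ₀| ≤ M * |p.1 - t₀| := e3
      linarith
    refine tendsto_iff_dist_tendsto_zero.2 (squeeze_zero (fun _ => dist_nonneg) hb ?_)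
    have : Continuous fun p : ℝ × ℝ =>
        (1 + Λ) * (|p.2 - φ₀| + M * |p.1 - t₀|) + M * |p.1 - t₀| := by fun_prop
    have := this.tendsto (t₀, φ₀)
    simpa using this
  have hslope : ∀ δ > 0, ∃ d > 0, ∀ t φ₁ φ₂ φ₃ φ₄ : ℝ, |φ₂ - φ₁| < d → |φ₃ - φ₁| < d →
      |φ₄ - φ₁| < d → φ₃ ≠ φ₄ →
      |U t φ₁ + (φ₂ - φ₁) / (φ₄ - φ₃) * (U t φ₄ - U t φ₃) - U t φ₂| ≤ δ * |φ₂ - φ₁| := by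
    intro δ hδ
    obtain ⟨d, hd, hh⟩ := h.slope_close hδ
    refine ⟨d, hd, fun t φ₁ φ₂ φ₃ φ₄ h1 h2 h3 h4 => ?_⟩
    have := hh t (Z t φ₁) (Z t φ₂) (Z t φ₃) (Z t φ₄) (hZ _ _) (hZ _ _) (hZ _ _) (hZ _ _)
      (hZs _ _) (hZs _ _) (hZs _ _) (hZs _ _)
    simp only [hZ0] at this
    exact this h1 h2 h3 h4
  obtain ⟨D, hDc, hD⟩ := exists_partial_of_slope_close hcont hslope
  refine ⟨U, contDiff_of_invariant h.flow.cont hcont hDc hD hsol, ?_, ?_, hbd, hsol⟩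
  · intro t φ
    have hs : IsGlobalSol G fun s => Z (t + T) φ (s + T) := fun s => by
      have := (hZ (t + T) φ (s + T)).comp_add_const s T
      rwa [hGT] at this
    have hst : StaysInStrip V w fun s => Z (t + T) φ (s + T) := fun s => by
      have := hZs (t + T) φ (s + T)
      rwa [hwT] at this
    have := hUz _ hs hst t
    simp only [hZ0] at this
    exact this
  · intro t φ
    have hs : IsGlobalSol G fun s => Z t φ s + (ω, 0) := fun s => by
      have := (hZ t φ s).add_const (ω, (0 : ℝ))
      have e : Z t φ s + (ω, 0) = ((Z t φ s).1 + ω, (Z t φ s).2) := by ext <;> simp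
      beta_reduce
      rw [e, hGω]
      exact this
    have hst : StaysInStrip V w fun s => Z t φ s + (ω, 0) := fun s => by
      have := hZs t φ s
      have e : Z t φ s + (ω, 0) = ((Z t φ s).1 + ω, (Z t φ s).2) := by ext <;> simp
      beta_reduce
      rw [e, hwω]
      exact this
    have := hUz _ hs hst t
    simp only [Prod.fst_add, Prod.snd_add, hZ0, add_zero] at this
    exact this.symm

/-- A system with an expanding or contracting cone field has an invariant graph. -/
theorem exists_invariant_graph (h : IsConeSystem σ G w ψ Wd Ψd K M V V₀ κ a a' c C Λ)
    (hσ : σ = 1 ∨ σ = -1)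
    {T ω : ℝ} (hGT : ∀ t z, G (t + T) z = G t z) (hwT : ∀ t z, w (t + T) z = w t z)
    (hGω : ∀ t φ v, G t (φ + ω, v) = G t (φ, v)) (hwω : ∀ t φ v, w t (φ + ω, v) = w t (φ, v)) :
    ∃ U : ℝ → ℝ → ℝ, ContDiff ℝ 1 (uncurry U) ∧ (∀ t φ, U (t + T) φ = U t φ) ∧
      (∀ t φ, U t (φ + ω) = U t φ) ∧ (∀ t φ, |U t φ| ≤ V₀) ∧
      ∀ t₀ φ₀, ∃ z, IsGlobalSol G z ∧ z t₀ = (φ₀, U t₀ φ₀) ∧ ∀ t, (z t).2 = U t (z t).1 := by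
  rcases hσ with rfl | rfl
  · exact h.exists_invariant_graph_pos hGT hwT hGω hwω
  have h' := h.reverse
  rw [neg_neg] at h'
  have shift : ∀ {X : Type} (F : ℝ → ℝ × ℝ → X), (∀ t z, F (t + T) z = F t z) →
      ∀ t z, F (-(t + T)) z = F (-t) z := fun F hF t z => by
    rw [← hF (-(t + T)) z]; congr 1; ring
  obtain ⟨U, h1, h2, h3, h4, h5⟩ := h'.exists_invariant_graph_pos (T := T) (ω := ω)
    (fun t z => by rw [shift G hGT]) (fun t z => shift w hwT t z)
    (fun t φ v => by rw [hGω]) (fun t φ v => hwω _ _ _)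
  refine ⟨fun t => U (-t), ?_, fun t φ => ?_, fun t φ => h3 _ _, fun t φ => h4 _ _,
    fun t₀ φ₀ => ?_⟩
  · exact h1.comp (by fun_prop : ContDiff ℝ 1 fun p : ℝ × ℝ => (-p.1, p.2))
  · change U (-(t + T)) φ = U (-t) φ
    rw [← h2 (-(t + T)) φ]; congr 1; ring
  · obtain ⟨z, hz, hz0, hzU⟩ := h5 (-t₀) φ₀
    refine ⟨fun t => z (-t), ?_, hz0, fun t => hzU (-t)⟩
    have := hz.reverse
    simpa using this

end IsConeSystem

end InvariantGraph


/-! ### Functions that are smooth or analytic in the angle -/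

section Angle

open Filter Topology

/-- `f(t, φ)` is continuous, together with its derivatives in `φ` up to order `n`. -/
def IsAngleC : ℕ → (ℝ → ℝ → ℝ) → Prop
  | 0, f => Continuous (uncurry f)
  | n + 1, f => Continuous (uncurry f) ∧
      ∃ f' : ℝ → ℝ → ℝ, (∀ t φ, HasDerivAt (f t) (f' t φ) φ) ∧ IsAngleC n f'

theorem IsAngleC.continuous {n : ℕ} {f : ℝ → ℝ → ℝ} (h : IsAngleC n f) : Continuous (uncurry f) := by
  cases n with
  | zero => exact h
  | succ n => exact h.1

theorem isOpen_imStrip (δ : ℝ) : IsOpen {z : ℂ | |z.im| < δ} :=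
  isOpen_lt (by fun_prop) continuous_const

theorem isPreconnected_imStrip (δ : ℝ) : IsPreconnected {z : ℂ | |z.im| < δ} := by
  have : {z : ℂ | |z.im| < δ} = Complex.imLm ⁻¹' (Ioo (-δ) δ) := by
    ext z; simp [abs_lt]
  rw [this]
  exact ((convex_Ioo (-δ) δ).linear_preimage Complex.imLm).isPreconnected

theorem IsAnalyticInAngle.continuous {v : ℝ → ℝ → ℝ} (h : IsAnalyticInAngle v) :
    Continuous (uncurry v) := by
  obtain ⟨δ, hδ, F, hF, -, hFv⟩ := h
  have h1 : Continuous fun p : ℝ × ℝ => uncurry F (p.1, (p.2 : ℂ)) :=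
    hF.comp_continuous (by fun_prop) fun p => ⟨trivial, by simpa using hδ⟩
  have h2 : uncurry v = fun p : ℝ × ℝ => (uncurry F (p.1, (p.2 : ℂ))).re := by
    funext p
    simp [uncurry, hFv]
  rw [h2]
  exact Complex.continuous_re.comp h1

/-- The angular derivative of a function that is analytic in the angle. -/
theorem IsAnalyticInAngle.exists_deriv {v : ℝ → ℝ → ℝ} (h : IsAnalyticInAngle v) :
    ∃ v' : ℝ → ℝ → ℝ, (∀ t φ, HasDerivAt (v t) (v' t φ) φ) ∧ IsAnalyticInAngle v' := by
  obtain ⟨δ, hδ, F, hF, hFd, hFv⟩ := h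
  have hop := isOpen_imStrip δ
  have hmem : ∀ φ : ℝ, (φ : ℂ) ∈ {z : ℂ | |z.im| < δ} := fun φ => by simpa using hδ
  have hda : ∀ t (φ : ℝ), HasDerivAt (F t) (deriv (F t) φ) φ := fun t φ =>
    ((hFd t).differentiableAt (hop.mem_nhds (hmem φ))).hasDerivAt
  have hre : ∀ t (φ : ℝ), HasDerivAt (v t) (deriv (F t) φ).re φ := fun t φ => by
    have := (hda t φ).real_of_complex
    simpa [hFv] using this
  refine ⟨fun t φ => (deriv (F t) φ).re, hre, δ, hδ, fun t => deriv (F t), ?_,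
    fun t => (hFd t).deriv hop, fun t φ => ?_⟩
  · rintro ⟨t₀, z₀⟩ hz₀
    have hlu : TendstoLocallyUniformlyOn F (F t₀) (𝓝 t₀) {z : ℂ | |z.im| < δ} := by
      rw [Metric.tendstoLocallyUniformlyOn_iff]
      intro ε hε z hz
      have hc : ContinuousAt (uncurry F) (t₀, z) :=
        hF.continuousAt ((isOpen_univ.prod hop).mem_nhds ⟨trivial, hz⟩)
      have h1 := Metric.continuousAt_iff'.1 hc (ε / 2) (half_pos hε)
      rw [nhds_prod_eq] at h1
      obtain ⟨p, hp, q, hq, hpq⟩ := eventually_prod_iff.1 h1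
      refine ⟨{y | q y}, mem_nhdsWithin_of_mem_nhds hq, ?_⟩
      filter_upwards [hp] with t ht y hy
      have e1 := hpq ht hy
      have e2 := hpq hp.self_of_nhds hy
      calc dist (F t₀ y) (F t y) ≤ dist (F t₀ y) (F t₀ z) + dist (F t y) (F t₀ z) :=
            dist_triangle_right _ _ _
        _ < ε := by
          simp only [uncurry] at e1 e2
          linarith
    have hlu' := hlu.deriv (Eventually.of_forall hFd) hop
    have hcd : ContinuousAt (deriv (F t₀)) z₀ :=
      (((hFd t₀).deriv hop).differentiableAt (hop.mem_nhds hz₀.2)).continuousAt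
    refine ContinuousAt.continuousWithinAt ?_
    rw [Metric.continuousAt_iff']
    intro ε hε
    obtain ⟨s, hs, hs'⟩ := Metric.tendstoLocallyUniformlyOn_iff.1 hlu' (ε / 2) (half_pos hε) z₀ hz₀.2
    rw [hop.nhdsWithin_eq hz₀.2] at hs
    have h2 := Metric.continuousAt_iff'.1 hcd (ε / 2) (half_pos hε)
    rw [nhds_prod_eq]
    filter_upwards [(hs'.prod_mk (h2.and hs))] with p hp
    have e1 := hp.1 p.2 hp.2.2
    have e2 := hp.2.1
    calc dist (deriv (F p.1) p.2) (deriv (F t₀) z₀)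
        ≤ dist (deriv (F p.1) p.2) (deriv (F t₀) p.2) + dist (deriv (F t₀) p.2) (deriv (F t₀) z₀) :=
          dist_triangle _ _ _
      _ < ε := by
        rw [dist_comm] at e1
        simp only [comp_apply] at e1
        linarith
  · have h1 := (hda t φ).comp_ofReal
    have h2 : HasDerivAt (fun x : ℝ => F t x) (((deriv (F t) φ).re : ℝ) : ℂ) φ := by
      have := (hre t φ).ofReal_comp
      simpa [hFv] using this
    exact h1.unique h2

theorem IsAnalyticInAngle.isAngleC {v : ℝ → ℝ → ℝ} (h : IsAnalyticInAngle v) (n : ℕ) :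
    IsAngleC n v := by
  induction n generalizing v with
  | zero => exact h.continuous
  | succ n ih =>
    obtain ⟨v', hv', ha⟩ := h.exists_deriv
    exact ⟨h.continuous, v', hv', ih ha⟩

end Angle

/-! ### The homological equation -/

section Homological

open Filter Topology Complex

theorem summable_exp_neg_abs {r : ℝ} (hr : 0 < r) :
    Summable fun n : ℤ => Real.exp (-(r * |(n : ℝ)|)) := by
  have h : Summable fun n : ℕ => Real.exp (-(r * (n : ℝ))) := by
    have := summable_geometric_of_lt_one (Real.exp_pos (-r)).le (Real.exp_lt_one_iff.2 (by linarith))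
    refine this.congr fun n => ?_
    rw [← Real.exp_nat_mul]; congr 1; ring
  refine Summable.of_nat_of_neg ?_ ?_
  · refine h.congr fun n => by simp
  · refine h.congr fun n => by simp

theorem siegel_lower_bound {T ω : ℝ} (hT : 0 < T) (hω : 0 < ω) (hS : Siegel T ω) {ρ : ℝ}
    (hρ : 0 < ρ) : ∃ A > 0, ∀ n : ℤ, n ≠ 0 →
      Real.exp (-(ρ * |(n : ℝ)|)) ≤ A * ‖exp (I * (2 * Real.pi * n / ω * T : ℝ)) - 1‖ := by
  obtain ⟨K, τ, hK, hτ, hS⟩ := hS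
  set B := T / ω + 2 with hB
  have hBp : 2 ≤ B := by have := div_pos hT hω; linarith
  set N := ⌈τ⌉₊ with hN
  have hNτ : τ ≤ N := Nat.le_ceil τ
  set A₁ := 1 / T + (N.factorial * (B / ρ) ^ N) / K with hA₁
  have hfac : (0 : ℝ) < N.factorial := by positivity
  have hA₁p : 0 < A₁ := by positivity
  have hnat : ∀ n : ℕ, 0 < n → Real.exp (-(ρ * n)) ≤
      A₁ * ω * |n * T / ω - round (n * T / ω)| := by
    intro n hn
    have hn1 : (1 : ℝ) ≤ n := by exact_mod_cast hn
    set θ := n * T / ω with hθ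
    have hθp : 0 < θ := by positivity
    have hr : |θ - round θ| ≤ 1 / 2 := abs_sub_round θ
    have hr0 : 0 ≤ round θ := by
      have h1 := (abs_le.1 hr).2
      have h2 : (-1 : ℝ) < round θ := by linarith
      have h3 : (-1 : ℤ) < round θ := by exact_mod_cast h2
      omega
    have hmul : ω * |θ - round θ| = |n * T - round θ * ω| := by
      rw [← abs_of_pos hω, ← abs_mul, abs_of_pos hω, hθ]; congr 1; field_simp
    rw [mul_assoc, hmul]
    obtain ⟨m, hm⟩ := Int.eq_ofNat_of_zero_le hr0
    have hm' : (round θ : ℝ) = m := by rw [hm]; simp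
    rw [hm'] at hmul hr ⊢
    rcases Nat.eq_zero_or_pos m with h0 | hmp
    · subst h0
      have e1 : Real.exp (-(ρ * n)) ≤ 1 := Real.exp_le_one_iff.2 (by
        have : 0 ≤ ρ * n := by positivity
        linarith)
      have e2 : 1 / T ≤ A₁ := by rw [hA₁]; have : 0 ≤ (N.factorial * (B / ρ) ^ N) / K := by positivity
                                 linarith
      have e3 : |(n : ℝ) * T - (0 : ℕ) * ω| = n * T := by
        simp only [Nat.cast_zero, zero_mul, sub_zero]; exact abs_of_pos (by positivity)
      rw [e3]
      calc Real.exp (-(ρ * n)) ≤ 1 := e1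
        _ = 1 / T * T := by field_simp
        _ ≤ A₁ * (n * T) := by gcongr; nlinarith
    · have e1 := hS n m hn hmp
      have hnm : (n : ℝ) + m ≤ n * B := by
        have h1 := (abs_le.1 hr).1
        have h2 : θ = n * (T / ω) := by rw [hθ]; ring
        rw [hB]; nlinarith
      have hnB : 1 ≤ n * B := by nlinarith
      have hnmp : (0 : ℝ) < n + m := by positivity
      have e2 : ((n * B) ^ N)⁻¹ ≤ ((n : ℝ) + m) ^ (-τ) := by
        calc ((n * B) ^ N)⁻¹ = (n * B) ^ (-(N : ℝ)) := by
              rw [Real.rpow_neg (by positivity), Real.rpow_natCast]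
          _ ≤ (n * B) ^ (-τ) := Real.rpow_le_rpow_of_exponent_le hnB (by linarith)
          _ ≤ ((n : ℝ) + m) ^ (-τ) :=
              Real.rpow_le_rpow_of_nonpos hnmp hnm (by linarith)
      have e3 : Real.exp (-(ρ * n)) ≤ N.factorial * (B / ρ) ^ N * ((n * B) ^ N)⁻¹ := by
        have h1 := Real.pow_div_factorial_le_exp (ρ * n) (by positivity) N
        rw [Real.exp_neg]
        have h2 : N.factorial * (B / ρ) ^ N * ((n * B) ^ N)⁻¹ = ((ρ * n) ^ N / N.factorial)⁻¹ := by
          rw [inv_div, div_pow, mul_pow, mul_pow]; field_simp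
        rw [h2]
        exact inv_anti₀ (by positivity) h1
      have e4 : N.factorial * (B / ρ) ^ N / K ≤ A₁ := by
        rw [hA₁]; have : 0 < 1 / T := by positivity
        linarith
      calc Real.exp (-(ρ * n)) ≤ N.factorial * (B / ρ) ^ N * ((n * B) ^ N)⁻¹ := e3
        _ ≤ N.factorial * (B / ρ) ^ N * (((n : ℝ) + m) ^ (-τ)) := by gcongr
        _ = N.factorial * (B / ρ) ^ N / K * (K * ((n : ℝ) + m) ^ (-τ)) := by field_simp
        _ ≤ A₁ * |n * T - m * ω| := by gcongr
  have hsin : ∀ n : ℕ, 4 * |n * T / ω - round (n * T / ω)| ≤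
      ‖2 * Real.sin (2 * Real.pi * n / ω * T / 2)‖ := by
    intro n
    set θ := n * T / ω with hθ
    have h1 : 2 * Real.pi * n / ω * T / 2 = Real.pi * (θ - round θ) + round θ * Real.pi := by
      rw [hθ]; field_simp; ring
    have hr := abs_sub_round θ
    have h2 : |Real.sin (2 * Real.pi * n / ω * T / 2)| = |Real.sin (Real.pi * (θ - round θ))| := by
      rw [h1, Real.sin_add_int_mul_pi, abs_mul, abs_zpow]; simp
    have h3 := Real.mul_abs_le_abs_sin (x := Real.pi * (θ - round θ)) (by
      rw [abs_mul, abs_of_pos Real.pi_pos]; nlinarith [Real.pi_pos])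
    rw [abs_mul, abs_of_pos Real.pi_pos] at h3
    have h4 : 2 / Real.pi * (Real.pi * |θ - round θ|) = 2 * |θ - round θ| := by
      have := Real.pi_pos.ne'; field_simp
    rw [norm_mul, Real.norm_eq_abs, Real.norm_eq_abs, h2, abs_of_pos (two_pos : (0 : ℝ) < 2)]
    linarith
  refine ⟨A₁ * ω / 4, by positivity, fun n hn => ?_⟩
  rw [norm_exp_I_mul_ofReal_sub_one]
  have hmain : ∀ k : ℕ, 0 < k → Real.exp (-(ρ * k)) ≤
      A₁ * ω / 4 * ‖2 * Real.sin (2 * Real.pi * k / ω * T / 2)‖ := fun k hk => by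
    have h1 := hnat k hk
    have h2 := mul_le_mul_of_nonneg_left (hsin k) (show 0 ≤ A₁ * ω / 4 by positivity)
    linarith
  obtain ⟨k, rfl | rfl⟩ := n.eq_nat_or_neg
  · have := hmain k (by omega)
    simpa using this
  · have := hmain k (by omega)
    have e : 2 * Real.pi * ((-(k : ℤ) : ℤ) : ℝ) / ω * T / 2 = -(2 * Real.pi * k / ω * T / 2) := by
      push_cast; ring
    rw [e, Real.sin_neg, mul_neg, norm_neg]
    simpa using this

/-- Exponential decay of the Fourier coefficients of a periodic function that is holomorphic in a
strip. -/
theorem norm_fourier_integral_le {ω δ δ' : ℝ} (hω : 0 < ω) (hδ' : 0 < δ') (hδ : δ' < δ) {f : ℂ → ℂ}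
    (hf : DifferentiableOn ℂ f {z : ℂ | |z.im| < δ})
    (hper : ∀ z : ℂ, |z.im| < δ → f (z + ω) = f z) {B : ℝ}
    (hB : ∀ x y : ℝ, x ∈ Icc 0 ω → |y| ≤ δ' → ‖f (x + y * I)‖ ≤ B) (n : ℤ) :
    ‖∫ x in (0 : ℝ)..ω, exp (-(I * (2 * Real.pi * n / ω : ℝ) * x)) * f x‖ ≤
      B * Real.exp (-(2 * Real.pi / ω * δ' * |(n : ℝ)|)) * ω := by
  set l : ℝ := 2 * Real.pi * n / ω with hl
  let h : ℂ → ℂ := fun z => exp (-(I * l * z)) * f z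
  obtain ⟨y, hy, hly⟩ : ∃ y : ℝ, |y| = δ' ∧ l * y = -(2 * Real.pi / ω * δ' * |(n : ℝ)|) := by
    rcases le_total 0 (n : ℝ) with h0 | h0
    · exact ⟨-δ', by rw [abs_neg, abs_of_pos hδ'], by rw [abs_of_nonneg h0, hl]; ring⟩
    · exact ⟨δ', abs_of_pos hδ', by rw [abs_of_nonpos h0, hl]; ring⟩
  have hstrip : ∀ z : ℂ, z ∈ uIcc (0 : ℂ).re (ω + y * I : ℂ).re ×ℂ
      uIcc (0 : ℂ).im (ω + y * I : ℂ).im → |z.im| < δ := fun z hz => by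
    have h2 : z.im ∈ uIcc 0 y := by simpa using hz.2
    have h3 : |z.im| ≤ |y| := by
      have := abs_sub_left_of_mem_uIcc h2
      simpa using this
    linarith
  have hd : DifferentiableOn ℂ h (uIcc (0 : ℂ).re (ω + y * I : ℂ).re ×ℂ
      uIcc (0 : ℂ).im (ω + y * I : ℂ).im) := by
    refine DifferentiableOn.mul (by fun_prop) (hf.mono hstrip)
  have hrect := integral_boundary_rect_eq_zero_of_differentiableOn h 0 (ω + y * I) hd
  have hex : exp (-(I * l * ω)) = 1 := by
    rw [Complex.exp_eq_one_iff]
    refine ⟨-n, ?_⟩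
    rw [hl]; push_cast
    have : (ω : ℂ) ≠ 0 := by exact_mod_cast hω.ne'
    field_simp
  have hside : (∫ s in (0 : ℝ)..y, h (ω + s * I)) = ∫ s in (0 : ℝ)..y, h (0 + s * I) := by
    refine intervalIntegral.integral_congr fun s hs => ?_
    have h3 : |s| ≤ |y| := by
      have := abs_sub_left_of_mem_uIcc hs
      simpa using this
    have e1 : f (ω + s * I) = f (0 + s * I) := by
      have := hper (s * I) (by simp; linarith)
      rw [zero_add, ← this, add_comm]
    simp only [h]
    rw [e1]
    congr 1
    rw [show -(I * l * (ω + s * I)) = -(I * l * ω) + -(I * l * (0 + s * I)) by ring,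
      Complex.exp_add, hex, one_mul]
  have hre : (ω + y * I : ℂ).re = ω := by simp
  have him : (ω + y * I : ℂ).im = y := by simp
  rw [hre, him] at hrect
  simp only [zero_re, zero_im, ofReal_zero, zero_mul, add_zero] at hrect
  rw [hside, add_sub_assoc, sub_self, add_zero, sub_eq_zero] at hrect
  change ‖∫ x in (0 : ℝ)..ω, h x‖ ≤ _
  rw [hrect]
  have hb := intervalIntegral.norm_integral_le_of_norm_le_const (a := 0) (b := ω)
    (f := fun x : ℝ => h (x + y * I)) (C := B * Real.exp (-(2 * Real.pi / ω * δ' * |(n : ℝ)|)))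
    fun x hx => by
      rw [uIoc_of_le hω.le] at hx
      have e1 : ‖exp (-(I * l * (x + y * I)))‖ = Real.exp (l * y) := by
        rw [Complex.norm_exp]; congr 1; simp
      simp only [h]
      rw [norm_mul, e1, hly, mul_comm]
      gcongr
      exact hB x y ⟨hx.1.le, hx.2⟩ hy.le
  rwa [sub_zero, abs_of_pos hω] at hb

end Homological


section Homological

open Filter Topology Complex

/-- The holomorphic extension of a periodic function is periodic. -/
theorem periodic_of_real {δ ω : ℝ} (hδ : 0 < δ) {f : ℂ → ℂ}
    (hf : DifferentiableOn ℂ f {z : ℂ | |z.im| < δ}) (hper : ∀ x : ℝ, f (x + ω) = f x) :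
    ∀ z : ℂ, |z.im| < δ → f (z + ω) = f z := by
  have hop := isOpen_imStrip δ
  have hf1 : AnalyticOnNhd ℂ f {z : ℂ | |z.im| < δ} := hf.analyticOnNhd hop
  have hf2 : AnalyticOnNhd ℂ (fun z => f (z + ω)) {z : ℂ | |z.im| < δ} := by
    refine DifferentiableOn.analyticOnNhd ?_ hop
    exact hf.comp (by fun_prop) fun z hz => by simpa using hz
  refine fun z hz => hf2.eqOn_of_preconnected_of_frequently_eq hf1 (isPreconnected_imStrip δ)
    (z₀ := 0) (by simpa using hδ) ?_ hz
  have ht : Tendsto (fun x : ℝ => (x : ℂ)) (𝓝[≠] 0) (𝓝[≠] 0) := by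
    refine tendsto_nhdsWithin_of_tendsto_nhds_of_eventually_within _ ?_ ?_
    · have := Complex.continuous_ofReal.tendsto (0 : ℝ)
      rw [ofReal_zero] at this
      exact this.mono_left nhdsWithin_le_nhds
    · filter_upwards [self_mem_nhdsWithin] with x hx
      simpa using hx
  exact ht.frequently (Frequently.of_forall fun x => hper x)

theorem intervalIntegral_swap_of_continuous {v : ℝ → ℝ → ℝ} (hv : Continuous (uncurry v))
    (a b c d : ℝ) :
    (∫ s in a..b, ∫ x in c..d, v s x) = ∫ x in c..d, ∫ s in a..b, v s x := by
  refine MeasureTheory.intervalIntegral_intervalIntegral_swap ?_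
  exact (hv.continuousOn.integrableOn_compact (isCompact_uIcc.prod isCompact_uIcc)).mono_set
    (prod_mono uIoc_subset_uIcc uIoc_subset_uIcc)

theorem average_sub_const {T ω : ℝ} (hT : 0 < T) (hω : 0 < ω) {v : ℝ → ℝ → ℝ}
    (hv : Continuous (uncurry v)) (a : ℝ) :
    average T ω (fun t φ => v t φ - a) = average T ω v - a := by
  have h1 : ∀ φ, (∫ t in (0 : ℝ)..T, (v t φ - a)) = (∫ t in (0 : ℝ)..T, v t φ) - T * a := fun φ => by
    have : Continuous fun t => v t φ := hv.comp (by fun_prop : Continuous fun t : ℝ => (t, φ))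
    rw [intervalIntegral.integral_sub (this.intervalIntegrable _ _) (by simp)]
    simp
  have h2 : Continuous fun φ => ∫ t in (0 : ℝ)..T, v t φ :=
    intervalIntegral.continuous_parametric_intervalIntegral_of_continuous'
      (f := fun φ t => v t φ) (hv.comp continuous_swap) _ _
  unfold average
  simp only [h1]
  rw [intervalIntegral.integral_sub (h2.intervalIntegrable _ _) (by simp)]
  simp only [intervalIntegral.integral_const, smul_eq_mul, sub_zero]
  field_simp

/-- The homological equation `∂g/∂t + ∂g/∂φ = v` is solvable under the Siegel condition. -/
theorem exists_isHomologicalSolution {T ω : ℝ} (hT : 0 < T) (hω : 0 < ω) (hS : Siegel T ω)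
    {v : ℝ → ℝ → ℝ} (hv : IsAnalyticInAngle v) (hvT : ∀ t φ, v (t + T) φ = v t φ)
    (hvω : ∀ t φ, v t (φ + ω) = v t φ) (hv0 : average T ω v = 0) :
    ∃ g, IsHomologicalSolution T ω v g := by
  have hvc := hv.continuous
  obtain ⟨δ, hδ, F, hF, hFd, hFv⟩ := hv
  have hvcc : Continuous fun p : ℝ × ℝ => ((v p.1 p.2 : ℝ) : ℂ) := continuous_ofReal.comp hvc
  let l : ℤ → ℝ := fun n => 2 * Real.pi * n / ω
  let c : ℤ → ℝ → ℂ := fun n t => 1 / ω * ∫ x in (0 : ℝ)..ω, exp (-(I * l n * x)) * v t x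
  have hcc : ∀ n, Continuous (c n) := fun n => by
    refine continuous_const.mul
      (intervalIntegral.continuous_parametric_intervalIntegral_of_continuous' ?_ _ _)
    simp only [uncurry_def]
    fun_prop
  have hcT : ∀ n t, c n (t + T) = c n t := fun n t => by simp only [c, hvT]
  -- decay of the coefficients
  obtain ⟨ρ, hρ, B, hB0, hcb⟩ : ∃ ρ > 0, ∃ B ≥ 0, ∀ n t, ‖c n t‖ ≤ B * Real.exp (-(ρ * |(n : ℝ)|)) := by
    have hcomp : IsCompact (Icc (0 : ℝ) T ×ˢ (Icc (0 : ℝ) ω ×ˢ Icc (-(δ / 2)) (δ / 2))) :=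
      isCompact_Icc.prod (isCompact_Icc.prod isCompact_Icc)
    have hcont : ContinuousOn (fun p : ℝ × ℝ × ℝ => F p.1 (p.2.1 + p.2.2 * I))
        (Icc (0 : ℝ) T ×ˢ (Icc (0 : ℝ) ω ×ˢ Icc (-(δ / 2)) (δ / 2))) := by
      refine hF.comp (f := fun p : ℝ × ℝ × ℝ => (p.1, (p.2.1 + p.2.2 * I : ℂ))) (by fun_prop) ?_
      rintro ⟨t, x, y⟩ ⟨-, -, hy⟩
      refine ⟨trivial, ?_⟩
      have : |y| ≤ δ / 2 := abs_le.2 hy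
      simp; linarith
    obtain ⟨B, hB⟩ := hcomp.exists_bound_of_continuousOn hcont
    have hBp : 0 ≤ B := (norm_nonneg _).trans (hB (0, 0, 0)
      ⟨⟨le_rfl, hT.le⟩, ⟨le_rfl, hω.le⟩, by simp; linarith, by simp; linarith⟩)
    refine ⟨2 * Real.pi / ω * (δ / 2), by have := Real.pi_pos; positivity, B, hBp, fun n t => ?_⟩
    obtain ⟨s, hs, hst⟩ := Function.Periodic.exists_mem_Ico₀ (f := c n) (fun t => hcT n t) hT t
    rw [hst]
    have h1 := norm_fourier_integral_le hω (half_pos hδ) (half_lt_self hδ) (hFd s)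
      (periodic_of_real hδ (hFd s) fun x => by
        have := hvω s x
        rw [← ofReal_add, hFv, hFv, this]) (B := B)
      (fun x y hx hy => hB (s, x, y) ⟨⟨hs.1, hs.2.le⟩, hx, abs_le.1 hy⟩) n
    simp only [hFv] at h1
    simp only [c]
    rw [norm_mul]
    calc ‖(1 / ω : ℂ)‖ * _ ≤ ‖(1 / ω : ℂ)‖ *
          (B * Real.exp (-(2 * Real.pi / ω * (δ / 2) * |(n : ℝ)|)) * ω) := by gcongr
      _ = _ := by
          rw [norm_div, norm_one, norm_real, Real.norm_eq_abs, abs_of_pos hω]; field_simp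
  -- Fourier expansion
  have hFour : ∀ t φ : ℝ, HasSum (fun n => c n t * exp (I * l n * φ)) (v t φ) := by
    intro t φ
    have : Fact (0 < ω) := ⟨hω⟩
    have hper : Function.Periodic (fun φ => ((v t φ : ℝ) : ℂ)) ω := fun φ => by simp [hvω]
    let f : C(AddCircle ω, ℂ) := ⟨hper.lift, continuous_quot_lift _
      (hvcc.comp (by fun_prop : Continuous fun φ : ℝ => (t, φ)))⟩
    have hf : ∀ x : ℝ, f (x : AddCircle ω) = v t x := fun x => hper.lift_coe x
    have hcoef : ∀ n, fourierCoeff f n = c n t := fun n => by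
      rw [fourierCoeff_eq_intervalIntegral _ n 0]
      simp only [c, zero_add]
      rw [real_smul]
      push_cast
      congr 1
      refine intervalIntegral.integral_congr fun x _ => ?_
      simp only [hf, smul_eq_mul]
      rw [fourier_coe_apply]
      congr 2
      simp only [l]; push_cast; ring
    have hsum : Summable (fourierCoeff f) := by
      refine Summable.of_norm_bounded ((summable_exp_neg_abs hρ).mul_left B) fun n => ?_
      rw [hcoef]; exact hcb n t
    have := has_pointwise_sum_fourier_series_of_summable hsum (φ : AddCircle ω)
    rw [hf] at this
    refine this.congr_fun fun n => ?_
    rw [hcoef, smul_eq_mul, fourier_coe_apply]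
    congr 2
    simp only [l]; push_cast; ring
  -- coefficients of the solution
  let Fh : ℤ → ℂ := fun n => ∫ s in (0 : ℝ)..T, exp (I * l n * s) * c n s
  let d : ℤ → ℂ := fun n => exp (I * (l n * T : ℝ)) - 1
  let a : ℤ → ℝ → ℂ := fun n t =>
    exp (-(I * l n * t)) * (Fh n / d n + ∫ s in (0 : ℝ)..t, exp (I * l n * s) * c n s)
  have hic : ∀ n, Continuous fun s : ℝ => exp (I * l n * s) * c n s := fun n => by
    have := hcc n; fun_prop
  have hda : ∀ n t, HasDerivAt (a n) (-(I * l n) * a n t + c n t) t := fun n t => by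
    have h1 : HasDerivAt (fun t : ℝ => exp (-(I * l n * t))) (exp (-(I * l n * t)) * -(I * l n)) t := by
      have h0 : HasDerivAt (fun z : ℂ => exp (-(I * l n * z))) (exp (-(I * l n * t)) * -(I * l n)) t := by
        have := (((hasDerivAt_id (t : ℂ)).const_mul (I * l n)).neg).cexp
        simpa using this
      exact h0.comp_ofReal
    have h2 : HasDerivAt (fun t : ℝ => Fh n / d n + ∫ s in (0 : ℝ)..t, exp (I * l n * s) * c n s)
        (exp (I * l n * t) * c n t) t :=
      (intervalIntegral.integral_hasDerivAt_right ((hic n).intervalIntegrable _ _)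
        ((hic n).stronglyMeasurableAtFilter _ _) (hic n).continuousAt).const_add _
    refine (h1.mul h2).congr_deriv ?_
    simp only [a]
    have h3 : exp (-(I * l n * t)) * (exp (I * l n * t) * c n t) = c n t := by
      rw [← mul_assoc, ← Complex.exp_add, neg_add_cancel, Complex.exp_zero, one_mul]
    rw [h3]; ring
  obtain ⟨A, hA, hAb⟩ := siegel_lower_bound hT hω hS (half_pos hρ)
  have hd0 : ∀ n ≠ 0, d n ≠ 0 := fun n hn h0 => by
    have := hAb n hn
    have h1 : exp (I * (2 * Real.pi * n / ω * T : ℝ)) - 1 = 0 := h0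
    rw [h1, norm_zero, mul_zero] at this
    exact absurd this (not_le.2 (Real.exp_pos _))
  have hFh0 : Fh 0 = 0 := by
    have h1 : Fh 0 = ∫ s in (0 : ℝ)..T, ((1 / ω * ∫ x in (0 : ℝ)..ω, v s x : ℝ) : ℂ) := by
      refine intervalIntegral.integral_congr fun s _ => ?_
      simp only [l, c, Int.cast_zero, mul_zero, zero_div, ofReal_zero, zero_mul, Complex.exp_zero,
        neg_zero, one_mul]
      push_cast
      rw [intervalIntegral.integral_ofReal]
    rw [h1, intervalIntegral.integral_ofReal, intervalIntegral.integral_const_mul]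
    have h2 : (∫ s in (0 : ℝ)..T, ∫ x in (0 : ℝ)..ω, v s x) =
        ∫ x in (0 : ℝ)..ω, ∫ s in (0 : ℝ)..T, v s x :=
      intervalIntegral_swap_of_continuous hvc _ _ _ _
    rw [h2]
    unfold average at hv0
    have h3 := (mul_eq_zero.1 hv0).resolve_left (by positivity)
    rw [h3]; simp
  have hd1 : ∀ n, Fh n / d n * d n = Fh n := fun n => by
    by_cases hn : n = 0
    · subst hn; rw [hFh0]; simp
    · rw [div_mul_cancel₀ _ (hd0 n hn)]
  have haT : ∀ n t, a n (t + T) = a n t := fun n t => by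
    simp only [a]
    have h1 : (∫ s in (0 : ℝ)..(t + T), exp (I * l n * s) * c n s) =
        Fh n + exp (I * (l n * T : ℝ)) * ∫ s in (0 : ℝ)..t, exp (I * l n * s) * c n s := by
      rw [← intervalIntegral.integral_add_adjacent_intervals (b := T)
        ((hic n).intervalIntegrable _ _) ((hic n).intervalIntegrable _ _)]
      congr 1
      have h2 := intervalIntegral.integral_comp_add_right
        (f := fun s : ℝ => exp (I * l n * s) * c n s) (a := 0) (b := t) T
      rw [zero_add] at h2
      rw [← h2, ← intervalIntegral.integral_const_mul]
      refine intervalIntegral.integral_congr fun s _ => ?_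
      rw [hcT n s, ← mul_assoc (exp _) (exp _), ← Complex.exp_add]
      congr 2
      push_cast; ring
    have h3 : exp (-(I * l n * ((t + T : ℝ) : ℂ))) =
        exp (-(I * l n * t)) * exp (-(I * (l n * T : ℝ))) := by
      rw [← Complex.exp_add]; congr 1; push_cast; ring
    have h4 : Fh n / d n + Fh n = Fh n / d n * exp (I * (l n * T : ℝ)) := by
      have := hd1 n
      simp only [d] at this ⊢
      linear_combination -this
    rw [h1, ← add_assoc, h4, h3, mul_comm (Fh n / d n), ← mul_add, mul_assoc,
      ← mul_assoc (exp (-(I * (l n * T : ℝ)))), ← Complex.exp_add, neg_add_cancel, Complex.exp_zero,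
      one_mul]
  obtain ⟨B', hB', hab⟩ : ∃ B' ≥ 0, ∀ n t, ‖a n t‖ ≤ B' * Real.exp (-(ρ / 2 * |(n : ℝ)|)) := by
    refine ⟨B * T * A + B * T, by positivity, fun n t => ?_⟩
    obtain ⟨s, hs, hst⟩ := Function.Periodic.exists_mem_Ico₀ (f := a n) (fun t => haT n t) hT t
    rw [hst]
    have h_int : ∀ u ∈ Icc 0 T, ‖∫ s in (0 : ℝ)..u, exp (I * l n * s) * c n s‖ ≤
        B * Real.exp (-(ρ * |(n : ℝ)|)) * T := fun u hu => by
      have := intervalIntegral.norm_integral_le_of_norm_le_const (a := 0) (b := u)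
        (f := fun s : ℝ => exp (I * l n * s) * c n s) (C := B * Real.exp (-(ρ * |(n : ℝ)|)))
        fun x _ => by
          rw [norm_mul]
          have : ‖exp (I * l n * x)‖ = 1 := by rw [Complex.norm_exp]; simp
          rw [this, one_mul]; exact hcb n x
      refine this.trans ?_
      rw [sub_zero, abs_of_nonneg hu.1]
      gcongr
      exact hu.2
    have e1 : ‖exp (-(I * l n * s))‖ = 1 := by rw [Complex.norm_exp]; simp
    have e2 : Real.exp (-(ρ * |(n : ℝ)|)) =
        Real.exp (-(ρ / 2 * |(n : ℝ)|)) * Real.exp (-(ρ / 2 * |(n : ℝ)|)) := by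
      rw [← Real.exp_add]; congr 1; ring
    have e3 : Real.exp (-(ρ / 2 * |(n : ℝ)|)) ≤ 1 := Real.exp_le_one_iff.2 (by
      have : 0 ≤ ρ / 2 * |(n : ℝ)| := by positivity
      linarith)
    have e4 : ‖Fh n / d n‖ ≤ B * T * A * Real.exp (-(ρ / 2 * |(n : ℝ)|)) := by
      by_cases hn : n = 0
      · subst hn; rw [hFh0]; simp; positivity
      · rw [norm_div, div_le_iff₀ (norm_pos_iff.2 (hd0 n hn))]
        have h1 := hAb n hn
        have h2 := h_int T ⟨hT.le, le_rfl⟩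
        calc ‖Fh n‖ ≤ B * Real.exp (-(ρ * |(n : ℝ)|)) * T := h2
          _ = B * T * Real.exp (-(ρ / 2 * |(n : ℝ)|)) * Real.exp (-(ρ / 2 * |(n : ℝ)|)) := by
              rw [e2]; ring
          _ ≤ B * T * Real.exp (-(ρ / 2 * |(n : ℝ)|)) * (A * ‖d n‖) := by gcongr
          _ = _ := by ring
    simp only [a]
    rw [norm_mul, e1, one_mul]
    refine (norm_add_le _ _).trans ?_
    have h5 := h_int s ⟨hs.1, hs.2.le⟩
    rw [e2] at h5
    have h6 : B * (Real.exp (-(ρ / 2 * |(n : ℝ)|)) * Real.exp (-(ρ / 2 * |(n : ℝ)|))) * T ≤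
        B * T * Real.exp (-(ρ / 2 * |(n : ℝ)|)) := by
      have : 0 ≤ B * T * Real.exp (-(ρ / 2 * |(n : ℝ)|)) := by positivity
      nlinarith
    linarith
  -- the series and its derivatives
  have hpi := Real.pi_pos
  set r := ρ / 4 with hr
  have hrp : 0 < r := by positivity
  have hexp2 : ∀ n : ℤ, Real.exp (-(ρ / 2 * |(n : ℝ)|)) =
      Real.exp (-(r * |(n : ℝ)|)) * Real.exp (-(r * |(n : ℝ)|)) := fun n => by
    rw [← Real.exp_add]; congr 1; rw [hr]; ring
  have hexp1 : ∀ n : ℤ, Real.exp (-(r * |(n : ℝ)|)) ≤ 1 := fun n => Real.exp_le_one_iff.2 (by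
    have : 0 ≤ r * |(n : ℝ)| := by positivity
    linarith)
  have hla : ∀ n, |l n| = 2 * Real.pi / ω * |(n : ℝ)| := fun n => by
    simp only [l]
    rw [abs_div, abs_mul, abs_of_pos hω, abs_of_pos (by positivity : 0 < 2 * Real.pi)]; ring
  have hlb : ∀ n, |l n| * Real.exp (-(r * |(n : ℝ)|)) ≤ 2 * Real.pi / ω / r := fun n => by
    rw [hla, Real.exp_neg, ← div_eq_mul_inv, div_le_iff₀ (Real.exp_pos _)]
    have h1 := Real.add_one_le_exp (r * |(n : ℝ)|)
    calc 2 * Real.pi / ω * |(n : ℝ)| = 2 * Real.pi / ω / r * (r * |(n : ℝ)|) := by field_simp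
      _ ≤ 2 * Real.pi / ω / r * Real.exp (r * |(n : ℝ)|) := by gcongr; linarith
  have hab1 : ∀ n t, ‖a n t‖ ≤ B' * Real.exp (-(r * |(n : ℝ)|)) := fun n t => by
    refine (hab n t).trans ?_
    rw [hexp2]
    gcongr
    have := hexp1 n
    nlinarith [Real.exp_pos (-(r * |(n : ℝ)|))]
  have hab2 : ∀ n t, |l n| * ‖a n t‖ ≤ B' * (2 * Real.pi / ω / r) * Real.exp (-(r * |(n : ℝ)|)) :=
    fun n t => by
    calc |l n| * ‖a n t‖ ≤ |l n| * (B' * Real.exp (-(ρ / 2 * |(n : ℝ)|))) := by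
          gcongr; exact hab n t
      _ = B' * (|l n| * Real.exp (-(r * |(n : ℝ)|))) * Real.exp (-(r * |(n : ℝ)|)) := by
          rw [hexp2]; ring
      _ ≤ _ := by gcongr; exact hlb n
  have hcb1 : ∀ n t, ‖c n t‖ ≤ B * Real.exp (-(r * |(n : ℝ)|)) := fun n t => by
    refine (hcb n t).trans ?_
    gcongr
    rw [hr]; linarith
  let e : ℤ → ℝ → ℂ := fun n φ => exp (I * l n * φ)
  have hen : ∀ n φ, ‖e n φ‖ = 1 := fun n φ => by simp only [e]; rw [Complex.norm_exp]; simp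
  have hde : ∀ n φ, HasDerivAt (e n) (I * l n * e n φ) φ := fun n φ => by
    have h0 : HasDerivAt (fun z : ℂ => exp (I * l n * z)) (exp (I * l n * φ) * (I * l n)) φ := by
      have := ((hasDerivAt_id (φ : ℂ)).const_mul (I * l n)).cexp
      simpa using this
    exact h0.comp_ofReal.congr_deriv (mul_comm _ _)
  let f : ℤ → ℝ × ℝ → ℂ := fun n p => a n p.1 * e n p.2
  let f' : ℤ → ℝ × ℝ → (ℝ × ℝ →L[ℝ] ℂ) := fun n p =>
    (ContinuousLinearMap.fst ℝ ℝ ℝ).smulRight ((-(I * l n) * a n p.1 + c n p.1) * e n p.2) +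
    (ContinuousLinearMap.snd ℝ ℝ ℝ).smulRight (a n p.1 * (I * l n * e n p.2))
  have hf : ∀ n p, HasFDerivAt (f n) (f' n p) p := fun n p => by
    have h1 := (hda n p.1).hasFDerivAt.comp p (hasFDerivAt_fst (𝕜 := ℝ) (p := p))
    have h2 := (hde n p.2).hasFDerivAt.comp p (hasFDerivAt_snd (𝕜 := ℝ) (p := p))
    refine (h1.mul h2).congr_fderiv ?_
    ext <;> simp [f'] <;> ring
  set B₁ := 2 * (B' * (2 * Real.pi / ω / r)) + B with hB₁
  have hf'b : ∀ n p, ‖f' n p‖ ≤ B₁ * Real.exp (-(r * |(n : ℝ)|)) := fun n p => by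
    refine (norm_add_le _ _).trans ?_
    rw [ContinuousLinearMap.norm_smulRight_apply, ContinuousLinearMap.norm_smulRight_apply]
    have e1 : ‖(-(I * l n) * a n p.1 + c n p.1) * e n p.2‖ ≤ |l n| * ‖a n p.1‖ + ‖c n p.1‖ := by
      rw [norm_mul, hen, mul_one]
      refine (norm_add_le _ _).trans ?_
      simp
    have e2 : ‖a n p.1 * (I * l n * e n p.2)‖ = |l n| * ‖a n p.1‖ := by
      simp only [norm_mul, hen, norm_I, norm_real, Real.norm_eq_abs]; ring
    rw [e2]
    have n1 : ‖ContinuousLinearMap.fst ℝ ℝ ℝ‖ ≤ 1 := ContinuousLinearMap.norm_fst_le ..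
    have n2 : ‖ContinuousLinearMap.snd ℝ ℝ ℝ‖ ≤ 1 := ContinuousLinearMap.norm_snd_le ..
    have h1 := hab2 n p.1
    have h2 := hcb1 n p.1
    have h3 : 0 ≤ |l n| * ‖a n p.1‖ := by positivity
    calc _ ≤ 1 * (|l n| * ‖a n p.1‖ + ‖c n p.1‖) + 1 * (|l n| * ‖a n p.1‖) := by gcongr
      _ ≤ _ := by rw [hB₁]; linarith
  have hsr := summable_exp_neg_abs hrp
  have hfs : ∀ p, Summable fun n => f n p := fun p => by
    refine Summable.of_norm_bounded (hsr.mul_left B') fun n => ?_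
    simp only [f]
    rw [norm_mul, hen, mul_one]; exact hab1 n p.1
  have hac : ∀ n, Continuous (a n) := fun n =>
    continuous_iff_continuousAt.2 fun t => (hda n t).continuousAt
  have hec : ∀ n, Continuous (e n) := fun n =>
    continuous_iff_continuousAt.2 fun t => (hde n t).continuousAt
  have hsum : ∀ p, HasFDerivAt (fun p => ∑' n, f n p) (∑' n, f' n p) p :=
    hasFDerivAt_tsum (hsr.mul_left B₁) hf hf'b (hfs 0)
  have hsum' : Continuous fun p => ∑' n, f' n p := by
    refine continuous_tsum (fun n => ?_) (hsr.mul_left B₁) hf'b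
    have := hac n
    have := hec n
    have := hcc n
    simp only [f']
    refine Continuous.add ?_ ?_
    · exact (ContinuousLinearMap.smulRightL ℝ (ℝ × ℝ) ℂ (ContinuousLinearMap.fst ℝ ℝ ℝ)).continuous.comp
        (by fun_prop : Continuous fun p : ℝ × ℝ => (-(I * l n) * a n p.1 + c n p.1) * e n p.2)
    · exact (ContinuousLinearMap.smulRightL ℝ (ℝ × ℝ) ℂ (ContinuousLinearMap.snd ℝ ℝ ℝ)).continuous.comp
        (by fun_prop : Continuous fun p : ℝ × ℝ => a n p.1 * (I * l n * e n p.2))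
  have hcd : ContDiff ℝ 1 fun p => ∑' n, f n p := by
    rw [contDiff_one_iff_fderiv]
    refine ⟨fun p => (hsum p).differentiableAt, ?_⟩
    rw [show fderiv ℝ (fun p => ∑' n, f n p) = fun p => ∑' n, f' n p from
      funext fun p => (hsum p).fderiv]
    exact hsum'
  let g₁ : ℝ → ℝ → ℝ := fun t φ => (∑' n, f n (t, φ)).re
  have hg₁ : ContDiff ℝ 1 (uncurry g₁) := reCLM.contDiff.comp hcd
  set m := average T ω g₁ with hm
  -- the holomorphic extension
  let H : ℝ → ℂ → ℂ := fun t z => ∑' n, a n t * exp (I * l n * z)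
  set δ₁ := r * ω / (2 * Real.pi) with hδ₁
  have hδ₁p : 0 < δ₁ := by positivity
  have hHb : ∀ n t (z : ℂ), |z.im| < δ₁ → ‖a n t * exp (I * l n * z)‖ ≤
      B' * Real.exp (-(r * |(n : ℝ)|)) := fun n t z hz => by
    rw [norm_mul, Complex.norm_exp]
    have e1 : (I * l n * z).re = -(l n * z.im) := by simp
    have e2 : -(l n * z.im) ≤ r * |(n : ℝ)| := by
      refine (neg_le_abs _).trans ?_
      rw [abs_mul, hla]
      calc 2 * Real.pi / ω * |(n : ℝ)| * |z.im| ≤ 2 * Real.pi / ω * |(n : ℝ)| * δ₁ := by gcongr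
        _ = r * |(n : ℝ)| := by rw [hδ₁]; field_simp
    rw [e1]
    calc ‖a n t‖ * Real.exp (-(l n * z.im)) ≤
          (B' * Real.exp (-(ρ / 2 * |(n : ℝ)|))) * Real.exp (r * |(n : ℝ)|) := by
          gcongr
          exact hab n t
      _ = _ := by
          rw [mul_assoc, ← Real.exp_add]; congr 2; rw [hr]; ring
  have hHc : ContinuousOn (uncurry H) (univ ×ˢ {z : ℂ | |z.im| < δ₁}) := by
    refine continuousOn_tsum (fun n => ?_) (hsr.mul_left B') fun n p hp => hHb n p.1 p.2 hp.2
    have := hac n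
    exact Continuous.continuousOn (by fun_prop)
  have hHd : ∀ t, DifferentiableOn ℂ (H t) {z : ℂ | |z.im| < δ₁} := fun t =>
    differentiableOn_tsum_of_summable_norm (hsr.mul_left B') (fun n => by fun_prop)
      (isOpen_imStrip δ₁) fun n z hz => hHb n t z hz
  refine ⟨fun t φ => g₁ t φ - m, ?_, ⟨δ₁, hδ₁p,
    fun t z => (H t z + (starRingEnd ℂ) (H t ((starRingEnd ℂ) z))) / 2 - m, ?_, ?_, ?_⟩, ?_, ?_, ?_, ?_⟩
  · exact hg₁.sub contDiff_const
  · have h1 : ContinuousOn (fun p : ℝ × ℂ => H p.1 ((starRingEnd ℂ) p.2))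
        (univ ×ˢ {z : ℂ | |z.im| < δ₁}) :=
      hHc.comp (f := fun p : ℝ × ℂ => (p.1, (starRingEnd ℂ) p.2))
        (by fun_prop) fun p hp => ⟨trivial, by simpa using hp.2⟩
    exact ((hHc.add (continuous_conj.comp_continuousOn h1)).div_const 2).sub continuousOn_const
  · intro t
    have h1 : DifferentiableOn ℂ (fun z => (starRingEnd ℂ) (H t ((starRingEnd ℂ) z)))
        {z : ℂ | |z.im| < δ₁} := fun z hz => by
      have hz' : (starRingEnd ℂ) z ∈ {z : ℂ | |z.im| < δ₁} := by simpa using hz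
      have h2 := ((hHd t).differentiableAt
        ((isOpen_imStrip δ₁).mem_nhds hz')).hasDerivAt.conj_conj
      rw [Complex.conj_conj] at h2
      exact h2.differentiableAt.differentiableWithinAt
    exact (((hHd t).add h1).div_const 2).sub (differentiableOn_const _)
  · intro t φ
    beta_reduce
    rw [conj_ofReal, add_conj]
    simp only [g₁, f, e, H]
    push_cast
    ring
  · intro t φ
    simp only [g₁, f, haT]
  · intro t φ
    have : ∀ n, e n (φ + ω) = e n φ := fun n => by
      simp only [e]
      rw [show I * l n * ((φ + ω : ℝ) : ℂ) = I * l n * φ + n * (2 * Real.pi * I) by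
        simp only [l]; push_cast
        have : (ω : ℂ) ≠ 0 := by exact_mod_cast hω.ne'
        field_simp, Complex.exp_add, Complex.exp_int_mul_two_pi_mul_I, mul_one]
    simp only [g₁, f, this]
  · rw [average_sub_const hT hω hg₁.continuous, ← hm, sub_self]
  · intro t φ
    have hs := hsum (t, φ)
    have h1 : HasDerivAt (fun s => g₁ s φ - m) (((∑' n, f' n (t, φ)) (1, 0)).re) t := by
      have h2 : HasDerivAt (fun s : ℝ => (s, φ)) ((1 : ℝ), (0 : ℝ)) t :=
        (hasDerivAt_id t).prodMk (hasDerivAt_const t φ)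
      have h3 := hs.comp_hasDerivAt t h2
      exact (reCLM.hasFDerivAt.comp_hasDerivAt t h3).sub_const m
    have h1' : HasDerivAt (fun s => g₁ t s - m) (((∑' n, f' n (t, φ)) (0, 1)).re) φ := by
      have h2 : HasDerivAt (fun s : ℝ => (t, s)) ((0 : ℝ), (1 : ℝ)) φ :=
        (hasDerivAt_const φ t).prodMk (hasDerivAt_id φ)
      have h3 := hs.comp_hasDerivAt φ h2
      exact (reCLM.hasFDerivAt.comp_hasDerivAt φ h3).sub_const m
    rw [h1.deriv, h1'.deriv, ← add_re, ← map_add]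
    have h4 : Summable fun n => f' n (t, φ) :=
      Summable.of_norm_bounded (hsr.mul_left B₁) fun n => hf'b n _
    have h5 : (∑' n, f' n (t, φ)) ((1, 0) + (0, 1)) = ∑' n, f' n (t, φ) ((1, 0) + (0, 1)) :=
      (ContinuousLinearMap.apply ℝ ℂ ((1, 0) + (0, 1) : ℝ × ℝ)).map_tsum h4
    have h6 : ∀ n, f' n (t, φ) ((1, 0) + (0, 1)) = c n t * exp (I * l n * φ) := fun n => by
      simp only [f', e, add_apply, ContinuousLinearMap.smulRight_apply,
        ContinuousLinearMap.coe_fst', ContinuousLinearMap.coe_snd', Prod.fst_add, Prod.snd_add,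
        add_zero, zero_add, one_smul]
      ring
    rw [h5]
    simp only [h6]
    rw [(hFour t φ).tsum_eq, ofReal_re]

end Homological


/-! ### Averages along lines on the torus -/

section Weyl

open Filter Topology UnitAddTorus

/-- The point of the unit torus with coordinates `t / T`, `φ / ω`. -/
noncomputable def torusPoint (T ω t φ : ℝ) : UnitAddTorus (Fin 2) :=
  ![((t / T : ℝ) : UnitAddCircle), ((φ / ω : ℝ) : UnitAddCircle)]

theorem continuous_torusPoint (T ω : ℝ) {X : Type*} [TopologicalSpace X] {a b : X → ℝ}
    (ha : Continuous a) (hb : Continuous b) : Continuous fun x => torusPoint T ω (a x) (b x) := by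
  refine continuous_pi fun i => ?_
  fin_cases i
  · exact (AddCircle.continuous_mk' 1).comp (ha.div_const T)
  · exact (AddCircle.continuous_mk' 1).comp (hb.div_const ω)

theorem mFourier_torusPoint (T ω t φ : ℝ) (n : Fin 2 → ℤ) :
    mFourier n (torusPoint T ω t φ) =
      Complex.exp ((2 * Real.pi * n 0 / T : ℝ) * Complex.I * t) *
        Complex.exp ((2 * Real.pi * n 1 / ω : ℝ) * Complex.I * φ) := by
  have h : ∀ x : Fin 2 → UnitAddCircle, mFourier n x = fourier (n 0) (x 0) * fourier (n 1) (x 1) :=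
    fun x => by simp [mFourier, Fin.prod_univ_two]
  rw [h]
  simp only [torusPoint, Matrix.cons_val_zero, Matrix.cons_val_one, fourier_coe_apply]
  congr 2 <;> (push_cast; ring)

theorem exists_torus_function {T ω : ℝ} (hT : 0 < T) (hω : 0 < ω) {f : ℝ → ℝ → ℝ}
    (hf : Continuous (uncurry f)) (hfT : ∀ t φ, f (t + T) φ = f t φ)
    (hfω : ∀ t φ, f t (φ + ω) = f t φ) :
    ∃ F : C(UnitAddTorus (Fin 2), ℂ), ∀ t φ, F (torusPoint T ω t φ) = f t φ := by
  have hπ₀ : IsOpenQuotientMap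
      (Pi.map fun _ x => (x : UnitAddCircle) : (Fin 2 → ℝ) → UnitAddTorus (Fin 2)) :=
    IsOpenQuotientMap.piMap fun _ => QuotientAddGroup.isOpenQuotientMap_mk
  let π : C(Fin 2 → ℝ, UnitAddTorus (Fin 2)) := ⟨_, hπ₀.continuous⟩
  have hπ : Topology.IsQuotientMap π := hπ₀.isQuotientMap
  let g : C(Fin 2 → ℝ, ℂ) := ⟨fun x => (f (T * x 0) (ω * x 1) : ℂ), by
    have : Continuous fun x : Fin 2 → ℝ => uncurry f (T * x 0, ω * x 1) := hf.comp (by fun_prop)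
    exact Complex.continuous_ofReal.comp this⟩
  have hg : FactorsThrough g π := by
    intro a b hab
    have h : ∀ i, ∃ m : ℤ, b i = a i + m := fun i => by
      have h1 := congrFun hab i
      have h2 : ((a i : ℝ) : UnitAddCircle) = (b i : ℝ) := h1
      rw [QuotientAddGroup.eq, AddSubgroup.mem_zmultiples_iff] at h2
      obtain ⟨m, hm⟩ := h2
      refine ⟨m, ?_⟩
      simp only [zsmul_eq_mul, mul_one] at hm
      linarith
    obtain ⟨m, hm⟩ := h 0
    obtain ⟨n, hn⟩ := h 1
    have p1 : Periodic (fun t => f t (ω * a 1)) T := fun t => hfT t _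
    have p2 : Periodic (f (T * b 0)) ω := fun φ => hfω _ φ
    have e1 := p1.int_mul m (T * a 0)
    have e2 := p2.int_mul n (ω * a 1)
    have e3 : f (T * a 0) (ω * a 1) = f (T * b 0) (ω * b 1) := by
      rw [hn, mul_add, mul_comm ω (n : ℝ), e2, hm, mul_add, mul_comm T (m : ℝ)]
      exact e1.symm
    simp only [g, ContinuousMap.coe_mk, e3]
  refine ⟨hπ.lift g hg, fun t φ => ?_⟩
  have h1 : torusPoint T ω t φ = π ![t / T, φ / ω] := by
    ext i; fin_cases i <;> rfl
  have h2 := congrArg (fun k : C(Fin 2 → ℝ, ℂ) => k ![t / T, φ / ω])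
    (hπ.lift_comp g hg)
  rw [h1]
  refine h2.trans ?_
  simp only [g, ContinuousMap.coe_mk, Matrix.cons_val_zero, Matrix.cons_val_one]
  rw [mul_div_cancel₀ _ hT.ne', mul_div_cancel₀ _ hω.ne']

/-- The difference of the mean of a function along a segment and of its mean over the torus. -/
noncomputable def meanDefect (T ω N e t φ : ℝ) (F : C(UnitAddTorus (Fin 2), ℂ)) : ℂ :=
  (1 / N : ℝ) * (∫ s in (0 : ℝ)..N, F (torusPoint T ω (t + s / e) (φ + s)))
    - (1 / (ω * T) : ℝ) * ∫ x in (0 : ℝ)..ω, ∫ s in (0 : ℝ)..T, F (torusPoint T ω s x)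

theorem meanDefect_add (T ω N e t φ : ℝ) (F F' : C(UnitAddTorus (Fin 2), ℂ)) :
    meanDefect T ω N e t φ (F + F') = meanDefect T ω N e t φ F + meanDefect T ω N e t φ F' := by
  have c : ∀ G : C(UnitAddTorus (Fin 2), ℂ), Continuous fun s => G (torusPoint T ω (t + s / e) (φ + s)) :=
    fun G => G.continuous.comp (continuous_torusPoint T ω (by fun_prop) (by fun_prop))
  have c1 : ∀ (G : C(UnitAddTorus (Fin 2), ℂ)) x, Continuous fun s => G (torusPoint T ω s x) :=
    fun G x => G.continuous.comp (continuous_torusPoint T ω (by fun_prop) (by fun_prop))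
  have c2 : ∀ G : C(UnitAddTorus (Fin 2), ℂ), Continuous fun x => ∫ s in (0 : ℝ)..T, G (torusPoint T ω s x) :=
    fun G => intervalIntegral.continuous_parametric_intervalIntegral_of_continuous'
      (f := fun x s => G (torusPoint T ω s x))
      (G.continuous.comp (continuous_torusPoint T ω continuous_snd continuous_fst)) _ _
  simp only [meanDefect, ContinuousMap.add_apply]
  rw [intervalIntegral.integral_add ((c F).intervalIntegrable _ _) ((c F').intervalIntegrable _ _)]
  have h : ∀ x, (∫ s in (0 : ℝ)..T, (F (torusPoint T ω s x) + F' (torusPoint T ω s x))) =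
      (∫ s in (0 : ℝ)..T, F (torusPoint T ω s x)) + ∫ s in (0 : ℝ)..T, F' (torusPoint T ω s x) :=
    fun x => intervalIntegral.integral_add ((c1 F x).intervalIntegrable 0 T)
      ((c1 F' x).intervalIntegrable 0 T)
  simp_rw [h]
  rw [intervalIntegral.integral_add ((c2 F).intervalIntegrable _ _) ((c2 F').intervalIntegrable _ _)]
  ring

theorem meanDefect_smul (T ω N e t φ : ℝ) (a : ℂ) (F : C(UnitAddTorus (Fin 2), ℂ)) :
    meanDefect T ω N e t φ (a • F) = a * meanDefect T ω N e t φ F := by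
  simp only [meanDefect, ContinuousMap.smul_apply, smul_eq_mul,
    intervalIntegral.integral_const_mul]
  ring

theorem norm_meanDefect_le {T ω N : ℝ} (hT : 0 < T) (hω : 0 < ω) (hN : 0 < N) (e t φ : ℝ)
    (F : C(UnitAddTorus (Fin 2), ℂ)) : ‖meanDefect T ω N e t φ F‖ ≤ 2 * ‖F‖ := by
  have h1 : ‖∫ s in (0 : ℝ)..N, F (torusPoint T ω (t + s / e) (φ + s))‖ ≤ ‖F‖ * N := by
    have := intervalIntegral.norm_integral_le_of_norm_le_const (a := 0) (b := N)
      (f := fun s => F (torusPoint T ω (t + s / e) (φ + s))) (C := ‖F‖)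
      fun s _ => F.norm_coe_le_norm _
    rwa [sub_zero, abs_of_pos hN] at this
  have h2 : ‖∫ x in (0 : ℝ)..ω, ∫ s in (0 : ℝ)..T, F (torusPoint T ω s x)‖ ≤ ‖F‖ * T * ω := by
    have := intervalIntegral.norm_integral_le_of_norm_le_const (a := 0) (b := ω)
      (f := fun x => ∫ s in (0 : ℝ)..T, F (torusPoint T ω s x)) (C := ‖F‖ * T) fun x _ => by
        have := intervalIntegral.norm_integral_le_of_norm_le_const (a := 0) (b := T)
          (f := fun s => F (torusPoint T ω s x)) (C := ‖F‖) fun s _ => F.norm_coe_le_norm _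
        rwa [sub_zero, abs_of_pos hT] at this
    rwa [sub_zero, abs_of_pos hω] at this
  have h3 : ‖((1 / N : ℝ) : ℂ)‖ = 1 / N := by
    rw [Complex.norm_real, Real.norm_of_nonneg (by positivity)]
  have h4 : ‖((1 / (ω * T) : ℝ) : ℂ)‖ = 1 / (ω * T) := by
    rw [Complex.norm_real, Real.norm_of_nonneg (by positivity)]
  calc ‖meanDefect T ω N e t φ F‖ ≤ 1 / N * (‖F‖ * N) + 1 / (ω * T) * (‖F‖ * T * ω) := by
        refine (norm_sub_le _ _).trans ?_
        rw [norm_mul, norm_mul, h3, h4]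
        gcongr
    _ = 2 * ‖F‖ := by field_simp; ring

theorem norm_meanDefect_mFourier_le {T ω N : ℝ} (hT : 0 < T) (hω : 0 < ω) (hN : 0 < N)
    (e t φ : ℝ) {n : Fin 2 → ℤ} (hn : n ≠ 0) {c : ℝ} (hc : 0 < c)
    (hce : c ≤ |2 * Real.pi * n 0 / T / e + 2 * Real.pi * n 1 / ω|) :
    ‖meanDefect T ω N e t φ (mFourier n)‖ ≤ 2 / (c * N) := by
  set μ : ℝ := 2 * Real.pi * n 0 / T with hμ
  set l : ℝ := 2 * Real.pi * n 1 / ω with hl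
  have hzero : ∀ (P : ℝ) (m : ℤ), 0 < P → m ≠ 0 →
      ∫ s in (0 : ℝ)..P, Complex.exp ((2 * Real.pi * m / P : ℝ) * Complex.I * s) = 0 := by
    intro P m hP hm
    have h1 : ((2 * Real.pi * m / P : ℝ) : ℂ) * Complex.I ≠ 0 := by
      have : (2 * Real.pi * m / P : ℝ) ≠ 0 := by
        have := Real.pi_pos
        have hm' : (m : ℝ) ≠ 0 := by exact_mod_cast hm
        positivity
      exact mul_ne_zero (by exact_mod_cast this) Complex.I_ne_zero
    rw [integral_exp_mul_complex h1]
    have : ((2 * Real.pi * m / P : ℝ) : ℂ) * Complex.I * P = m * (2 * Real.pi * Complex.I) := by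
      have : (P : ℂ) ≠ 0 := by exact_mod_cast hP.ne'
      push_cast; field_simp
    rw [this, Complex.exp_int_mul_two_pi_mul_I]
    simp
  have hsecond : ∫ x in (0 : ℝ)..ω, ∫ s in (0 : ℝ)..T, mFourier n (torusPoint T ω s x) = 0 := by
    simp_rw [mFourier_torusPoint, intervalIntegral.integral_mul_const,
      intervalIntegral.integral_const_mul]
    by_cases h0 : n 0 = 0
    · have h1 : n 1 ≠ 0 := fun h1 => hn (by ext i; fin_cases i <;> simp [h0, h1])
      rw [hzero ω _ hω h1, mul_zero]
    · rw [hzero T _ hT h0, zero_mul]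
  have hz : ((μ / e + l : ℝ) : ℂ) * Complex.I ≠ 0 := by
    have : μ / e + l ≠ 0 := fun h => by rw [h, abs_zero] at hce; linarith
    exact mul_ne_zero (by exact_mod_cast this) Complex.I_ne_zero
  have hfirst : ∀ s : ℝ, mFourier n (torusPoint T ω (t + s / e) (φ + s)) =
      Complex.exp (((μ * t + l * φ : ℝ) : ℂ) * Complex.I) *
        Complex.exp (((μ / e + l : ℝ) : ℂ) * Complex.I * s) := fun s => by
    rw [mFourier_torusPoint, ← Complex.exp_add, ← Complex.exp_add, ← hμ, ← hl]
    congr 1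
    push_cast; ring
  have hexp : ∀ x : ℝ, ‖Complex.exp ((x : ℂ) * Complex.I)‖ = 1 := Complex.norm_exp_ofReal_mul_I
  simp only [meanDefect]
  rw [hsecond, mul_zero, sub_zero]
  simp_rw [hfirst]
  rw [intervalIntegral.integral_const_mul, integral_exp_mul_complex hz, norm_mul, norm_mul, hexp,
    norm_div, norm_mul, Complex.norm_I, Complex.norm_real, Complex.norm_real, Real.norm_eq_abs,
    Real.norm_eq_abs, abs_of_pos (by positivity : 0 < 1 / N), one_mul, mul_one]
  have h2 : ‖Complex.exp (((μ / e + l : ℝ) : ℂ) * Complex.I * N) -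
      Complex.exp (((μ / e + l : ℝ) : ℂ) * Complex.I * (0 : ℝ))‖ ≤ 2 := by
    refine (norm_sub_le _ _).trans ?_
    have e1 : ((μ / e + l : ℝ) : ℂ) * Complex.I * N = (((μ / e + l) * N : ℝ) : ℂ) * Complex.I := by
      push_cast; ring
    rw [e1, hexp]
    simp
    norm_num
  calc 1 / N * (_ / |μ / e + l|) ≤ 1 / N * (2 / c) := by gcongr
    _ = 2 / (c * N) := by field_simp

/-- Equidistribution: the means of a continuous function on the torus along long segments are close
to its mean over the torus, if no resonance occurs. -/
theorem exists_forall_mean_near_average {T ω : ℝ} (hT : 0 < T) (hω : 0 < ω) {e : ℝ → ℝ}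
    (hres : ∀ j k : ℤ, ¬(j = 0 ∧ k = 0) → ∃ c > 0, ∀ᶠ ε in 𝓝[>] (0 : ℝ),
      c ≤ |2 * Real.pi * j / T / e ε + 2 * Real.pi * k / ω|)
    {f : ℝ → ℝ → ℝ} (hf : Continuous (uncurry f)) (hfT : ∀ t φ, f (t + T) φ = f t φ)
    (hfω : ∀ t φ, f t (φ + ω) = f t φ) {δ : ℝ} (hδ : 0 < δ) :
    ∃ N₀ > 0, ∀ N ≥ N₀, ∀ᶠ ε in 𝓝[>] (0 : ℝ), ∀ t φ,
      |1 / N * (∫ s in (0 : ℝ)..N, f (t + s / e ε) (φ + s)) - average T ω f| ≤ δ := by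
  have key : ∀ F : C(UnitAddTorus (Fin 2), ℂ), ∀ δ > 0, ∃ N₀ > 0, ∀ N ≥ N₀,
      ∀ᶠ ε in 𝓝[>] (0 : ℝ), ∀ t φ, ‖meanDefect T ω N (e ε) t φ F‖ ≤ δ := by
    have hspan : ∀ F ∈ Submodule.span ℂ (range (mFourier (d := Fin 2))), ∀ δ > 0, ∃ N₀ > 0, ∀ N ≥ N₀,
        ∀ᶠ ε in 𝓝[>] (0 : ℝ), ∀ t φ, ‖meanDefect T ω N (e ε) t φ F‖ ≤ δ := by
      intro F hF
      induction hF using Submodule.span_induction with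
      | mem F hF =>
        obtain ⟨n, rfl⟩ := hF
        intro δ hδ
        by_cases hn : n = 0
        · refine ⟨1, one_pos, fun N hN => Eventually.of_forall fun ε t φ => ?_⟩
          have hN' : N ≠ 0 := by linarith
          have : meanDefect T ω N (e ε) t φ (mFourier n) = 0 := by
            simp only [meanDefect, hn, mFourier_zero, ContinuousMap.one_apply,
              intervalIntegral.integral_const, Complex.real_smul, mul_one]
            have h1 : (T : ℂ) ≠ 0 := by exact_mod_cast hT.ne'
            have h2 : (ω : ℂ) ≠ 0 := by exact_mod_cast hω.ne'
            have h3 : (N : ℂ) ≠ 0 := by exact_mod_cast hN'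
            push_cast
            simp only [sub_zero]
            field_simp
            simp
          rw [this, norm_zero]; exact hδ.le
        · obtain ⟨c, hc, hce⟩ := hres (n 0) (n 1) fun h => hn (by
            ext i; fin_cases i <;> simp [h.1, h.2])
          refine ⟨2 / (c * δ), by positivity, fun N hN => hce.mono fun ε hε t φ => ?_⟩
          have hN0 : 0 < N := lt_of_lt_of_le (by positivity) hN
          refine (norm_meanDefect_mFourier_le hT hω hN0 _ t φ hn hc hε).trans ?_
          rw [ge_iff_le, div_le_iff₀ (by positivity)] at hN
          rw [div_le_iff₀ (by positivity)]
          linarith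
      | zero =>
        intro δ hδ
        refine ⟨1, one_pos, fun N _ => Eventually.of_forall fun ε t φ => ?_⟩
        simpa [meanDefect] using hδ.le
      | add F F' _ _ h h' =>
        intro δ hδ
        obtain ⟨N₁, hN₁, h1⟩ := h (δ / 2) (by positivity)
        obtain ⟨N₂, hN₂, h2⟩ := h' (δ / 2) (by positivity)
        refine ⟨max N₁ N₂, lt_max_of_lt_left hN₁, fun N hN => ?_⟩
        filter_upwards [h1 N (le_of_max_le_left hN), h2 N (le_of_max_le_right hN)] with ε e1 e2 t φ
        rw [meanDefect_add]
        refine (norm_add_le _ _).trans ?_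
        linarith [e1 t φ, e2 t φ]
      | smul a F _ h =>
        intro δ hδ
        obtain ⟨N₁, hN₁, h1⟩ := h (δ / (‖a‖ + 1)) (by positivity)
        refine ⟨N₁, hN₁, fun N hN => ?_⟩
        filter_upwards [h1 N hN] with ε e1 t φ
        rw [meanDefect_smul, norm_mul]
        have := e1 t φ
        rw [le_div_iff₀ (by positivity)] at this
        nlinarith [norm_nonneg (meanDefect T ω N (e ε) t φ F), norm_nonneg a]
    intro F δ hδ
    have hF : F ∈ closure (Submodule.span ℂ (range (mFourier (d := Fin 2))) : Set _) := by
      have : F ∈ (Submodule.span ℂ (range (mFourier (d := Fin 2)))).topologicalClosure := by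
        rw [span_mFourier_closure_eq_top]; trivial
      exact this
    obtain ⟨F', hF', hd⟩ := Metric.mem_closure_iff.1 hF (δ / 4) (by positivity)
    obtain ⟨N₁, hN₁, h1⟩ := hspan F' hF' (δ / 2) (by positivity)
    refine ⟨N₁, hN₁, fun N hN => ?_⟩
    filter_upwards [h1 N hN] with ε e1 t φ
    have h2 := norm_meanDefect_le hT hω (lt_of_lt_of_le hN₁ hN) (e ε) t φ (F - F')
    have h3 := meanDefect_add T ω N (e ε) t φ (F - F') F'
    rw [sub_add_cancel] at h3
    rw [h3]
    refine (norm_add_le _ _).trans ?_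
    rw [dist_eq_norm] at hd
    linarith [e1 t φ]
  obtain ⟨F, hF⟩ := exists_torus_function hT hω hf hfT hfω
  obtain ⟨N₀, hN₀, h⟩ := key F δ hδ
  refine ⟨N₀, hN₀, fun N hN => (h N hN).mono fun ε hε t φ => ?_⟩
  have h1 := hε t φ
  have h2 : meanDefect T ω N (e ε) t φ F =
      ((1 / N * (∫ s in (0 : ℝ)..N, f (t + s / e ε) (φ + s)) - average T ω f : ℝ) : ℂ) := by
    simp only [meanDefect, hF, average]
    simp only [intervalIntegral.integral_ofReal]
    push_cast
    ring
  rwa [h2, Complex.norm_real, Real.norm_eq_abs] at h1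

end Weyl


/-! ### Bounded Lipschitz functions on a strip -/

section BoundedLipschitz

open Filter Topology

/-- `E(t, z)` is bounded by `a` and has Lipschitz constant `a` with respect to `z = (φ, v)` on the
strip `|v| ≤ V`. -/
def BL (V a : ℝ) (E : ℝ → ℝ × ℝ → ℝ) : Prop :=
  ∀ t z₁ z₂, |z₁.2| ≤ V → |z₂.2| ≤ V →
    |E t z₁| ≤ a ∧ |E t z₁ - E t z₂| ≤ a * (|z₁.1 - z₂.1| + |z₁.2 - z₂.2|)

variable {V a b : ℝ} {E F : ℝ → ℝ × ℝ → ℝ}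

theorem BL.mono (h : BL V a E) (hab : a ≤ b) : BL V b E := fun t z₁ z₂ h₁ h₂ => by
  obtain ⟨p, q⟩ := h t z₁ z₂ h₁ h₂
  exact ⟨p.trans hab, q.trans (by gcongr)⟩

theorem BL.add (h : BL V a E) (h' : BL V b F) : BL V (a + b) fun t z => E t z + F t z :=
  fun t z₁ z₂ h₁ h₂ => by
    obtain ⟨p, q⟩ := h t z₁ z₂ h₁ h₂
    obtain ⟨p', q'⟩ := h' t z₁ z₂ h₁ h₂
    refine ⟨(abs_add_le _ _).trans (by linarith), ?_⟩
    rw [show E t z₁ + F t z₁ - (E t z₂ + F t z₂) = (E t z₁ - E t z₂) + (F t z₁ - F t z₂) by ring]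
    exact (abs_add_le _ _).trans (by linarith)

theorem BL.neg (h : BL V a E) : BL V a fun t z => -E t z := fun t z₁ z₂ h₁ h₂ => by
  obtain ⟨p, q⟩ := h t z₁ z₂ h₁ h₂
  refine ⟨by rwa [abs_neg], ?_⟩
  rwa [show -E t z₁ - -E t z₂ = -(E t z₁ - E t z₂) by ring, abs_neg]

theorem BL.mul (h : BL V a E) (h' : BL V b F) : BL V (2 * (a * b)) fun t z => E t z * F t z :=
  fun t z₁ z₂ h₁ h₂ => by
    obtain ⟨p, q⟩ := h t z₁ z₂ h₁ h₂
    obtain ⟨p', q'⟩ := h' t z₁ z₂ h₁ h₂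
    have p2 := (h' t z₂ z₁ h₂ h₁).1
    have ha : 0 ≤ a := (abs_nonneg _).trans p
    have hb : 0 ≤ b := (abs_nonneg _).trans p'
    refine ⟨?_, ?_⟩
    · rw [abs_mul]
      have := mul_le_mul p p' (abs_nonneg _) ha
      nlinarith [mul_nonneg ha hb]
    rw [show E t z₁ * F t z₁ - E t z₂ * F t z₂ =
      E t z₁ * (F t z₁ - F t z₂) + (E t z₁ - E t z₂) * F t z₂ by ring]
    refine (abs_add_le _ _).trans ?_
    rw [abs_mul, abs_mul]
    have e1 := mul_le_mul p q' (abs_nonneg _) ha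
    have e2 := mul_le_mul q p2 (abs_nonneg _) (by positivity)
    linarith

theorem BL.const_mul (h : BL V a E) (k : ℝ) : BL V (|k| * a) fun t z => k * E t z :=
  fun t z₁ z₂ h₁ h₂ => by
    obtain ⟨p, q⟩ := h t z₁ z₂ h₁ h₂
    rw [← mul_sub, abs_mul, abs_mul, mul_assoc]
    exact ⟨by gcongr, by gcongr⟩

theorem BL.const (V k : ℝ) : BL V |k| fun _ _ => k := fun t z₁ z₂ _ _ =>
  ⟨le_rfl, by rw [sub_self, abs_zero]; positivity⟩

/-- A function of `(t, φ)` with bounded derivative in `φ`. -/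
theorem BL.of_angle (V : ℝ) {f f' : ℝ → ℝ → ℝ} (hf' : ∀ t φ, HasDerivAt (f t) (f' t φ) φ)
    (h : ∀ t φ, |f t φ| ≤ a) (h' : ∀ t φ, |f' t φ| ≤ a) : BL V a fun t z => f t z.1 :=
  fun t z₁ z₂ _ _ => by
    refine ⟨h t _, ?_⟩
    have := Convex.norm_image_sub_le_of_norm_hasDerivWithin_le (f := f t) (f' := f' t) (s := univ)
      (C := a) (fun x _ => (hf' t x).hasDerivWithinAt) (fun x _ => h' t x) convex_univ
      (mem_univ z₂.1) (mem_univ z₁.1)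
    have ha : 0 ≤ a := (abs_nonneg _).trans (h t 0)
    refine this.trans ?_
    rw [Real.norm_eq_abs, mul_add]
    have := mul_nonneg ha (abs_nonneg (z₁.2 - z₂.2))
    linarith

/-- A family that is bounded and Lipschitz uniformly for small positive `ε`. -/
def BLBounded (V : ℝ) (E : ℝ → ℝ → ℝ × ℝ → ℝ) : Prop :=
  ∃ a, ∀ᶠ ε in 𝓝[>] (0 : ℝ), BL V a (E ε)

/-- A family that tends to zero, together with its Lipschitz constants, as `ε → 0+`. -/
def BLSmall (V : ℝ) (E : ℝ → ℝ → ℝ × ℝ → ℝ) : Prop :=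
  ∀ δ > 0, ∀ᶠ ε in 𝓝[>] (0 : ℝ), BL V δ (E ε)

variable {E F : ℝ → ℝ → ℝ × ℝ → ℝ}

theorem BLSmall.bounded (h : BLSmall V E) : BLBounded V E := ⟨1, h 1 one_pos⟩

theorem BLBounded.add (h : BLBounded V E) (h' : BLBounded V F) :
    BLBounded V fun ε t z => E ε t z + F ε t z := by
  obtain ⟨a, ha⟩ := h
  obtain ⟨b, hb⟩ := h'
  exact ⟨a + b, by filter_upwards [ha, hb] with ε p q using p.add q⟩

theorem BLBounded.mul (h : BLBounded V E) (h' : BLBounded V F) :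
    BLBounded V fun ε t z => E ε t z * F ε t z := by
  obtain ⟨a, ha⟩ := h
  obtain ⟨b, hb⟩ := h'
  exact ⟨_, by filter_upwards [ha, hb] with ε p q using p.mul q⟩

theorem BLBounded.const (V k : ℝ) : BLBounded V fun _ _ _ => k :=
  ⟨|k|, Eventually.of_forall fun _ => BL.const V k⟩

theorem BLSmall.add (h : BLSmall V E) (h' : BLSmall V F) :
    BLSmall V fun ε t z => E ε t z + F ε t z := fun δ hδ => by
  filter_upwards [h (δ / 2) (by positivity), h' (δ / 2) (by positivity)] with ε p q
  exact (p.add q).mono (by linarith)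

theorem BLSmall.neg (h : BLSmall V E) : BLSmall V fun ε t z => -E ε t z := fun δ hδ => by
  filter_upwards [h δ hδ] with ε p using p.neg

theorem BLSmall.mul_bounded (h : BLSmall V E) (h' : BLBounded V F) :
    BLSmall V fun ε t z => E ε t z * F ε t z := fun δ hδ => by
  obtain ⟨b, hb⟩ := h'
  have hb' : 0 < 2 * (|b| + 1) := by positivity
  filter_upwards [h (δ / (2 * (|b| + 1))) (by positivity), hb] with ε p q
  refine (p.mul (q.mono ((le_abs_self b).trans (by linarith : |b| ≤ |b| + 1)))).mono ?_
  rw [show 2 * (δ / (2 * (|b| + 1)) * (|b| + 1)) = δ by field_simp]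

theorem BLBounded.eps_mul (h : BLBounded V E) : BLSmall V fun ε t z => ε * E ε t z := fun δ hδ => by
  obtain ⟨b, hb⟩ := h
  have h1 : ∀ᶠ ε in 𝓝[>] (0 : ℝ), ε < δ / (|b| + 1) :=
    nhdsWithin_le_nhds (Iio_mem_nhds (by positivity))
  filter_upwards [hb, h1, self_mem_nhdsWithin] with ε p q hε
  refine (p.const_mul ε).mono ?_
  rw [abs_of_pos hε]
  rw [lt_div_iff₀ (by positivity)] at q
  have := mul_le_mul_of_nonneg_left (le_abs_self b) (le_of_lt hε)
  have : (0 : ℝ) < ε := hε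
  nlinarith

theorem BLSmall.congr (h : BLSmall V E) (hEF : ∀ᶠ ε in 𝓝[>] (0 : ℝ), ∀ t z, |z.2| ≤ V → E ε t z = F ε t z) :
    BLSmall V F := fun δ hδ => by
  filter_upwards [h δ hδ, hEF] with ε p q t z₁ z₂ h₁ h₂
  rw [← q t z₁ h₁, ← q t z₂ h₂]
  exact p t z₁ z₂ h₁ h₂

theorem BLBounded.congr (h : BLBounded V E) (hEF : ∀ᶠ ε in 𝓝[>] (0 : ℝ), ∀ t z, |z.2| ≤ V → E ε t z = F ε t z) :
    BLBounded V F := by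
  obtain ⟨a, ha⟩ := h
  refine ⟨a, ?_⟩
  filter_upwards [ha, hEF] with ε p q t z₁ z₂ h₁ h₂
  rw [← q t z₁ h₁, ← q t z₂ h₂]
  exact p t z₁ z₂ h₁ h₂

end BoundedLipschitz

/-! ### Systems close to a linear hyperbolic one -/

section ConeOfClose

open scoped NNReal

set_option maxHeartbeats 1000000 in
/-- A system in which, up to small bounded Lipschitz terms, `w = α v - g + B`, `ψ = φ`,
`w' = e ε L w` and `ψ' = e (1 + ε (Q w + c₁))`, has an expanding cone field. -/
theorem isConeSystem_of_close {G : ℝ → ℝ × ℝ → ℝ × ℝ} {w ψ E E' : ℝ → ℝ × ℝ → ℝ} {K : ℝ≥0}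
    {M V V₀ e ε L σ Q B c₁ δ κ α₀ a₁ g₁ : ℝ} {α : ℝ → ℝ} {g : ℝ → ℝ → ℝ}
    (hflow : IsFlowField G K M)
    (hstrict : ∃ G' : ℝ → ℝ × ℝ → (ℝ × ℝ →L[ℝ] ℝ × ℝ), (∀ t z, |z.2| < V → ‖G' t z‖ ≤ K) ∧
      ∀ η > 0, ∃ d > 0, ∀ t z₀ z₁ z₂, |z₀.2| < V → |z₁.2| < V → |z₂.2| < V →
        dist z₁ z₀ < d → dist z₂ z₀ < d →
          ‖G t z₁ - G t z₂ - G' t z₀ (z₁ - z₂)‖ ≤ η * ‖z₁ - z₂‖)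
    (he : 0 < e) (hε : 0 < ε) (hL : 0 < σ * L) (hσ : |σ| = 1) (hα₀ : 0 < α₀)
    (hα : ∀ φ, α₀ ≤ |α φ|) (hαc : Continuous α) (hgc : Continuous (uncurry g))
    (hg : ∀ t φ, |g t φ| ≤ g₁) (hlin : BL V a₁ fun t z => α z.1 * z.2 - g t z.1)
    (hV₀ : (2 + |B| + g₁) / α₀ ≤ V₀) (hV : V₀ < V)
    (hwc : Continuous (uncurry w))
    (hdw : ∀ z t, HasDerivAt z (G t (z t)) t → |(z t).2| < V →
      HasDerivAt (fun s => w s (z s)) (e * ε * (L * w t (z t) + E t (z t))) t)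
    (hdψ : ∀ z t, HasDerivAt z (G t (z t)) t → |(z t).2| < V →
      HasDerivAt (fun s => ψ s (z s)) (e * (1 + ε * (Q * w t (z t) + c₁ + E' t (z t)))) t)
    (hw : BL V δ fun t z => w t z - (α z.1 * z.2 - g t z.1 + B))
    (hψ : BL V δ fun t z => ψ t z - z.1) (hE : BL V δ E) (hE' : BL V δ E')
    (hκ : 0 < κ) (hκ1 : κ ≤ 1) (hκQ : κ * |Q| ≤ |L| / 4) (hδ1 : δ ≤ 1) (hδα : δ ≤ α₀ / 4)
    (hδC : δ * (2 * (1 + (a₁ + 1) / α₀)) ≤ 1)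
    (hδL : δ * (2 * (1 + (a₁ + 1) / α₀)) * (1 + 1 / κ) ≤ |L| / 4) :
    IsConeSystem σ G w ψ (fun t z => e * ε * (L * w t z + E t z))
      (fun t z => e * (1 + ε * (Q * w t z + c₁ + E' t z))) K M V V₀ κ (e * ε * (3 / 4 * |L|))
      (e * ε * (|L| / 2)) (α₀ / 2)
      (2 * (1 + (a₁ + 1) / α₀) * (1 + κ) + 2 * (a₁ + δ) + 1 + 2 * δ)
      (2 * (1 + a₁ + α₀ / 2) / α₀) := by
  set C₁ := 2 * (1 + (a₁ + 1) / α₀) with hC₁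
  have hg0 : 0 ≤ g₁ := (abs_nonneg _).trans (hg 0 0)
  have hV₀p : 0 < V₀ := lt_of_lt_of_le (by positivity) hV₀
  have ha₁ : 0 ≤ a₁ := (abs_nonneg _).trans (hlin 0 (0, 0) (0, 0) (by simp; linarith) (by simp; linarith)).1
  have hδ0 : 0 ≤ δ := (abs_nonneg _).trans (hE 0 (0, 0) (0, 0) (by simp; linarith) (by simp; linarith)).1
  have hC₁p : 2 ≤ C₁ := by
    have : 0 ≤ (a₁ + 1) / α₀ := by positivity
    rw [hC₁]; linarith
  have hLp : 0 < |L| := abs_pos.2 fun h => by rw [h, mul_zero] at hL; exact lt_irrefl _ hL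
  have hσL : σ * L = |L| := by rw [← abs_of_pos hL, abs_mul, hσ, one_mul]
  have hδL' : δ < |L| := by
    have h1 : 1 ≤ 1 / κ := by rw [le_div_iff₀ hκ]; linarith
    have h2 : δ * 2 * 2 ≤ δ * C₁ * (1 + 1 / κ) := by gcongr; linarith
    linarith
  have hψd : ∀ t z₁ z₂, |z₁.2| ≤ V → |z₂.2| ≤ V →
      |ψ t z₁ - ψ t z₂ - (z₁.1 - z₂.1)| ≤ δ * (|z₁.1 - z₂.1| + |z₁.2 - z₂.2|) := fun t z₁ z₂ h₁ h₂ => by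
    have := (hψ t z₁ z₂ h₁ h₂).2
    rwa [show ψ t z₁ - z₁.1 - (ψ t z₂ - z₂.1) = ψ t z₁ - ψ t z₂ - (z₁.1 - z₂.1) by ring] at this
  have hψ1 : ∀ t z₁ z₂, |z₁.2| ≤ V → |z₂.2| ≤ V →
      |z₁.1 - z₂.1| ≤ |ψ t z₁ - ψ t z₂| + δ * (|z₁.1 - z₂.1| + |z₁.2 - z₂.2|) := fun t z₁ z₂ h₁ h₂ => by
    have h1 := hψd t z₁ z₂ h₁ h₂
    have h2 := abs_sub_abs_le_abs_sub (z₁.1 - z₂.1) (ψ t z₁ - ψ t z₂)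
    rw [abs_sub_comm (z₁.1 - z₂.1) (ψ t z₁ - ψ t z₂)] at h2
    linarith
  have hψ2 : ∀ t z₁ z₂, |z₁.2| ≤ V → |z₂.2| ≤ V →
      |ψ t z₁ - ψ t z₂| ≤ |z₁.1 - z₂.1| + δ * (|z₁.1 - z₂.1| + |z₁.2 - z₂.2|) := fun t z₁ z₂ h₁ h₂ => by
    have h1 := hψd t z₁ z₂ h₁ h₂
    have h2 := abs_sub_abs_le_abs_sub (ψ t z₁ - ψ t z₂) (z₁.1 - z₂.1)
    linarith
  have hw1 : ∀ t z₁ z₂, |z₁.2| ≤ V → |z₂.2| ≤ V →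
      α₀ * |z₁.2 - z₂.2| ≤ |w t z₁ - w t z₂| + a₁ * |z₁.1 - z₂.1| +
        δ * (|z₁.1 - z₂.1| + |z₁.2 - z₂.2|) := fun t z₁ z₂ h₁ h₂ => by
    have h1 := (hw t z₁ z₂ h₁ h₂).2
    have h2 := (hlin t (z₁.1, z₂.2) z₂ h₂ h₂).2
    simp only [sub_self, abs_zero, add_zero] at h2
    have h3 : α z₁.1 * (z₁.2 - z₂.2) = (w t z₁ - w t z₂) -
        (α z₁.1 * z₂.2 - g t z₁.1 - (α z₂.1 * z₂.2 - g t z₂.1)) -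
        (w t z₁ - (α z₁.1 * z₁.2 - g t z₁.1 + B) - (w t z₂ - (α z₂.1 * z₂.2 - g t z₂.1 + B))) := by
      ring
    have h4 : α₀ * |z₁.2 - z₂.2| ≤ |α z₁.1 * (z₁.2 - z₂.2)| := by
      rw [abs_mul]; gcongr; exact hα _
    rw [h3] at h4
    have h5 := abs_sub (w t z₁ - w t z₂ - (α z₁.1 * z₂.2 - g t z₁.1 - (α z₂.1 * z₂.2 - g t z₂.1)))
      (w t z₁ - (α z₁.1 * z₁.2 - g t z₁.1 + B) - (w t z₂ - (α z₂.1 * z₂.2 - g t z₂.1 + B)))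
    have h6 := abs_sub (w t z₁ - w t z₂) (α z₁.1 * z₂.2 - g t z₁.1 - (α z₂.1 * z₂.2 - g t z₂.1))
    linarith
  have hw2 : ∀ t z₁ z₂, |z₁.2| ≤ V → |z₂.2| ≤ V →
      |w t z₁ - w t z₂| ≤ (a₁ + δ) * (|z₁.1 - z₂.1| + |z₁.2 - z₂.2|) := fun t z₁ z₂ h₁ h₂ => by
    have h1 := (hw t z₁ z₂ h₁ h₂).2
    have h2 := (hlin t z₁ z₂ h₁ h₂).2
    have h3 : w t z₁ - w t z₂ = (α z₁.1 * z₁.2 - g t z₁.1 - (α z₂.1 * z₂.2 - g t z₂.1)) +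
        (w t z₁ - (α z₁.1 * z₁.2 - g t z₁.1 + B) - (w t z₂ - (α z₂.1 * z₂.2 - g t z₂.1 + B))) := by
      ring
    rw [h3]
    refine (abs_add_le _ _).trans ?_
    linarith
  have hs : ∀ t z₁ z₂, |z₁.2| ≤ V → |z₂.2| ≤ V →
      |z₁.1 - z₂.1| + |z₁.2 - z₂.2| ≤ C₁ * (|ψ t z₁ - ψ t z₂| + |w t z₁ - w t z₂|) :=
    fun t z₁ z₂ h₁ h₂ => by
    have h1 := hψ1 t z₁ z₂ h₁ h₂
    have h2 := hw1 t z₁ z₂ h₁ h₂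
    have hx := abs_nonneg (z₁.1 - z₂.1)
    have hy := abs_nonneg (z₁.2 - z₂.2)
    have hp := abs_nonneg (ψ t z₁ - ψ t z₂)
    have hq := abs_nonneg (w t z₁ - w t z₂)
    generalize |z₁.1 - z₂.1| = x at *
    generalize |z₁.2 - z₂.2| = y at *
    generalize |ψ t z₁ - ψ t z₂| = p at *
    generalize |w t z₁ - w t z₂| = r at *
    have hCα : C₁ * α₀ = 2 * (α₀ + a₁ + 1) := by rw [hC₁]; field_simp; ring
    have h3 : α₀ * (x + y) ≤ (α₀ + a₁) * p + r + (α₀ + a₁ + 1) * (δ * (x + y)) := by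
      have := mul_le_mul_of_nonneg_left h1 (by positivity : 0 ≤ α₀ + a₁)
      nlinarith
    have h4 : (α₀ + a₁ + 1) * (δ * (x + y)) ≤ α₀ * (x + y) / 2 := by
      have : δ * C₁ * (α₀ * (x + y)) ≤ 1 * (α₀ * (x + y)) := by gcongr
      have e : δ * C₁ * (α₀ * (x + y)) = δ * (C₁ * α₀) * (x + y) := by ring
      rw [e, hCα] at this
      linarith
    have h5 : α₀ * (x + y) ≤ α₀ * (C₁ * (p + r)) := by
      rw [← mul_assoc, mul_comm α₀ C₁, hCα]
      nlinarith
    exact le_of_mul_le_mul_left h5 hα₀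
  have hnorm : ∀ z₁ z₂ : ℝ × ℝ, ‖z₁ - z₂‖ ≤ |z₁.1 - z₂.1| + |z₁.2 - z₂.2| ∧
      |z₁.1 - z₂.1| + |z₁.2 - z₂.2| ≤ 2 * ‖z₁ - z₂‖ ∧ |z₁.1 - z₂.1| ≤ ‖z₁ - z₂‖ := fun z₁ z₂ => by
    have h1 : |z₁.1 - z₂.1| ≤ ‖z₁ - z₂‖ := norm_fst_le (z₁ - z₂)
    have h2 : |z₁.2 - z₂.2| ≤ ‖z₁ - z₂‖ := norm_snd_le (z₁ - z₂)
    refine ⟨?_, by linarith, h1⟩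
    rw [Prod.norm_def]
    exact max_le (by simp) (by simp)
  have hκi : κ * (1 / κ) = 1 := by field_simp
  refine ⟨hflow, hV, by positivity, ?_, hκ, by positivity, by positivity, by positivity, hwc, hdw,
    hdψ, ?_, ?_, ?_, ?_, ?_, ?_, ?_, ?_, ?_, ?_, ?_, hstrict⟩
  · have : 0 < e * ε * |L| := by positivity
    nlinarith
  · intro t z hz hwz
    have h1 := (hw t z z hz hz).1
    refine le_trans ?_ hV₀
    rw [le_div_iff₀ hα₀]
    have h2 : |z.2| * α₀ ≤ |α z.1 * z.2| := by
      rw [abs_mul, mul_comm]; gcongr; exact hα _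
    have h3 : α z.1 * z.2 = w t z - (w t z - (α z.1 * z.2 - g t z.1 + B)) + g t z.1 - B := by ring
    rw [h3] at h2
    have h4 := abs_sub (w t z - (w t z - (α z.1 * z.2 - g t z.1 + B)) + g t z.1) B
    have h5 := abs_add_le (w t z - (w t z - (α z.1 * z.2 - g t z.1 + B))) (g t z.1)
    have h6 := abs_sub (w t z) (w t z - (α z.1 * z.2 - g t z.1 + B))
    linarith [hg t z.1]
  · intro t
    have hα0 : ∀ φ, α φ ≠ 0 := fun φ => abs_pos.1 (hα₀.trans_le (hα φ))
    refine ⟨fun φ => (g t φ - B) / α φ, ?_, fun φ => ?_⟩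
    · have : Continuous (g t) := hgc.comp (by fun_prop : Continuous fun φ : ℝ => (t, φ))
      exact (this.sub continuous_const).div hαc hα0
    have h1 : |(g t φ - B) / α φ| ≤ V := by
      refine le_trans ?_ hV.le
      refine le_trans ?_ hV₀
      rw [abs_div]
      refine div_le_div₀ (by positivity) ?_ hα₀ (hα φ)
      exact (abs_sub _ _).trans (by linarith [hg t φ])
    refine ⟨h1, ?_⟩
    have h2 := (hw t (φ, (g t φ - B) / α φ) (φ, (g t φ - B) / α φ) h1 h1).1
    simp only at h2
    rw [mul_div_cancel₀ _ (hα0 φ)] at h2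
    rw [show w t (φ, (g t φ - B) / α φ) - (g t φ - B - g t φ + B) = w t (φ, (g t φ - B) / α φ) by ring]
      at h2
    linarith
  · intro t z hz hwz
    have h1 := (hE t z z hz hz).1
    have h2 : |σ * E t z| < |L| := by rw [abs_mul, hσ, one_mul]; linarith
    have h3 := (abs_lt.1 h2).1
    rw [hwz]
    have : 0 < e * ε * (σ * L + σ * E t z) := by rw [hσL]; have : 0 < |L| + σ * E t z := by linarith
                                                 positivity
    linarith
  · intro t z hz hwz
    have h1 := (hE t z z hz hz).1
    have h2 : |σ * E t z| < |L| := by rw [abs_mul, hσ, one_mul]; linarith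
    have h3 := (abs_lt.1 h2).2
    rw [hwz]
    have : 0 < e * ε * (σ * L - σ * E t z) := by rw [hσL]; have : 0 < |L| - σ * E t z := by linarith
                                                 positivity
    linarith
  · intro t z₁ z₂ h₁ h₂ hc
    have h3 := hs t z₁ z₂ h₁.le h₂.le
    have hEd := (hE t z₁ z₂ h₁.le h₂.le).2
    have hE'd := (hE' t z₁ z₂ h₁.le h₂.le).2
    have hp : |ψ t z₁ - ψ t z₂| ≤ 1 / κ * |w t z₁ - w t z₂| := by
      rw [one_div, inv_mul_eq_div, le_div_iff₀ hκ]; linarith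
    have h4 : δ * (|z₁.1 - z₂.1| + |z₁.2 - z₂.2|) ≤ |L| / 4 * |w t z₁ - w t z₂| := by
      calc δ * (|z₁.1 - z₂.1| + |z₁.2 - z₂.2|)
          ≤ δ * (C₁ * (1 / κ * |w t z₁ - w t z₂| + |w t z₁ - w t z₂|)) := by
            gcongr; exact h3.trans (by gcongr)
        _ = δ * C₁ * (1 + 1 / κ) * |w t z₁ - w t z₂| := by ring
        _ ≤ _ := by gcongr
    constructor
    · set Δ := w t z₁ - w t z₂
      set ΔE := E t z₁ - E t z₂
      have h5 : |σ * (Δ * ΔE)| ≤ |L| / 4 * Δ ^ 2 := by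
        rw [abs_mul, hσ, one_mul, abs_mul, ← sq_abs Δ, pow_two]
        have := mul_le_mul_of_nonneg_left (hEd.trans h4) (abs_nonneg Δ)
        linarith
      have h6 := (abs_le.1 h5).1
      have h7 : σ * (Δ * (e * ε * (L * w t z₁ + E t z₁) - e * ε * (L * w t z₂ + E t z₂))) =
          e * ε * (σ * L * Δ ^ 2 + σ * (Δ * ΔE)) := by simp only [Δ, ΔE]; ring
      rw [h7, hσL]
      have : e * ε * (3 / 4 * |L|) * Δ ^ 2 = e * ε * (|L| * Δ ^ 2 - |L| / 4 * Δ ^ 2) := by ring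
      rw [this]
      gcongr
      linarith
    · have h7 : e * (1 + ε * (Q * w t z₁ + c₁ + E' t z₁)) - e * (1 + ε * (Q * w t z₂ + c₁ + E' t z₂)) =
          e * ε * (Q * (w t z₁ - w t z₂) + (E' t z₁ - E' t z₂)) := by ring
      simp only [h7]
      rw [abs_mul, abs_of_pos (by positivity : 0 < e * ε)]
      have h8 := abs_add_le (Q * (w t z₁ - w t z₂)) (E' t z₁ - E' t z₂)
      rw [abs_mul] at h8
      have h9 : κ * |Q * (w t z₁ - w t z₂) + (E' t z₁ - E' t z₂)| ≤ |L| / 2 * |w t z₁ - w t z₂| := by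
        have e1 := mul_le_mul_of_nonneg_left h8 hκ.le
        have e2 := mul_le_mul_of_nonneg_right hκQ (abs_nonneg (w t z₁ - w t z₂))
        have e3 := mul_le_mul_of_nonneg_right hκ1 (abs_nonneg (E' t z₁ - E' t z₂))
        linarith
      calc κ * (e * ε * |Q * (w t z₁ - w t z₂) + (E' t z₁ - E' t z₂)|)
          = e * ε * (κ * |Q * (w t z₁ - w t z₂) + (E' t z₁ - E' t z₂)|) := by ring
        _ ≤ e * ε * (|L| / 2 * |w t z₁ - w t z₂|) := by gcongr
        _ = _ := by ring
  · intro t z₁ z₂ h₁ h₂ hc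
    have h3 := hs t z₁ z₂ h₁.le h₂.le
    have hE'd := (hE' t z₁ z₂ h₁.le h₂.le).2
    have h4 : δ * (|z₁.1 - z₂.1| + |z₁.2 - z₂.2|) ≤ |L| / 4 * |ψ t z₁ - ψ t z₂| := by
      calc δ * (|z₁.1 - z₂.1| + |z₁.2 - z₂.2|)
          ≤ δ * (C₁ * (|ψ t z₁ - ψ t z₂| + 1 / κ * |ψ t z₁ - ψ t z₂|)) := by
            gcongr; refine h3.trans ?_; gcongr; refine hc.trans ?_; gcongr
            rw [le_div_iff₀ hκ]; nlinarith
        _ = δ * C₁ * (1 + 1 / κ) * |ψ t z₁ - ψ t z₂| := by ring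
        _ ≤ _ := by gcongr
    have h7 : e * (1 + ε * (Q * w t z₁ + c₁ + E' t z₁)) - e * (1 + ε * (Q * w t z₂ + c₁ + E' t z₂)) =
        e * ε * (Q * (w t z₁ - w t z₂) + (E' t z₁ - E' t z₂)) := by ring
    simp only [h7]
    rw [abs_mul, abs_of_pos (by positivity : 0 < e * ε), mul_assoc (e * ε)]
    gcongr
    have h8 := abs_add_le (Q * (w t z₁ - w t z₂)) (E' t z₁ - E' t z₂)
    rw [abs_mul] at h8
    have e1 := mul_le_mul_of_nonneg_left hc (abs_nonneg Q)
    have e2 := mul_le_mul_of_nonneg_right hκQ (abs_nonneg (ψ t z₁ - ψ t z₂))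
    linarith
  · intro t z₁ z₂ h₁ h₂ hc
    have h3 := hs t z₁ z₂ h₁.le h₂.le
    have hp := abs_nonneg (ψ t z₁ - ψ t z₂)
    calc ‖z₁ - z₂‖ ≤ C₁ * (|ψ t z₁ - ψ t z₂| + κ * |ψ t z₁ - ψ t z₂|) :=
          (hnorm z₁ z₂).1.trans (h3.trans (by gcongr))
      _ = C₁ * (1 + κ) * |ψ t z₁ - ψ t z₂| := by ring
      _ ≤ _ := by gcongr; linarith
  · intro t z₁ z₂ h₁ h₂
    have h3 := hw2 t z₁ z₂ h₁.le h₂.le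
    have h4 := (hnorm z₁ z₂).2.1
    calc |w t z₁ - w t z₂| ≤ (a₁ + δ) * (2 * ‖z₁ - z₂‖) := h3.trans (by gcongr)
      _ = 2 * (a₁ + δ) * ‖z₁ - z₂‖ := by ring
      _ ≤ _ := by
        gcongr
        have : 0 ≤ C₁ * (1 + κ) := by positivity
        linarith
  · intro t z₁ z₂ h₁ h₂
    have h3 := hψ2 t z₁ z₂ h₁.le h₂.le
    obtain ⟨-, h4, h5⟩ := hnorm z₁ z₂
    calc |ψ t z₁ - ψ t z₂| ≤ ‖z₁ - z₂‖ + δ * (2 * ‖z₁ - z₂‖) := h3.trans (by gcongr)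
      _ = (1 + 2 * δ) * ‖z₁ - z₂‖ := by ring
      _ ≤ _ := by
        gcongr
        have : 0 ≤ C₁ * (1 + κ) := by positivity
        linarith
  · intro t z₁ z₂ h₁ h₂ hx
    have h3 := hψ2 t z₁ z₂ h₁.le h₂.le
    have h4 := hw1 t z₁ z₂ h₁.le h₂.le
    rw [hx, sub_self, abs_zero] at h3 h4
    have hy := abs_nonneg (z₁.2 - z₂.2)
    have h5 := mul_le_mul_of_nonneg_right hδα hy
    have h6 := mul_le_mul_of_nonneg_right hκ1 (abs_nonneg (ψ t z₁ - ψ t z₂))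
    have h7 := mul_nonneg hα₀.le hy
    constructor <;> linarith
  · intro t z₁ z₂ h₁ h₂ hc
    have h3 := hψ2 t z₁ z₂ h₁.le h₂.le
    have h4 := hw1 t z₁ z₂ h₁.le h₂.le
    have hx := abs_nonneg (z₁.1 - z₂.1)
    have hy := abs_nonneg (z₁.2 - z₂.2)
    have h5 := mul_le_mul_of_nonneg_right hδα (add_nonneg hx hy)
    have h6 := mul_le_mul_of_nonneg_right hκ1 (abs_nonneg (ψ t z₁ - ψ t z₂))
    rw [div_mul_eq_mul_div, le_div_iff₀ hα₀]
    linarith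

end ConeOfClose


/-! ### Functions on the torus and their means along lines -/

section TorusFunctions

open Filter Topology

theorem hasDerivAt_intervalIntegral_of_continuous {F F' : ℝ → ℝ → ℝ} (hF : Continuous (uncurry F))
    (hF' : Continuous (uncurry F')) (h : ∀ x s, HasDerivAt (fun y => F y s) (F' x s) x)
    (a b x : ℝ) : HasDerivAt (fun y => ∫ s in a..b, F y s) (∫ s in a..b, F' x s) x := by
  obtain ⟨B, hB⟩ := ((isCompact_Icc (a := x - 1) (b := x + 1)).prod
    (isCompact_uIcc (a := a) (b := b))).exists_bound_of_continuousOn hF'.continuousOn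
  have c1 : ∀ y, Continuous (F y) := fun y => hF.comp (by fun_prop : Continuous fun s : ℝ => (y, s))
  have c2 : Continuous (F' x) := hF'.comp (by fun_prop : Continuous fun s : ℝ => (x, s))
  refine (intervalIntegral.hasDerivAt_integral_of_dominated_loc_of_deriv_le (bound := fun _ => B)
    (F := F) (F' := F') (Icc_mem_nhds (by linarith : x - 1 < x) (by linarith : x < x + 1))
    (Eventually.of_forall fun y => (c1 y).aestronglyMeasurable) ((c1 x).intervalIntegrable _ _)
    c2.aestronglyMeasurable (Eventually.of_forall fun s hs y hy => ?_) (by simp)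
    (Eventually.of_forall fun s _ y _ => h y s)).2
  exact hB (y, s) ⟨hy, uIoc_subset_uIcc hs⟩

/-- Functions of `(t, φ)` with `n` continuous derivatives in `φ` and with periods `T`, `ω`. -/
structure IsTorusC (T ω : ℝ) (n : ℕ) (f : ℝ → ℝ → ℝ) : Prop where
  isAngleC : IsAngleC n f
  periodic_t : ∀ t φ, f (t + T) φ = f t φ
  periodic_φ : ∀ t φ, f t (φ + ω) = f t φ

variable {T ω : ℝ} {n : ℕ} {f : ℝ → ℝ → ℝ}

theorem IsTorusC.continuous (h : IsTorusC T ω n f) : Continuous (uncurry f) := h.isAngleC.continuous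

theorem IsTorusC.exists_deriv (h : IsTorusC T ω (n + 1) f) :
    ∃ f', (∀ t φ, HasDerivAt (f t) (f' t φ) φ) ∧ IsTorusC T ω n f' := by
  obtain ⟨-, f', hf', hc⟩ := h.isAngleC
  refine ⟨f', hf', hc, fun t φ => ?_, fun t φ => ?_⟩
  · have h1 : f (t + T) = f t := funext fun x => h.periodic_t t x
    have h2 := hf' (t + T) φ
    rw [h1] at h2
    exact h2.unique (hf' t φ)
  · have h2 := (hf' t (φ + ω)).comp_add_const φ ω
    have h1 : (fun x => f t (x + ω)) = f t := funext fun x => h.periodic_φ t x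
    rw [h1] at h2
    exact h2.unique (hf' t φ)

theorem IsTorusC.exists_bound (hT : 0 < T) (hω : 0 < ω) (h : IsTorusC T ω n f) :
    ∃ B, 0 ≤ B ∧ ∀ t φ, |f t φ| ≤ B := by
  obtain ⟨B, hB⟩ := ((isCompact_Icc (a := (0 : ℝ)) (b := T)).prod
    (isCompact_Icc (a := (0 : ℝ)) (b := ω))).exists_bound_of_continuousOn h.continuous.continuousOn
  have key : ∀ t φ, |f t φ| ≤ B := fun t φ => by
    have p1 : Periodic (fun t => f t φ) T := fun t => h.periodic_t t φ
    obtain ⟨t', ht', e1⟩ := p1.exists_mem_Ico₀ hT t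
    have p2 : Periodic (f t') ω := h.periodic_φ t'
    obtain ⟨φ', hφ', e2⟩ := p2.exists_mem_Ico₀ hω φ
    have e3 : f t φ = f t' φ' := e1.trans e2
    rw [e3]
    exact hB (t', φ') ⟨Ico_subset_Icc_self ht', Ico_subset_Icc_self hφ'⟩
  exact ⟨B, (abs_nonneg _).trans (key 0 0), key⟩

theorem average_deriv_eq_zero {f' : ℝ → ℝ → ℝ} (hf' : ∀ t φ, HasDerivAt (f t) (f' t φ) φ)
    (hc : Continuous (uncurry f')) (hp : ∀ t φ, f t (φ + ω) = f t φ) : average T ω f' = 0 := by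
  rw [average, ← intervalIntegral_swap_of_continuous hc]
  have : ∀ t, ∫ φ in (0 : ℝ)..ω, f' t φ = 0 := fun t => by
    have c : Continuous (f' t) := hc.comp (by fun_prop : Continuous fun s : ℝ => (t, s))
    rw [intervalIntegral.integral_eq_sub_of_hasDerivAt (fun x _ => hf' t x)
      (c.intervalIntegrable _ _)]
    have := hp t 0
    rw [zero_add] at this
    rw [this, sub_self]
  simp [this]

/-- The integral of `f` along the line of direction `(1 / e, 1)`, with a weight. -/
noncomputable def lineIntegral (N e : ℝ) (k : ℝ → ℝ) (f : ℝ → ℝ → ℝ) (t φ : ℝ) : ℝ :=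
  ∫ s in (0 : ℝ)..N, k s * f (t + s / e) (φ + s)

/-- The mean of `f` along a segment of direction `(1 / e, 1)`. -/
noncomputable def lineMean (N e : ℝ) (f : ℝ → ℝ → ℝ) (t φ : ℝ) : ℝ :=
  lineIntegral N e (fun _ => 1 / N) f t φ

/-- The function whose derivative along the direction `(1, e)` is `e (f - lineMean f)`. -/
noncomputable def corrector (N e : ℝ) (f : ℝ → ℝ → ℝ) (t φ : ℝ) : ℝ :=
  lineIntegral N e (fun s => s / N - 1) f t φ

variable {N e : ℝ} {k : ℝ → ℝ} {f' : ℝ → ℝ → ℝ}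

theorem continuous_lineIntegral (hk : Continuous k) (hf : Continuous (uncurry f)) :
    Continuous (uncurry (lineIntegral N e k f)) := by
  have : Continuous (uncurry fun (p : ℝ × ℝ) s => k s * f (p.1 + s / e) (p.2 + s)) :=
    (hk.comp continuous_snd).mul
      (hf.comp (by fun_prop : Continuous fun q : (ℝ × ℝ) × ℝ => (q.1.1 + q.2 / e, q.1.2 + q.2)))
  exact intervalIntegral.continuous_parametric_intervalIntegral_of_continuous' this 0 N

theorem hasDerivAt_lineIntegral (hk : Continuous k) (hf : Continuous (uncurry f))
    (hf' : ∀ t φ, HasDerivAt (f t) (f' t φ) φ) (hc : Continuous (uncurry f')) (t φ : ℝ) :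
    HasDerivAt (lineIntegral N e k f t) (lineIntegral N e k f' t φ) φ := by
  refine hasDerivAt_intervalIntegral_of_continuous
    (F := fun φ s => k s * f (t + s / e) (φ + s)) (F' := fun φ s => k s * f' (t + s / e) (φ + s))
    ?_ ?_ (fun x s => ?_) 0 N φ
  · exact (hk.comp continuous_snd).mul
      (hf.comp (by fun_prop : Continuous fun q : ℝ × ℝ => (t + q.2 / e, q.1 + q.2)))
  · exact (hk.comp continuous_snd).mul
      (hc.comp (by fun_prop : Continuous fun q : ℝ × ℝ => (t + q.2 / e, q.1 + q.2)))
  · exact ((hf' (t + s / e) (x + s)).comp_add_const x s).const_mul (k s)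

theorem abs_lineIntegral_le (hN : 0 < N) {c B : ℝ} (hk : ∀ s ∈ Icc 0 N, |k s| ≤ c)
    (hB : ∀ t φ, |f t φ| ≤ B) (t φ : ℝ) : |lineIntegral N e k f t φ| ≤ c * B * N := by
  have := intervalIntegral.norm_integral_le_of_norm_le_const (a := 0) (b := N)
    (f := fun s => k s * f (t + s / e) (φ + s)) (C := c * B) fun s hs => by
      rw [uIoc_of_le hN.le] at hs
      have h1 := hk s ⟨hs.1.le, hs.2⟩
      rw [norm_mul]
      exact mul_le_mul h1 (hB _ _) (abs_nonneg _) ((abs_nonneg _).trans h1)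
  rwa [sub_zero, abs_of_pos hN] at this

theorem lineIntegral_periodic_t (h : ∀ t φ, f (t + T) φ = f t φ) (t φ : ℝ) :
    lineIntegral N e k f (t + T) φ = lineIntegral N e k f t φ := by
  unfold lineIntegral
  congr 1; ext s
  rw [add_right_comm, h]

theorem lineIntegral_periodic_φ (h : ∀ t φ, f t (φ + ω) = f t φ) (t φ : ℝ) :
    lineIntegral N e k f t (φ + ω) = lineIntegral N e k f t φ := by
  unfold lineIntegral
  congr 1; ext s
  rw [add_right_comm, h]

theorem hasDerivAt_corrector (hN : 0 < N) (he : e ≠ 0) (hf : Continuous (uncurry f)) (t φ : ℝ) :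
    HasDerivAt (fun τ => corrector N e f τ (φ + e * (τ - t)))
      (e * (f t φ - lineMean N e f t φ)) t := by
  set F : ℝ → ℝ := fun y => f (t + y / e) (φ + y) with hF
  have hFc : Continuous F := hf.comp (by fun_prop : Continuous fun y : ℝ => (t + y / e, φ + y))
  have hyF : Continuous fun y => y * F y := continuous_id.mul hFc
  set I : ℝ → ℝ := fun x => ∫ y in (0 : ℝ)..x, F y
  set J : ℝ → ℝ := fun x => ∫ y in (0 : ℝ)..x, y * F y
  have hI : ∀ x, HasDerivAt I (F x) x := fun x => hFc.integral_hasStrictDerivAt 0 x |>.hasDerivAt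
  have hJ : ∀ x, HasDerivAt J (x * F x) x := fun x => hyF.integral_hasStrictDerivAt 0 x |>.hasDerivAt
  have hrep : ∀ τ, corrector N e f τ (φ + e * (τ - t)) =
      1 / N * (J (e * (τ - t) + N) - J (e * (τ - t)))
        - (1 + e * (τ - t) / N) * (I (e * (τ - t) + N) - I (e * (τ - t))) := by
    intro τ
    set x := e * (τ - t) with hx
    have h1 : corrector N e f τ (φ + x) = ∫ s in (0 : ℝ)..N, ((s + x - x) / N - 1) * F (s + x) := by
      unfold corrector lineIntegral
      congr 1; ext s
      simp only [hF, add_sub_cancel_right]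
      congr 2
      · rw [hx]; field_simp; ring
      · ring
    rw [h1, intervalIntegral.integral_comp_add_right (fun y => ((y - x) / N - 1) * F y)]
    have h2 : ∀ y, ((y - x) / N - 1) * F y = 1 / N * (y * F y) - (1 + x / N) * F y := fun y => by ring
    simp_rw [h2]
    rw [intervalIntegral.integral_sub ((hyF.const_mul _ |>.intervalIntegrable _ _))
      ((hFc.const_mul _ |>.intervalIntegrable _ _)), intervalIntegral.integral_const_mul,
      intervalIntegral.integral_const_mul, zero_add, add_comm N x,
      intervalIntegral.integral_interval_sub_left (hyF.intervalIntegrable _ _)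
        (hyF.intervalIntegrable _ _),
      intervalIntegral.integral_interval_sub_left (hFc.intervalIntegrable _ _)
        (hFc.intervalIntegrable _ _)]
  have hx : HasDerivAt (fun τ => e * (τ - t)) e t := by
    simpa using ((hasDerivAt_id t).sub_const t).const_mul e
  have hx' : HasDerivAt (fun τ => e * (τ - t) + N) e t := hx.add_const N
  have d1 := (hJ (e * (t - t) + N)).comp t hx'
  have d2 := (hJ (e * (t - t))).comp t hx
  have d3 := (hI (e * (t - t) + N)).comp t hx'
  have d4 := (hI (e * (t - t))).comp t hx
  have d5 : HasDerivAt (fun τ => 1 + e * (τ - t) / N) (e / N) t := (hx.div_const N).const_add 1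
  have d := ((d1.sub d2).const_mul (1 / N)).sub (d5.mul (d3.sub d4))
  refine (d.congr_of_eventuallyEq (Eventually.of_forall hrep)).congr_deriv ?_
  have hM : lineMean N e f t φ = 1 / N * I N := by
    simp only [lineMean, lineIntegral, I]
    rw [intervalIntegral.integral_const_mul]
  have hI0 : I 0 = 0 := by simp [I]
  have hF0 : F 0 = f t φ := by simp [hF]
  rw [hM]
  simp only [Pi.sub_apply, Function.comp_apply, sub_self, mul_zero, zero_add, hI0, hF0, sub_zero,
    zero_div, add_zero]
  field_simp
  ring

/-- Derivative along a curve of a function with a derivative in the direction `(1, e)`. -/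
theorem hasDerivAt_along_curve {m m' d : ℝ → ℝ → ℝ} (hm' : ∀ t φ, HasDerivAt (m t) (m' t φ) φ)
    (hc : Continuous (uncurry m')) {t : ℝ} {u : ℝ → ℝ} {u' : ℝ}
    (hd : HasDerivAt (fun τ => m τ (u t + e * (τ - t))) (d t (u t)) t) (hu : HasDerivAt u u' t) :
    HasDerivAt (fun s => m s (u s)) (d t (u t) + m' t (u t) * (u' - e)) t := by
  set k : ℝ → ℝ := fun s => u s - (u t + e * (s - t)) with hk
  have hkd : HasDerivAt k (u' - e) t := by
    have h1 : HasDerivAt (fun s => u t + e * (s - t)) e t := by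
      simpa using (((hasDerivAt_id t).sub_const t).const_mul e).const_add (u t)
    exact hu.sub h1
  set g : ℝ × ℝ × ℝ → ℝ := fun p => ∫ θ in (0 : ℝ)..1, m' p.1 (p.2.1 + θ * (p.2.2 - p.2.1)) with hg
  have hgc : Continuous g := by
    have : Continuous (uncurry fun (p : ℝ × ℝ × ℝ) θ => m' p.1 (p.2.1 + θ * (p.2.2 - p.2.1))) :=
      hc.comp (by fun_prop : Continuous fun q : (ℝ × ℝ × ℝ) × ℝ =>
        (q.1.1, q.1.2.1 + q.2 * (q.1.2.2 - q.1.2.1)))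
    exact intervalIntegral.continuous_parametric_intervalIntegral_of_continuous' this 0 1
  have hrep : ∀ s a b, m s b - m s a = (b - a) * g (s, a, b) := fun s a b => by
    have c : Continuous fun θ : ℝ => m' s (a + θ * (b - a)) * (b - a) :=
      (hc.comp (by fun_prop : Continuous fun θ : ℝ => (s, a + θ * (b - a)))).mul continuous_const
    have h1 : ∀ θ : ℝ, HasDerivAt (fun θ => m s (a + θ * (b - a))) (m' s (a + θ * (b - a)) * (b - a)) θ :=
      fun θ => by
        have h2 : HasDerivAt (fun θ : ℝ => a + θ * (b - a)) (b - a) θ := by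
          simpa using ((hasDerivAt_id θ).mul_const (b - a)).const_add a
        exact (hm' s (a + θ * (b - a))).comp θ h2
    have h3 := intervalIntegral.integral_eq_sub_of_hasDerivAt (a := 0) (b := 1)
      (fun θ _ => h1 θ) (c.intervalIntegrable _ _)
    rw [intervalIntegral.integral_mul_const] at h3
    simp only [one_mul, zero_mul, add_zero, add_sub_cancel] at h3
    rw [← h3, mul_comm]
  have hcont : ContinuousAt (fun s => g (s, u t + e * (s - t), u s)) t := by
    refine hgc.continuousAt.comp ?_
    exact continuousAt_id.prodMk (ContinuousAt.prodMk (by fun_prop) hu.continuousAt)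
  have hprod : HasDerivAt (fun s => k s * g (s, u t + e * (s - t), u s))
      ((u' - e) * g (t, u t + e * (t - t), u t)) t := by
    rw [hasDerivAt_iff_tendsto_slope] at hkd ⊢
    have hk0 : k t = 0 := by simp [hk]
    have := hkd.mul (hcont.tendsto.mono_left (nhdsWithin_le_nhds (s := {t}ᶜ)))
    refine this.congr fun s => ?_
    simp only [slope_def_field, hk0, zero_mul, sub_zero]
    ring
  have hg0 : g (t, u t + e * (t - t), u t) = m' t (u t) := by simp [hg]
  rw [hg0] at hprod
  have := hd.add hprod
  refine (this.congr_of_eventuallyEq (Eventually.of_forall fun s => ?_)).congr_deriv (by ring)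
  have h := hrep s (u t + e * (s - t)) (u s)
  simp only [Pi.add_apply, hk]
  linarith

theorem corrector_bound (hT : 0 < T) (hω : 0 < ω) (hN : 0 < N) (hf : IsTorusC T ω n f) :
    ∃ B, ∀ e t φ, |corrector N e f t φ| ≤ B := by
  obtain ⟨B, -, hB⟩ := hf.exists_bound hT hω
  refine ⟨1 * B * N, fun e t φ => abs_lineIntegral_le hN (fun s hs => ?_) hB t φ⟩
  have h1 : s / N ≤ 1 := (div_le_one hN).2 hs.2
  have h2 : 0 ≤ s / N := div_nonneg hs.1 hN.le
  rw [abs_le]; constructor <;> linarith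

theorem hasDerivAt_corrector_angle (hf : Continuous (uncurry f))
    (hf' : ∀ t φ, HasDerivAt (f t) (f' t φ) φ) (hc : Continuous (uncurry f')) (t φ : ℝ) :
    HasDerivAt (corrector N e f t) (corrector N e f' t φ) φ :=
  hasDerivAt_lineIntegral (by fun_prop) hf hf' hc t φ

theorem continuous_corrector (hf : Continuous (uncurry f)) : Continuous (uncurry (corrector N e f)) :=
  continuous_lineIntegral (by fun_prop) hf

theorem blBounded_corrector (V : ℝ) (hT : 0 < T) (hω : 0 < ω) (hN : 0 < N)
    (hf : IsTorusC T ω (n + 1) f) (e : ℝ → ℝ) :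
    BLBounded V fun ε t z => corrector N (e ε) f t z.1 := by
  obtain ⟨f', hf', hc⟩ := hf.exists_deriv
  obtain ⟨B, hB⟩ := corrector_bound hT hω hN hf
  obtain ⟨B', hB'⟩ := corrector_bound hT hω hN hc
  exact ⟨max B B', Eventually.of_forall fun ε => BL.of_angle V
    (hasDerivAt_corrector_angle hf.continuous hf' hc.continuous)
    (fun t φ => (hB _ t φ).trans (le_max_left _ _)) (fun t φ => (hB' _ t φ).trans (le_max_right _ _))⟩

theorem blBounded_torus (V : ℝ) (hT : 0 < T) (hω : 0 < ω) (hf : IsTorusC T ω (n + 1) f) :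
    BLBounded V fun _ t z => f t z.1 := by
  obtain ⟨f', hf', hc⟩ := hf.exists_deriv
  obtain ⟨B, -, hB⟩ := hf.exists_bound hT hω
  obtain ⟨B', -, hB'⟩ := hc.exists_bound hT hω
  exact ⟨max B B', Eventually.of_forall fun ε => BL.of_angle V hf'
    (fun t φ => (hB t φ).trans (le_max_left _ _)) (fun t φ => (hB' t φ).trans (le_max_right _ _))⟩

/-- The absence of resonances between the periods `T` and `ω` for the direction `(1, e(ε))`. -/
def NonResonant (T ω : ℝ) (e : ℝ → ℝ) : Prop :=
  ∀ j k : ℤ, ¬(j = 0 ∧ k = 0) → ∃ c > 0, ∀ᶠ ε in 𝓝[>] (0 : ℝ),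
    c ≤ |2 * Real.pi * j / T / e ε + 2 * Real.pi * k / ω|

theorem bl_lineMean (V : ℝ) (hT : 0 < T) (hω : 0 < ω) {e : ℝ → ℝ} (hres : NonResonant T ω e)
    (hf : IsTorusC T ω (n + 1) f) {δ : ℝ} (hδ : 0 < δ) :
    ∃ N₀ > 0, ∀ N ≥ N₀, ∀ᶠ ε in 𝓝[>] (0 : ℝ),
      BL V δ fun t z => lineMean N (e ε) f t z.1 - average T ω f := by
  obtain ⟨f', hf', hc⟩ := hf.exists_deriv
  obtain ⟨N₁, hN₁, h1⟩ := exists_forall_mean_near_average hT hω hres hf.continuous hf.periodic_t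
    hf.periodic_φ hδ
  obtain ⟨N₂, hN₂, h2⟩ := exists_forall_mean_near_average hT hω hres hc.continuous hc.periodic_t
    hc.periodic_φ hδ
  have hM : ∀ N e g t φ, lineMean N e g t φ = 1 / N * ∫ s in (0 : ℝ)..N, g (t + s / e) (φ + s) :=
    fun N e g t φ => by simp only [lineMean, lineIntegral, intervalIntegral.integral_const_mul]
  refine ⟨max N₁ N₂, lt_max_of_lt_left hN₁, fun N hN => ?_⟩
  filter_upwards [h1 N (le_of_max_le_left hN), h2 N (le_of_max_le_right hN)] with ε p q
  refine BL.of_angle V (f := fun t φ => lineMean N (e ε) f t φ - average T ω f)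
    (f' := lineMean N (e ε) f') (fun t φ => ?_) (fun t φ => ?_) fun t φ => ?_
  · exact (hasDerivAt_lineIntegral continuous_const hf.continuous hf' hc.continuous t φ).sub_const _
  · rw [hM]; exact p t φ
  · have := q t φ
    rw [average_deriv_eq_zero hf' hc.continuous hf.periodic_φ, sub_zero] at this
    rw [hM]; exact this

theorem nonResonant_one (hT : 0 < T) (hω : 0 < ω) (hS : Siegel T ω) : NonResonant T ω fun _ => 1 := by
  intro j k hjk
  obtain ⟨K, τ, hK, -, hS⟩ := hS
  refine ⟨|2 * Real.pi * j / T / 1 + 2 * Real.pi * k / ω|, abs_pos.2 fun h => ?_,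
    Eventually.of_forall fun _ => le_rfl⟩
  have h1 : (j : ℝ) * ω + k * T = 0 := by
    have hpi := Real.pi_pos
    field_simp at h
    nlinarith
  have hpos : ∀ p q : ℤ, 0 < p → 0 < q → (p : ℝ) * T ≠ q * ω := fun p q hp hq hpq => by
    have h2 := hS p.toNat q.toNat (by omega) (by omega)
    have e1 : ((p.toNat : ℕ) : ℝ) = p := by exact_mod_cast Int.toNat_of_nonneg hp.le
    have e2 : ((q.toNat : ℕ) : ℝ) = q := by exact_mod_cast Int.toNat_of_nonneg hq.le
    rw [e1, e2, hpq, sub_self, abs_zero] at h2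
    have h3 : (0 : ℝ) < (p : ℝ) + q := by
      have : (0 : ℝ) < p := by exact_mod_cast hp
      have : (0 : ℝ) < q := by exact_mod_cast hq
      linarith
    have := mul_pos hK (Real.rpow_pos_of_pos h3 (-τ))
    linarith
  rcases lt_trichotomy k 0 with hk | hk | hk
  · have hk' : (k : ℝ) < 0 := by exact_mod_cast hk
    have hj : 0 < j := by
      have : (0 : ℝ) < j := by nlinarith [mul_neg_of_neg_of_pos hk' hT]
      exact_mod_cast this
    exact hpos (-k) j (by omega) hj (by push_cast; linarith)
  · refine hjk ⟨?_, hk⟩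
    rw [hk] at h1
    have : (j : ℝ) = 0 := by
      simp only [Int.cast_zero, zero_mul, add_zero] at h1
      rcases mul_eq_zero.1 h1 with h | h
      · exact h
      · exact absurd h hω.ne'
    exact_mod_cast this
  · have hk' : (0 : ℝ) < k := by exact_mod_cast hk
    have hj : j < 0 := by
      have : (j : ℝ) < 0 := by nlinarith [mul_pos hk' hT]
      exact_mod_cast this
    exact hpos k (-j) hk (by omega) (by push_cast; linarith)

theorem nonResonant_id (hT : 0 < T) (hω : 0 < ω) : NonResonant T ω fun ε => ε := by
  intro j k hjk
  have hpi := Real.pi_pos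
  by_cases hj : j = 0
  · have hk : k ≠ 0 := fun hk => hjk ⟨hj, hk⟩
    have hk' : (k : ℝ) ≠ 0 := by exact_mod_cast hk
    refine ⟨|2 * Real.pi * k / ω|, by positivity, Eventually.of_forall fun ε => ?_⟩
    simp [hj]
  · have hj' : (j : ℝ) ≠ 0 := by exact_mod_cast hj
    set a := |2 * Real.pi * j / T| with ha
    have hap : 0 < a := by positivity
    set b := |2 * Real.pi * k / ω|
    have hb : 0 ≤ b := abs_nonneg _
    refine ⟨1, one_pos, ?_⟩
    have h1 : ∀ᶠ ε in 𝓝[>] (0 : ℝ), ε < a / (b + 1) :=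
      nhdsWithin_le_nhds (Iio_mem_nhds (by positivity))
    filter_upwards [h1, self_mem_nhdsWithin] with ε hε hε0
    have hε0 : 0 < ε := hε0
    have h2 : |2 * Real.pi * j / T / ε| = a / ε := by rw [abs_div, abs_of_pos hε0]
    have h3 : b + 1 ≤ a / ε := by
      rw [lt_div_iff₀ (by positivity)] at hε
      rw [le_div_iff₀ hε0]; linarith
    have h4 := abs_sub_abs_le_abs_sub (2 * Real.pi * j / T / ε) (-(2 * Real.pi * k / ω))
    rw [abs_neg, h2, sub_neg_eq_add] at h4
    linarith

end TorusFunctions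


/-! ### Invariant graphs for systems in normal form -/

section NormalForm

open Filter Topology
open scoped NNReal

/-- The terms that remain after the averaging transformation. -/
noncomputable def averagingError (T ω N e ε k : ℝ) (f₁ f₁' f₀ f₀' m n : ℝ → ℝ → ℝ)
    (w₁ F P E : ℝ → ℝ × ℝ → ℝ) (t : ℝ) (z : ℝ × ℝ) : ℝ :=
  (lineMean N e f₁ t z.1 - average T ω f₁) * w₁ t z + (lineMean N e f₀ t z.1 - average T ω f₀) +
    E t z + -(ε * (corrector N e f₁' t z.1 * F t z * w₁ t z + corrector N e f₁ t z.1 * P t z +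
      corrector N e f₀' t z.1 * F t z)) +
    ε * (k * (corrector N e m t z.1 * w₁ t z + corrector N e n t z.1))

theorem bl_averagingError {T ω V k : ℝ} (hT : 0 < T) (hω : 0 < ω) {e : ℝ → ℝ}
    (hres : NonResonant T ω e) {f₁ f₁' f₀ f₀' m n : ℝ → ℝ → ℝ} (hf₁ : IsTorusC T ω 2 f₁)
    (hf₁' : IsTorusC T ω 1 f₁') (hf₀ : IsTorusC T ω 2 f₀) (hf₀' : IsTorusC T ω 1 f₀')
    (hm : IsTorusC T ω 2 m) (hn : IsTorusC T ω 2 n) {w₁ F P E : ℝ → ℝ → ℝ × ℝ → ℝ}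
    (hw₁ : BLBounded V w₁) (hF : BLBounded V F) (hP : BLBounded V P) (hE : BLSmall V E)
    {δ : ℝ} (hδ : 0 < δ) :
    ∃ N₀ > 0, ∀ N ≥ N₀, ∀ᶠ ε in 𝓝[>] (0 : ℝ),
      BL V δ (averagingError T ω N (e ε) ε k f₁ f₁' f₀ f₀' m n (w₁ ε) (F ε) (P ε) (E ε)) := by
  obtain ⟨b, hb⟩ := hw₁
  have hb' : 0 < 2 * (|b| + 1) := by positivity
  obtain ⟨N₁, hN₁, h1⟩ := bl_lineMean V hT hω hres hf₁ (δ := δ / 4 / (2 * (|b| + 1))) (by positivity)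
  obtain ⟨N₂, hN₂, h2⟩ := bl_lineMean V hT hω hres hf₀ (δ := δ / 4) (by positivity)
  refine ⟨max N₁ N₂, lt_max_of_lt_left hN₁, fun N hN => ?_⟩
  have hNp : 0 < N := lt_of_lt_of_le (lt_max_of_lt_left hN₁) hN
  have hw₁ : BLBounded V w₁ := ⟨b, hb⟩
  have s1 := (((((blBounded_corrector V hT hω hNp hf₁' e).mul hF).mul hw₁).add
    ((blBounded_corrector V hT hω hNp hf₁ e).mul hP)).add
    ((blBounded_corrector V hT hω hNp hf₀' e).mul hF)).eps_mul.neg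
  have s2 := ((BLBounded.const V k).mul (((blBounded_corrector V hT hω hNp hm e).mul hw₁).add
    (blBounded_corrector V hT hω hNp hn e))).eps_mul
  have s := (hE.add s1).add s2
  filter_upwards [h1 N (le_of_max_le_left hN), h2 N (le_of_max_le_right hN), hb,
    s (δ / 2) (by positivity)] with ε p q r u
  have p' := p.mul (r.mono ((le_abs_self b).trans (by linarith : |b| ≤ |b| + 1)))
  rw [show 2 * (δ / 4 / (2 * (|b| + 1)) * (|b| + 1)) = δ / 4 by field_simp] at p'
  have := ((p'.add q).add u).mono (by linarith : δ / 4 + δ / 4 + δ / 2 ≤ δ)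
  intro t z₁ z₂ h₁ h₂
  have h3 := this t z₁ z₂ h₁ h₂
  have h4 : ∀ z, averagingError T ω N (e ε) ε k f₁ f₁' f₀ f₀' m n (w₁ ε) (F ε) (P ε) (E ε) t z = _ :=
    fun z => by unfold averagingError; simp only [add_assoc]; rfl
  rw [h4, h4]
  simp only [add_assoc] at h3 ⊢
  exact h3

/-- The derivative of a corrector term along a solution. -/
theorem hasDerivAt_correction {N e ε : ℝ} {f₁ f₁' f₀ f₀' : ℝ → ℝ → ℝ} (hN : 0 < N) (he : e ≠ 0)
    (h₁ : Continuous (uncurry f₁)) (h₁' : ∀ t φ, HasDerivAt (f₁ t) (f₁' t φ) φ)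
    (h₁c : Continuous (uncurry f₁'))
    (h₀ : Continuous (uncurry f₀)) (h₀' : ∀ t φ, HasDerivAt (f₀ t) (f₀' t φ) φ)
    (h₀c : Continuous (uncurry f₀')) {φ w : ℝ → ℝ} {t F P : ℝ}
    (hφ : HasDerivAt φ (e * (1 + ε * F)) t) (hw : HasDerivAt w (e * ε * P) t) :
    HasDerivAt (fun s => corrector N e f₁ s (φ s) * w s + corrector N e f₀ s (φ s))
      (e * ((f₁ t (φ t) - lineMean N e f₁ t (φ t)) * w t + (f₀ t (φ t) - lineMean N e f₀ t (φ t)) +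
        ε * (corrector N e f₁' t (φ t) * F * w t + corrector N e f₁ t (φ t) * P +
          corrector N e f₀' t (φ t) * F))) t := by
  have d1 := hasDerivAt_along_curve (d := fun t φ => e * (f₁ t φ - lineMean N e f₁ t φ))
    (hasDerivAt_corrector_angle (N := N) (e := e) h₁ h₁' h₁c) (continuous_corrector h₁c)
    (hasDerivAt_corrector hN he h₁ t (φ t)) hφ
  have d0 := hasDerivAt_along_curve (d := fun t φ => e * (f₀ t φ - lineMean N e f₀ t φ))
    (hasDerivAt_corrector_angle (N := N) (e := e) h₀ h₀' h₀c) (continuous_corrector h₀c)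
    (hasDerivAt_corrector hN he h₀ t (φ t)) hφ
  refine ((d1.mul hw).add d0).congr_deriv ?_
  ring

/-- A family of systems `φ' = e (1 + ε (q w₁ + d + small))`, `w₁' = e ε (A w₁ + D + small)` with
`w₁ = α v - g + small`, where the mean `L` of `A` does not vanish, has invariant graphs `v = U(t, φ)`
for all small `ε > 0`. -/
theorem exists_invariant_graph_of_normalForm {T ω V V₀ L α₀ g₁ a₁ : ℝ} (hT : 0 < T) (hω : 0 < ω)
    {e : ℝ → ℝ} (he : ∀ᶠ ε in 𝓝[>] (0 : ℝ), 0 < e ε) (hres : NonResonant T ω e)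
    {A D q d : ℝ → ℝ → ℝ} (hA : IsTorusC T ω 2 A) (hD : IsTorusC T ω 2 D) (hq : IsTorusC T ω 2 q)
    (hd : IsTorusC T ω 2 d) (hL : average T ω A = L) (hL0 : L ≠ 0)
    {α : ℝ → ℝ} {g : ℝ → ℝ → ℝ} (hα₀ : 0 < α₀) (hα : ∀ φ, α₀ ≤ |α φ|) (hαc : Continuous α)
    (hgc : Continuous (uncurry g)) (hg : ∀ t φ, |g t φ| ≤ g₁)
    (hlin : BL V a₁ fun t z => α z.1 * z.2 - g t z.1)
    (hV₀ : (2 + |average T ω D / L| + g₁) / α₀ ≤ V₀) (hV : V₀ < V)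
    {G : ℝ → ℝ → ℝ × ℝ → ℝ × ℝ} {w₁ Ew Eφ : ℝ → ℝ → ℝ × ℝ → ℝ}
    (hG : ∀ᶠ ε in 𝓝[>] (0 : ℝ), ∃ (K : ℝ≥0) (M : ℝ), IsFlowField (G ε) K M ∧
      ∃ G' : ℝ → ℝ × ℝ → (ℝ × ℝ →L[ℝ] ℝ × ℝ), (∀ t z, |z.2| < V → ‖G' t z‖ ≤ K) ∧
        ∀ η > 0, ∃ d > 0, ∀ t z₀ z₁ z₂, |z₀.2| < V → |z₁.2| < V → |z₂.2| < V →
          dist z₁ z₀ < d → dist z₂ z₀ < d →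
            ‖G ε t z₁ - G ε t z₂ - G' t z₀ (z₁ - z₂)‖ ≤ η * ‖z₁ - z₂‖)
    (hGT : ∀ᶠ ε in 𝓝[>] (0 : ℝ), ∀ t z, G ε (t + T) z = G ε t z)
    (hGω : ∀ᶠ ε in 𝓝[>] (0 : ℝ), ∀ t φ v, G ε t (φ + ω, v) = G ε t (φ, v))
    (hwc : ∀ᶠ ε in 𝓝[>] (0 : ℝ), Continuous (uncurry (w₁ ε)))
    (hwT : ∀ᶠ ε in 𝓝[>] (0 : ℝ), ∀ t z, w₁ ε (t + T) z = w₁ ε t z)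
    (hwω : ∀ᶠ ε in 𝓝[>] (0 : ℝ), ∀ t φ v, w₁ ε t (φ + ω, v) = w₁ ε t (φ, v))
    (hdw : ∀ᶠ ε in 𝓝[>] (0 : ℝ), ∀ z t, HasDerivAt z (G ε t (z t)) t → |(z t).2| < V →
      HasDerivAt (fun s => w₁ ε s (z s))
        (e ε * ε * (A t (z t).1 * w₁ ε t (z t) + D t (z t).1 + Ew ε t (z t))) t)
    (hdφ : ∀ᶠ ε in 𝓝[>] (0 : ℝ), ∀ t z, |z.2| < V →
      (G ε t z).1 = e ε * (1 + ε * (q t z.1 * w₁ ε t z + d t z.1 + Eφ ε t z)))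
    (hw : BLSmall V fun ε t z => w₁ ε t z - (α z.1 * z.2 - g t z.1))
    (hEw : BLSmall V Ew) (hEφ : BLSmall V Eφ) :
    ∀ᶠ ε in 𝓝[>] (0 : ℝ), ∃ U : ℝ → ℝ → ℝ, ContDiff ℝ 1 (uncurry U) ∧
      (∀ t φ, U (t + T) φ = U t φ) ∧ (∀ t φ, U t (φ + ω) = U t φ) ∧ (∀ t φ, |U t φ| ≤ V₀) ∧
      ∀ t₀ φ₀, ∃ z, IsGlobalSol (G ε) z ∧ z t₀ = (φ₀, U t₀ φ₀) ∧ ∀ t, (z t).2 = U t (z t).1 := by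
  have hLp : 0 < |L| := abs_pos.2 hL0
  set Q := average T ω q with hQ
  set B := average T ω D / L with hB
  have hg0 : 0 ≤ g₁ := (abs_nonneg _).trans (hg 0 0)
  have hV₀p : 0 < V₀ := lt_of_lt_of_le (by positivity) hV₀
  have ha₁ : 0 ≤ a₁ :=
    (abs_nonneg _).trans (hlin 0 (0, 0) (0, 0) (by simp; linarith) (by simp; linarith)).1
  set κ := min 1 (|L| / (4 * (|Q| + 1))) with hκ
  have hκp : 0 < κ := lt_min one_pos (by positivity)
  have hκ1 : κ ≤ 1 := min_le_left _ _
  have hκQ : κ * |Q| ≤ |L| / 4 := by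
    have h1 : κ ≤ |L| / (4 * (|Q| + 1)) := min_le_right _ _
    rw [le_div_iff₀ (by positivity)] at h1
    nlinarith
  set C₁ := 2 * (1 + (a₁ + 1) / α₀) with hC₁
  have hC₁p : 0 < C₁ := by positivity
  obtain ⟨δ, hδp, hδ1, hδα, hδC, hδL⟩ : ∃ δ > 0, δ ≤ 1 ∧ δ ≤ α₀ / 4 ∧ δ * C₁ ≤ 1 ∧
      δ * C₁ * (1 + 1 / κ) ≤ |L| / 4 := by
    refine ⟨min (min 1 (α₀ / 4)) (min (1 / C₁) (|L| / 4 / (C₁ * (1 + 1 / κ)))),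
      by positivity, (min_le_left _ _).trans (min_le_left _ _),
      (min_le_left _ _).trans (min_le_right _ _), ?_, ?_⟩
    · rw [← le_div_iff₀ hC₁p]; exact (min_le_right _ _).trans (min_le_left _ _)
    · rw [mul_assoc, ← le_div_iff₀ (by positivity)]
      exact (min_le_right _ _).trans (min_le_right _ _)
  obtain ⟨A', hA', hA'c⟩ := hA.exists_deriv
  obtain ⟨D', hD', hD'c⟩ := hD.exists_deriv
  obtain ⟨q', hq', hq'c⟩ := hq.exists_deriv
  obtain ⟨d', hd', hd'c⟩ := hd.exists_deriv
  have hlinB : BLBounded V fun _ t z => α z.1 * z.2 - g t z.1 := ⟨a₁, Eventually.of_forall fun _ => hlin⟩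
  have hw₁ : BLBounded V w₁ := (hw.bounded.add hlinB).congr
    (Eventually.of_forall fun ε t z _ => by ring)
  set F : ℝ → ℝ → ℝ × ℝ → ℝ := fun ε t z => q t z.1 * w₁ ε t z + d t z.1 + Eφ ε t z with hF
  set P : ℝ → ℝ → ℝ × ℝ → ℝ := fun ε t z => A t z.1 * w₁ ε t z + D t z.1 + Ew ε t z with hP
  have hFb : BLBounded V F :=
    (((blBounded_torus V hT hω hq).mul hw₁).add (blBounded_torus V hT hω hd)).add hEφ.bounded
  have hPb : BLBounded V P :=
    (((blBounded_torus V hT hω hA).mul hw₁).add (blBounded_torus V hT hω hD)).add hEw.bounded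
  obtain ⟨N₁, hN₁, hE1⟩ := bl_averagingError (k := L) hT hω hres hA hA'c hD hD'c hA hD hw₁ hFb hPb hEw hδp
  obtain ⟨N₂, hN₂, hE2⟩ := bl_averagingError (k := Q) hT hω hres hq hq'c hd hd'c hA hD hw₁ hFb hPb hEφ hδp
  set N := max N₁ N₂ with hN
  have hNp : 0 < N := lt_max_of_lt_left hN₁
  have hsw := ((((blBounded_corrector V hT hω hNp hA e).mul hw₁).add
    (blBounded_corrector V hT hω hNp hD e)).eps_mul.neg).add hw
  have hsψ := ((((blBounded_corrector V hT hω hNp hq e).mul hw₁).add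
    (blBounded_corrector V hT hω hNp hd e)).eps_mul.neg)
  filter_upwards [hE1 N (le_max_left _ _), hE2 N (le_max_right _ _), hsw δ hδp, hsψ δ hδp, he, hG,
    hGT, hGω, hwc, hwT, hwω, hdw, hdφ, self_mem_nhdsWithin] with ε e1 e2 bw bψ eε ⟨K, M, hflow, hst⟩
    gT gω wc wT wω dw dφ hε
  have hε : 0 < ε := hε
  obtain ⟨σ, hσ, hσL⟩ : ∃ σ : ℝ, (σ = 1 ∨ σ = -1) ∧ 0 < σ * L := by
    rcases lt_or_gt_of_ne hL0 with h | h
    · exact ⟨-1, Or.inr rfl, by linarith⟩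
    · exact ⟨1, Or.inl rfl, by linarith⟩
  have hσ' : |σ| = 1 := by rcases hσ with h | h <;> simp [h]
  have hLB : L * B = average T ω D := by rw [hB]; field_simp
  have hcone := isConeSystem_of_close (G := G ε)
    (w := fun t z => w₁ ε t z - ε * (corrector N (e ε) A t z.1 * w₁ ε t z + corrector N (e ε) D t z.1) + B)
    (ψ := fun t z => z.1 - ε * (corrector N (e ε) q t z.1 * w₁ ε t z + corrector N (e ε) d t z.1))
    (E := averagingError T ω N (e ε) ε L A A' D D' A D (w₁ ε) (F ε) (P ε) (Ew ε))
    (E' := averagingError T ω N (e ε) ε Q q q' d d' A D (w₁ ε) (F ε) (P ε) (Eφ ε))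
    (B := B) (c₁ := average T ω d - Q * B)
    hflow hst eε hε hσL hσ' hα₀ hα hαc hgc hg hlin hV₀ hV ?_ ?_ ?_ ?_ ?_ e1 e2 hκp hκ1 hκQ hδ1 hδα
    hδC hδL
  · obtain ⟨U, hU, hUT, hUω, hUV, hUinv⟩ := hcone.exists_invariant_graph (T := T) (ω := ω) hσ gT
      (fun t z => by
        simp only [corrector, wT, lineIntegral_periodic_t hA.periodic_t,
          lineIntegral_periodic_t hD.periodic_t]) gω
      (fun t φ v => by
        simp only [corrector, wω, lineIntegral_periodic_φ hA.periodic_φ,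
          lineIntegral_periodic_φ hD.periodic_φ])
    exact ⟨U, hU, hUT, hUω, hUV, hUinv⟩
  · have c1 : ∀ f : ℝ → ℝ → ℝ, Continuous (uncurry f) →
        Continuous fun p : ℝ × ℝ × ℝ => corrector N (e ε) f p.1 p.2.1 := fun f hf =>
      (continuous_corrector hf).comp (by fun_prop : Continuous fun p : ℝ × ℝ × ℝ => (p.1, p.2.1))
    have wc' : Continuous fun p : ℝ × ℝ × ℝ => w₁ ε p.1 p.2 := wc
    exact (wc'.sub (continuous_const.mul (((c1 A hA.continuous).mul wc').add
      (c1 D hD.continuous)))).add continuous_const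
  · intro z t hz hv
    have h1 := dw z t hz hv
    have hz1 : HasDerivAt (fun s => (z s).1) (e ε * (1 + ε * F ε t (z t))) t := by
      have := (ContinuousLinearMap.fst ℝ ℝ ℝ).hasFDerivAt.comp_hasDerivAt t hz
      rwa [ContinuousLinearMap.coe_fst', dφ t (z t) hv] at this
    have h2 := hasDerivAt_correction (N := N) (e := e ε) (ε := ε) (φ := fun s => (z s).1)
      (w := fun s => w₁ ε s (z s)) hNp eε.ne' hA.continuous hA' hA'c.continuous
      hD.continuous hD' hD'c.continuous hz1 h1
    refine ((h1.sub (h2.const_mul ε)).add_const B).congr_deriv ?_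
    simp only [averagingError, hP, hL]
    linear_combination (e ε * ε) * -hLB
  · intro z t hz hv
    have h1 := dw z t hz hv
    have hz1 : HasDerivAt (fun s => (z s).1) (e ε * (1 + ε * F ε t (z t))) t := by
      have := (ContinuousLinearMap.fst ℝ ℝ ℝ).hasFDerivAt.comp_hasDerivAt t hz
      rwa [ContinuousLinearMap.coe_fst', dφ t (z t) hv] at this
    have h2 := hasDerivAt_correction (N := N) (e := e ε) (ε := ε) (φ := fun s => (z s).1)
      (w := fun s => w₁ ε s (z s)) hNp eε.ne' hq.continuous hq' hq'c.continuous
      hd.continuous hd' hd'c.continuous hz1 h1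
    refine (hz1.sub (h2.const_mul ε)).congr_deriv ?_
    simp only [averagingError, hP, hF, ← hQ]
    ring
  · intro t z₁ z₂ h₁ h₂
    have h3 := bw t z₁ z₂ h₁ h₂
    have h4 : ∀ z : ℝ × ℝ, w₁ ε t z - ε * (corrector N (e ε) A t z.1 * w₁ ε t z + corrector N (e ε) D t z.1)
        + B - (α z.1 * z.2 - g t z.1 + B) =
        -(ε * (corrector N (e ε) A t z.1 * w₁ ε t z + corrector N (e ε) D t z.1)) +
          (w₁ ε t z - (α z.1 * z.2 - g t z.1)) := fun z => by ring
    simp only [h4]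
    exact h3
  · intro t z₁ z₂ h₁ h₂
    have h3 := bψ t z₁ z₂ h₁ h₂
    have h4 : ∀ z : ℝ × ℝ, z.1 - ε * (corrector N (e ε) q t z.1 * w₁ ε t z + corrector N (e ε) d t z.1)
        - z.1 = -(ε * (corrector N (e ε) q t z.1 * w₁ ε t z + corrector N (e ε) d t z.1)) :=
      fun z => by ring
    simp only [h4]
    exact h3

end NormalForm


/-! ### Functions of `(t, p)` that are smooth in `p`, with derivatives continuous in `(t, p)` -/

section PhaseSmooth

/-- Joint continuity on `ℝ × D` together with periodicity in `t` and in the direction `τ`. -/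
structure IsPeriodicCont {E : Type*} [NormedAddCommGroup E] (T : ℝ) (τ : E) (D : Set E) (Q : ℝ → E → ℝ) : Prop where
  continuousOn : ContinuousOn (uncurry Q) (univ ×ˢ D)
  periodic_t : ∀ t, ∀ p ∈ D, Q (t + T) p = Q t p
  periodic_τ : ∀ t, ∀ p ∈ D, Q t (p + τ) = Q t p

variable {E : Type*} [NormedAddCommGroup E]

theorem IsPeriodicCont.congr {T : ℝ} {τ : E} {D : Set E} {P Q : ℝ → E → ℝ}
    (h : IsPeriodicCont T τ D Q) (hD : ∀ p ∈ D, p + τ ∈ D)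
    (hPQ : ∀ t, ∀ p ∈ D, P t p = Q t p) : IsPeriodicCont T τ D P where
  continuousOn := h.continuousOn.congr fun s hs => hPQ s.1 s.2 hs.2
  periodic_t t p hp := by rw [hPQ _ p hp, hPQ _ p hp, h.periodic_t t p hp]
  periodic_τ t p hp := by rw [hPQ _ p hp, hPQ _ _ (hD p hp), h.periodic_τ t p hp]

variable [NormedSpace ℝ E]

/-- `Q(t, p)` has `n` derivatives in `p ∈ D` that are jointly continuous and periodic. -/
def IsPhaseC (T : ℝ) (τ : E) (D : Set E) : ℕ → (ℝ → E → ℝ) → Prop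
  | 0, Q => IsPeriodicCont T τ D Q
  | n + 1, Q => IsPeriodicCont T τ D Q ∧ ∃ Q' : ℝ → E → (E →L[ℝ] ℝ),
      (∀ t, ∀ p ∈ D, HasFDerivWithinAt (Q t) (Q' t p) D p) ∧
        ∀ v, IsPhaseC T τ D n fun t p => Q' t p v

variable {T : ℝ} {τ : E} {D : Set E} {n : ℕ} {P Q : ℝ → E → ℝ}

theorem IsPhaseC.isPeriodicCont (h : IsPhaseC T τ D n Q) : IsPeriodicCont T τ D Q := by
  cases n with
  | zero => exact h
  | succ n => exact h.1

theorem IsPhaseC.of_succ (h : IsPhaseC T τ D (n + 1) Q) : IsPhaseC T τ D n Q := by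
  induction n generalizing Q with
  | zero => exact h.1
  | succ n ih =>
    obtain ⟨h0, Q', hQ', hc⟩ := h
    exact ⟨h0, Q', hQ', fun v => ih (hc v)⟩

theorem IsPhaseC.of_le {m : ℕ} (h : IsPhaseC T τ D n Q) (hm : m ≤ n) : IsPhaseC T τ D m Q := by
  induction n with
  | zero => obtain rfl : m = 0 := by omega
            exact h
  | succ n ih =>
    rcases Nat.lt_or_ge n m with h1 | h1
    · obtain rfl : m = n + 1 := by omega
      exact h
    · exact ih h.of_succ h1

theorem IsPhaseC.congr (h : IsPhaseC T τ D n Q) (hD : ∀ p ∈ D, p + τ ∈ D)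
    (hPQ : ∀ t, ∀ p ∈ D, P t p = Q t p) : IsPhaseC T τ D n P := by
  cases n with
  | zero => exact IsPeriodicCont.congr h hD hPQ
  | succ n =>
    obtain ⟨h0, Q', hQ', hc⟩ := h
    exact ⟨h0.congr hD hPQ, Q',
      fun t p hp => (hQ' t p hp).congr (fun x hx => hPQ t x hx) (hPQ t p hp), hc⟩

theorem isPhaseC_const (n : ℕ) (c : ℝ) : IsPhaseC T τ D n fun _ _ => c := by
  have h0 : ∀ c : ℝ, IsPeriodicCont T τ D fun _ _ => c := fun c =>
    ⟨continuousOn_const, fun _ _ _ => rfl, fun _ _ _ => rfl⟩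
  induction n generalizing c with
  | zero => exact h0 c
  | succ n ih => exact ⟨h0 c, fun _ _ => 0, fun t p _ => hasFDerivWithinAt_const c p D, fun v => ih 0⟩

theorem IsPhaseC.add (hP : IsPhaseC T τ D n P) (hQ : IsPhaseC T τ D n Q) :
    IsPhaseC T τ D n fun t p => P t p + Q t p := by
  have h0 : ∀ {P Q : ℝ → E → ℝ}, IsPeriodicCont T τ D P → IsPeriodicCont T τ D Q →
      IsPeriodicCont T τ D fun t p => P t p + Q t p := fun hP hQ =>
    ⟨hP.continuousOn.add hQ.continuousOn,
      fun t p hp => by rw [hP.periodic_t t p hp, hQ.periodic_t t p hp],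
      fun t p hp => by rw [hP.periodic_τ t p hp, hQ.periodic_τ t p hp]⟩
  induction n generalizing P Q with
  | zero => exact h0 hP hQ
  | succ n ih =>
    obtain ⟨p0, P', hP', pc⟩ := hP
    obtain ⟨q0, Q', hQ', qc⟩ := hQ
    exact ⟨h0 p0 q0, fun t p => P' t p + Q' t p, fun t p hp => (hP' t p hp).add (hQ' t p hp),
      fun v => ih (pc v) (qc v)⟩

theorem IsPhaseC.mul (hP : IsPhaseC T τ D n P) (hQ : IsPhaseC T τ D n Q) :
    IsPhaseC T τ D n fun t p => P t p * Q t p := by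
  have h0 : ∀ {P Q : ℝ → E → ℝ}, IsPeriodicCont T τ D P → IsPeriodicCont T τ D Q →
      IsPeriodicCont T τ D fun t p => P t p * Q t p := fun hP hQ =>
    ⟨hP.continuousOn.mul hQ.continuousOn,
      fun t p hp => by rw [hP.periodic_t t p hp, hQ.periodic_t t p hp],
      fun t p hp => by rw [hP.periodic_τ t p hp, hQ.periodic_τ t p hp]⟩
  induction n generalizing P Q with
  | zero => exact h0 hP hQ
  | succ n ih =>
    have hP1 := hP.of_succ
    have hQ1 := hQ.of_succ
    obtain ⟨p0, P', hP', pc⟩ := hP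
    obtain ⟨q0, Q', hQ', qc⟩ := hQ
    exact ⟨h0 p0 q0, fun t p => P t p • Q' t p + Q t p • P' t p,
      fun t p hp => (hP' t p hp).mul (hQ' t p hp),
      fun v => (ih hP1 (qc v)).add (ih hQ1 (pc v))⟩

theorem IsPhaseC.neg (hP : IsPhaseC T τ D n P) : IsPhaseC T τ D n fun t p => -P t p := by
  have h := (isPhaseC_const (T := T) (τ := τ) (D := D) n (-1)).mul hP
  simpa only [neg_mul, one_mul] using h

theorem IsPhaseC.sub (hP : IsPhaseC T τ D n P) (hQ : IsPhaseC T τ D n Q) :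
    IsPhaseC T τ D n fun t p => P t p - Q t p := by
  simpa only [sub_eq_add_neg] using hP.add hQ.neg

theorem IsPhaseC.pow (hP : IsPhaseC T τ D n P) (k : ℕ) : IsPhaseC T τ D n fun t p => P t p ^ k := by
  induction k with
  | zero => simpa only [pow_zero] using isPhaseC_const n 1
  | succ k ih => simpa only [pow_succ] using ih.mul hP

theorem IsPhaseC.inv (hP : IsPhaseC T τ D n P) (hne : ∀ t, ∀ p ∈ D, P t p ≠ 0) :
    IsPhaseC T τ D n fun t p => (P t p)⁻¹ := by
  have h0 : ∀ {P : ℝ → E → ℝ}, IsPeriodicCont T τ D P → (∀ t, ∀ p ∈ D, P t p ≠ 0) →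
      IsPeriodicCont T τ D fun t p => (P t p)⁻¹ := fun hP hne =>
    ⟨hP.continuousOn.inv₀ fun s hs => hne s.1 s.2 hs.2,
      fun t p hp => by rw [hP.periodic_t t p hp], fun t p hp => by rw [hP.periodic_τ t p hp]⟩
  induction n with
  | zero => exact h0 hP hne
  | succ n ih =>
    have hi := ih hP.of_succ
    obtain ⟨p0, P', hP', pc⟩ := hP
    refine ⟨h0 p0 hne, fun t p => (-(P t p ^ 2)⁻¹) • P' t p, fun t p hp => ?_, fun v => ?_⟩
    · exact (hasDerivAt_inv (hne t p hp)).comp_hasFDerivWithinAt p (hP' t p hp)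
    · have := ((hi.pow 2).neg).mul (pc v)
      simp only [inv_pow] at this
      exact this

/-- Composition with functions of the same class. -/
theorem IsPhaseC.comp {D₂ : Set (ℝ × ℝ × ℝ)} {R : ℝ → ℝ × ℝ × ℝ → ℝ} {a b c : ℝ → E → ℝ}
    (hR : IsPhaseC T 0 D₂ n R) (ha : IsPhaseC T τ D n a) (hb : IsPhaseC T τ D n b)
    (hc : IsPhaseC T τ D n c) (hmaps : ∀ t, ∀ p ∈ D, (a t p, b t p, c t p) ∈ D₂) :
    IsPhaseC T τ D n fun t p => R t (a t p, b t p, c t p) := by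
  have h0 : ∀ {R : ℝ → ℝ × ℝ × ℝ → ℝ}, IsPeriodicCont T 0 D₂ R → IsPeriodicCont T τ D a →
      IsPeriodicCont T τ D b → IsPeriodicCont T τ D c →
      IsPeriodicCont T τ D fun t p => R t (a t p, b t p, c t p) := fun hR ha hb hc =>
    ⟨hR.continuousOn.comp (f := fun s : ℝ × E => (s.1, a s.1 s.2, b s.1 s.2, c s.1 s.2))
      (continuousOn_fst.prodMk (ha.continuousOn.prodMk (hb.continuousOn.prodMk hc.continuousOn)))
      fun s hs => ⟨trivial, hmaps s.1 s.2 hs.2⟩,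
      fun t p hp => by
        rw [ha.periodic_t t p hp, hb.periodic_t t p hp, hc.periodic_t t p hp,
          hR.periodic_t t _ (hmaps t p hp)],
      fun t p hp => by rw [ha.periodic_τ t p hp, hb.periodic_τ t p hp, hc.periodic_τ t p hp]⟩
  induction n generalizing R with
  | zero => exact h0 hR ha hb hc
  | succ n ih =>
    have ha1 := ha.of_succ
    have hb1 := hb.of_succ
    have hc1 := hc.of_succ
    obtain ⟨r0, R', hR', rc⟩ := hR
    obtain ⟨a0, a', ha', ac⟩ := ha
    obtain ⟨b0, b', hb', bc⟩ := hb
    obtain ⟨c0, c', hc', cc⟩ := hc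
    refine ⟨h0 r0 a0 b0 c0, fun t p => (R' t (a t p, b t p, c t p)).comp
      ((a' t p).prod ((b' t p).prod (c' t p))), fun t p hp => ?_, fun v => ?_⟩
    · exact (hR' t _ (hmaps t p hp)).comp p
        ((ha' t p hp).prodMk ((hb' t p hp).prodMk (hc' t p hp))) fun x hx => hmaps t x hx
    · have hsum := (((ac v).mul (ih (rc (1, 0, 0)) ha1 hb1 hc1)).add
        ((bc v).mul (ih (rc (0, 1, 0)) ha1 hb1 hc1))).add
        ((cc v).mul (ih (rc (0, 0, 1)) ha1 hb1 hc1))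
      have e : ∀ t p, ((R' t (a t p, b t p, c t p)).comp ((a' t p).prod ((b' t p).prod (c' t p)))) v =
          a' t p v * R' t (a t p, b t p, c t p) (1, 0, 0) +
            b' t p v * R' t (a t p, b t p, c t p) (0, 1, 0) +
            c' t p v * R' t (a t p, b t p, c t p) (0, 0, 1) := fun t p => by
        have h1 : ((a' t p v, b' t p v, c' t p v) : ℝ × ℝ × ℝ) =
            a' t p v • ((1, 0, 0) : ℝ × ℝ × ℝ) + b' t p v • ((0, 1, 0) : ℝ × ℝ × ℝ) +
              c' t p v • ((0, 0, 1) : ℝ × ℝ × ℝ) := by simp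
        simp only [ContinuousLinearMap.comp_apply, ContinuousLinearMap.prod_apply]
        rw [h1]
        simp only [map_add, map_smul, smul_eq_mul]
      simp only [e]
      exact hsum

/-- A function of the angle only. -/
theorem IsTorusC.isPhaseC {ω : ℝ} {f : ℝ → ℝ → ℝ} (hf : IsTorusC T ω n f) (D : Set (ℝ × ℝ × ℝ)) :
    IsPhaseC T ((ω, 0, 0) : ℝ × ℝ × ℝ) D n fun t p => f t p.1 := by
  have h0 : ∀ {n : ℕ} {f : ℝ → ℝ → ℝ}, IsTorusC T ω n f →
      IsPeriodicCont T ((ω, 0, 0) : ℝ × ℝ × ℝ) D fun t p => f t p.1 := fun hf =>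
    ⟨(hf.continuous.comp (by fun_prop : Continuous fun s : ℝ × ℝ × ℝ × ℝ => (s.1, s.2.1))).continuousOn,
      fun t p _ => hf.periodic_t t p.1, fun t p _ => hf.periodic_φ t p.1⟩
  induction n generalizing f with
  | zero => exact h0 hf
  | succ n ih =>
    obtain ⟨f', hf', hc⟩ := hf.exists_deriv
    refine ⟨h0 hf, fun t p => f' t p.1 • ContinuousLinearMap.fst ℝ ℝ (ℝ × ℝ), fun t p _ => ?_,
      fun v => ?_⟩
    · exact (hf' t p.1).comp_hasFDerivWithinAt p
        (ContinuousLinearMap.fst ℝ ℝ (ℝ × ℝ)).hasFDerivWithinAt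
    · exact (ih hc).mul (isPhaseC_const n v.1)

theorem isPhaseC_clm (n : ℕ) (l : E →L[ℝ] ℝ) (hl : l τ = 0) : IsPhaseC T τ D n fun _ p => l p := by
  have h0 : IsPeriodicCont T τ D fun _ p => l p :=
    ⟨(l.continuous.comp continuous_snd).continuousOn, fun _ _ _ => rfl,
      fun _ p _ => by rw [map_add, hl, add_zero]⟩
  cases n with
  | zero => exact h0
  | succ n => exact ⟨h0, fun _ _ => l, fun t p _ => l.hasFDerivWithinAt, fun v => isPhaseC_const n (l v)⟩

/-- Restriction to the curve `(φ, 0, 0)`. -/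
theorem IsPhaseC.isTorusC {ω : ℝ} {D : Set (ℝ × ℝ × ℝ)} {Q : ℝ → ℝ × ℝ × ℝ → ℝ}
    (hQ : IsPhaseC T ((ω, 0, 0) : ℝ × ℝ × ℝ) D n Q) (hD : ∀ φ : ℝ, (φ, 0, 0) ∈ D) :
    IsTorusC T ω n fun t φ => Q t (φ, 0, 0) := by
  have h0 : ∀ {Q : ℝ → ℝ × ℝ × ℝ → ℝ}, IsPeriodicCont T ((ω, 0, 0) : ℝ × ℝ × ℝ) D Q →
      Continuous (uncurry fun t φ => Q t (φ, 0, 0)) := fun hQ =>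
    hQ.continuousOn.comp_continuous
      (by fun_prop : Continuous fun s : ℝ × ℝ => (s.1, s.2, (0 : ℝ), (0 : ℝ))) fun s => ⟨trivial, hD s.2⟩
  have h1 : IsAngleC n fun t φ => Q t (φ, 0, 0) := by
    induction n generalizing Q with
    | zero => exact h0 hQ
    | succ n ih =>
      obtain ⟨q0, Q', hQ', qc⟩ := hQ
      refine ⟨h0 q0, fun t φ => Q' t (φ, 0, 0) (1, 0, 0), fun t φ => ?_, ih (qc (1, 0, 0))⟩
      have hl : HasDerivAt (fun φ : ℝ => ((φ, 0, 0) : ℝ × ℝ × ℝ)) (1, 0, 0) φ :=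
        (hasDerivAt_id φ).prodMk (hasDerivAt_const φ ((0, 0) : ℝ × ℝ))
      have := (hQ' t (φ, 0, 0) (hD φ)).comp_hasDerivWithinAt φ (hl.hasDerivWithinAt (s := univ))
        fun x _ => hD x
      exact this.hasDerivAt Filter.univ_mem
  refine ⟨h1, fun t φ => hQ.isPeriodicCont.periodic_t t _ (hD φ), fun t φ => ?_⟩
  have := hQ.isPeriodicCont.periodic_τ t _ (hD φ)
  simpa using this

/-- Functions with jointly continuous iterated derivatives. -/
theorem isPhaseC_of_iteratedFDerivWithin {D : Set (ℝ × ℝ × ℝ)} (hD : UniqueDiffOn ℝ D) {n : ℕ}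
    {G : Type} [NormedAddCommGroup G] [NormedSpace ℝ G] {F : ℝ → ℝ × ℝ × ℝ → G}
    (hF : ∀ t, ContDiffOn ℝ n (F t) D)
    (hc : ∀ j ≤ n, ContinuousOn
      (fun s : ℝ × ℝ × ℝ × ℝ => iteratedFDerivWithin ℝ j (F s.1) D s.2) (univ ×ˢ D))
    (hT : ∀ t, ∀ p ∈ D, F (t + T) p = F t p) (l : G →L[ℝ] ℝ) :
    IsPhaseC T 0 D n fun t p => l (F t p) := by
  have h0 : IsPeriodicCont T 0 D fun t p => l (F t p) := by
    refine ⟨l.continuous.comp_continuousOn ?_, fun t p hp => by rw [hT t p hp],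
      fun t p _ => by rw [add_zero]⟩
    have h1 := (continuousMultilinearCurryFin0 ℝ (ℝ × ℝ × ℝ) G).continuous.comp_continuousOn
      (hc 0 (Nat.zero_le n))
    refine h1.congr fun s hs => ?_
    simp [iteratedFDerivWithin_zero_eq_comp]
  induction n generalizing G with
  | zero => exact h0
  | succ n ih =>
    refine ⟨h0, fun t p => l.comp (fderivWithin ℝ (F t) D p), fun t p hp => ?_, fun v => ?_⟩
    · exact l.hasFDerivAt.comp_hasFDerivWithinAt p
        (((hF t).differentiableOn (by simp)) p hp).hasFDerivWithinAt
    · have h2 : ∀ t, ContDiffOn ℝ n (fderivWithin ℝ (F t) D) D := fun t =>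
        (hF t).fderivWithin hD (by norm_cast)
      have h3 : ∀ j ≤ n, ContinuousOn (fun s : ℝ × ℝ × ℝ × ℝ =>
          iteratedFDerivWithin ℝ j (fderivWithin ℝ (F s.1) D) D s.2) (univ ×ˢ D) := fun j hj => by
        have h4 : ContinuousOn (fun s : ℝ × ℝ × ℝ × ℝ =>
            (continuousMultilinearCurryRightEquiv' ℝ j (ℝ × ℝ × ℝ) G).symm
              (iteratedFDerivWithin ℝ j (fderivWithin ℝ (F s.1) D) D s.2)) (univ ×ˢ D) :=
          (hc (j + 1) (by omega)).congr fun s hs =>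
            (iteratedFDerivWithin_succ_eq_comp_right hD hs.2).symm
        exact (LinearIsometryEquiv.comp_continuousOn_iff _).1 h4
      have h5 : ∀ t, ∀ p ∈ D, fderivWithin ℝ (F (t + T)) D p = fderivWithin ℝ (F t) D p :=
        fun t p hp => fderivWithin_congr (fun x hx => hT t x hx) (hT t p hp)
      have h6 : IsPeriodicCont T 0 D fun t p => (l.comp (ContinuousLinearMap.apply ℝ G v))
          (fderivWithin ℝ (F t) D p) := by
        refine ⟨ContinuousLinearMap.continuous _ |>.comp_continuousOn ?_,
          fun t p hp => by rw [h5 t p hp], fun t p _ => by rw [add_zero]⟩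
        have h1 := (continuousMultilinearCurryFin0 ℝ (ℝ × ℝ × ℝ) _).continuous.comp_continuousOn
          (h3 0 (Nat.zero_le n))
        refine h1.congr fun s hs => ?_
        simp [iteratedFDerivWithin_zero_eq_comp]
      exact ih (F := fun t => fderivWithin ℝ (F t) D) h2 h3 h5
        (l.comp (ContinuousLinearMap.apply ℝ G v)) h6

theorem uniqueDiffOn_perturbationDomain (Mx My ε₀ : ℝ) :
    UniqueDiffOn ℝ (perturbationDomain Mx My ε₀) := by
  have : perturbationDomain Mx My ε₀ = Ioo (-Mx) Mx ×ˢ Ioo (-My) My ×ˢ Ico 0 ε₀ := by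
    ext p
    simp only [perturbationDomain, mem_ofPred_eq, mem_prod, mem_Ioo, mem_Ico, abs_lt]
  rw [this]
  exact (uniqueDiffOn_Ioo _ _).prod ((uniqueDiffOn_Ioo _ _).prod (uniqueDiffOn_Ico _ _))

theorem IsC3InPhase.isPhaseC {Mx My ε₀ T : ℝ} {F : ℝ → ℝ → ℝ → ℝ → ℝ} (hF : IsC3InPhase Mx My ε₀ F)
    (hT : ∀ t x y ε, (x, y, ε) ∈ perturbationDomain Mx My ε₀ → F (t + T) x y ε = F t x y ε) :
    IsPhaseC T 0 (perturbationDomain Mx My ε₀) 3 fun t p => F t p.1 p.2.1 p.2.2 :=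
  isPhaseC_of_iteratedFDerivWithin (uniqueDiffOn_perturbationDomain Mx My ε₀) (n := 3) hF.1 hF.2
    (fun t p hp => hT t p.1 p.2.1 p.2.2 hp) (ContinuousLinearMap.id ℝ ℝ)

end PhaseSmooth


/-! ### Taylor expansion near the curve `(φ, 0, 0)` -/

section Tube

open Filter Topology

/-- The closed neighbourhood `|r| ≤ r₀`, `0 ≤ ε ≤ ε₁` of the curve `(φ, 0, 0)`. -/
def tube (r₀ ε₁ : ℝ) : Set (ℝ × ℝ × ℝ) := {p | |p.2.1| ≤ r₀ ∧ 0 ≤ p.2.2 ∧ p.2.2 ≤ ε₁}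

theorem tube_eq (r₀ ε₁ : ℝ) : tube r₀ ε₁ = univ ×ˢ Icc (-r₀) r₀ ×ˢ Icc 0 ε₁ := by
  ext p
  simp only [tube, mem_ofPred_eq, mem_prod, mem_univ, true_and, mem_Icc, abs_le]

theorem convex_tube (r₀ ε₁ : ℝ) : Convex ℝ (tube r₀ ε₁) := by
  rw [tube_eq]
  exact convex_univ.prod ((convex_Icc _ _).prod (convex_Icc _ _))

variable {T ω r₀ ε₁ V : ℝ} {Q : ℝ → ℝ × ℝ × ℝ → ℝ}

theorem tube_add {p : ℝ × ℝ × ℝ} (hp : p ∈ tube r₀ ε₁) : p + (ω, 0, 0) ∈ tube r₀ ε₁ := by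
  simpa [tube] using hp

theorem IsPeriodicCont.shift (hQ : IsPeriodicCont T ((ω, 0, 0) : ℝ × ℝ × ℝ) (tube r₀ ε₁) Q)
    (m n : ℤ) (t : ℝ) {p : ℝ × ℝ × ℝ} (hp : p ∈ tube r₀ ε₁) :
    Q (t - m • T) (p.1 - n • ω, p.2) = Q t p := by
  have p1 : Periodic (fun t => Q t (p.1 - n • ω, p.2)) T := fun t =>
    hQ.periodic_t t _ (by simpa [tube] using hp)
  have p2 : Periodic (fun x => Q t (x, p.2)) ω := fun x => by
    have := hQ.periodic_τ t (x, p.2) (by simpa [tube] using hp)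
    rwa [show ((x, p.2) + (ω, 0, 0) : ℝ × ℝ × ℝ) = (x + ω, p.2) by
      ext <;> simp] at this
  have e1 := p1.sub_zsmul_eq m (x := t)
  have e2 := p2.sub_zsmul_eq n (x := p.1)
  exact e1.trans e2

theorem IsPeriodicCont.exists_bound (hT : 0 < T) (hω : 0 < ω)
    (hQ : IsPeriodicCont T ((ω, 0, 0) : ℝ × ℝ × ℝ) (tube r₀ ε₁) Q) :
    ∃ B, 0 ≤ B ∧ ∀ t, ∀ p ∈ tube r₀ ε₁, |Q t p| ≤ B := by
  have hK : IsCompact (Icc 0 T ×ˢ (Icc 0 ω ×ˢ Icc (-r₀) r₀ ×ˢ Icc 0 ε₁)) :=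
    isCompact_Icc.prod (isCompact_Icc.prod (isCompact_Icc.prod isCompact_Icc))
  obtain ⟨B, hB⟩ := hK.exists_bound_of_continuousOn (hQ.continuousOn.mono (by
    rw [tube_eq]
    exact prod_mono (subset_univ _) (prod_mono (subset_univ _) subset_rfl)))
  refine ⟨|B|, abs_nonneg B, fun t p hp => ?_⟩
  rw [← hQ.shift (toIcoDiv hT 0 t) (toIcoDiv hω 0 p.1) t hp]
  have h1 := toIcoMod_mem_Ico hT 0 t
  have h2 := toIcoMod_mem_Ico hω 0 p.1
  rw [zero_add] at h1 h2
  rw [tube_eq] at hp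
  exact (hB (_, _, p.2) ⟨Ico_subset_Icc_self h1, Ico_subset_Icc_self h2, hp.2⟩).trans (le_abs_self B)

theorem IsPeriodicCont.exists_modulus (hT : 0 < T) (hω : 0 < ω)
    (hQ : IsPeriodicCont T ((ω, 0, 0) : ℝ × ℝ × ℝ) (tube r₀ ε₁) Q) {η : ℝ} (hη : 0 < η) :
    ∃ d > 0, ∀ t, ∀ p ∈ tube r₀ ε₁, ∀ p' ∈ tube r₀ ε₁, dist p p' < d → |Q t p - Q t p'| ≤ η := by
  have hK : IsCompact (Icc 0 T ×ˢ (Icc (-1) (ω + 1) ×ˢ Icc (-r₀) r₀ ×ˢ Icc 0 ε₁)) :=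
    isCompact_Icc.prod (isCompact_Icc.prod (isCompact_Icc.prod isCompact_Icc))
  have hu := hK.uniformContinuousOn_of_continuous (hQ.continuousOn.mono (by
    rw [tube_eq]
    exact prod_mono (subset_univ _) (prod_mono (subset_univ _) subset_rfl)))
  obtain ⟨d, hd, h⟩ := Metric.uniformContinuousOn_iff.1 hu η hη
  refine ⟨min d 1, by positivity, fun t p hp p' hp' hpp => ?_⟩
  rw [← hQ.shift (toIcoDiv hT 0 t) (toIcoDiv hω 0 p.1) t hp,
    ← hQ.shift (toIcoDiv hT 0 t) (toIcoDiv hω 0 p.1) t hp']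
  have h1 : t - toIcoDiv hT 0 t • T ∈ Ico 0 (0 + T) := toIcoMod_mem_Ico hT 0 t
  have h2 : p.1 - toIcoDiv hω 0 p.1 • ω ∈ Ico 0 (0 + ω) := toIcoMod_mem_Ico hω 0 p.1
  rw [zero_add] at h1 h2
  have h3 : |p.1 - p'.1| < 1 := by
    have : dist p.1 p'.1 ≤ dist p p' := by rw [Prod.dist_eq]; exact le_max_left _ _
    rw [Real.dist_eq] at this
    exact lt_of_le_of_lt this (lt_of_lt_of_le hpp (min_le_right _ _))
  rw [abs_lt] at h3
  rw [tube_eq] at hp hp'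
  refine (h (_, p.1 - toIcoDiv hω 0 p.1 • ω, p.2) ⟨Ico_subset_Icc_self h1, ⟨?_, ?_⟩, hp.2⟩
    (_, p'.1 - toIcoDiv hω 0 p.1 • ω, p'.2) ⟨Ico_subset_Icc_self h1, ⟨?_, ?_⟩, hp'.2⟩ ?_).le
  · linarith [h2.1]
  · linarith [h2.2]
  · linarith [h2.1]
  · linarith [h2.2]
  · refine lt_of_le_of_lt ?_ (lt_of_lt_of_le hpp (min_le_left _ _))
    rw [Prod.dist_eq, dist_self, Prod.dist_eq, Prod.dist_eq]
    simp only [dist_sub_right]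
    exact max_le (by positivity) le_rfl

theorem clm_norm_le (l : ℝ × ℝ × ℝ →L[ℝ] ℝ) :
    ‖l‖ ≤ |l (1, 0, 0)| + |l (0, 1, 0)| + |l (0, 0, 1)| := by
  refine l.opNorm_le_bound (by positivity) fun x => ?_
  have h1 : x = x.1 • ((1, 0, 0) : ℝ × ℝ × ℝ) + x.2.1 • ((0, 1, 0) : ℝ × ℝ × ℝ) +
      x.2.2 • ((0, 0, 1) : ℝ × ℝ × ℝ) := by ext <;> simp
  have n1 : |x.1| ≤ ‖x‖ := norm_fst_le x
  have n2 : |x.2.1| ≤ ‖x‖ := (norm_fst_le x.2).trans (norm_snd_le x)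
  have n3 : |x.2.2| ≤ ‖x‖ := (norm_snd_le x.2).trans (norm_snd_le x)
  conv_lhs => rw [h1]
  simp only [map_add, map_smul, smul_eq_mul]
  rw [Real.norm_eq_abs]
  refine (abs_add_three _ _ _).trans ?_
  rw [abs_mul, abs_mul, abs_mul]
  have := mul_le_mul_of_nonneg_right n1 (abs_nonneg (l (1, 0, 0)))
  have := mul_le_mul_of_nonneg_right n2 (abs_nonneg (l (0, 1, 0)))
  have := mul_le_mul_of_nonneg_right n3 (abs_nonneg (l (0, 0, 1)))
  linarith

variable {Q' : ℝ → ℝ × ℝ × ℝ → (ℝ × ℝ × ℝ →L[ℝ] ℝ)}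

theorem exists_bound_fderiv (hT : 0 < T) (hω : 0 < ω)
    (hc : ∀ v, IsPhaseC T ((ω, 0, 0) : ℝ × ℝ × ℝ) (tube r₀ ε₁) 0 fun t p => Q' t p v) :
    ∃ B, 0 ≤ B ∧ ∀ t, ∀ p ∈ tube r₀ ε₁, ‖Q' t p‖ ≤ B := by
  obtain ⟨B₁, h1, b1⟩ := IsPeriodicCont.exists_bound hT hω (hc (1, 0, 0))
  obtain ⟨B₂, h2, b2⟩ := IsPeriodicCont.exists_bound hT hω (hc (0, 1, 0))
  obtain ⟨B₃, h3, b3⟩ := IsPeriodicCont.exists_bound hT hω (hc (0, 0, 1))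
  refine ⟨B₁ + B₂ + B₃, by positivity, fun t p hp => (clm_norm_le _).trans ?_⟩
  linarith [b1 t p hp, b2 t p hp, b3 t p hp]

theorem exists_modulus_fderiv (hT : 0 < T) (hω : 0 < ω)
    (hc : ∀ v, IsPhaseC T ((ω, 0, 0) : ℝ × ℝ × ℝ) (tube r₀ ε₁) 0 fun t p => Q' t p v) {η : ℝ}
    (hη : 0 < η) : ∃ d > 0, ∀ t, ∀ p ∈ tube r₀ ε₁, ∀ p' ∈ tube r₀ ε₁, dist p p' < d →
      ‖Q' t p - Q' t p'‖ ≤ η := by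
  obtain ⟨d₁, h1, b1⟩ := IsPeriodicCont.exists_modulus hT hω (hc (1, 0, 0)) (η := η / 3) (by positivity)
  obtain ⟨d₂, h2, b2⟩ := IsPeriodicCont.exists_modulus hT hω (hc (0, 1, 0)) (η := η / 3) (by positivity)
  obtain ⟨d₃, h3, b3⟩ := IsPeriodicCont.exists_modulus hT hω (hc (0, 0, 1)) (η := η / 3) (by positivity)
  refine ⟨min d₁ (min d₂ d₃), by positivity, fun t p hp p' hp' hd => (clm_norm_le _).trans ?_⟩
  simp only [lt_min_iff] at hd
  have e1 := b1 t p hp p' hp' hd.1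
  have e2 := b2 t p hp p' hp' hd.2.1
  have e3 := b3 t p hp p' hp' hd.2.2
  simp only [sub_apply]
  linarith

theorem lipschitz_of_fderiv (hQ' : ∀ t, ∀ p ∈ tube r₀ ε₁, HasFDerivWithinAt (Q t) (Q' t p) (tube r₀ ε₁) p)
    {B : ℝ} (hB : ∀ t, ∀ p ∈ tube r₀ ε₁, ‖Q' t p‖ ≤ B) (t : ℝ) {p p' : ℝ × ℝ × ℝ}
    (hp : p ∈ tube r₀ ε₁) (hp' : p' ∈ tube r₀ ε₁) : |Q t p - Q t p'| ≤ B * ‖p - p'‖ :=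
  (convex_tube r₀ ε₁).norm_image_sub_le_of_norm_hasFDerivWithin_le (hQ' t) (hB t) hp' hp

/-- Strict differentiability, uniform on the tube. -/
theorem exists_strict_modulus (hT : 0 < T) (hω : 0 < ω)
    (hQ' : ∀ t, ∀ p ∈ tube r₀ ε₁, HasFDerivWithinAt (Q t) (Q' t p) (tube r₀ ε₁) p)
    (hc : ∀ v, IsPhaseC T ((ω, 0, 0) : ℝ × ℝ × ℝ) (tube r₀ ε₁) 0 fun t p => Q' t p v) {η : ℝ}
    (hη : 0 < η) : ∃ d > 0, ∀ t, ∀ p₀ ∈ tube r₀ ε₁, ∀ p₁ ∈ tube r₀ ε₁, ∀ p₂ ∈ tube r₀ ε₁,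
      dist p₁ p₀ < d → dist p₂ p₀ < d → |Q t p₁ - Q t p₂ - Q' t p₀ (p₁ - p₂)| ≤ η * ‖p₁ - p₂‖ := by
  obtain ⟨d, hd, h⟩ := exists_modulus_fderiv hT hω hc hη
  refine ⟨d, hd, fun t p₀ h₀ p₁ h₁ p₂ h₂ hd₁ hd₂ => ?_⟩
  exact ((convex_tube r₀ ε₁).inter (convex_ball p₀ d)).norm_image_sub_le_of_norm_hasFDerivWithin_le'
    (fun p hp => (hQ' t p hp.1).mono inter_subset_left)
    (fun p hp => h t p hp.1 p₀ h₀ hp.2) ⟨h₂, hd₂⟩ ⟨h₁, hd₁⟩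

theorem eventually_mem_tube (V : ℝ) (hr₀ : 0 < r₀) (hε₁ : 0 < ε₁) :
    ∀ᶠ ε in 𝓝[>] (0 : ℝ), ∀ s ∈ Icc (0 : ℝ) 1, ∀ φ v : ℝ, |v| ≤ V → (φ, s * (ε * v), s * ε) ∈ tube r₀ ε₁ := by
  have h1 : ∀ᶠ ε in 𝓝[>] (0 : ℝ), ε < min (r₀ / (|V| + 1)) ε₁ :=
    nhdsWithin_le_nhds (Iio_mem_nhds (by positivity))
  filter_upwards [h1, self_mem_nhdsWithin] with ε h2 (hε : 0 < ε) s hs φ v hv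
  rw [lt_min_iff, lt_div_iff₀ (by positivity)] at h2
  refine ⟨?_, by have := hs.1; positivity, ?_⟩
  · simp only
    rw [abs_mul, abs_mul, abs_of_nonneg hs.1, abs_of_pos hε]
    have : ε * |v| ≤ r₀ := by
      have : ε * |v| ≤ ε * (|V| + 1) := by gcongr; linarith [le_abs_self V]
      linarith
    have := mul_le_mul hs.2 this (by positivity) one_pos.le
    linarith
  · simp only
    have := mul_le_mul_of_nonneg_right hs.2 hε.le
    linarith [h2.2]

/-- Difference of values on the tube and on the curve. -/
theorem bl_shift (hT : 0 < T) (hω : 0 < ω) (hr₀ : 0 < r₀) (hε₁ : 0 < ε₁) (V : ℝ)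
    (hQ : IsPhaseC T ((ω, 0, 0) : ℝ × ℝ × ℝ) (tube r₀ ε₁) 1 Q) {η : ℝ} (hη : 0 < η) :
    ∀ᶠ ε in 𝓝[>] (0 : ℝ), ∀ s ∈ Icc (0 : ℝ) 1,
      BL V η fun t z => Q t (z.1, s * (ε * z.2), s * ε) - Q t (z.1, 0, 0) := by
  obtain ⟨q0, Q', hQ', hc⟩ := hQ
  obtain ⟨B, hB0, hB⟩ := exists_bound_fderiv hT hω hc
  obtain ⟨d₁, hd₁, m1⟩ := q0.exists_modulus hT hω hη
  obtain ⟨d₂, hd₂, m2⟩ := IsPeriodicCont.exists_modulus hT hω (hc (1, 0, 0)) hη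
  have h1 : ∀ᶠ ε in 𝓝[>] (0 : ℝ), ε < min (min d₁ d₂ / (|V| + 1)) (η / (B + 1)) :=
    nhdsWithin_le_nhds (Iio_mem_nhds (by positivity))
  filter_upwards [h1, self_mem_nhdsWithin, eventually_mem_tube V hr₀ hε₁] with ε h2 (hε : 0 < ε) ht s hs
  rw [lt_min_iff, lt_div_iff₀ (by positivity), lt_div_iff₀ (by positivity), lt_min_iff] at h2
  have hmem0 : ∀ φ : ℝ, (φ, 0, 0) ∈ tube r₀ ε₁ := fun φ => by
    simp [tube, hr₀.le, hε₁.le]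
  have hdist : ∀ φ v : ℝ, |v| ≤ V →
      dist ((φ, s * (ε * v), s * ε) : ℝ × ℝ × ℝ) (φ, 0, 0) ≤ ε * (|V| + 1) := fun φ v hv => by
    rw [Prod.dist_eq, Prod.dist_eq]
    simp only [dist_self, Real.dist_eq, sub_zero]
    have e1 : |s * (ε * v)| ≤ ε * (|V| + 1) := by
      rw [abs_mul, abs_mul, abs_of_nonneg hs.1, abs_of_pos hε]
      have := mul_le_mul hs.2 (mul_le_mul_of_nonneg_left hv hε.le) (by positivity) one_pos.le
      have := mul_le_mul_of_nonneg_left (le_abs_self V) hε.le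
      linarith
    have e2 : |s * ε| ≤ ε * (|V| + 1) := by
      rw [abs_mul, abs_of_nonneg hs.1, abs_of_pos hε]
      have := mul_le_mul_of_nonneg_right hs.2 hε.le
      have := mul_nonneg hε.le (abs_nonneg V)
      linarith
    exact max_le (by positivity) (max_le e1 e2)
  intro t z₁ z₂ hz₁ hz₂
  refine ⟨m1 t _ (ht s hs _ _ hz₁) _ (hmem0 _) (lt_of_le_of_lt (hdist _ _ hz₁) h2.1.1), ?_⟩
  have hline : ∀ (φ a b : ℝ), HasDerivAt (fun φ : ℝ => ((φ, a, b) : ℝ × ℝ × ℝ)) (1, 0, 0) φ :=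
    fun φ a b => (hasDerivAt_id φ).prodMk (hasDerivAt_const φ ((a, b) : ℝ × ℝ))
  have hdφ : ∀ φ : ℝ, HasDerivAt (fun φ => Q t (φ, s * (ε * z₁.2), s * ε) - Q t (φ, 0, 0))
      (Q' t (φ, s * (ε * z₁.2), s * ε) (1, 0, 0) - Q' t (φ, 0, 0) (1, 0, 0)) φ := fun φ => by
    have a1 := ((hQ' t _ (ht s hs φ _ hz₁)).comp_hasDerivWithinAt φ
      ((hline φ _ _).hasDerivWithinAt (s := univ)) fun x _ => ht s hs x _ hz₁).hasDerivAt univ_mem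
    have a2 := ((hQ' t _ (hmem0 φ)).comp_hasDerivWithinAt φ
      ((hline φ 0 0).hasDerivWithinAt (s := univ)) fun x _ => hmem0 x).hasDerivAt univ_mem
    exact a1.sub a2
  have e1 := Convex.norm_image_sub_le_of_norm_hasDerivWithin_le (s := univ)
    (fun x _ => (hdφ x).hasDerivWithinAt) (fun x _ => m2 t _ (ht s hs x _ hz₁) _ (hmem0 x)
      (lt_of_le_of_lt (hdist x _ hz₁) h2.1.2)) convex_univ (mem_univ z₂.1) (mem_univ z₁.1)
  have e2 := lipschitz_of_fderiv hQ' hB t (ht s hs z₂.1 _ hz₁) (ht s hs z₂.1 _ hz₂)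
  have e3 : ‖((z₂.1, s * (ε * z₁.2), s * ε) - (z₂.1, s * (ε * z₂.2), s * ε) : ℝ × ℝ × ℝ)‖ ≤
      ε * |z₁.2 - z₂.2| := by
    simp only [Prod.mk_sub_mk, sub_self]
    rw [Prod.norm_def, Prod.norm_def]
    simp only [norm_zero, ← mul_sub, norm_mul, Real.norm_eq_abs, abs_of_nonneg hs.1, abs_of_pos hε]
    have : s * (ε * |z₁.2 - z₂.2|) ≤ 1 * (ε * |z₁.2 - z₂.2|) := by gcongr; exact hs.2
    exact max_le (by positivity) (max_le (by linarith) (by positivity))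
  have e4 : |Q t (z₂.1, s * (ε * z₁.2), s * ε) - Q t (z₂.1, s * (ε * z₂.2), s * ε)| ≤
      η * |z₁.2 - z₂.2| := by
    refine e2.trans ((mul_le_mul_of_nonneg_left e3 hB0).trans ?_)
    rw [← mul_assoc]
    gcongr
    nlinarith [h2.2]
  rw [Real.norm_eq_abs, Real.norm_eq_abs] at e1
  have e5 : Q t (z₁.1, s * (ε * z₁.2), s * ε) - Q t (z₁.1, 0, 0) -
      (Q t (z₂.1, s * (ε * z₂.2), s * ε) - Q t (z₂.1, 0, 0)) =
      (Q t (z₁.1, s * (ε * z₁.2), s * ε) - Q t (z₁.1, 0, 0) -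
        (Q t (z₂.1, s * (ε * z₁.2), s * ε) - Q t (z₂.1, 0, 0))) +
      (Q t (z₂.1, s * (ε * z₁.2), s * ε) - Q t (z₂.1, s * (ε * z₂.2), s * ε)) := by ring
  simp only
  rw [e5, mul_add]
  exact (abs_add_le _ _).trans (add_le_add e1 e4)

theorem BL.of_hasDerivWithinAt {η : ℝ} {g H : ℝ → ℝ → ℝ × ℝ → ℝ}
    (hg : ∀ t z, |z.2| ≤ V → ∀ s ∈ Icc (0 : ℝ) 1,
      HasDerivWithinAt (fun s => g s t z) (H s t z) (Icc 0 1) s)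
    (hH : ∀ s ∈ Icc (0 : ℝ) 1, BL V η (H s)) : BL V η fun t z => g 1 t z - g 0 t z := by
  intro t z₁ z₂ h₁ h₂
  have m0 : (0 : ℝ) ∈ Icc (0 : ℝ) 1 := ⟨le_rfl, one_pos.le⟩
  have m1 : (1 : ℝ) ∈ Icc (0 : ℝ) 1 := ⟨one_pos.le, le_rfl⟩
  have e1 := Convex.norm_image_sub_le_of_norm_hasDerivWithin_le (hg t z₁ h₁)
    (fun s hs => (hH s hs t z₁ z₂ h₁ h₂).1) (convex_Icc 0 1) m0 m1
  have e2 := Convex.norm_image_sub_le_of_norm_hasDerivWithin_le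
    (fun s hs => (hg t z₁ h₁ s hs).sub (hg t z₂ h₂ s hs))
    (fun s hs => (hH s hs t z₁ z₂ h₁ h₂).2) (convex_Icc 0 1) m0 m1
  simp only [sub_zero, norm_one, mul_one, Real.norm_eq_abs, Pi.sub_apply] at e1 e2
  refine ⟨e1, ?_⟩
  simp only
  rwa [show g 1 t z₁ - g 0 t z₁ - (g 1 t z₂ - g 0 t z₂) =
    g 1 t z₁ - g 1 t z₂ - (g 0 t z₁ - g 0 t z₂) by ring]

theorem bl_snd (hV : 0 ≤ V) : BL V (V + 1) fun _ z => z.2 := fun t z₁ z₂ h₁ _ => by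
  refine ⟨by linarith, ?_⟩
  simp only
  nlinarith [abs_nonneg (z₁.1 - z₂.1), abs_nonneg (z₁.2 - z₂.2)]

/-- First order Taylor expansion in `ε` of `Q(t, φ, ε v, ε)`. -/
theorem blSmall_taylor (hT : 0 < T) (hω : 0 < ω) (hr₀ : 0 < r₀) (hε₁ : 0 < ε₁) (hV : 0 ≤ V)
    (hQ' : ∀ t, ∀ p ∈ tube r₀ ε₁, HasFDerivWithinAt (Q t) (Q' t p) (tube r₀ ε₁) p)
    (hc : ∀ v, IsPhaseC T ((ω, 0, 0) : ℝ × ℝ × ℝ) (tube r₀ ε₁) 1 fun t p => Q' t p v) :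
    BLSmall V fun ε t z => (Q t (z.1, ε * z.2, ε) - Q t (z.1, 0, 0)) / ε -
      (Q' t (z.1, 0, 0) (0, 1, 0) * z.2 + Q' t (z.1, 0, 0) (0, 0, 1)) := by
  intro η hη
  have hη' : 0 < η / (2 * (2 * (V + 1))) := by positivity
  filter_upwards [bl_shift hT hω hr₀ hε₁ V (hc (0, 1, 0)) hη',
    bl_shift hT hω hr₀ hε₁ V (hc (0, 0, 1)) (η := η / 2) (by positivity), self_mem_nhdsWithin,
    eventually_mem_tube V hr₀ hε₁] with ε b1 b2 (hε : 0 < ε) ht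
  have key := BL.of_hasDerivWithinAt (V := V) (η := η)
    (g := fun s t z => Q t (z.1, s * (ε * z.2), s * ε) / ε -
      s * (Q' t (z.1, 0, 0) (0, 1, 0) * z.2 + Q' t (z.1, 0, 0) (0, 0, 1)))
    (H := fun s t z => (Q' t (z.1, s * (ε * z.2), s * ε) (0, 1, 0) - Q' t (z.1, 0, 0) (0, 1, 0)) * z.2 +
      (Q' t (z.1, s * (ε * z.2), s * ε) (0, 0, 1) - Q' t (z.1, 0, 0) (0, 0, 1))) ?_ ?_
  · intro t z₁ z₂ h₁ h₂
    have h3 := key t z₁ z₂ h₁ h₂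
    simp only [one_mul, zero_mul, sub_zero] at h3
    have e : ∀ z : ℝ × ℝ, (Q t (z.1, ε * z.2, ε) - Q t (z.1, 0, 0)) / ε -
        (Q' t (z.1, 0, 0) (0, 1, 0) * z.2 + Q' t (z.1, 0, 0) (0, 0, 1)) =
        Q t (z.1, ε * z.2, ε) / ε - (Q' t (z.1, 0, 0) (0, 1, 0) * z.2 + Q' t (z.1, 0, 0) (0, 0, 1)) -
          Q t (z.1, 0, 0) / ε := fun z => by ring
    simp only [e]
    exact h3
  · intro t z hz s hs
    have hl : HasDerivAt (fun s : ℝ => ((z.1, s * (ε * z.2), s * ε) : ℝ × ℝ × ℝ)) (0, ε * z.2, ε) s := by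
      refine (hasDerivAt_const s z.1).prodMk (HasDerivAt.prodMk ?_ ?_)
      · simpa using (hasDerivAt_id s).mul_const (ε * z.2)
      · simpa using (hasDerivAt_id s).mul_const ε
    have h1 := (hQ' t _ (ht s hs z.1 z.2 hz)).comp_hasDerivWithinAt s
      (hl.hasDerivWithinAt (s := Icc 0 1)) fun x hx => ht x hx z.1 z.2 hz
    have h2 : HasDerivWithinAt (fun s : ℝ => s *
        (Q' t (z.1, 0, 0) (0, 1, 0) * z.2 + Q' t (z.1, 0, 0) (0, 0, 1)))
        (Q' t (z.1, 0, 0) (0, 1, 0) * z.2 + Q' t (z.1, 0, 0) (0, 0, 1)) (Icc 0 1) s := by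
      simpa using ((hasDerivAt_id s).mul_const _).hasDerivWithinAt
    refine ((h1.div_const ε).sub h2).congr_deriv ?_
    have h3 : ((0, ε * z.2, ε) : ℝ × ℝ × ℝ) = (ε * z.2) • ((0, 1, 0) : ℝ × ℝ × ℝ) +
        ε • ((0, 0, 1) : ℝ × ℝ × ℝ) := by ext <;> simp
    rw [h3, map_add, map_smul, map_smul, smul_eq_mul, smul_eq_mul]
    field_simp
    ring
  · intro s hs
    refine (((b1 s hs).mul (bl_snd hV)).add (b2 s hs)).mono (le_of_eq ?_)
    field_simp
    ring

end Tube


/-! ### Invariant graphs for smooth perturbations of an annulus of periodic orbits -/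

section SmoothPerturbation

open Filter Topology
open scoped NNReal

variable {T ω : ℝ} {n : ℕ} {f₁ f₂ : ℝ → ℝ → ℝ}

theorem IsTorusC.add (h₁ : IsTorusC T ω n f₁) (h₂ : IsTorusC T ω n f₂) :
    IsTorusC T ω n fun t φ => f₁ t φ + f₂ t φ :=
  ((h₁.isPhaseC univ).add (h₂.isPhaseC univ)).isTorusC fun _ => trivial

theorem IsTorusC.sub (h₁ : IsTorusC T ω n f₁) (h₂ : IsTorusC T ω n f₂) :
    IsTorusC T ω n fun t φ => f₁ t φ - f₂ t φ :=
  ((h₁.isPhaseC univ).sub (h₂.isPhaseC univ)).isTorusC fun _ => trivial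

theorem IsTorusC.mul (h₁ : IsTorusC T ω n f₁) (h₂ : IsTorusC T ω n f₂) :
    IsTorusC T ω n fun t φ => f₁ t φ * f₂ t φ :=
  ((h₁.isPhaseC univ).mul (h₂.isPhaseC univ)).isTorusC fun _ => trivial

theorem IsTorusC.inv (h₁ : IsTorusC T ω n f₁) (hne : ∀ t φ, f₁ t φ ≠ 0) :
    IsTorusC T ω n fun t φ => (f₁ t φ)⁻¹ :=
  ((h₁.isPhaseC univ).inv fun t p _ => hne t p.1).isTorusC fun _ => trivial

theorem BL.exists_of_bounded {V : ℝ} {E : ℝ → ℝ × ℝ → ℝ} (h : BLBounded V fun _ => E) :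
    ∃ a, BL V a E := by
  obtain ⟨a, ha⟩ := h
  exact ⟨a, ha.exists.choose_spec⟩

/-- Truncation to `[-V, V]`. -/
noncomputable def clamp (V v : ℝ) : ℝ := max (-V) (min v V)

theorem clamp_of_abs_le {V v : ℝ} (h : |v| ≤ V) : clamp V v = v := by
  rw [abs_le] at h
  rw [clamp, min_eq_left h.2, max_eq_right h.1]

theorem abs_clamp_le {V : ℝ} (hV : 0 ≤ V) (v : ℝ) : |clamp V v| ≤ V := by
  rw [abs_le]
  exact ⟨le_max_left _ _, max_le (by linarith) (min_le_right _ _)⟩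

theorem abs_clamp_sub_le (V a b : ℝ) : |clamp V a - clamp V b| ≤ |a - b| := by
  unfold clamp
  rw [max_comm (-V), max_comm (-V)]
  refine (abs_max_sub_max_le_abs _ _ _).trans ?_
  have := abs_min_sub_min_le_max a V b V
  simpa using this

theorem continuous_clamp (V : ℝ) : Continuous (clamp V) := by unfold clamp; fun_prop

/-- The field in the coordinates `(φ, v)`, `r = ε v`, truncated for large `v`. -/
noncomputable def scaledField (V ε e : ℝ) (f ρ : ℝ → ℝ × ℝ × ℝ → ℝ) (t : ℝ) (z : ℝ × ℝ) : ℝ × ℝ :=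
  (e * f t (z.1, ε * clamp V z.2, ε), e * ε⁻¹ * ρ t (z.1, ε * clamp V z.2, ε))

theorem scaledField_regular {r₀ ε₁ V ε e : ℝ} (hT : 0 < T) (hω : 0 < ω) (hV : 0 < V) (hε : 0 < ε)
    (hε1 : ε ≤ 1) (he : 0 < e) (hmem : ∀ φ v : ℝ, |v| ≤ V → (φ, ε * v, ε) ∈ tube r₀ ε₁)
    {f ρ : ℝ → ℝ × ℝ × ℝ → ℝ} (hf : IsPhaseC T ((ω, 0, 0) : ℝ × ℝ × ℝ) (tube r₀ ε₁) 1 f)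
    (hρ : IsPhaseC T ((ω, 0, 0) : ℝ × ℝ × ℝ) (tube r₀ ε₁) 1 ρ) :
    ∃ (K : ℝ≥0) (M : ℝ), IsFlowField (scaledField V ε e f ρ) K M ∧
      ∃ G' : ℝ → ℝ × ℝ → (ℝ × ℝ →L[ℝ] ℝ × ℝ), (∀ t z, |z.2| < V → ‖G' t z‖ ≤ K) ∧
        ∀ η > 0, ∃ d > 0, ∀ t z₀ z₁ z₂, |z₀.2| < V → |z₁.2| < V → |z₂.2| < V →
          dist z₁ z₀ < d → dist z₂ z₀ < d →
            ‖scaledField V ε e f ρ t z₁ - scaledField V ε e f ρ t z₂ - G' t z₀ (z₁ - z₂)‖ ≤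
              η * ‖z₁ - z₂‖ := by
  obtain ⟨f0, f', hf', fc⟩ := hf
  obtain ⟨ρ0, ρ', hρ', ρc⟩ := hρ
  obtain ⟨Bf, hBf0, hBf⟩ := exists_bound_fderiv hT hω fc
  obtain ⟨Bρ, hBρ0, hBρ⟩ := exists_bound_fderiv hT hω ρc
  obtain ⟨Mf, hMf0, hMf⟩ := f0.exists_bound hT hω
  obtain ⟨Mρ, hMρ0, hMρ⟩ := ρ0.exists_bound hT hω
  have hm : ∀ z : ℝ × ℝ, (z.1, ε * clamp V z.2, ε) ∈ tube r₀ ε₁ := fun z =>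
    hmem _ _ (abs_clamp_le hV.le _)
  have hcp : Continuous fun s : ℝ × ℝ × ℝ => (s.1, s.2.1, ε * clamp V s.2.2, ε) := by
    have := (continuous_clamp V).comp (by fun_prop : Continuous fun s : ℝ × ℝ × ℝ => s.2.2)
    exact continuous_fst.prodMk ((by fun_prop : Continuous fun s : ℝ × ℝ × ℝ => s.2.1).prodMk
      ((continuous_const.mul this).prodMk continuous_const))
  set e' := e * ε⁻¹ with he'
  have he'0 : 0 < e' := by positivity
  set J : ℝ × ℝ →L[ℝ] ℝ × ℝ × ℝ := (ContinuousLinearMap.fst ℝ ℝ ℝ).prod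
    ((ε • ContinuousLinearMap.snd ℝ ℝ ℝ).prod 0) with hJ
  have hJapp : ∀ x : ℝ × ℝ, J x = (x.1, ε * x.2, 0) := fun x => rfl
  have hvec : ∀ x : ℝ × ℝ, ∀ a : ℝ, |a| ≤ |x.2| → ‖((x.1, ε * a, 0) : ℝ × ℝ × ℝ)‖ ≤ ‖x‖ := fun x a ha => by
    rw [Prod.norm_def, Prod.norm_def]
    have n1 : |x.1| ≤ ‖x‖ := norm_fst_le x
    have n2 : |x.2| ≤ ‖x‖ := norm_snd_le x
    simp only [norm_mul, Real.norm_eq_abs, abs_of_pos hε, abs_zero]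
    refine max_le n1 (max_le ?_ (norm_nonneg _))
    have := mul_le_mul hε1 ha (abs_nonneg _) one_pos.le
    linarith
  have hJn : ∀ x, ‖J x‖ ≤ ‖x‖ := fun x => by rw [hJapp]; exact hvec x x.2 le_rfl
  have hpd : ∀ z₁ z₂ : ℝ × ℝ, ‖((z₁.1, ε * clamp V z₁.2, ε) - (z₂.1, ε * clamp V z₂.2, ε) : ℝ × ℝ × ℝ)‖ ≤
      ‖z₁ - z₂‖ := fun z₁ z₂ => by
    have := hvec (z₁ - z₂) (clamp V z₁.2 - clamp V z₂.2) (abs_clamp_sub_le _ _ _)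
    simpa only [Prod.mk_sub_mk, sub_self, mul_sub, Prod.fst_sub] using this
  have hK : 0 ≤ e * Bf + e' * Bρ := by positivity
  refine ⟨⟨e * Bf + e' * Bρ, hK⟩, e * Mf + e' * Mρ, ⟨?_, fun t => ?_, fun t z => ?_⟩, ?_⟩
  · have c1 : Continuous fun s : ℝ × ℝ × ℝ => uncurry f (s.1, s.2.1, ε * clamp V s.2.2, ε) :=
      f0.continuousOn.comp_continuous hcp fun s => ⟨trivial, hm s.2⟩
    have c2 : Continuous fun s : ℝ × ℝ × ℝ => uncurry ρ (s.1, s.2.1, ε * clamp V s.2.2, ε) :=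
      ρ0.continuousOn.comp_continuous hcp fun s => ⟨trivial, hm s.2⟩
    exact (continuous_const.mul c1).prodMk (continuous_const.mul c2)
  · refine LipschitzWith.of_dist_le_mul fun z₁ z₂ => ?_
    rw [dist_eq_norm, dist_eq_norm, Prod.norm_def]
    have e1 := lipschitz_of_fderiv hf' hBf t (hm z₁) (hm z₂)
    have e2 := lipschitz_of_fderiv hρ' hBρ t (hm z₁) (hm z₂)
    have e3 := hpd z₁ z₂
    have e1' := e1.trans (mul_le_mul_of_nonneg_left e3 hBf0)
    have e2' := e2.trans (mul_le_mul_of_nonneg_left e3 hBρ0)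
    have hn := norm_nonneg (z₁ - z₂)
    change max ‖e * _ - e * _‖ ‖e' * _ - e' * _‖ ≤ (e * Bf + e' * Bρ) * ‖z₁ - z₂‖
    rw [← mul_sub, ← mul_sub, norm_mul, norm_mul, Real.norm_of_nonneg he.le,
      Real.norm_of_nonneg he'0.le, Real.norm_eq_abs, Real.norm_eq_abs]
    have e1'' := mul_le_mul_of_nonneg_left e1' he.le
    have e2'' := mul_le_mul_of_nonneg_left e2' he'0.le
    have := mul_nonneg (mul_nonneg he.le hBf0) hn
    have := mul_nonneg (mul_nonneg he'0.le hBρ0) hn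
    exact max_le (by linarith) (by linarith)
  · rw [Prod.norm_def]
    change max ‖e * _‖ ‖e' * _‖ ≤ _
    rw [norm_mul, norm_mul, Real.norm_of_nonneg he.le, Real.norm_of_nonneg he'0.le]
    have e1 := mul_le_mul_of_nonneg_left (hMf t _ (hm z)) he.le
    have e2 := mul_le_mul_of_nonneg_left (hMρ t _ (hm z)) he'0.le
    have := mul_nonneg he.le hMf0
    have := mul_nonneg he'0.le hMρ0
    exact max_le (e1.trans (by linarith)) (e2.trans (by linarith))
  · refine ⟨fun t z => (e • (f' t (z.1, ε * z.2, ε)).comp J).prod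
      (e' • (ρ' t (z.1, ε * z.2, ε)).comp J), fun t z hz => ?_, fun η hη => ?_⟩
    · refine ContinuousLinearMap.opNorm_le_bound _ hK fun x => ?_
      have b1 := (f' t (z.1, ε * z.2, ε)).le_of_opNorm_le (hBf t _ (hmem _ _ hz.le)) (J x)
      have b2 := (ρ' t (z.1, ε * z.2, ε)).le_of_opNorm_le (hBρ t _ (hmem _ _ hz.le)) (J x)
      have b1' := mul_le_mul_of_nonneg_left (b1.trans (mul_le_mul_of_nonneg_left (hJn x) hBf0)) he.le
      have b2' := mul_le_mul_of_nonneg_left (b2.trans (mul_le_mul_of_nonneg_left (hJn x) hBρ0)) he'0.le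
      rw [Prod.norm_def]
      change max ‖e * _‖ ‖e' * _‖ ≤ (e * Bf + e' * Bρ) * ‖x‖
      rw [norm_mul, norm_mul, Real.norm_of_nonneg he.le, Real.norm_of_nonneg he'0.le]
      have hn := norm_nonneg x
      have := mul_nonneg (mul_nonneg he.le hBf0) hn
      have := mul_nonneg (mul_nonneg he'0.le hBρ0) hn
      exact max_le (b1'.trans (by linarith)) (b2'.trans (by linarith))
    · obtain ⟨d₁, hd₁, s1⟩ := exists_strict_modulus hT hω hf' fc (η := η / e) (by positivity)
      obtain ⟨d₂, hd₂, s2⟩ := exists_strict_modulus hT hω hρ' ρc (η := η / e') (by positivity)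
      refine ⟨min d₁ d₂, by positivity, fun t z₀ z₁ z₂ h₀ h₁ h₂ hd1 hd2 => ?_⟩
      simp only [lt_min_iff] at hd1 hd2
      have hpz : ∀ z z' : ℝ × ℝ, |z.2| < V → |z'.2| < V →
          ‖((z.1, ε * z.2, ε) - (z'.1, ε * z'.2, ε) : ℝ × ℝ × ℝ)‖ ≤ ‖z - z'‖ := fun z z' h h' => by
        have := hpd z z'
        rwa [clamp_of_abs_le h.le, clamp_of_abs_le h'.le] at this
      have hdist : ∀ z z' : ℝ × ℝ, |z.2| < V → |z'.2| < V →
          dist ((z.1, ε * z.2, ε) : ℝ × ℝ × ℝ) (z'.1, ε * z'.2, ε) ≤ dist z z' := fun z z' h h' => by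
        rw [dist_eq_norm, dist_eq_norm]; exact hpz z z' h h'
      have hJd : ((z₁.1, ε * z₁.2, ε) - (z₂.1, ε * z₂.2, ε) : ℝ × ℝ × ℝ) = J (z₁ - z₂) := by
        rw [hJapp]; ext <;> simp [mul_sub]
      have e1 := s1 t _ (hmem z₀.1 _ h₀.le) _ (hmem z₁.1 _ h₁.le) _ (hmem z₂.1 _ h₂.le)
        ((hdist _ _ h₁ h₀).trans_lt hd1.1) ((hdist _ _ h₂ h₀).trans_lt hd2.1)
      have e2 := s2 t _ (hmem z₀.1 _ h₀.le) _ (hmem z₁.1 _ h₁.le) _ (hmem z₂.1 _ h₂.le)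
        ((hdist _ _ h₁ h₀).trans_lt hd1.2) ((hdist _ _ h₂ h₀).trans_lt hd2.2)
      have e1' := e1.trans (mul_le_mul_of_nonneg_left (hpz z₁ z₂ h₁ h₂) (by positivity))
      have e2' := e2.trans (mul_le_mul_of_nonneg_left (hpz z₁ z₂ h₁ h₂) (by positivity))
      rw [hJd] at e1' e2'
      have e1'' := mul_le_mul_of_nonneg_left e1' he.le
      have e2'' := mul_le_mul_of_nonneg_left e2' he'0.le
      rw [← mul_assoc, mul_div_cancel₀ _ he.ne'] at e1''
      rw [← mul_assoc, mul_div_cancel₀ _ he'0.ne'] at e2''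
      have hs : ∀ z : ℝ × ℝ, |z.2| < V → scaledField V ε e f ρ t z =
          (e * f t (z.1, ε * z.2, ε), e' * ρ t (z.1, ε * z.2, ε)) := fun z hz => by
        simp only [scaledField, clamp_of_abs_le hz.le, he']
      rw [hs z₁ h₁, hs z₂ h₂, Prod.norm_def]
      change max ‖e * f t _ - e * f t _ - e * f' t _ (J (z₁ - z₂))‖
        ‖e' * ρ t _ - e' * ρ t _ - e' * ρ' t _ (J (z₁ - z₂))‖ ≤ _
      rw [← mul_sub, ← mul_sub, ← mul_sub, ← mul_sub, norm_mul, norm_mul, Real.norm_of_nonneg he.le,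
        Real.norm_of_nonneg he'0.le]
      exact max_le e1'' e2''

end SmoothPerturbation


section SmoothInvariantGraph

open Filter Topology

variable {T ω : ℝ}

theorem hasDerivAt_fst_of {z : ℝ → ℝ × ℝ} {z' : ℝ × ℝ} {t : ℝ} (h : HasDerivAt z z' t) :
    HasDerivAt (fun s => (z s).1) z'.1 t :=
  (ContinuousLinearMap.fst ℝ ℝ ℝ).hasFDerivAt.comp_hasDerivAt t h

theorem hasDerivAt_snd_of {z : ℝ → ℝ × ℝ} {z' : ℝ × ℝ} {t : ℝ} (h : HasDerivAt z z' t) :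
    HasDerivAt (fun s => (z s).2) z'.2 t :=
  (ContinuousLinearMap.snd ℝ ℝ ℝ).hasFDerivAt.comp_hasDerivAt t h

/-- A system `φ' = e f(t, φ, r, ε)`, `r' = e ρ(t, φ, r, ε)` with a function `h` whose derivative along
solutions is `e ε Rt`, and with a dissipativity constant that does not vanish, has an invariant graph
`r = ε U(t, φ)` for all small `ε > 0`. -/
theorem exists_invariant_graph_of_smooth {r₀ ε₁ : ℝ} (hT : 0 < T) (hω : 0 < ω) (hr₀ : 0 < r₀)
    (hε₁ : 0 < ε₁) {e : ℝ → ℝ} (he : ∀ᶠ ε in 𝓝[>] (0 : ℝ), 0 < e ε) (hres : NonResonant T ω e)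
    {f ρ Rt : ℝ → ℝ × ℝ × ℝ → ℝ} {h : ℝ × ℝ × ℝ → ℝ}
    {f' Rt' : ℝ → ℝ × ℝ × ℝ → (ℝ × ℝ × ℝ →L[ℝ] ℝ)} {h' : ℝ × ℝ × ℝ → (ℝ × ℝ × ℝ →L[ℝ] ℝ)}
    (hf : IsPhaseC T ((ω, 0, 0) : ℝ × ℝ × ℝ) (tube r₀ ε₁) 1 f)
    (hρ : IsPhaseC T ((ω, 0, 0) : ℝ × ℝ × ℝ) (tube r₀ ε₁) 1 ρ)
    (hh : IsPhaseC T ((ω, 0, 0) : ℝ × ℝ × ℝ) (tube r₀ ε₁) 1 fun _ => h)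
    (hf' : ∀ t, ∀ p ∈ tube r₀ ε₁, HasFDerivWithinAt (f t) (f' t p) (tube r₀ ε₁) p)
    (fc : ∀ v, IsPhaseC T ((ω, 0, 0) : ℝ × ℝ × ℝ) (tube r₀ ε₁) 2 fun t p => f' t p v)
    (hRt' : ∀ t, ∀ p ∈ tube r₀ ε₁, HasFDerivWithinAt (Rt t) (Rt' t p) (tube r₀ ε₁) p)
    (Rc : ∀ v, IsPhaseC T ((ω, 0, 0) : ℝ × ℝ × ℝ) (tube r₀ ε₁) 2 fun t p => Rt' t p v)
    (hh' : ∀ p ∈ tube r₀ ε₁, HasFDerivWithinAt h (h' p) (tube r₀ ε₁) p)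
    (hc : ∀ v, IsPhaseC T ((ω, 0, 0) : ℝ × ℝ × ℝ) (tube r₀ ε₁) 2 fun _ p => h' p v)
    (hf0 : ∀ t φ, f t (φ, 0, 0) = 1) {α : ℝ → ℝ} (hα0 : ∀ φ, α φ ≠ 0)
    (hh0 : ∀ φ, h (φ, 0, 0) = 0) (hhr : ∀ φ, h' (φ, 0, 0) (0, 1, 0) = α φ)
    (hhε : ∀ φ, h' (φ, 0, 0) (0, 0, 1) = 0)
    (hrel : ∀ t, ∀ p ∈ tube r₀ ε₁, h' p (f t p, ρ t p, 0) = p.2.2 * Rt t p)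
    {g g' K K' : ℝ → ℝ → ℝ} (hg : IsTorusC T ω 2 g) (hg' : ∀ t φ, HasDerivAt (g t) (g' t φ) φ)
    (gc : IsTorusC T ω 2 g') (hK : IsTorusC T ω 1 K) (hK' : ∀ t φ, HasDerivAt (K t) (K' t φ) φ)
    (Kc : IsTorusC T ω 2 K')
    (hgK : ∀ᶠ ε in 𝓝[>] (0 : ℝ), ∀ t φ,
      HasDerivAt (fun τ => g τ (φ + e ε * (τ - t)) + ε * K τ (φ + e ε * (τ - t)))
        (e ε * (Rt t (φ, 0, 0) + ε * K' t φ)) t)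
    (hL : average T ω (fun t φ =>
      (α φ)⁻¹ * (Rt' t (φ, 0, 0) (0, 1, 0) - f' t (φ, 0, 0) (0, 1, 0) * g' t φ)) ≠ 0) :
    ∃ V₀ > 0, ∀ᶠ ε in 𝓝[>] (0 : ℝ), ∃ U : ℝ → ℝ → ℝ, ContDiff ℝ 1 (uncurry U) ∧
      (∀ t φ, U (t + T) φ = U t φ) ∧ (∀ t φ, U t (φ + ω) = U t φ) ∧ (∀ t φ, |U t φ| ≤ V₀) ∧
      ∀ t₀ φ₀, ∃ u v : ℝ → ℝ, u t₀ = φ₀ ∧ (∀ t, v t = U t (u t)) ∧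
        (∀ t, HasDerivAt u (e ε * f t (u t, ε * v t, ε)) t) ∧
        ∀ t, HasDerivAt v (e ε * ε⁻¹ * ρ t (u t, ε * v t, ε)) t := by
  have hmem0 : ∀ φ : ℝ, (φ, 0, 0) ∈ tube r₀ ε₁ := fun φ => by simp [tube, hr₀.le, hε₁.le]
  have hαT : IsTorusC T ω 2 fun _ φ => α φ := by
    have := (hc (0, 1, 0)).isTorusC hmem0
    simpa only [hhr] using this
  have hαi := hαT.inv fun _ φ => hα0 φ
  set fr : ℝ → ℝ → ℝ := fun t φ => f' t (φ, 0, 0) (0, 1, 0) with hfr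
  set fe : ℝ → ℝ → ℝ := fun t φ => f' t (φ, 0, 0) (0, 0, 1) with hfe
  set Rr : ℝ → ℝ → ℝ := fun t φ => Rt' t (φ, 0, 0) (0, 1, 0) with hRr
  set Re : ℝ → ℝ → ℝ := fun t φ => Rt' t (φ, 0, 0) (0, 0, 1) with hRe
  have hfrT : IsTorusC T ω 2 fr := (fc (0, 1, 0)).isTorusC hmem0
  have hfeT : IsTorusC T ω 2 fe := (fc (0, 0, 1)).isTorusC hmem0
  have hRrT : IsTorusC T ω 2 Rr := (Rc (0, 1, 0)).isTorusC hmem0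
  have hReT : IsTorusC T ω 2 Re := (Rc (0, 0, 1)).isTorusC hmem0
  set A : ℝ → ℝ → ℝ := fun t φ => (α φ)⁻¹ * (Rr t φ - fr t φ * g' t φ) with hA
  set q : ℝ → ℝ → ℝ := fun t φ => (α φ)⁻¹ * fr t φ with hq
  set D : ℝ → ℝ → ℝ := fun t φ => A t φ * g t φ + Re t φ - g' t φ * fe t φ - K' t φ with hD
  set d : ℝ → ℝ → ℝ := fun t φ => q t φ * g t φ + fe t φ with hd
  have hAT : IsTorusC T ω 2 A := hαi.mul (hRrT.sub (hfrT.mul gc))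
  have hqT : IsTorusC T ω 2 q := hαi.mul hfrT
  have hDT : IsTorusC T ω 2 D := (((hAT.mul hg).add hReT).sub (gc.mul hfeT)).sub Kc
  have hdT : IsTorusC T ω 2 d := (hqT.mul hg).add hfeT
  obtain ⟨B, hB0, hB⟩ := hαi.exists_bound hT hω
  obtain ⟨g₁, hg₁0, hg₁⟩ := hg.exists_bound hT hω
  set α₀ := 1 / (B + 1) with hα₀
  have hα₀p : 0 < α₀ := by positivity
  have hα : ∀ φ, α₀ ≤ |α φ| := fun φ => by
    have h1 := hB 0 φ
    rw [abs_inv] at h1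
    have h2 : 0 < |α φ| := abs_pos.2 (hα0 φ)
    rw [hα₀, div_le_iff₀ (by positivity)]
    rw [inv_le_iff_one_le_mul₀ h2] at h1
    nlinarith
  set L := average T ω A with hLdef
  set V₀ := (2 + |average T ω D / L| + g₁) / α₀ with hV₀
  have hV₀p : 0 < V₀ := by positivity
  set V := V₀ + 1 with hV
  have hVp : 0 < V := by positivity
  have hαB := blBounded_torus V hT hω hαT
  have hgB := blBounded_torus V hT hω hg
  have hKB := blBounded_torus (n := 0) V hT hω hK
  have hzB : BLBounded V fun _ _ z => z.2 := ⟨_, Eventually.of_forall fun _ => bl_snd hVp.le⟩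
  obtain ⟨a₁, ha₁⟩ := BL.exists_of_bounded (V := V) (E := fun t z => α z.1 * z.2 - g t z.1) (by
    have := (hαB.mul hzB).add ((BLBounded.const V (-1)).mul hgB)
    simpa only [neg_mul, one_mul, ← sub_eq_add_neg] using this)
  have t1 := blSmall_taylor hT hω hr₀ hε₁ hVp.le hRt' fun v => (Rc v).of_succ
  have t2 := blSmall_taylor hT hω hr₀ hε₁ hVp.le hf' fun v => (fc v).of_succ
  have t3 := blSmall_taylor (Q := fun _ => h) (Q' := fun _ => h') hT hω hr₀ hε₁ hVp.le
    (fun _ => hh') fun v => (hc v).of_succ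
  set w₁ : ℝ → ℝ → ℝ × ℝ → ℝ := fun ε t z =>
    h (z.1, ε * clamp V z.2, ε) / ε - (g t z.1 + ε * K t z.1) with hw₁
  have t4 : BLSmall V fun ε t z => w₁ ε t z - (α z.1 * z.2 - g t z.1) := by
    refine (t3.add hKB.eps_mul.neg).congr (Eventually.of_forall fun ε t z hz => ?_)
    simp only [hw₁, clamp_of_abs_le hz, hh0, hhr, hhε]
    ring
  set E₁ : ℝ → ℝ → ℝ × ℝ → ℝ := fun ε t z => (Rt t (z.1, ε * z.2, ε) - Rt t (z.1, 0, 0)) / ε -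
      (Rr t z.1 * z.2 + Re t z.1) with hE₁
  set E₂ : ℝ → ℝ → ℝ × ℝ → ℝ := fun ε t z => (f t (z.1, ε * z.2, ε) - f t (z.1, 0, 0)) / ε -
      (fr t z.1 * z.2 + fe t z.1) with hE₂
  set E₃ : ℝ → ℝ → ℝ × ℝ → ℝ := fun ε t z => w₁ ε t z - (α z.1 * z.2 - g t z.1) with hE₃
  have hAα : ∀ t φ, A t φ * α φ = Rr t φ - fr t φ * g' t φ := fun t φ => by
    simp only [hA]; have := hα0 φ; field_simp
  have hqα : ∀ t φ, q t φ * α φ = fr t φ := fun t φ => by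
    simp only [hq]; have := hα0 φ; field_simp
  set Ew : ℝ → ℝ → ℝ × ℝ → ℝ := fun ε t z => E₁ ε t z + -(E₂ ε t z * g' t z.1) +
      -(ε * (K' t z.1 * (fr t z.1 * z.2 + fe t z.1 + E₂ ε t z))) + -(E₃ ε t z * A t z.1) with hEw
  set Eφ : ℝ → ℝ → ℝ × ℝ → ℝ := fun ε t z => E₂ ε t z + -(E₃ ε t z * q t z.1) with hEφ
  have sEw : BLSmall V Ew := by
    have b1 := ((blBounded_torus V hT hω hfrT).mul hzB).add (blBounded_torus V hT hω hfeT)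
    exact ((BLSmall.add t1 (BLSmall.mul_bounded t2 (blBounded_torus V hT hω gc)).neg).add
      ((blBounded_torus V hT hω Kc).mul (b1.add (BLSmall.bounded t2))).eps_mul.neg).add
      (t4.mul_bounded (blBounded_torus V hT hω hAT)).neg
  have sEφ : BLSmall V Eφ := BLSmall.add t2 (t4.mul_bounded (blBounded_torus V hT hω hqT)).neg
  have hone : ∀ᶠ ε in 𝓝[>] (0 : ℝ), ε < 1 := nhdsWithin_le_nhds (Iio_mem_nhds one_pos)
  have hmem : ∀ᶠ ε in 𝓝[>] (0 : ℝ), ∀ φ v : ℝ, |v| ≤ V → (φ, ε * v, ε) ∈ tube r₀ ε₁ := by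
    filter_upwards [eventually_mem_tube V hr₀ hε₁] with ε hm φ v hv
    simpa using hm 1 ⟨one_pos.le, le_rfl⟩ φ v hv
  refine ⟨V₀, hV₀p, ?_⟩
  have main := exists_invariant_graph_of_normalForm (V := V) (V₀ := V₀) (α := α) (g := g) (α₀ := α₀)
    (G := fun ε => scaledField V ε (e ε) f ρ) (w₁ := w₁) (Ew := Ew) (Eφ := Eφ)
    hT hω he hres hAT hDT hqT hdT hLdef.symm hL hα₀p hα ?_ hg.continuous hg₁ ha₁ le_rfl
    (lt_add_one V₀) ?_ ?_ ?_ ?_ ?_ ?_ ?_ ?_ t4 sEw sEφ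
  · filter_upwards [main] with ε ⟨U, hU, hUT, hUω, hUV, hUinv⟩
    refine ⟨U, hU, hUT, hUω, hUV, fun t₀ φ₀ => ?_⟩
    obtain ⟨z, hz, hz0, hzU⟩ := hUinv t₀ φ₀
    have hzV : ∀ t, clamp V (z t).2 = (z t).2 := fun t => clamp_of_abs_le (by
      rw [hzU t]; exact (hUV _ _).trans (by linarith))
    refine ⟨fun t => (z t).1, fun t => (z t).2, by simp only [hz0], hzU, fun t => ?_, fun t => ?_⟩
    · have := hasDerivAt_fst_of (hz t)
      simpa only [scaledField, hzV] using this
    · have := hasDerivAt_snd_of (hz t)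
      simpa only [scaledField, hzV] using this
  · exact hαT.continuous.comp (by fun_prop : Continuous fun φ : ℝ => ((0 : ℝ), φ))
  · filter_upwards [he, hone, hmem, self_mem_nhdsWithin] with ε h1 h2 h3 (h4 : 0 < ε)
    exact scaledField_regular hT hω hVp h4 h2.le h1 h3 hf hρ
  · filter_upwards [hmem] with ε h3 t z
    have hm := h3 z.1 _ (abs_clamp_le hVp.le z.2)
    simp only [scaledField, hf.isPeriodicCont.periodic_t t _ hm, hρ.isPeriodicCont.periodic_t t _ hm]
  · filter_upwards [hmem] with ε h3 t φ v
    have hm := h3 φ _ (abs_clamp_le hVp.le v)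
    have e1 := hf.isPeriodicCont.periodic_τ t _ hm
    have e2 := hρ.isPeriodicCont.periodic_τ t _ hm
    simp only [Prod.mk_add_mk, add_zero] at e1 e2
    simp only [scaledField, e1, e2]
  · filter_upwards [hmem] with ε h3
    have hcp : Continuous fun s : ℝ × ℝ × ℝ => ((0 : ℝ), s.2.1, ε * clamp V s.2.2, ε) := by
      have := (continuous_clamp V).comp (by fun_prop : Continuous fun s : ℝ × ℝ × ℝ => s.2.2)
      exact continuous_const.prodMk ((by fun_prop : Continuous fun s : ℝ × ℝ × ℝ => s.2.1).prodMk
        ((continuous_const.mul this).prodMk continuous_const))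
    have c1 : Continuous fun s : ℝ × ℝ × ℝ => h (s.2.1, ε * clamp V s.2.2, ε) :=
      hh.isPeriodicCont.continuousOn.comp_continuous hcp
        fun s => ⟨trivial, h3 _ _ (abs_clamp_le hVp.le _)⟩
    have hs : Continuous fun s : ℝ × ℝ × ℝ => (s.1, s.2.1) := by fun_prop
    exact (c1.div_const ε).sub ((hg.continuous.comp hs).add
      (continuous_const.mul (hK.continuous.comp hs)))
  · exact Eventually.of_forall fun ε t z => by simp only [hw₁, hg.periodic_t, hK.periodic_t]
  · filter_upwards [hmem] with ε h3 t φ v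
    have e1 := hh.isPeriodicCont.periodic_τ t _ (h3 φ _ (abs_clamp_le hVp.le v))
    simp only [Prod.mk_add_mk, add_zero] at e1
    simp only [hw₁, e1, hg.periodic_φ, hK.periodic_φ]
  · filter_upwards [hmem, hgK, self_mem_nhdsWithin] with ε h3 h5 (hε : 0 < ε) z t hz hv
    set p : ℝ × ℝ × ℝ := ((z t).1, ε * (z t).2, ε) with hp
    have hcl : clamp V (z t).2 = (z t).2 := clamp_of_abs_le hv.le
    have hpm : p ∈ tube r₀ ε₁ := h3 _ _ hv.le
    have hz1 : HasDerivAt (fun s => (z s).1) (e ε * f t p) t := by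
      have := hasDerivAt_fst_of hz
      simpa only [scaledField, hcl] using this
    have hz2 : HasDerivAt (fun s => clamp V (z s).2) (e ε * ε⁻¹ * ρ t p) t := by
      have h6 := hasDerivAt_snd_of hz
      have h7 : HasDerivAt (fun s => (z s).2) (e ε * ε⁻¹ * ρ t p) t := by
        simpa only [scaledField, hcl] using h6
      refine h7.congr_of_eventuallyEq ?_
      have := h7.continuousAt.abs.tendsto.eventually (Iio_mem_nhds hv)
      filter_upwards [this] with s hs using clamp_of_abs_le (le_of_lt hs)
    have hcurve : HasDerivAt (fun s => (((z s).1, ε * clamp V (z s).2, ε) : ℝ × ℝ × ℝ))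
        (e ε • ((f t p, ρ t p, 0) : ℝ × ℝ × ℝ)) t := by
      have h8 := hz1.prodMk ((hz2.const_mul ε).prodMk (hasDerivAt_const t ε))
      refine h8.congr_deriv ?_
      ext
      · simp
      · simp; field_simp
      · simp
    have hpt : (((z t).1, ε * clamp V (z t).2, ε) : ℝ × ℝ × ℝ) = p := by rw [hcl]
    have dh := ((show HasFDerivWithinAt h (h' p) (tube r₀ ε₁) ((z t).1, ε * clamp V (z t).2, ε) by
      rw [hpt]; exact hh' p hpm).comp_hasDerivWithinAt t (hcurve.hasDerivWithinAt (s := univ))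
      fun x _ => h3 _ _ (abs_clamp_le hVp.le _)).hasDerivAt univ_mem
    rw [map_smul, hrel t p hpm, smul_eq_mul] at dh
    have dg := hasDerivAt_along_curve (m := fun t φ => g t φ + ε * K t φ)
      (m' := fun t φ => g' t φ + ε * K' t φ) (e := e ε)
      (d := fun t φ => e ε * (Rt t (φ, 0, 0) + ε * K' t φ))
      (fun t φ => (hg' t φ).add ((hK' t φ).const_mul ε))
      (gc.continuous.add (continuous_const.mul Kc.continuous)) (h5 t (z t).1) hz1
    refine ((dh.div_const ε).sub dg).congr_deriv ?_
    have x1 : Rt t p = Rt t ((z t).1, 0, 0) +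
        ε * (E₁ ε t (z t) + (Rr t (z t).1 * (z t).2 + Re t (z t).1)) := by
      simp only [hE₁, ← hp]; field_simp; ring
    have x2 : f t p = 1 + ε * (E₂ ε t (z t) + (fr t (z t).1 * (z t).2 + fe t (z t).1)) := by
      simp only [hE₂, ← hp, hf0]; field_simp; ring
    have x3 : p.2.2 = ε := rfl
    have x4 : w₁ ε t (z t) = E₃ ε t (z t) + (α (z t).1 * (z t).2 - g t (z t).1) := by
      simp only [hE₃]; ring
    rw [x1, x2, x3, x4]
    have hAα' := hAα t (z t).1
    simp only [hEw, hD]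
    field_simp
    linear_combination (-(e ε * ε * (z t).2)) * hAα'
  · filter_upwards [self_mem_nhdsWithin] with ε (hε : 0 < ε) t z hz
    have hcl : clamp V z.2 = z.2 := clamp_of_abs_le hz.le
    have x2 : f t (z.1, ε * z.2, ε) = 1 + ε * (E₂ ε t z + (fr t z.1 * z.2 + fe t z.1)) := by
      simp only [hE₂, hf0]; field_simp; ring
    have x4 : w₁ ε t z = E₃ ε t z + (α z.1 * z.2 - g t z.1) := by
      simp only [hE₃]; ring
    simp only [scaledField, hcl]
    rw [x2, x4]
    have hqα' := hqα t z.1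
    simp only [hEφ, hd]
    linear_combination (-(e ε * ε * z.2)) * hqα'

end SmoothInvariantGraph


/-! ### Closed orbits that wind around a point -/

section StarOrbit

open Filter Topology

/-- Local uniqueness implies uniqueness on open intervals. -/
theorem eqOn_of_locally_lipschitz {v : ℝ → ℝ × ℝ → ℝ × ℝ} {Ω : Set (ℝ × ℝ)}
    (hv : ∀ t₀, ∀ p₀ ∈ Ω, ∃ K : NNReal, ∃ N ∈ 𝓝 p₀, ∀ᶠ t in 𝓝 t₀, LipschitzOnWith K (v t) N)
    {J : Set ℝ} (hJ : IsOpen J) (hJc : IsPreconnected J) {f g : ℝ → ℝ × ℝ}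
    (hf : ∀ t ∈ J, f t ∈ Ω ∧ HasDerivAt f (v t (f t)) t)
    (hg : ∀ t ∈ J, HasDerivAt g (v t (g t)) t) {t₀ : ℝ} (ht₀ : t₀ ∈ J) (h : f t₀ = g t₀) :
    ∀ t ∈ J, f t = g t := by
  have hfc : ContinuousOn f J := fun t ht => (hf t ht).2.continuousAt.continuousWithinAt
  have hgc : ContinuousOn g J := fun t ht => (hg t ht).continuousAt.continuousWithinAt
  have hu : IsOpen {t | t ∈ J ∧ f t = g t} := by
    rw [isOpen_iff_mem_nhds]
    rintro t ⟨ht, hfg⟩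
    obtain ⟨K, N, hN, hK⟩ := hv t (f t) (hf t ht).1
    have hJt : ∀ᶠ s in 𝓝 t, s ∈ J := hJ.mem_nhds ht
    have h1 : ∀ᶠ s in 𝓝 t, f s ∈ N := (hf t ht).2.continuousAt.eventually hN
    have h2 : ∀ᶠ s in 𝓝 t, g s ∈ N := (hg t ht).continuousAt.eventually (by rw [← hfg]; exact hN)
    have key := ODE_solution_unique_of_eventually (v := v) (s := fun _ => N) (K := K) (t₀ := t) hK
      (by filter_upwards [hJt, h1] with s a b using ⟨(hf s a).2, b⟩)
      (by filter_upwards [hJt, h2] with s a b using ⟨hg s a, b⟩) hfg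
    filter_upwards [hJt, key] with s a b using ⟨a, b⟩
  have hv' : IsOpen {t | t ∈ J ∧ f t ≠ g t} := by
    have := (hfc.sub hgc).isOpen_inter_preimage hJ (isOpen_compl_singleton (x := (0 : ℝ × ℝ)))
    convert this using 1
    ext t
    simp [sub_eq_zero]
  have := hJc.subset_left_of_subset_union hu hv'
    (disjoint_left.2 fun t h1 h2 => h2.2 h1.2) (fun t ht => by
      by_cases h : f t = g t
      · exact Or.inl ⟨ht, h⟩
      · exact Or.inr ⟨ht, h⟩) ⟨t₀, ht₀, ht₀, h⟩
  exact fun t ht => (this ht).2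

/-- An orbit of the unperturbed system in a compact set that is met at most once by the rays from
`(k, l)`, transversally. -/
structure IsStarOrbit (γ k l : ℝ) (K : Set (ℝ × ℝ)) (C S : ℝ → ℝ) : Prop where
  deriv_C : ∀ φ, HasDerivAt C (γ * (S φ ^ 3 - S φ)) φ
  deriv_S : ∀ φ, HasDerivAt S (-(C φ ^ 3 - C φ)) φ
  compact : IsCompact K
  mem : ∀ φ, (C φ, S φ) ∈ K
  transversal : ∀ p ∈ K, γ * (p.2 ^ 3 - p.2) * (p.2 - l) + (p.1 - k) * (p.1 ^ 3 - p.1) ≠ 0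
  ray : ∀ p ∈ K, ∀ p' ∈ K, ∀ c > 0, p.1 - k = c * (p'.1 - k) → p.2 - l = c * (p'.2 - l) → p = p'

namespace IsStarOrbit

variable {γ k l : ℝ} {K : Set (ℝ × ℝ)} {C S : ℝ → ℝ}

/-- A lift of the polar angle, normalized to be increasing. -/
theorem exists_angle (h : IsStarOrbit γ k l K C S) : ∃ Ψ : ℝ → ℝ, Continuous Ψ ∧ StrictMono Ψ ∧
    Ψ 0 = 0 ∧ Tendsto Ψ atTop atTop ∧
    (∀ a b : ℝ, (∃ n : ℤ, Ψ a - Ψ b = n * (2 * Real.pi)) ↔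
      ∃ c > 0, C a - k = c * (C b - k) ∧ S a - l = c * (S b - l)) ∧
    ∀ w, Periodic C w → Periodic S w → ∀ φ, Ψ (φ + w) = Ψ φ + Ψ w := by
  have hC : Continuous C := continuous_iff_continuousAt.2 fun φ => (h.deriv_C φ).continuousAt
  have hS : Continuous S := continuous_iff_continuousAt.2 fun φ => (h.deriv_S φ).continuousAt
  set A : ℝ × ℝ → ℝ := fun p => γ * (p.2 ^ 3 - p.2) * (p.2 - l) + (p.1 - k) * (p.1 ^ 3 - p.1) with hA
  have hAc : Continuous A := by fun_prop
  set z : ℝ → ℂ := fun φ => ((C φ - k : ℝ) : ℂ) + ((S φ - l : ℝ) : ℂ) * Complex.I with hz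
  set z' : ℝ → ℂ := fun φ => ((γ * (S φ ^ 3 - S φ) : ℝ) : ℂ) +
    ((-(C φ ^ 3 - C φ) : ℝ) : ℂ) * Complex.I with hz'
  have hzre : ∀ φ, (z φ).re = C φ - k := fun φ => by simp [hz]
  have hzim : ∀ φ, (z φ).im = S φ - l := fun φ => by simp [hz]
  have hz're : ∀ φ, (z' φ).re = γ * (S φ ^ 3 - S φ) := fun φ => by
    simp only [hz', Complex.add_re, Complex.mul_re, Complex.ofReal_re, Complex.ofReal_im,
      Complex.I_re, Complex.I_im]; ring
  have hz'im : ∀ φ, (z' φ).im = -(C φ ^ 3 - C φ) := fun φ => by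
    simp only [hz', Complex.add_im, Complex.mul_im, Complex.ofReal_re, Complex.ofReal_im,
      Complex.I_re, Complex.I_im]; ring
  have hzd : ∀ φ, HasDerivAt z (z' φ) φ := fun φ =>
    (((h.deriv_C φ).sub_const k).ofReal_comp).add ((((h.deriv_S φ).sub_const l).ofReal_comp).mul_const _)
  have hz0 : ∀ φ, z φ ≠ 0 := fun φ h0 => by
    refine h.transversal _ (h.mem φ) ?_
    have e1 := hzre φ
    have e2 := hzim φ
    rw [h0] at e1 e2
    simp only [Complex.zero_re, Complex.zero_im] at e1 e2
    simp only [← e1, ← e2]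
    ring
  have hzc : Continuous z := continuous_iff_continuousAt.2 fun φ => (hzd φ).continuousAt
  have hz'c : Continuous z' := by
    simp only [hz']
    fun_prop
  set lam : ℝ → ℂ := fun φ => z' φ / z φ with hlam
  have hlamc : Continuous lam := hz'c.div hzc hz0
  set W : ℝ → ℂ := fun φ => ∫ s in (0 : ℝ)..φ, lam s with hW
  have hWd : ∀ φ, HasDerivAt W (lam φ) φ := fun φ =>
    (hlamc.integral_hasStrictDerivAt 0 φ).hasDerivAt
  have hrep : ∀ a b, z a = Complex.exp (W a - W b) * z b := by
    have hconst : ∀ a b, z a * Complex.exp (-W a) = z b * Complex.exp (-W b) := by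
      refine is_const_of_deriv_eq_zero (f := fun a => z a * Complex.exp (-W a)) ?_ ?_
      · exact fun φ => ((hzd φ).mul (hWd φ).neg.cexp).differentiableAt
      · intro φ
        have hd : HasDerivAt (fun a => z a * Complex.exp (-W a)) _ φ :=
          (hzd φ).mul (hWd φ).neg.cexp
        refine hd.deriv.trans ?_
        have h1 : lam φ * z φ = z' φ := div_mul_cancel₀ _ (hz0 φ)
        linear_combination -Complex.exp (-W φ) * h1
    intro a b
    have h1 := hconst a b
    have h2 : z a = z a * Complex.exp (-W a) * Complex.exp (W a) := by
      rw [mul_assoc, ← Complex.exp_add]; simp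
    rw [h2, h1, mul_assoc, ← Complex.exp_add, mul_comm, neg_add_eq_sub]
  have hlamim : ∀ φ, (lam φ).im = -A (C φ, S φ) / Complex.normSq (z φ) := fun φ => by
    simp only [hlam, Complex.div_im, hzre, hzim, hz're, hz'im, hA]
    ring
  obtain ⟨σ, hσ, hσA⟩ : ∃ σ : ℝ, (σ = 1 ∨ σ = -1) ∧ ∀ φ, 0 < σ * A (C φ, S φ) := by
    have hAφ : Continuous fun φ => A (C φ, S φ) := hAc.comp (hC.prodMk hS)
    have hne : ∀ φ, A (C φ, S φ) ≠ 0 := fun φ => h.transversal _ (h.mem φ)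
    rcases lt_or_gt_of_ne (hne 0) with h0 | h0
    · refine ⟨-1, Or.inr rfl, fun φ => ?_⟩
      by_contra hcon
      obtain ⟨x, hx⟩ := mem_range_of_exists_le_of_exists_ge hAφ ⟨0, h0.le⟩ ⟨φ, by linarith⟩
      exact hne x hx
    · refine ⟨1, Or.inl rfl, fun φ => ?_⟩
      by_contra hcon
      obtain ⟨x, hx⟩ := mem_range_of_exists_le_of_exists_ge hAφ ⟨φ, by linarith⟩ ⟨0, h0.le⟩
      exact hne x hx
  have hσ2 : σ * σ = 1 := by rcases hσ with h | h <;> rw [h] <;> norm_num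
  obtain ⟨p₀, hp₀, hmin⟩ := h.compact.exists_isMinOn ⟨_, h.mem 0⟩ (hAc.abs.continuousOn (s := K))
  set c := |A p₀| with hc
  have hcp : 0 < c := abs_pos.2 (h.transversal p₀ hp₀)
  obtain ⟨B, hB⟩ := h.compact.exists_bound_of_continuousOn
    (f := fun p : ℝ × ℝ => (p.1 - k) ^ 2 + (p.2 - l) ^ 2) (by fun_prop)
  have hnsq : ∀ φ, 0 < Complex.normSq (z φ) ∧ Complex.normSq (z φ) ≤ B := fun φ => by
    refine ⟨Complex.normSq_pos.2 (hz0 φ), ?_⟩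
    have := hB _ (h.mem φ)
    rw [Real.norm_of_nonneg (by positivity)] at this
    rw [Complex.normSq_apply, hzre, hzim]
    nlinarith
  have hBp : 0 < B := lt_of_lt_of_le (hnsq 0).1 (hnsq 0).2
  set m := c / B with hm
  have hmp : 0 < m := by positivity
  set Ψ : ℝ → ℝ := fun φ => -σ * (W φ).im with hΨ
  have hΨd : ∀ φ, HasDerivAt Ψ (-σ * (lam φ).im) φ := fun φ => by
    exact (Complex.imCLM.hasFDerivAt.comp_hasDerivAt φ (hWd φ)).const_mul (-σ)
  have hΨm : ∀ φ, m ≤ -σ * (lam φ).im := fun φ => by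
    rw [hlamim]
    have e1 : -σ * (-A (C φ, S φ) / Complex.normSq (z φ)) =
        σ * A (C φ, S φ) / Complex.normSq (z φ) := by ring
    rw [e1]
    have e2 : c ≤ σ * A (C φ, S φ) := by
      have h1 : c ≤ |A (C φ, S φ)| := hmin (h.mem φ)
      have h2 : |A (C φ, S φ)| = σ * A (C φ, S φ) := by
        rw [← abs_of_pos (hσA φ), abs_mul]
        rcases hσ with h | h <;> simp [h]
      linarith
    exact div_le_div₀ (hσA φ).le e2 (hnsq φ).1 (hnsq φ).2
  have hΨc : Continuous Ψ := continuous_iff_continuousAt.2 fun φ => (hΨd φ).continuousAt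
  have hΨ0 : Ψ 0 = 0 := by simp [hΨ, hW]
  have hmono : StrictMono Ψ := strictMono_of_deriv_pos fun φ => by
    rw [(hΨd φ).deriv]; exact hmp.trans_le (hΨm φ)
  have hgrow : ∀ φ, 0 ≤ φ → m * φ ≤ Ψ φ := fun φ hφ => by
    have := mul_sub_le_image_sub_of_le_deriv (f := Ψ) (C := m)
      (fun x => (hΨd x).differentiableAt) (fun x => by rw [(hΨd x).deriv]; exact hΨm x) hφ
    rw [hΨ0] at this
    simpa using this
  refine ⟨Ψ, hΨc, hmono, hΨ0, ?_, fun a b => ?_, fun w hwC hwS φ => ?_⟩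
  · refine tendsto_atTop_mono' atTop ?_ (tendsto_id.const_mul_atTop hmp)
    filter_upwards [eventually_ge_atTop 0] with φ hφ using hgrow φ hφ
  · constructor
    · rintro ⟨n, hn⟩
      refine ⟨Real.exp (W a - W b).re, Real.exp_pos _, ?_⟩
      have h1 : (W a - W b).im = (-σ * n : ℝ) * (2 * Real.pi) := by
        simp only [hΨ] at hn
        rw [Complex.sub_im]
        linear_combination (-σ) * hn + ((W b).im - (W a).im) * hσ2
      obtain ⟨n', hn'⟩ : ∃ n' : ℤ, (n' : ℝ) = -σ * n := by
        rcases hσ with h | h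
        · exact ⟨-n, by rw [h]; push_cast; ring⟩
        · exact ⟨n, by rw [h]; ring⟩
      have h2 : Complex.exp (W a - W b) = (Real.exp (W a - W b).re : ℂ) := by
        conv_lhs => rw [← Complex.re_add_im (W a - W b), h1, ← hn', Complex.exp_add]
        have : Complex.exp ((((n' : ℝ) * (2 * Real.pi) : ℝ) : ℂ) * Complex.I) = 1 := by
          rw [← Complex.exp_int_mul_two_pi_mul_I n']
          push_cast
          ring_nf
        rw [this, mul_one, Complex.ofReal_exp]
      have h3 := hrep a b
      rw [h2] at h3
      have h4 := congrArg Complex.re h3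
      have h5 := congrArg Complex.im h3
      rw [Complex.re_ofReal_mul, hzre, hzre] at h4
      rw [Complex.im_ofReal_mul, hzim, hzim] at h5
      exact ⟨h4, h5⟩
    · rintro ⟨c, hc, e1, e2⟩
      have h1 : z a = (c : ℂ) * z b := by
        apply Complex.ext
        · rw [Complex.re_ofReal_mul, hzre, hzre, e1]
        · rw [Complex.im_ofReal_mul, hzim, hzim, e2]
      have h2 : Complex.exp (W a - W b) = Complex.exp (Real.log c : ℂ) := by
        rw [← Complex.ofReal_exp, Real.exp_log hc]
        exact mul_right_cancel₀ (hz0 b) ((hrep a b).symm.trans h1)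
      obtain ⟨n, hn⟩ := Complex.exp_eq_exp_iff_exists_int.1 h2
      have h3 := congrArg Complex.im hn
      simp only [Complex.sub_im, Complex.add_im, Complex.ofReal_im, Complex.mul_im,
        Complex.intCast_re, Complex.intCast_im, Complex.I_re, Complex.I_im, Complex.mul_re,
        Complex.ofReal_re, Complex.re_ofNat, Complex.im_ofNat] at h3
      ring_nf at h3
      rcases hσ with h | h
      · exact ⟨-n, by simp only [hΨ, h]; push_cast; linarith⟩
      · exact ⟨n, by simp only [hΨ, h]; linarith⟩
  · have hper : Periodic lam w := fun s => by
      simp only [hlam, hz, hz', hwC s, hwS s]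
    have h1 := hper.intervalIntegral_add_eq φ 0
    rw [zero_add] at h1
    have h2 : W (φ + w) - W φ = W w := by
      simp only [hW]
      rw [intervalIntegral.integral_interval_sub_left (hlamc.intervalIntegrable _ _)
        (hlamc.intervalIntegrable _ _), h1]
    have h3 : W (φ + w) = W φ + W w := by rw [← h2]; ring
    simp only [hΨ, h3, Complex.add_im]
    ring

theorem period_spec (h : IsStarOrbit γ k l K C S) :
    0 < orbitPeriod C S ∧ Periodic C (orbitPeriod C S) ∧ Periodic S (orbitPeriod C S) ∧
      ∀ a b c, 0 < c → C a - k = c * (C b - k) → S a - l = c * (S b - l) →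
        ∃ n : ℤ, a = b + n * orbitPeriod C S := by
  obtain ⟨Ψ, hΨc, hmono, hΨ0, htop, hray, hper⟩ := h.exists_angle
  obtain ⟨w, hw0, hw⟩ : ∃ w, 0 < w ∧ Ψ w = 2 * Real.pi := by
    obtain ⟨M, hM⟩ := (htop.eventually (eventually_ge_atTop (2 * Real.pi))).exists
    obtain ⟨w, hw⟩ := mem_range_of_exists_le_of_exists_ge hΨc
      ⟨0, by rw [hΨ0]; positivity⟩ ⟨M, hM⟩
    refine ⟨w, ?_, hw⟩
    rw [← hmono.lt_iff_lt, hΨ0, hw]; positivity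
  have hback : C w = C 0 ∧ S w = S 0 := by
    obtain ⟨c, hc, e1, e2⟩ := (hray w 0).1 ⟨1, by rw [hw, hΨ0]; push_cast; ring⟩
    have := h.ray _ (h.mem w) _ (h.mem 0) c hc e1 e2
    exact ⟨congrArg Prod.fst this, congrArg Prod.snd this⟩
  have hperw : Periodic C w ∧ Periodic S w := by
    let F : ℝ × ℝ → ℝ × ℝ := fun p => (γ * (p.2 ^ 3 - p.2), -(p.1 ^ 3 - p.1))
    have hF : ContDiff ℝ 1 F := by fun_prop
    have := eqOn_of_locally_lipschitz (v := fun _ => F) (Ω := univ) (J := univ) (t₀ := 0)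
      (f := fun φ => (C (φ + w), S (φ + w))) (g := fun φ => (C φ, S φ)) (fun t₀ p₀ _ => by
        obtain ⟨K, N, hN, hK⟩ := hF.contDiffAt.exists_lipschitzOnWith (x := p₀)
        exact ⟨K, N, hN, Eventually.of_forall fun _ => hK⟩) isOpen_univ isPreconnected_univ
      (fun t _ => ⟨trivial, ((h.deriv_C (t + w)).comp_add_const t w).prodMk
        ((h.deriv_S (t + w)).comp_add_const t w)⟩)
      (fun t _ => (h.deriv_C t).prodMk (h.deriv_S t)) trivial (by simp [hback.1, hback.2])
    exact ⟨fun φ => congrArg Prod.fst (this φ trivial), fun φ => congrArg Prod.snd (this φ trivial)⟩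
  have hleast : IsLeast {w | 0 < w ∧ Periodic C w ∧ Periodic S w} w := by
    refine ⟨⟨hw0, hperw⟩, fun w' hw' => ?_⟩
    obtain ⟨h1, h2, h3⟩ := hw'
    obtain ⟨n, hn⟩ := (hray w' 0).2 ⟨1, one_pos, by rw [h2.eq, one_mul], by rw [h3.eq, one_mul]⟩
    rw [hΨ0, sub_zero] at hn
    have h4 : 0 < Ψ w' := by rw [← hΨ0]; exact hmono h1
    have h5 : (1 : ℝ) ≤ n := by
      have : 0 < n := by
        by_contra hcon
        have : (n : ℝ) ≤ 0 := by exact_mod_cast not_lt.1 hcon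
        have := mul_nonpos_of_nonpos_of_nonneg this Real.two_pi_pos.le
        linarith
      exact_mod_cast this
    rw [← hmono.le_iff_le, hw, hn]
    nlinarith [Real.two_pi_pos]
  have hω : orbitPeriod C S = w := hleast.csInf_eq
  rw [hω]
  refine ⟨hw0, hperw.1, hperw.2, fun a b c hc e1 e2 => ?_⟩
  obtain ⟨n, hn⟩ := (hray a b).2 ⟨c, hc, e1, e2⟩
  refine ⟨n, hmono.injective ?_⟩
  have hpp : Periodic (fun φ => Ψ φ - 2 * Real.pi * (φ / w)) w := fun φ => by
    simp only
    rw [hper w hperw.1 hperw.2 φ, hw]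
    field_simp
    ring
  have h6 : Ψ (b + n * w) - 2 * Real.pi * ((b + n * w) / w) = Ψ b - 2 * Real.pi * (b / w) :=
    hpp.int_mul n b
  have h7 : (b + n * w) / w = b / w + n := by field_simp
  rw [h7] at h6
  linarith

end IsStarOrbit

end StarOrbit


/-! ### An inequality for the orbits around three equilibria -/

section ClassOne

/-- The conic `(β - D)² + γ (β - s D) = 0` with `D = s² (2 - s)` lies above its tangents. -/
theorem conic_pos_of_le_line {β γ s η E : ℝ} (hγ : 0 < γ) (hs : 0 < s) (hs1 : s < 1)
    (h1 : γ ≤ E + η * (η - 2) * β) (h2 : E < η * (s ^ 2 * (2 - s)) * (2 - η * s)) :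
    0 < (β - s ^ 2 * (2 - s)) ^ 2 + γ * (β - s * (s ^ 2 * (2 - s))) := by
  have hD : 0 < s ^ 2 * (2 - s) := mul_pos (pow_pos hs 2) (by linarith)
  set D := s ^ 2 * (2 - s)
  rcases lt_trichotomy β (s * D) with h | h | h
  · have h3 : 0 < (s * D - β) * (η * D * (2 - η * s) - E) :=
      mul_pos (by linarith) (by linarith)
    have h4 : 0 ≤ (s * D - β) * (E + η * (η - 2) * β - γ) :=
      mul_nonneg (by linarith) (by linarith)
    nlinarith [sq_nonneg ((η - 1) * (s * D - β) - D * (1 - s))]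
  · rw [h, sub_self, mul_zero, add_zero]
    have : 0 < D * (1 - s) := mul_pos hD (by linarith)
    nlinarith
  · have := mul_pos hγ (sub_pos.2 h)
    positivity

variable {b γ : ℝ}

/-- The function `(b² - 1)²` lies above its tangents. -/
theorem sq_sub_one_sq_ge_tangent {b₀ : ℝ} (hb : 1 ≤ b) (hb₀ : 1 ≤ b₀) :
    (b₀ ^ 2 - 1) ^ 2 + 4 * b₀ * (b₀ ^ 2 - 1) * (b - b₀) ≤ (b ^ 2 - 1) ^ 2 := by
  have h : 0 ≤ (b - b₀) ^ 2 * (b ^ 2 + 2 * b₀ * b + 3 * b₀ ^ 2 - 2) :=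
    mul_nonneg (sq_nonneg _) (by nlinarith)
  linarith [h]

/-- The region of admissible `(b, γ)` for the orbits around three equilibria. -/
structure IsClassOneRegion (b γ : ℝ) : Prop where
  pos : 0 < γ
  le : γ ≤ 0.806
  lt_b : 1.01 < b
  lower_left : γ ≤ 5 * b - 4.85
  lower_right : 0.6 * γ + 0.67 ≤ b
  upper_left : γ ≤ 0.5 → (b ^ 2 - 1) ^ 2 ≤ 1 - γ
  upper_right : 0.5 ≤ γ → (b ^ 2 - 1) ^ 2 ≤ 0.8125 - 0.25 * γ - 0.75 * γ ^ 2

theorem isClassOneRegion_of_mem (hγ : 0 < γ) (hγ1 : γ ≤ 0.806)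
    (hb : b ∈ Ioo (bMinus γ) (bPlus γ)) : IsClassOneRegion b γ := by
  obtain ⟨h1, h2⟩ := hb
  have h3 : 1.01 < b ∧ γ ≤ 5 * b - 4.85 ∧ 0.6 * γ + 0.67 ≤ b := by
    unfold bMinus at h1
    split_ifs at h1 with h h' <;> refine ⟨?_, ?_, ?_⟩ <;> linarith
  have h4 : 0 < b ^ 2 - 1 := by nlinarith [h3.1]
  have key : ∀ r : ℝ, b < √(1 + r) → b ^ 2 - 1 < r := fun r hr => by
    have := (Real.lt_sqrt (by linarith [h3.1])).1 hr
    linarith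
  refine ⟨hγ, hγ1, h3.1, h3.2.1, h3.2.2, fun h => ?_, fun h => ?_⟩
  · rw [bPlus, if_pos h] at h2
    have h5 := key _ h2
    exact ((Real.lt_sqrt h4.le).1 h5).le
  · rcases h.eq_or_lt with h0 | h0
    · rw [bPlus, if_pos h0.ge] at h2
      have h5 := (Real.lt_sqrt h4.le).1 (key _ h2)
      rw [← h0] at h5 ⊢
      norm_num at h5 ⊢
      linarith
    · rw [bPlus, if_neg (by linarith)] at h2
      have h5 := key _ h2
      have h6 : 2 * (b ^ 2 - 1) < √(3.25 - γ - 3 * γ ^ 2) := by linarith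
      have h7 := (Real.lt_sqrt (by linarith)).1 h6
      nlinarith

theorem IsClassOneRegion.le_tangent (h : IsClassOneRegion b γ) {c : ℝ} (hc : 0.5 ≤ c) :
    (b ^ 2 - 1) ^ 2 ≤ 1 - γ - 0.75 * (c - 0.5) * (2 * γ - c - 0.5) := by
  rcases le_total γ 0.5 with hγ | hγ
  · nlinarith [h.upper_left hγ]
  · nlinarith [h.upper_right hγ, sq_nonneg (γ - c)]

theorem IsClassOneRegion.conic_pos (h : IsClassOneRegion b γ) {s : ℝ} (hs : 0 < s) (hs1 : s < 1) :
    0 < ((b ^ 2 - 1) ^ 2 - s ^ 2 * (2 - s)) ^ 2 +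
      γ * ((b ^ 2 - 1) ^ 2 - s * (s ^ 2 * (2 - s))) := by
  obtain ⟨hγ, hγ1, hb, hl, hr, -, -⟩ := id h
  have tan : ∀ b₀ : ℝ, 1 ≤ b₀ → _ := fun b₀ hb₀ =>
    sq_sub_one_sq_ge_tangent (b := b) (b₀ := b₀) (by linarith) hb₀
  have hup := h.le_tangent (c := 0.806) (by norm_num)
  have quartic : ∀ η E s₁ s₂ : ℝ, s₁ ≤ s → s ≤ s₂ → 0 < s₁ → 0 < η →
      4 + η * (s₁ ^ 2 + 2 * s₁ * s₂ + 3 * s₂ ^ 2) ≤ (2 + 2 * η) * (2 * s₁ + s₂) →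
      E < η * (s₁ ^ 2 * (2 - s₁)) * (2 - η * s₁) → E < η * (s₂ ^ 2 * (2 - s₂)) * (2 - η * s₂) →
      E < η * (s ^ 2 * (2 - s)) * (2 - η * s) := by
    intro η E s₁ s₂ h1 h2 h0 hη hq e1 e2
    have hpos : 0 ≤ (s - s₁) * (s₂ - s) * (η * ((2 + 2 * η) * (s₁ + s + s₂) - 4 -
        η * (s₁ ^ 2 + s ^ 2 + s₂ ^ 2 + s₁ * s + s₁ * s₂ + s * s₂))) := by
      refine mul_nonneg (mul_nonneg (by linarith) (by linarith)) (mul_nonneg hη.le ?_)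
      have h4 : s₁ ^ 2 + s ^ 2 + s₂ ^ 2 + s₁ * s + s₁ * s₂ + s * s₂ ≤
          s₁ ^ 2 + 2 * s₁ * s₂ + 3 * s₂ ^ 2 := by nlinarith
      nlinarith [mul_le_mul_of_nonneg_left h4 hη.le]
    rcases h1.eq_or_lt with rfl | h1'
    · exact e1
    have h5 : 0 < (s₂ - s) * (η * (s₁ ^ 2 * (2 - s₁)) * (2 - η * s₁) - E) +
        (s - s₁) * (η * (s₂ ^ 2 * (2 - s₂)) * (2 - η * s₂) - E) :=
      add_pos_of_nonneg_of_pos (mul_nonneg (by linarith) (by linarith))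
        (mul_pos (by linarith) (by linarith))
    have h6 : 0 < (s₂ - s₁) * (η * (s ^ 2 * (2 - s)) * (2 - η * s) - E) := by
      have h7 := mul_nonneg (show 0 ≤ s₂ - s₁ by linarith) hpos
      linear_combination h5 + h7
    linarith [(mul_pos_iff_of_pos_left (show 0 < s₂ - s₁ by linarith)).1 h6]
  rcases le_or_gt s 0.058 with c1 | c1
  · have h3 := tan 1.01 (by norm_num)
    have h4 : s * (s ^ 2 * (2 - s)) ≤ 0.0004 := by
      have : s ^ 3 ≤ 0.058 ^ 3 := pow_le_pow_left₀ hs.le c1 3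
      nlinarith [pow_pos hs 3]
    have h5 := mul_pos hγ (show 0 < (b ^ 2 - 1) ^ 2 - s * (s ^ 2 * (2 - s)) by linarith)
    positivity
  have step : ∀ η E s₁ s₂ : ℝ, s₁ < s → s ≤ s₂ → 0 < s₁ → 0 < η →
      4 + η * (s₁ ^ 2 + 2 * s₁ * s₂ + 3 * s₂ ^ 2) ≤ (2 + 2 * η) * (2 * s₁ + s₂) →
      E < η * (s₁ ^ 2 * (2 - s₁)) * (2 - η * s₁) → E < η * (s₂ ^ 2 * (2 - s₂)) * (2 - η * s₂) →
      γ ≤ E + η * (η - 2) * (b ^ 2 - 1) ^ 2 → _ := fun η E s₁ s₂ h1 h2 h3 h4 h5 h6 h7 h8 =>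
    conic_pos_of_le_line (η := η) (E := E) hγ hs hs1 h8 (quartic η E s₁ s₂ h1.le h2 h3 h4 h5 h6 h7)
  rcases le_or_gt s 0.0889 with c2 | c2
  · refine step 21 0.039 0.058 0.0889 c1 c2 ?_ ?_ ?_ ?_ ?_ (by linarith [tan 1.01 (by norm_num)]) <;> norm_num
  rcases le_or_gt s 0.1663 with c3 | c3
  · refine step 10 0.1677 0.0889 0.1663 c2 c3 ?_ ?_ ?_ ?_ ?_ (by linarith [tan 1.01 (by norm_num)]) <;> norm_num
  rcases le_or_gt s 0.3865 with c4 | c4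
  · refine step 4.5 0.2824 0.1663 0.3865 c3 c4 ?_ ?_ ?_ ?_ ?_ (by linarith [tan 1.0516 (by norm_num)]) <;> norm_num
  rcases le_or_gt s 0.532 with c5 | c5
  · refine step 2.73 0.6211 0.3865 0.532 c4 c5 ?_ ?_ ?_ ?_ ?_ (by linarith [tan 1.12 (by norm_num)]) <;> norm_num
  rcases le_or_gt s 0.5904 with c6 | c6
  · refine step 2.2 0.75787 0.532 0.5904 c5 c6 ?_ ?_ ?_ ?_ ?_ (by linarith [tan 1.1536 (by norm_num)]) <;> norm_num
  rcases le_or_gt s 0.6137 with c7 | c7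
  · refine step 2.03 0.79935 0.5904 0.6137 c6 c7 ?_ ?_ ?_ ?_ ?_ (by linarith [tan 1.1536 (by norm_num)]) <;> norm_num
  rcases le_or_gt s 0.6265 with c8 | c8
  · refine step 1.96 0.81571 0.6137 0.6265 c7 c8 ?_ ?_ ?_ ?_ ?_ (by linarith [hup]) <;> norm_num
  rcases le_or_gt s 0.637 with c9 | c9
  · refine step 1.92 0.82502 0.6265 0.637 c8 c9 ?_ ?_ ?_ ?_ ?_ (by linarith [hup]) <;> norm_num
  rcases le_or_gt s 0.659 with c10 | c10
  · refine step 1.86 0.8384 0.637 0.659 c9 c10 ?_ ?_ ?_ ?_ ?_ (by linarith [hup]) <;> norm_num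
  rcases le_or_gt s 0.75 with c11 | c11
  · refine step 1.68 0.8727 0.659 0.75 c10 c11 ?_ ?_ ?_ ?_ ?_ (by linarith [hup]) <;> norm_num
  obtain ⟨c, rfl⟩ : ∃ c, s = 1 - c := ⟨1 - s, by ring⟩
  have hc : 0 < c := by linarith
  have hc1 : c < 0.25 := by linarith
  refine conic_pos_of_le_line (η := 1 + 2 * c) (E := 1 - 2 * c ^ 2 + 64 / 9 * c ^ 4) hγ hs hs1 ?_ ?_
  · have hc2 : 0 ≤ 1 - 4 * c ^ 2 := by nlinarith
    have hc3 : 0.75 ≤ 1 - 4 * c ^ 2 := by nlinarith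
    rcases le_total γ 0.5 with hg | hg
    · nlinarith [mul_le_mul_of_nonneg_left (h.upper_left hg) hc2, mul_nonneg (sq_nonneg c)
        (sub_nonneg.2 hg), pow_pos hc 4]
    · have h3 := mul_le_mul_of_nonneg_left (h.upper_right hg) hc2
      have h4 := mul_le_mul_of_nonneg_right hc3 (sq_nonneg (γ - 0.5))
      nlinarith [sq_nonneg (8 / 3 * c ^ 2 - 3 / 4 * (γ - 0.5))]
  · have h3 : 0 < c ^ 3 * (4 - (91 / 9) * c - 4 * c ^ 2 + 4 * c ^ 3) := by
      refine mul_pos (pow_pos hc 3) ?_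
      nlinarith [pow_pos hc 3]
    linear_combination h3

end ClassOne


/-! ### The closed orbits of the unperturbed system -/

section OrbitClasses

open Filter Topology

variable {γ a k l b : ℝ} {C S : ℝ → ℝ}

/-- Four times the energy of the unperturbed system. -/
def energy (γ : ℝ) (p : ℝ × ℝ) : ℝ := (p.1 ^ 2 - 1) ^ 2 + γ * (p.2 ^ 2 - 1) ^ 2

theorem energy_eq (hC : ∀ φ, HasDerivAt C (γ * (S φ ^ 3 - S φ)) φ)
    (hS : ∀ φ, HasDerivAt S (-(C φ ^ 3 - C φ)) φ) (φ : ℝ) :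
    energy γ (C φ, S φ) = energy γ (C 0, S 0) := by
  refine is_const_of_deriv_eq_zero (f := fun φ => energy γ (C φ, S φ)) ?_ ?_ φ 0
  · intro φ
    simp only [energy]
    exact ((((hC φ).pow 2).sub_const 1).pow 2).add
      (((((hS φ).pow 2).sub_const 1).pow 2).const_mul γ) |>.differentiableAt
  · intro φ
    have h : HasDerivAt (fun φ => energy γ (C φ, S φ)) _ φ :=
      ((((hC φ).pow 2).sub_const 1).pow 2).add
        (((((hS φ).pow 2).sub_const 1).pow 2).const_mul γ)
    rw [h.deriv]
    simp only [Pi.pow_apply]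
    push_cast
    ring

/-- An orbit that starts in an open set `U` whose boundary misses its energy level is a star orbit
if the level is transversal to the rays in `U`. -/
theorem isStarOrbit_of_level (hγ : 0 < γ) (hC : ∀ φ, HasDerivAt C (γ * (S φ ^ 3 - S φ)) φ)
    (hS : ∀ φ, HasDerivAt S (-(C φ ^ 3 - C φ)) φ) (ha : energy γ (C 0, S 0) = a)
    {U V : Set (ℝ × ℝ)} (hU : IsOpen U) (hV : IsClosed V) (hUV : U ⊆ V)
    (hVU : ∀ p ∈ V, energy γ p = a → p ∈ U) (h0 : (C 0, S 0) ∈ U)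
    (htr : ∀ p ∈ U, energy γ p = a →
      γ * (p.2 ^ 3 - p.2) * (p.2 - l) + (p.1 - k) * (p.1 ^ 3 - p.1) ≠ 0)
    (hray : ∀ p ∈ U, energy γ p = a → ∀ p' ∈ U, energy γ p' = a → ∀ c > 0,
      p.1 - k = c * (p'.1 - k) → p.2 - l = c * (p'.2 - l) → p = p') :
    ∃ K, IsStarOrbit γ k l K C S ∧ ∀ φ, energy γ (C φ, S φ) = a ∧ (C φ, S φ) ∈ U := by
  have hCc : Continuous C := continuous_iff_continuousAt.2 fun φ => (hC φ).continuousAt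
  have hSc : Continuous S := continuous_iff_continuousAt.2 fun φ => (hS φ).continuousAt
  have hE : ∀ φ, energy γ (C φ, S φ) = a := fun φ => (energy_eq hC hS φ).trans ha
  have hmem : ∀ φ, (C φ, S φ) ∈ U := by
    have hclopen : IsClopen {φ | (C φ, S φ) ∈ U} := by
      refine ⟨?_, hU.preimage (hCc.prodMk hSc)⟩
      have : {φ | (C φ, S φ) ∈ U} = {φ | (C φ, S φ) ∈ V} :=
        Set.ext fun φ => ⟨fun h => hUV h, fun h => hVU _ h (hE φ)⟩
      rw [this]
      exact hV.preimage (hCc.prodMk hSc)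
    have := hclopen.eq_univ ⟨0, h0⟩
    exact fun φ => this.ge (mem_univ φ)
  have hEc : Continuous (energy γ) := by unfold energy; fun_prop
  refine ⟨{p | energy γ p = a} ∩ V, ⟨hC, hS, ?_, fun φ => ⟨hE φ, hUV (hmem φ)⟩,
    fun p hp => htr p (hVU p hp.2 hp.1) hp.1,
    fun p hp p' hp' => hray p (hVU p hp.2 hp.1) hp.1 p' (hVU p' hp'.2 hp'.1) hp'.1⟩,
    fun φ => ⟨hE φ, hmem φ⟩⟩
  refine Metric.isCompact_of_isClosed_isBounded ((isClosed_eq hEc continuous_const).inter hV) ?_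
  refine (Metric.isBounded_closedBall (x := (0 : ℝ × ℝ)) (r := 2 + a + a / γ)).subset ?_
  rintro ⟨x, y⟩ ⟨hp, -⟩
  have hp' : (x ^ 2 - 1) ^ 2 + γ * (y ^ 2 - 1) ^ 2 = a := hp
  have h1 : 0 ≤ γ * (y ^ 2 - 1) ^ 2 := by positivity
  have ha0 : 0 ≤ a := by rw [← hp']; positivity
  have h2 : 0 ≤ a / γ := by positivity
  have h3 : (y ^ 2 - 1) ^ 2 ≤ a / γ := by
    rw [le_div_iff₀ hγ]; nlinarith [sq_nonneg (x ^ 2 - 1)]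
  have key : ∀ z r : ℝ, 0 ≤ r → (z ^ 2 - 1) ^ 2 ≤ r → |z| ≤ 2 + r := fun z r hr hz => by
    refine abs_le_of_sq_le_sq' (b := 2 + r) ?_ (by linarith) |> abs_le.2
    nlinarith [sq_nonneg (z ^ 2 - 2)]
  rw [mem_closedBall_zero_iff, Prod.norm_def, sup_le_iff]
  exact ⟨(key x a ha0 (by linarith)).trans (by linarith),
    (key y _ h2 h3).trans (by linarith)⟩

/-- A function cannot cross zero upwards twice without crossing it downwards in between. -/
theorem not_two_upcrossings {f f' : ℝ → ℝ} {u v : ℝ} (huv : u < v)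
    (hf : ∀ τ, HasDerivAt f (f' τ) τ) (fu : f u = 0) (fv : f v = 0)
    (h : ∀ τ ∈ Icc u v, f τ = 0 → 0 < f' τ) : False := by
  have hc : Continuous f := continuous_iff_continuousAt.2 fun τ => (hf τ).continuousAt
  have h1 : ∀ τ ∈ Icc u v, 0 ≤ f τ :=
    image_le_of_deriv_right_lt_deriv_boundary' (f := fun _ => (0 : ℝ)) (f' := fun _ => 0)
      continuousOn_const (fun x _ => hasDerivWithinAt_const ..) fu.ge hc.continuousOn
      (fun x _ => (hf x).hasDerivWithinAt) (fun x hx he => h x (Ico_subset_Icc_self hx) he.symm)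
  have h2 : ∀ τ ∈ Icc (-v) (-u), 0 ≤ -f (-τ) :=
    image_le_of_deriv_right_lt_deriv_boundary' (f := fun _ => (0 : ℝ)) (f' := fun _ => 0)
      (B' := fun τ => f' (-τ))
      continuousOn_const (fun x _ => hasDerivWithinAt_const ..) (by simp [fv])
      (by fun_prop)
      (fun x _ => by
        have := ((hf (-x)).comp x (hasDerivAt_neg x)).neg
        simp only [mul_neg, mul_one, neg_neg] at this
        exact this.hasDerivWithinAt)
      (fun x hx he => h (-x) ⟨by linarith [hx.2], by linarith [hx.1]⟩ (by linarith))
  have h3 : ∀ τ ∈ Icc u v, f τ = 0 := fun τ hτ => by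
    have := h2 (-τ) ⟨by linarith [hτ.2], by linarith [hτ.1]⟩
    rw [neg_neg] at this
    linarith [h1 τ hτ]
  have hm : (u + v) / 2 ∈ Ioo u v := ⟨by linarith, by linarith⟩
  have h4 : f =ᶠ[𝓝 ((u + v) / 2)] fun _ => 0 := by
    filter_upwards [Ioo_mem_nhds hm.1 hm.2] with τ hτ using h3 τ (Ioo_subset_Icc_self hτ)
  have h5 := (hf ((u + v) / 2)).unique ((hasDerivAt_const _ (0 : ℝ)).congr_of_eventuallyEq h4)
  exact (h _ (Ioo_subset_Icc_self hm) (h3 _ (Ioo_subset_Icc_self hm))).ne' h5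

theorem ray_center {p p' : ℝ × ℝ} (hE : energy γ p = energy γ p') {c : ℝ} (hc : 0 < c)
    (hx : p.1 = c * p'.1) (hy : p.2 = c * p'.2)
    (hs : 0 < (γ * (p.2 ^ 3 - p.2) * p.2 + p.1 * (p.1 ^ 3 - p.1)) *
      (γ * (p'.2 ^ 3 - p'.2) * p'.2 + p'.1 * (p'.1 ^ 3 - p'.1))) : p = p' := by
  obtain ⟨x, y⟩ := p
  obtain ⟨x', y'⟩ := p'
  simp only [energy] at *
  subst hx hy
  suffices c = 1 by simp [this]
  set A := x' ^ 4 + γ * y' ^ 4 with hA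
  set B := x' ^ 2 + γ * y' ^ 2 with hB
  have h1 : (c - 1) * ((c + 1) * (A * (c ^ 2 + 1) - 2 * B)) = 0 := by
    rw [hA, hB]; linear_combination hE
  rcases mul_eq_zero.1 h1 with h | h
  · linarith
  have h2 : A * c ^ 2 = 2 * B - A := by
    rcases mul_eq_zero.1 h with h | h <;> linarith
  have h3 : 0 < c ^ 2 * ((A * c ^ 2 - B) * (A - B)) := by
    rw [hA, hB]; linear_combination hs
  rw [h2] at h3
  nlinarith [mul_nonneg (sq_nonneg c) (sq_nonneg (A - B))]

/-- The orbits inside the square and the orbits around all equilibria. -/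
theorem exists_isStarOrbit_center (hγ : 0 < γ) (hγ1 : γ ≤ 1)
    (hC : ∀ φ, HasDerivAt C (γ * (S φ ^ 3 - S φ)) φ)
    (hS : ∀ φ, HasDerivAt S (-(C φ ^ 3 - C φ)) φ) (hS0 : S 0 = 0) (hC0 : 0 < C 0 ^ 2)
    (ha : 1 < (C 0 ^ 2 - 1) ^ 2 + γ) :
    ∃ K, IsStarOrbit γ 0 0 K C S ∧ ∀ φ, energy γ (C φ, S φ) = (C 0 ^ 2 - 1) ^ 2 + γ ∧
      (C 0 ^ 2 < 1 → C φ ^ 2 < 1 ∧ S φ ^ 2 < 1) := by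
  have hE0 : energy γ (C 0, S 0) = (C 0 ^ 2 - 1) ^ 2 + γ := by simp [energy, hS0]
  have hbd : ∀ p : ℝ × ℝ, p.1 ^ 2 ≤ 1 → p.2 ^ 2 ≤ 1 → energy γ p = (C 0 ^ 2 - 1) ^ 2 + γ →
      p.1 ^ 2 < 1 ∧ p.2 ^ 2 < 1 := by
    rintro ⟨x, y⟩ hx hy hE
    simp only [energy] at *
    refine ⟨hx.lt_of_ne fun h => ?_, hy.lt_of_ne fun h => ?_⟩
    · rw [h] at hE
      nlinarith [mul_nonneg hγ.le (mul_nonneg (sq_nonneg y) (show 0 ≤ 2 - y ^ 2 by linarith))]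
    · rw [h] at hE
      nlinarith [mul_nonneg (sq_nonneg x) (show 0 ≤ 2 - x ^ 2 by linarith)]
  rcases lt_or_ge (C 0 ^ 2) 1 with hin | hout
  · have hneg : ∀ p : ℝ × ℝ, p.1 ^ 2 < 1 ∧ p.2 ^ 2 < 1 → energy γ p = (C 0 ^ 2 - 1) ^ 2 + γ →
        γ * (p.2 ^ 3 - p.2) * p.2 + p.1 * (p.1 ^ 3 - p.1) < 0 := by
      rintro ⟨x, y⟩ ⟨hx, hy⟩ hE
      simp only [energy] at *
      have h1 : 0 ≤ x ^ 2 * (1 - x ^ 2) := mul_nonneg (sq_nonneg x) (by linarith)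
      have h2 : 0 ≤ γ * (y ^ 2 * (1 - y ^ 2)) :=
        mul_nonneg hγ.le (mul_nonneg (sq_nonneg y) (by linarith))
      by_contra hcon
      have hcon' := not_lt.1 hcon
      have h3 : x ^ 2 * (1 - x ^ 2) = 0 := by nlinarith
      have h4 : γ * (y ^ 2 * (1 - y ^ 2)) = 0 := by nlinarith
      have h5 : x ^ 2 = 0 := (mul_eq_zero.1 h3).resolve_right (by linarith)
      have h6 : y ^ 2 = 0 :=
        (mul_eq_zero.1 ((mul_eq_zero.1 h4).resolve_left hγ.ne')).resolve_right (by linarith)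
      rw [h5, h6] at hE
      nlinarith
    obtain ⟨K, hK, hφ⟩ := isStarOrbit_of_level (k := 0) (l := 0) hγ hC hS hE0
      (U := {p | p.1 ^ 2 < 1} ∩ {p | p.2 ^ 2 < 1}) (V := {p | p.1 ^ 2 ≤ 1} ∩ {p | p.2 ^ 2 ≤ 1})
      ((isOpen_lt (by fun_prop) (by fun_prop)).inter (isOpen_lt (by fun_prop) (by fun_prop)))
      ((isClosed_le (by fun_prop) (by fun_prop)).inter (isClosed_le (by fun_prop) (by fun_prop)))
      (fun p hp => by
        simp only [mem_inter_iff, mem_ofPred_eq] at *; exact ⟨hp.1.le, hp.2.le⟩)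
      (fun p hp hE => hbd p hp.1 hp.2 hE)
      ⟨hin, by simp [hS0]⟩ (fun p hp hE => by simpa using (hneg p hp hE).ne)
      (fun p hp hE p' hp' hE' c hc hx hy => ray_center (hE.trans hE'.symm) hc (by simpa using hx)
        (by simpa using hy) (mul_pos_of_neg_of_neg (hneg p hp hE) (hneg p' hp' hE')))
    exact ⟨K, hK, fun φ => ⟨(hφ φ).1, fun _ => (hφ φ).2⟩⟩
  · have hpos : ∀ p : ℝ × ℝ, 1 < p.1 ^ 2 ∨ 1 < p.2 ^ 2 → energy γ p = (C 0 ^ 2 - 1) ^ 2 + γ →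
        0 < γ * (p.2 ^ 3 - p.2) * p.2 + p.1 * (p.1 ^ 3 - p.1) := by
      rintro ⟨x, y⟩ hp hE
      simp only [energy] at *
      have h1 : γ * (y ^ 3 - y) * y + x * (x ^ 3 - x) =
        (C 0 ^ 2 - 1) ^ 2 + γ + (x ^ 2 - 1) + γ * (y ^ 2 - 1) := by rw [← hE]; ring
      rw [h1]
      rcases hp with h | h
      · nlinarith [mul_nonneg hγ.le (sq_nonneg y)]
      · nlinarith [mul_pos hγ (sub_pos.2 h), sq_nonneg x]
    have hVU : ∀ p : ℝ × ℝ, 1 ≤ p.1 ^ 2 ∨ 1 ≤ p.2 ^ 2 → energy γ p = (C 0 ^ 2 - 1) ^ 2 + γ →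
        1 < p.1 ^ 2 ∨ 1 < p.2 ^ 2 := fun p hp hE => by
      by_contra! hcon
      have := hbd p hcon.1 hcon.2 hE
      rcases hp with h | h <;> linarith
    obtain ⟨K, hK, hφ⟩ := isStarOrbit_of_level (k := 0) (l := 0) hγ hC hS hE0
      (U := {p | 1 < p.1 ^ 2} ∪ {p | 1 < p.2 ^ 2}) (V := {p | 1 ≤ p.1 ^ 2} ∪ {p | 1 ≤ p.2 ^ 2})
      ((isOpen_lt (by fun_prop) (by fun_prop)).union (isOpen_lt (by fun_prop) (by fun_prop)))
      ((isClosed_le (by fun_prop) (by fun_prop)).union (isClosed_le (by fun_prop) (by fun_prop)))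
      (fun p hp => by
        simp only [mem_union, mem_ofPred_eq] at *; exact hp.imp le_of_lt le_of_lt) hVU
      (hVU _ (Or.inl hout) hE0) (fun p hp hE => by simpa using (hpos p hp hE).ne')
      (fun p hp hE p' hp' hE' c hc hx hy => ray_center (hE.trans hE'.symm) hc (by simpa using hx)
        (by simpa using hy) (mul_pos (hpos p hp hE) (hpos p' hp' hE')))
    exact ⟨K, hK, fun φ => ⟨(hφ φ).1, fun h => absurd h (by linarith)⟩⟩

theorem level_sub_level {k x x' c : ℝ} (hk : k ^ 2 = 1) (h : x = k + c * (x' - k)) :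
    (x ^ 2 - 1) ^ 2 - (x' ^ 2 - 1) ^ 2 =
      (c - 1) * ((k * x + k * x') * (c * (k * x + 1) + (k * x' + 1)) * (x' - k) ^ 2) := by
  have h1 : ∀ z : ℝ, z ^ 2 = (k * z) ^ 2 := fun z => by rw [mul_pow, hk, one_mul]
  have h2 : (x' - k) ^ 2 = (k * x' - 1) ^ 2 := by rw [h1 (x' - k), mul_sub, ← pow_two, hk]
  have h3 : k * x = 1 + c * (k * x' - 1) := by rw [h]; linear_combination (1 - c) * hk
  rw [h1 x, h1 x', h2, h3]
  ring

/-- The orbits around one equilibrium. -/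
theorem exists_isStarOrbit_corner (hγ : 0 < γ) (hγ1 : γ ≤ 1) (hk : k ^ 2 = 1) (hl : l ^ 2 = 1)
    (hC : ∀ φ, HasDerivAt C (γ * (S φ ^ 3 - S φ)) φ)
    (hS : ∀ φ, HasDerivAt S (-(C φ ^ 3 - C φ)) φ) (hS0 : S 0 = l) (hC0 : 1 < k * C 0)
    (ha : (C 0 ^ 2 - 1) ^ 2 < γ) :
    ∃ K, IsStarOrbit γ k l K C S ∧ ∀ φ, energy γ (C φ, S φ) = (C 0 ^ 2 - 1) ^ 2 := by
  have hE0 : energy γ (C 0, S 0) = (C 0 ^ 2 - 1) ^ 2 := by simp [energy, hS0, hl]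
  have hC1 : C 0 ^ 2 = (k * C 0) ^ 2 := by rw [mul_pow, hk, one_mul]
  have ha0 : 0 < (C 0 ^ 2 - 1) ^ 2 := pow_pos (by rw [hC1]; nlinarith) 2
  set a := (C 0 ^ 2 - 1) ^ 2
  have hne : ∀ p : ℝ × ℝ, energy γ p = a → ∀ {u v : ℝ}, 0 < u → 0 < v →
      0 < u * (p.1 - k) ^ 2 + v * (p.2 - l) ^ 2 := by
    rintro ⟨x, y⟩ hE u v hu hv
    by_cases hx : x = k
    · by_cases hy : y = l
      · simp only [energy, hx, hy, hk, hl] at hE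
        linarith
      · have : 0 < (y - l) ^ 2 := by have := sub_ne_zero.2 hy; positivity
        positivity
    · have : 0 < (x - k) ^ 2 := by have := sub_ne_zero.2 hx; positivity
      positivity
  refine (isStarOrbit_of_level (k := k) (l := l) hγ hC hS hE0
    (U := {p | 0 < k * p.1} ∩ {p | 0 < l * p.2}) (V := {p | 0 ≤ k * p.1} ∩ {p | 0 ≤ l * p.2})
    ((isOpen_lt (by fun_prop) (by fun_prop)).inter (isOpen_lt (by fun_prop) (by fun_prop)))
    ((isClosed_le (by fun_prop) (by fun_prop)).inter (isClosed_le (by fun_prop) (by fun_prop)))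
    (fun p hp => by
      simp only [mem_inter_iff, mem_ofPred_eq] at *; exact ⟨hp.1.le, hp.2.le⟩) ?_
    ⟨by simp only [mem_ofPred_eq]; linarith,
      by simp only [mem_ofPred_eq, hS0]; nlinarith⟩ ?_ ?_).imp fun K h => ⟨h.1, fun φ => (h.2 φ).1⟩
  · rintro ⟨x, y⟩ ⟨hx, hy⟩ hE
    simp only [energy, mem_ofPred_eq] at *
    refine ⟨lt_of_le_of_ne hx fun h => ?_, lt_of_le_of_ne hy fun h => ?_⟩
    · have h1 : x ^ 2 = 0 := by
        have : x ^ 2 = (k * x) ^ 2 := by rw [mul_pow, hk, one_mul]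
        rw [this, ← h]; norm_num
      rw [h1] at hE
      nlinarith [mul_nonneg hγ.le (sq_nonneg (y ^ 2 - 1))]
    · have h1 : y ^ 2 = 0 := by
        have : y ^ 2 = (l * y) ^ 2 := by rw [mul_pow, hl, one_mul]
        rw [this, ← h]; norm_num
      rw [h1] at hE
      nlinarith [sq_nonneg (x ^ 2 - 1)]
  · rintro ⟨x, y⟩ ⟨hx, hy⟩ hE
    simp only [mem_ofPred_eq] at hx hy
    have h := hne _ hE (u := k * x * (k * x + 1)) (v := γ * (l * y * (l * y + 1))) (by positivity)
      (by positivity)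
    refine ne_of_gt (lt_of_lt_of_eq h ?_)
    simp only
    linear_combination (γ * ((y - l) ^ 2 * y ^ 2 - y * (y - l))) * hl +
      ((x - k) ^ 2 * x ^ 2 - x * (x - k)) * hk
  · rintro ⟨x, y⟩ ⟨hx, hy⟩ hE ⟨x', y'⟩ ⟨hx', hy'⟩ hE' c hc hcx hcy
    simp only [mem_ofPred_eq] at *
    have h := hne _ hE' (u := (k * x + k * x') * (c * (k * x + 1) + (k * x' + 1)))
      (v := γ * ((l * y + l * y') * (c * (l * y + 1) + (l * y' + 1)))) (by positivity)
      (by positivity)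
    simp only [energy] at *
    have e1 : x = k + c * (x' - k) := by linarith
    have e2 : y = l + c * (y' - l) := by linarith
    have hc1 : c = 1 := by
      by_contra hcon
      have h2 := hE.trans hE'.symm
      have h3 : (c - 1) * ((k * x + k * x') * (c * (k * x + 1) + (k * x' + 1)) * (x' - k) ^ 2 +
        γ * ((l * y + l * y') * (c * (l * y + 1) + (l * y' + 1))) * (y' - l) ^ 2) = 0 := by
        linear_combination h2 - level_sub_level hk e1 - γ * level_sub_level hl e2
      rcases mul_eq_zero.1 h3 with h4 | h4
      · exact hcon (by linarith)
      · exact h.ne' h4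
    rw [e1, e2, hc1]
    simp

/-- The level of an orbit around three equilibria is transversal to the rays. -/
theorem side_transversal {β X y : ℝ} (hγ : 0 < γ) (hβ0 : 0 < β)
    (hcon : ∀ s, 0 < s → s < 1 →
      0 < (β - s ^ 2 * (2 - s)) ^ 2 + γ * (β - s * (s ^ 2 * (2 - s))))
    (hX : 0 < X) (hE : energy γ (X, y) = β + γ) :
    0 < γ * (y ^ 3 - y) * y + (X - 1) * (X ^ 3 - X) := by
  simp only [energy] at hE
  obtain ⟨s, rfl⟩ : ∃ s, X = 1 - s := ⟨1 - X, by ring⟩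
  have hs1 : s < 1 := by linarith
  set D := s ^ 2 * (2 - s) with hD
  have hD0 : 0 ≤ D := mul_nonneg (sq_nonneg s) (by linarith)
  have hP : 0 < (β - D) ^ 2 + γ * (β - s * D) := by
    rcases le_or_gt s 0 with h | h
    · have : 0 < γ * (β - s * D) := mul_pos hγ (by nlinarith)
      positivity
    · exact hcon s h hs1
  have hE' : D * (2 - s) + γ * (y ^ 2 - 1) ^ 2 = β + γ := by rw [← hE, hD]; ring
  have h1 : γ * (y ^ 3 - y) * y + ((1 - s) - 1) * ((1 - s) ^ 3 - (1 - s)) =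
      (β + γ - D) + γ * (y ^ 2 - 1) := by rw [← hE', hD]; ring
  rw [h1]
  by_contra hneg
  have h2 : γ * (y ^ 2 - 1) ≤ -(β + γ - D) := by linarith [not_lt.1 hneg]
  have h3 : 0 ≤ β + γ - D := by nlinarith [mul_nonneg hγ.le (sq_nonneg (y ^ 2 - 1))]
  have h4 : (β + γ - D) ^ 2 ≤ (γ * (y ^ 2 - 1)) ^ 2 := by nlinarith
  have h5 : (γ * (y ^ 2 - 1)) ^ 2 = γ * (β + γ - D * (2 - s)) := by rw [← hE']; ring
  nlinarith

theorem ray_side {β m n u v : ℝ}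
    (hpos : ∀ X y : ℝ, 0 < X → energy γ (X, y) = β + γ →
      0 < γ * (y ^ 3 - y) * y + (X - 1) * (X ^ 3 - X))
    (hu : 0 < u) (huv : u < v) (hvm : 0 < 1 + v * m)
    (eu : energy γ (1 + u * m, u * n) = β + γ) (ev : energy γ (1 + v * m, v * n) = β + γ) :
    False := by
  have hG : ∀ τ, HasDerivAt (fun τ => energy γ (1 + τ * m, τ * n) - (β + γ))
      (2 * ((1 + τ * m) ^ 2 - 1) * (2 * (1 + τ * m) * m) +
        γ * (2 * ((τ * n) ^ 2 - 1) * (2 * (τ * n) * n))) τ := fun τ => by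
    have d1 : HasDerivAt (fun τ : ℝ => 1 + τ * m) m τ := by
      simpa using ((hasDerivAt_id τ).mul_const m).const_add 1
    have d2 : HasDerivAt (fun τ : ℝ => τ * n) n τ := by
      simpa using (hasDerivAt_id τ).mul_const n
    have := (((((d1.pow 2).sub_const 1).pow 2).add
      ((((d2.pow 2).sub_const 1).pow 2).const_mul γ)).sub_const (β + γ))
    refine this.congr_deriv ?_
    simp only [Pi.pow_apply]
    push_cast
    ring
  refine not_two_upcrossings huv hG (by linarith) (by linarith) fun τ hτ h0 => ?_
  have hτ0 : 0 < τ := hu.trans_le hτ.1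
  have h3 : 0 < 1 + τ * m := by
    rcases le_total 0 m with h | h
    · linarith [mul_nonneg hτ0.le h]
    · nlinarith [hτ.2]
  have h4 := hpos _ _ h3 (sub_eq_zero.1 h0)
  have h5 : 0 < τ * (2 * ((1 + τ * m) ^ 2 - 1) * (2 * (1 + τ * m) * m) +
      γ * (2 * ((τ * n) ^ 2 - 1) * (2 * (τ * n) * n))) := by
    refine lt_of_lt_of_eq (mul_pos four_pos h4) ?_
    ring
  exact (mul_pos_iff_of_pos_left hτ0).1 h5

/-- The orbits around three equilibria. -/
theorem exists_isStarOrbit_side (hγ : 0 < γ) (hk : k ^ 2 = 1)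
    (hC : ∀ φ, HasDerivAt C (γ * (S φ ^ 3 - S φ)) φ)
    (hS : ∀ φ, HasDerivAt S (-(C φ ^ 3 - C φ)) φ) (hS0 : S 0 = 0) (hC0 : 1 < k * C 0)
    (ha : (C 0 ^ 2 - 1) ^ 2 + γ < 1) (hreg : IsClassOneRegion (k * C 0) γ) :
    ∃ K, IsStarOrbit γ k 0 K C S ∧ ∀ φ, energy γ (C φ, S φ) = (C 0 ^ 2 - 1) ^ 2 + γ := by
  have hE0 : energy γ (C 0, S 0) = (C 0 ^ 2 - 1) ^ 2 + γ := by simp [energy, hS0]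
  have hC1 : (k * C 0) ^ 2 = C 0 ^ 2 := by rw [mul_pow, hk, one_mul]
  have hβ0 : 0 < (C 0 ^ 2 - 1) ^ 2 := pow_pos (by rw [← hC1]; nlinarith) 2
  have hcon : ∀ s, 0 < s → s < 1 → 0 < ((C 0 ^ 2 - 1) ^ 2 - s ^ 2 * (2 - s)) ^ 2 +
      γ * ((C 0 ^ 2 - 1) ^ 2 - s * (s ^ 2 * (2 - s))) := fun s hs hs1 => by
    have := hreg.conic_pos hs hs1
    rwa [hC1] at this
  set β := (C 0 ^ 2 - 1) ^ 2
  have hpos : ∀ X y : ℝ, 0 < X → energy γ (X, y) = β + γ →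
      0 < γ * (y ^ 3 - y) * y + (X - 1) * (X ^ 3 - X) :=
    fun X y hX hE => side_transversal hγ hβ0 hcon hX hE
  have hkE : ∀ x y, energy γ (k * x, y) = energy γ (x, y) := fun x y => by
    simp only [energy, mul_pow, hk, one_mul]
  refine (isStarOrbit_of_level (k := k) (l := 0) hγ hC hS hE0
    (U := {p | 0 < k * p.1}) (V := {p | 0 ≤ k * p.1})
    (isOpen_lt (by fun_prop) (by fun_prop)) (isClosed_le (by fun_prop) (by fun_prop))
    (fun p hp => by simp only [mem_ofPred_eq] at *; exact hp.le) ?_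
    (by simp only [mem_ofPred_eq]; linarith) ?_ ?_).imp fun K h => ⟨h.1, fun φ => (h.2 φ).1⟩
  · rintro ⟨x, y⟩ hx hE
    simp only [mem_ofPred_eq] at *
    refine lt_of_le_of_ne hx fun h => ?_
    rw [← hkE, ← h] at hE
    simp only [energy] at hE
    nlinarith [mul_nonneg hγ.le (sq_nonneg (y ^ 2 - 1))]
  · rintro ⟨x, y⟩ hx hE
    simp only [mem_ofPred_eq] at *
    have := hpos (k * x) y hx (by rw [hkE]; exact hE)
    refine ne_of_gt (lt_of_lt_of_eq this ?_)
    linear_combination (k ^ 2 * x ^ 4 + x ^ 4 - x ^ 2 - k * x ^ 3) * hk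
  · rintro ⟨x, y⟩ hx hE ⟨x', y'⟩ hx' hE' c hc hcx hcy
    simp only [mem_ofPred_eq, sub_zero] at *
    rw [← hkE] at hE hE'
    have hX : k * x = 1 + c * (k * x' - 1) := by linear_combination k * hcx + (1 - c) * hk
    have e1 : x = k + c * (x' - k) := by linarith
    set m := k * x' - 1 with hm
    have hx1 : k * x' = 1 + 1 * m := by rw [hm]; ring
    rw [hX, hcy] at hE
    rw [hX] at hx
    rw [hx1, ← one_mul y'] at hE'
    rw [hx1] at hx'
    have hc1 : c = 1 := by
      rcases lt_trichotomy c 1 with h | h | h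
      · exact (ray_side hpos hc h hx' hE hE').elim
      · exact h
      · exact (ray_side hpos one_pos h hx hE' hE).elim
    rw [e1, hcy, hc1]
    simp

theorem abs_lt_of_level {x M : ℝ} (hM : 1 < M) (h : (x ^ 2 - 1) ^ 2 < (M ^ 2 - 1) ^ 2) :
    |x| < M := by
  by_contra hcon
  have h1 : M ^ 2 ≤ x ^ 2 := by
    rw [← sq_abs x]; exact pow_le_pow_left₀ (by linarith) (not_lt.1 hcon) 2
  have h2 : 0 ≤ M ^ 2 - 1 := by nlinarith
  linarith [pow_le_pow_left₀ h2 (show M ^ 2 - 1 ≤ x ^ 2 - 1 by linarith) 2]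

namespace PerturbedSystem

theorem bounds_spec (P : PerturbedSystem) : 1 < P.Mx ∧ 1 < P.My ∧ 1 < P.orbitBound := by
  have h0 := P.γ_pos
  have h1 : 0 < √P.γ := Real.sqrt_pos.2 h0
  have hx : 2 < P.Mx ^ 2 := (Real.sqrt_lt' ((Real.sqrt_nonneg _).trans_lt P.lt_Mx)).1 P.lt_Mx
  have hy : 1 + (√P.γ)⁻¹ < P.My ^ 2 :=
    (Real.sqrt_lt' ((Real.sqrt_nonneg _).trans_lt P.lt_My)).1 P.lt_My
  have hx0 : 0 < P.Mx := (Real.sqrt_nonneg _).trans_lt P.lt_Mx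
  have hy0 : 0 < P.My := (Real.sqrt_nonneg _).trans_lt P.lt_My
  have h2 : 0 < (√P.γ)⁻¹ := inv_pos.2 h1
  refine ⟨by nlinarith, by nlinarith, lt_min ?_ (by nlinarith)⟩
  have h3 : 1 < √P.γ * (P.My ^ 2 - 1) := by
    have := mul_lt_mul_of_pos_left (show (√P.γ)⁻¹ < P.My ^ 2 - 1 by linarith) h1
    rwa [mul_inv_cancel₀ h1.ne'] at this
  have h4 : P.γ * (P.My ^ 2 - 1) ^ 2 = (√P.γ * (P.My ^ 2 - 1)) ^ 2 := by
    rw [mul_pow, Real.sq_sqrt h0.le]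
  rw [h4]
  nlinarith

theorem abs_lt_of_energy_lt (P : PerturbedSystem) {x y : ℝ}
    (h : energy P.γ (x, y) < P.orbitBound) : |x| < P.Mx ∧ |y| < P.My := by
  obtain ⟨h1, h2, -⟩ := P.bounds_spec
  have h0 := P.γ_pos
  obtain ⟨h3, h4⟩ := lt_min_iff.1 h
  simp only [energy] at h3 h4
  refine ⟨abs_lt_of_level h1 ?_, abs_lt_of_level h2 ?_⟩
  · nlinarith [mul_nonneg h0.le (sq_nonneg (y ^ 2 - 1))]
  · refine lt_of_mul_lt_mul_left (a := P.γ) ?_ h0.le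
    nlinarith [sq_nonneg (x ^ 2 - 1)]

/-- The orbits of all classes are star orbits inside the domain. -/
theorem exists_isStarOrbit (P : PerturbedSystem) {k l : ℤ} {b : ℝ} {C S : ℝ → ℝ}
    (h : IsUnperturbedOrbit P.γ l b C S) (hpar : P.IsOrbitParameter k l b)
    (hone : |k| + |l| = 1 → P.γ ≤ 0.806 ∧ (k : ℝ) * b ∈ Ioo (bMinus P.γ) (bPlus P.γ)) :
    ∃ K, IsStarOrbit P.γ k l K C S ∧ ∀ φ, |C φ| < P.Mx ∧ |S φ| < P.My := by
  obtain ⟨hC, hS, hC0, hS0⟩ := h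
  have h0 := P.γ_pos
  have h1 := P.γ_le_one
  obtain ⟨hMx, hMy, hM⟩ := P.bounds_spec
  have hsq : ∀ {z r : ℝ}, 1 < z → z < √(1 + √r) → (z ^ 2 - 1) ^ 2 < r := fun {z r} hz h => by
    have h2 := (Real.lt_sqrt (by linarith)).1 h
    exact (Real.lt_sqrt (by nlinarith)).1 (by linarith)
  have hk2 : (k = 1 ∨ k = -1) → (k : ℝ) ^ 2 = 1 := by rintro (rfl | rfl) <;> norm_num
  have hl2 : (l = 1 ∨ l = -1) → (l : ℝ) ^ 2 = 1 := by rintro (rfl | rfl) <;> norm_num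
  have hr : 0 ≤ √(1 - P.γ) := Real.sqrt_nonneg _
  have hr2 : √(1 - P.γ) ^ 2 = 1 - P.γ := Real.sq_sqrt (by linarith)
  rcases hpar with ⟨rfl, rfl, hb⟩ | ⟨hk, rfl, hb⟩ | ⟨hk, hl, hb⟩
  · simp only [Int.cast_zero] at hS0 ⊢
    rcases hb with hb | hb
    · have hb2 : C 0 ^ 2 < 1 - √(1 - P.γ) := by
        rw [hC0]; exact (Real.lt_sqrt hb.1.le).1 hb.2
      have hlt : C 0 ^ 2 < 1 := by linarith
      obtain ⟨K, hK, hφ⟩ := exists_isStarOrbit_center h0 h1 hC hS hS0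
        (by rw [hC0]; exact pow_pos hb.1 2) (by nlinarith)
      refine ⟨K, hK, fun φ => ?_⟩
      obtain ⟨e1, e2⟩ := (hφ φ).2 hlt
      exact ⟨((sq_lt_one_iff_abs_lt_one _).1 e1).trans hMx,
        ((sq_lt_one_iff_abs_lt_one _).1 e2).trans hMy⟩
    · have hb0 : 0 < b := (Real.sqrt_nonneg _).trans_lt hb.1
      have hb2 : 1 + √(1 - P.γ) < b ^ 2 := (Real.sqrt_lt' hb0).1 hb.1
      have hb1 : 1 < b := by nlinarith
      have hlt := hsq hb1 hb.2
      obtain ⟨K, hK, hφ⟩ := exists_isStarOrbit_center h0 h1 hC hS hS0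
        (by rw [hC0]; positivity) (by rw [hC0]; nlinarith)
      refine ⟨K, hK, fun φ => P.abs_lt_of_energy_lt ?_⟩
      rw [(hφ φ).1, hC0]
      linarith
  · simp only [Int.cast_zero] at hS0 ⊢
    obtain ⟨hγ, hreg⟩ := hone (by rcases hk with rfl | rfl <;> norm_num)
    have hlt := hsq hb.1 hb.2
    rw [mul_pow, hk2 hk, one_mul, ← hC0] at hlt
    rw [← hC0] at hb hreg
    obtain ⟨K, hK, hφ⟩ := exists_isStarOrbit_side h0 (hk2 hk) hC hS hS0 hb.1 (by linarith)
      (isClassOneRegion_of_mem h0 hγ hreg)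
    exact ⟨K, hK, fun φ => P.abs_lt_of_energy_lt (by rw [hφ φ]; linarith)⟩
  · have hlt := hsq hb.1 hb.2
    rw [mul_pow, hk2 hk, one_mul, ← hC0] at hlt
    rw [← hC0] at hb
    obtain ⟨K, hK, hφ⟩ := exists_isStarOrbit_corner h0 h1 (hk2 hk) (hl2 hl) hC hS hS0 hb.1 hlt
    exact ⟨K, hK, fun φ => P.abs_lt_of_energy_lt (by rw [hφ φ]; linarith)⟩

end PerturbedSystem

end OrbitClasses


/-! ### Coordinates near a closed orbit -/

section Coordinates

open Filter Topology

theorem isTorusC_const (T ω : ℝ) (n : ℕ) (c : ℝ) : IsTorusC T ω n fun _ _ => c :=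
  (isPhaseC_const (D := univ) n c).isTorusC fun _ => trivial

theorem IsStarOrbit.isTorusC {γ k l : ℝ} {K : Set (ℝ × ℝ)} {C S : ℝ → ℝ}
    (h : IsStarOrbit γ k l K C S) (T : ℝ) (n : ℕ) :
    IsTorusC T (orbitPeriod C S) n (fun _ φ => C φ) ∧
      IsTorusC T (orbitPeriod C S) n fun _ φ => S φ := by
  obtain ⟨-, hCp, hSp, -⟩ := h.period_spec
  have hC : Continuous C := continuous_iff_continuousAt.2 fun φ => (h.deriv_C φ).continuousAt
  have hS : Continuous S := continuous_iff_continuousAt.2 fun φ => (h.deriv_S φ).continuousAt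
  induction n with
  | zero =>
    exact ⟨⟨hC.comp continuous_snd, fun _ _ => rfl, fun _ => hCp⟩,
      ⟨hS.comp continuous_snd, fun _ _ => rfl, fun _ => hSp⟩⟩
  | succ n ih =>
    have h1 := (ih.1.isPhaseC univ).pow 3 |>.sub (ih.1.isPhaseC univ) |>.neg.isTorusC
      fun _ => trivial
    have h2 := (isPhaseC_const n γ).mul ((ih.2.isPhaseC univ).pow 3 |>.sub (ih.2.isPhaseC univ))
      |>.isTorusC fun _ => trivial
    exact ⟨⟨⟨hC.comp continuous_snd, _, fun _ => h.deriv_C, h2.isAngleC⟩, fun _ _ => rfl,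
        fun _ => hCp⟩,
      ⟨⟨hS.comp continuous_snd, _, fun _ => h.deriv_S, h1.isAngleC⟩, fun _ _ => rfl, fun _ => hSp⟩⟩

/-- A coordinate of the point with angle `p.1` and radial deviation `p.2.1`. -/
def rayCoord (k : ℝ) (C : ℝ → ℝ) (p : ℝ × ℝ × ℝ) : ℝ := C p.1 + (C p.1 - k) * p.2.1

/-- The energy relative to the closed orbit. -/
noncomputable def energyDefect (γ : ℝ) (k l : ℤ) (C S : ℝ → ℝ) (p : ℝ × ℝ × ℝ) : ℝ :=
  (energy γ (rayCoord k C p, rayCoord l S p) - energy γ (C 0, S 0)) * 4⁻¹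

namespace PerturbedSystem

variable (P : PerturbedSystem) (k l : ℤ) (C S : ℝ → ℝ) (t : ℝ) (p : ℝ × ℝ × ℝ)

/-- The right-hand side of the equation for `x`, without the factor `ε ^ ν`. -/
def fieldX (x y ε : ℝ) : ℝ := P.γ * (y ^ 3 - y) + P.X t x y ε * ε

/-- The right-hand side of the equation for `y`, without the factor `ε ^ ν`. -/
def fieldY (x y ε : ℝ) : ℝ := -(x ^ 3 - x) + P.Y t x y ε * ε

/-- The transversality of the orbit to the rays. -/
def transversality (φ : ℝ) : ℝ :=
  P.γ * (S φ ^ 3 - S φ) * (S φ - l) + (C φ - k) * (C φ ^ 3 - C φ)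

/-- The velocity of the angle. -/
noncomputable def angularField : ℝ :=
  ((S p.1 - l) * P.fieldX t (rayCoord k C p) (rayCoord l S p) p.2.2 -
    (C p.1 - k) * P.fieldY t (rayCoord k C p) (rayCoord l S p) p.2.2) *
    ((1 + p.2.1) * P.transversality k l C S p.1)⁻¹

/-- The velocity of the radial deviation. -/
noncomputable def radialField : ℝ :=
  (P.γ * (S p.1 ^ 3 - S p.1) * P.fieldY t (rayCoord k C p) (rayCoord l S p) p.2.2 +
    (C p.1 ^ 3 - C p.1) * P.fieldX t (rayCoord k C p) (rayCoord l S p) p.2.2) *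
    (P.transversality k l C S p.1)⁻¹

/-- The velocity of the energy, divided by `ε`. -/
def energyRate : ℝ :=
  (rayCoord k C p ^ 3 - rayCoord k C p) * P.X t (rayCoord k C p) (rayCoord l S p) p.2.2 +
    P.γ * (rayCoord l S p ^ 3 - rayCoord l S p) * P.Y t (rayCoord k C p) (rayCoord l S p) p.2.2

variable {P k l C S}

theorem angular_radial_spec (hα : P.transversality k l C S p.1 ≠ 0) (hr : 1 + p.2.1 ≠ 0) :
    (1 + p.2.1) * (P.γ * (S p.1 ^ 3 - S p.1)) * P.angularField k l C S t p +
        (C p.1 - k) * P.radialField k l C S t p =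
      P.fieldX t (rayCoord k C p) (rayCoord l S p) p.2.2 ∧
    (1 + p.2.1) * (-(C p.1 ^ 3 - C p.1)) * P.angularField k l C S t p +
        (S p.1 - l) * P.radialField k l C S t p =
      P.fieldY t (rayCoord k C p) (rayCoord l S p) p.2.2 := by
  have h1 : P.transversality k l C S p.1 = P.γ * (S p.1 ^ 3 - S p.1) * (S p.1 - l) +
    (C p.1 - k) * (C p.1 ^ 3 - C p.1) := rfl
  simp only [angularField, radialField]
  generalize P.fieldX t (rayCoord k C p) (rayCoord l S p) p.2.2 = a
  generalize P.fieldY t (rayCoord k C p) (rayCoord l S p) p.2.2 = b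
  generalize P.transversality k l C S p.1 = α at *
  constructor
  · field_simp
    rw [h1]; ring
  · field_simp
    rw [h1]; ring

theorem isPhaseC_fields {K : Set (ℝ × ℝ)} (hK : IsStarOrbit P.γ k l K C S) {r₀ ε₁ : ℝ}
    (hr₀ : r₀ < 1) (hmaps : ∀ p ∈ tube r₀ ε₁, (rayCoord k C p, rayCoord l S p, p.2.2) ∈
      perturbationDomain P.Mx P.My P.ε₀) :
    IsPhaseC P.T ((orbitPeriod C S, 0, 0) : ℝ × ℝ × ℝ) (tube r₀ ε₁) 3 (P.angularField k l C S) ∧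
    IsPhaseC P.T ((orbitPeriod C S, 0, 0) : ℝ × ℝ × ℝ) (tube r₀ ε₁) 3 (P.radialField k l C S) ∧
    IsPhaseC P.T ((orbitPeriod C S, 0, 0) : ℝ × ℝ × ℝ) (tube r₀ ε₁) 3 (P.energyRate k l C S) ∧
    IsPhaseC P.T ((orbitPeriod C S, 0, 0) : ℝ × ℝ × ℝ) (tube r₀ ε₁) 3
      (fun _ => energyDefect P.γ k l C S) ∧
    IsPhaseC P.T ((orbitPeriod C S, 0, 0) : ℝ × ℝ × ℝ) (tube r₀ ε₁) 3
      (fun t p => P.X t (rayCoord k C p) (rayCoord l S p) p.2.2) ∧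
    IsPhaseC P.T ((orbitPeriod C S, 0, 0) : ℝ × ℝ × ℝ) (tube r₀ ε₁) 3
      (fun t p => P.Y t (rayCoord k C p) (rayCoord l S p) p.2.2) := by
  obtain ⟨hC, hS⟩ := hK.isTorusC P.T 3
  have cC := hC.isPhaseC (tube r₀ ε₁)
  have cS := hS.isPhaseC (tube r₀ ε₁)
  have cr := isPhaseC_clm (T := P.T) (τ := ((orbitPeriod C S, 0, 0) : ℝ × ℝ × ℝ))
    (D := tube r₀ ε₁) 3 ((ContinuousLinearMap.fst ℝ ℝ ℝ).comp (ContinuousLinearMap.snd ℝ ℝ (ℝ × ℝ)))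
    (by simp)
  have cε := isPhaseC_clm (T := P.T) (τ := ((orbitPeriod C S, 0, 0) : ℝ × ℝ × ℝ))
    (D := tube r₀ ε₁) 3 ((ContinuousLinearMap.snd ℝ ℝ ℝ).comp (ContinuousLinearMap.snd ℝ ℝ (ℝ × ℝ)))
    (by simp)
  have cc : ∀ c : ℝ, IsPhaseC P.T ((orbitPeriod C S, 0, 0) : ℝ × ℝ × ℝ) (tube r₀ ε₁) 3
    (fun _ _ => c) := isPhaseC_const 3
  have cx := cC.add ((cC.sub (cc k)).mul cr)
  have cy := cS.add ((cS.sub (cc l)).mul cr)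
  have cX := (P.X_C3.isPhaseC P.X_periodic).comp cx cy cε fun t p hp => hmaps p hp
  have cY := (P.Y_C3.isPhaseC P.Y_periodic).comp cx cy cε fun t p hp => hmaps p hp
  have cα := ((cc P.γ).mul ((cS.pow 3).sub cS)).mul (cS.sub (cc l)) |>.add
    ((cC.sub (cc k)).mul ((cC.pow 3).sub cC))
  have hα : ∀ φ, P.transversality k l C S φ ≠ 0 := fun φ => hK.transversal _ (hK.mem φ)
  have hr1 : ∀ p ∈ tube r₀ ε₁, 1 + p.2.1 ≠ 0 := fun p hp => by
    have := (abs_le.1 hp.1).1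
    linarith
  have cfx := ((cc P.γ).mul ((cy.pow 3).sub cy)).add (cX.mul cε)
  have cfy := ((cx.pow 3).sub cx).neg.add (cY.mul cε)
  refine ⟨?_, ?_, ?_, ?_, cX, cY⟩
  · exact (((cS.sub (cc l)).mul cfx).sub ((cC.sub (cc k)).mul cfy)).mul
      ((((cc 1).add cr).mul cα).inv fun t p hp => mul_ne_zero (hr1 p hp) (hα p.1))
  · exact ((((cc P.γ).mul ((cS.pow 3).sub cS)).mul cfy).add (((cC.pow 3).sub cC).mul cfx)).mul
      (cα.inv fun t p _ => hα p.1)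
  · exact (((cx.pow 3).sub cx).mul cX).add (((cc P.γ).mul ((cy.pow 3).sub cy)).mul cY)
  · exact (((((cx.pow 2).sub (cc 1)).pow 2).add
      ((cc P.γ).mul (((cy.pow 2).sub (cc 1)).pow 2))).sub (cc _)).mul (cc 4⁻¹)

/-- The coordinates are defined near the orbit. -/
theorem exists_tube {K : Set (ℝ × ℝ)} (hK : IsStarOrbit P.γ k l K C S)
    (hb : ∀ φ, |C φ| < P.Mx ∧ |S φ| < P.My) :
    ∃ r₀ ε₁ : ℝ, 0 < r₀ ∧ r₀ < 1 ∧ 0 < ε₁ ∧ ∀ p ∈ tube r₀ ε₁,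
      (rayCoord k C p, rayCoord l S p, p.2.2) ∈ perturbationDomain P.Mx P.My P.ε₀ := by
  obtain ⟨hω, hCp, hSp, -⟩ := hK.period_spec
  have key : ∀ (k : ℝ) (F : ℝ → ℝ) (M : ℝ), Continuous F → Periodic F (orbitPeriod C S) →
      (∀ φ, |F φ| < M) → ∃ r > 0, ∀ φ s, |s| ≤ r → |F φ + (F φ - k) * s| < M := by
    intro k F M hF hp hM
    obtain ⟨φ₀, -, hφ₀⟩ := (isCompact_Icc (a := (0 : ℝ)) (b := orbitPeriod C S)).exists_isMaxOn
      ⟨0, by simp [hω.le]⟩ hF.abs.continuousOn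
    have hmax : ∀ φ, |F φ| ≤ |F φ₀| := fun φ => by
      obtain ⟨φ', h1, h2⟩ := hp.exists_mem_Ico₀ hω φ
      rw [h2]; exact hφ₀ (Ico_subset_Icc_self h1)
    have hM0 : 0 < M := (abs_nonneg _).trans_lt (hM 0)
    have hd : 0 < M + |k| := by positivity
    refine ⟨(M - |F φ₀|) / 2 / (M + |k|), div_pos (by linarith [hM φ₀]) hd, fun φ s hs => ?_⟩
    have h1 : |F φ - k| ≤ M + |k| := (abs_sub _ _).trans (by linarith [hM φ])
    have h2 : |(F φ - k) * s| ≤ (M - |F φ₀|) / 2 := by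
      rw [abs_mul]
      calc |F φ - k| * |s| ≤ (M + |k|) * ((M - |F φ₀|) / 2 / (M + |k|)) := by gcongr
        _ = _ := mul_div_cancel₀ _ hd.ne'
    linarith [abs_add_le (F φ) ((F φ - k) * s), hmax φ, hM φ₀]
  have hC : Continuous C := continuous_iff_continuousAt.2 fun φ => (hK.deriv_C φ).continuousAt
  have hS : Continuous S := continuous_iff_continuousAt.2 fun φ => (hK.deriv_S φ).continuousAt
  obtain ⟨r₁, h1, h1'⟩ := key k C P.Mx hC hCp fun φ => (hb φ).1
  obtain ⟨r₂, h2, h2'⟩ := key l S P.My hS hSp fun φ => (hb φ).2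
  refine ⟨min (1 / 2) (min r₁ r₂), P.ε₀ / 2, by positivity, ?_, by linarith [P.ε₀_pos], ?_⟩
  · exact (min_le_left _ _).trans_lt (by norm_num)
  · rintro p ⟨hp1, hp2, hp3⟩
    have h3 := hp1.trans (min_le_right _ _)
    exact ⟨h1' _ _ (h3.trans (min_le_left _ _)), h2' _ _ (h3.trans (min_le_right _ _)), hp2,
      by linarith [P.ε₀_pos]⟩

end PerturbedSystem

end Coordinates


/-! ### The normal form of the perturbed system -/

section NormalForm

open Filter Topology

/-- The radial derivative on the closed orbit. -/
theorem hasDerivAt_radial {r₀ ε₁ : ℝ} (hr₀ : 0 < r₀) (hε₁ : 0 < ε₁) {Q : ℝ × ℝ × ℝ → ℝ}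
    {Q' : ℝ × ℝ × ℝ →L[ℝ] ℝ} {φ : ℝ} (h : HasFDerivWithinAt Q Q' (tube r₀ ε₁) (φ, 0, 0)) :
    HasDerivAt (fun r => Q (φ, r, 0)) (Q' (0, 1, 0)) 0 := by
  have hl : HasDerivAt (fun r : ℝ => ((φ, r, 0) : ℝ × ℝ × ℝ)) (0, 1, 0) 0 :=
    (hasDerivAt_const 0 φ).prodMk ((hasDerivAt_id 0).prodMk (hasDerivAt_const 0 0))
  have hm : MapsTo (fun r : ℝ => ((φ, r, 0) : ℝ × ℝ × ℝ)) (Icc (-r₀) r₀) (tube r₀ ε₁) :=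
    fun r hr => ⟨abs_le.2 hr, le_rfl, hε₁.le⟩
  have := h.comp_hasDerivWithinAt (0 : ℝ) (hl.hasDerivWithinAt (s := Icc (-r₀) r₀)) hm
  exact this.hasDerivAt (Icc_mem_nhds (by linarith) hr₀)

variable {P : PerturbedSystem} {k l : ℤ} {C S : ℝ → ℝ} {K : Set (ℝ × ℝ)}

theorem hasDerivAt_rayCoord {k c' : ℝ} {c : ℝ → ℝ} (p v : ℝ × ℝ × ℝ) (hc : HasDerivAt c c' p.1) :
    HasDerivAt (fun s : ℝ => rayCoord k c (p + s • v))
      ((1 + p.2.1) * c' * v.1 + (c p.1 - k) * v.2.1) 0 := by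
  have h1 : HasDerivAt (fun s : ℝ => p.1 + s * v.1) v.1 0 := by
    simpa using ((hasDerivAt_id (0 : ℝ)).mul_const v.1).const_add p.1
  have h2 : HasDerivAt (fun s : ℝ => p.2.1 + s * v.2.1) v.2.1 0 := by
    simpa using ((hasDerivAt_id (0 : ℝ)).mul_const v.2.1).const_add p.2.1
  have hc0 : HasDerivAt c c' (p.1 + 0 * v.1) := by simpa using hc
  have h3 := hc0.comp (0 : ℝ) h1
  refine (h3.add ((h3.sub_const k).mul h2)).congr_deriv ?_
  simp only [comp_apply, zero_mul, add_zero]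
  ring

/-- The derivative of the energy along a direction. -/
theorem energyDefect_deriv (hK : IsStarOrbit P.γ k l K C S) {p v : ℝ × ℝ × ℝ} :
    DifferentiableAt ℝ (energyDefect P.γ k l C S) p ∧
    fderiv ℝ (energyDefect P.γ k l C S) p v =
      (rayCoord k C p ^ 3 - rayCoord k C p) *
        ((1 + p.2.1) * (P.γ * (S p.1 ^ 3 - S p.1)) * v.1 + (C p.1 - k) * v.2.1) +
      P.γ * (rayCoord l S p ^ 3 - rayCoord l S p) *
        ((1 + p.2.1) * (-(C p.1 ^ 3 - C p.1)) * v.1 + (S p.1 - l) * v.2.1) := by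
  have dC : Differentiable ℝ C := fun φ => (hK.deriv_C φ).differentiableAt
  have dS : Differentiable ℝ S := fun φ => (hK.deriv_S φ).differentiableAt
  have hd : DifferentiableAt ℝ (energyDefect P.γ k l C S) p := by
    unfold energyDefect energy rayCoord
    fun_prop
  refine ⟨hd, ?_⟩
  have hl : HasDerivAt (fun s : ℝ => p + s • v) v 0 := by
    simpa using ((hasDerivAt_id (0 : ℝ)).smul_const v).const_add p
  have hp : p + (0 : ℝ) • v = p := by simp
  have h1 : HasDerivAt (fun s : ℝ => energyDefect P.γ k l C S (p + s • v)) _ 0 :=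
    HasFDerivAt.comp_hasDerivAt (l := energyDefect P.γ k l C S) (0 : ℝ) (by rw [hp]; exact hd.hasFDerivAt) hl
  have dx := hasDerivAt_rayCoord (k := k) p v (hK.deriv_C p.1)
  have dy := hasDerivAt_rayCoord (k := l) p v (hK.deriv_S p.1)
  have h2 : HasDerivAt (fun s : ℝ => energyDefect P.γ k l C S (p + s • v)) _ 0 :=
    ((((((dx.pow 2).sub_const 1).pow 2)).add
      ((((dy.pow 2).sub_const 1).pow 2).const_mul P.γ)).sub_const
        (energy P.γ (C 0, S 0))).mul_const 4⁻¹
  rw [h1.unique h2]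
  simp only [Pi.pow_apply, hp]
  push_cast
  ring

theorem alphaFun_eq (hK : IsStarOrbit P.γ k l K C S) (φ : ℝ) :
    alphaFun k l C S φ = P.transversality k l C S φ := by
  rw [alphaFun, PerturbedSystem.transversality, (hK.deriv_C φ).deriv, (hK.deriv_S φ).deriv]
  ring

/-- The second radial derivative of the energy on the closed orbit. -/
noncomputable def curvatureFun (γ : ℝ) (k l : ℤ) (C S : ℝ → ℝ) (φ : ℝ) : ℝ :=
  γ * (S φ - l) ^ 2 * (3 * S φ ^ 2 - 1) + (C φ - k) ^ 2 * (3 * C φ ^ 2 - 1)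

theorem qFun_eq (hK : IsStarOrbit P.γ k l K C S) (hk : (k : ℝ) ^ 3 = k) (hl : (l : ℝ) ^ 3 = l)
    (φ : ℝ) : P.transversality k l C S φ ^ 2 * qFun P.γ k l C S φ =
      curvatureFun P.γ k l C S φ - P.transversality k l C S φ := by
  have h0 : P.transversality k l C S φ ≠ 0 := hK.transversal _ (hK.mem φ)
  rw [qFun, alphaFun_eq hK, mul_inv_cancel_left₀ (pow_ne_zero 2 h0)]
  simp only [curvatureFun, PerturbedSystem.transversality]
  linear_combination (C φ - k) * hk + P.γ * (S φ - l) * hl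

theorem hasDerivAt_transversality (hK : IsStarOrbit P.γ k l K C S) (φ : ℝ) :
    HasDerivAt (P.transversality k l C S)
      (P.γ * (3 * S φ ^ 2 - 1) * (-(C φ ^ 3 - C φ)) * (S φ - l) +
        (C φ - k) * (3 * C φ ^ 2 - 1) * (P.γ * (S φ ^ 3 - S φ))) φ := by
  have hC := hK.deriv_C φ
  have hS := hK.deriv_S φ
  refine ((((hS.pow 3).sub hS).const_mul P.γ).mul (hS.sub_const (l : ℝ)) |>.add
    ((hC.sub_const (k : ℝ)).mul ((hC.pow 3).sub hC))).congr_deriv ?_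
  simp only [Pi.pow_apply, Pi.sub_apply]
  push_cast
  ring

theorem hasDerivAt_curvatureFun (hK : IsStarOrbit P.γ k l K C S) (φ : ℝ) :
    HasDerivAt (curvatureFun P.γ k l C S)
      (2 * deriv (P.transversality k l C S) φ + 2 * pFun P.γ k l C S φ) φ := by
  have hC := hK.deriv_C φ
  have hS := hK.deriv_S φ
  rw [(hasDerivAt_transversality hK φ).deriv]
  refine ((((hS.sub_const (l : ℝ)).pow 2).const_mul P.γ).mul
    (((hS.pow 2).const_mul 3).sub_const 1) |>.add
    (((hC.sub_const (k : ℝ)).pow 2).mul (((hC.pow 2).const_mul 3).sub_const 1))).congr_deriv ?_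
  simp only [Pi.pow_apply, pFun]
  push_cast
  ring

/-- The functions `q + α⁻¹` and `-2 β` differ by a constant. -/
theorem exists_twist_const (hK : IsStarOrbit P.γ k l K C S) (hk : (k : ℝ) ^ 3 = k)
    (hl : (l : ℝ) ^ 3 = l) : ∃ c, ∀ φ, curvatureFun P.γ k l C S φ *
      ((P.transversality k l C S φ) ^ 2)⁻¹ + 2 * betaFun P.γ k l C S φ = c := by
  have h0 : ∀ φ, P.transversality k l C S φ ≠ 0 := fun φ => hK.transversal _ (hK.mem φ)
  have hα : alphaFun k l C S = P.transversality k l C S := funext (alphaFun_eq hK)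
  have hC : Continuous C := continuous_iff_continuousAt.2 fun φ => (hK.deriv_C φ).continuousAt
  have hS : Continuous S := continuous_iff_continuousAt.2 fun φ => (hK.deriv_S φ).continuousAt
  have hξ : Continuous (xiFun P.γ k l C S) := by
    have cα : Continuous (P.transversality k l C S) := by
      unfold PerturbedSystem.transversality; fun_prop
    have cα' : Continuous (deriv (P.transversality k l C S)) := by
      rw [show deriv (P.transversality k l C S) = _ from
        funext fun φ => (hasDerivAt_transversality hK φ).deriv]
      fun_prop
    have ci : Continuous fun φ => (P.transversality k l C S φ)⁻¹ := cα.inv₀ h0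
    have ci2 : Continuous fun φ => (P.transversality k l C S φ ^ 2)⁻¹ :=
      (cα.pow 2).inv₀ fun φ => pow_ne_zero 2 (h0 φ)
    unfold xiFun qFun pFun
    rw [hα]
    fun_prop
  refine ⟨_, fun φ => is_const_of_deriv_eq_zero (f := fun φ => curvatureFun P.γ k l C S φ *
      ((P.transversality k l C S φ) ^ 2)⁻¹ + 2 * betaFun P.γ k l C S φ) ?_ ?_ φ 0⟩
  all_goals
    intro φ
    have hβ : HasDerivAt (betaFun P.γ k l C S) (xiFun P.γ k l C S φ) φ :=
      (hξ.integral_hasStrictDerivAt 0 φ).hasDerivAt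
    have hd : HasDerivAt (fun φ => curvatureFun P.γ k l C S φ *
      ((P.transversality k l C S φ) ^ 2)⁻¹ + 2 * betaFun P.γ k l C S φ) _ φ :=
      ((hasDerivAt_curvatureFun hK φ).mul
        (((hasDerivAt_transversality hK φ).differentiableAt.hasDerivAt.pow 2).inv
          (pow_ne_zero 2 (h0 φ)))).add (hβ.const_mul 2)
  · exact hd.differentiableAt
  · rw [hd.deriv]
    have hq := qFun_eq hK hk hl φ
    have := h0 φ
    simp only [xiFun, hα, Pi.pow_apply, Pi.inv_apply]
    generalize deriv (P.transversality k l C S) φ = α' at *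
    generalize P.transversality k l C S φ = α at *
    push_cast
    field_simp
    linear_combination (2 * α') * hq

theorem angularField_zero (hK : IsStarOrbit P.γ k l K C S) (t φ : ℝ) :
    P.angularField k l C S t (φ, 0, 0) = 1 := by
  have h0 : P.transversality k l C S φ ≠ 0 := hK.transversal _ (hK.mem φ)
  simp only [PerturbedSystem.angularField, PerturbedSystem.fieldX, PerturbedSystem.fieldY, rayCoord,
    mul_zero, add_zero, one_mul]
  rw [← div_eq_mul_inv, div_eq_one_iff_eq h0, PerturbedSystem.transversality]
  ring

theorem hasDerivAt_angularField (hK : IsStarOrbit P.γ k l K C S) (hk : (k : ℝ) ^ 3 = k)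
    (hl : (l : ℝ) ^ 3 = l) (t φ : ℝ) : HasDerivAt (fun r => P.angularField k l C S t (φ, r, 0))
      (P.transversality k l C S φ * qFun P.γ k l C S φ) 0 := by
  have h0 : P.transversality k l C S φ ≠ 0 := hK.transversal _ (hK.mem φ)
  have d : ∀ a k : ℝ, HasDerivAt (fun r : ℝ => a + (a - k) * r) (a - k) 0 := fun a k => by
    simpa using ((hasDerivAt_id (0 : ℝ)).const_mul (a - k)).const_add a
  have dx := d (C φ) k
  have dy := d (S φ) l
  have d1 : HasDerivAt (fun r : ℝ => ((1 + r) * P.transversality k l C S φ)⁻¹) _ 0 :=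
    ((((hasDerivAt_id (0 : ℝ)).const_add 1).mul_const (P.transversality k l C S φ)).inv
      (by simpa using h0))
  have h1 := ((((dy.pow 3).sub dy).const_mul P.γ).const_mul (S φ - l)).sub
    ((((dx.pow 3).sub dx).neg).const_mul (C φ - k)) |>.mul d1
  refine (h1.congr_of_eventuallyEq (Eventually.of_forall fun r => ?_)).congr_deriv ?_
  · simp [PerturbedSystem.angularField, PerturbedSystem.fieldX, PerturbedSystem.fieldY, rayCoord]
  · have hq := qFun_eq hK hk hl φ
    have h2 : P.transversality k l C S φ * qFun P.γ k l C S φ = (curvatureFun P.γ k l C S φ -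
        P.transversality k l C S φ) * (P.transversality k l C S φ)⁻¹ := by
      rw [← hq]; field_simp
    have h3 : P.γ * (S φ ^ 3 - S φ) * (S φ - l) + (C φ - k) * (C φ ^ 3 - C φ) =
      P.transversality k l C S φ := rfl
    rw [h2]
    simp only [Pi.sub_apply, Pi.pow_apply, Pi.neg_apply, mul_zero, add_zero, id_eq, curvatureFun]
    push_cast
    generalize P.transversality k l C S φ = α at *
    field_simp
    linear_combination (-1 : ℝ) * h3

/-- The radial derivative of the energy rate in terms of `Z`. -/
theorem hasDerivAt_energyRate (hK : IsStarOrbit P.γ k l K C S) {c : ℝ}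
    (hc : ∀ φ, curvatureFun P.γ k l C S φ * ((P.transversality k l C S φ) ^ 2)⁻¹ +
      2 * betaFun P.γ k l C S φ = c) {t φ : ℝ}
    (hX : DifferentiableAt ℝ (fun r => P.X t (C φ + (C φ - k) * r) (S φ + (S φ - l) * r) 0) 0)
    (hY : DifferentiableAt ℝ (fun r => P.Y t (C φ + (C φ - k) * r) (S φ + (S φ - l) * r) 0) 0) :
    HasDerivAt (fun r => P.energyRate k l C S t (φ, r, 0))
      (P.transversality k l C S φ * (P.Z k l C S t φ + c * P.Ro k l C S t φ)) 0 := by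
  have h0 : P.transversality k l C S φ ≠ 0 := hK.transversal _ (hK.mem φ)
  have hα : alphaFun k l C S = P.transversality k l C S := funext (alphaFun_eq hK)
  have d : ∀ a k : ℝ, HasDerivAt (fun r : ℝ => a + (a - k) * r) (a - k) 0 := fun a k => by
    simpa using ((hasDerivAt_id (0 : ℝ)).const_mul (a - k)).const_add a
  have dx := d (C φ) k
  have dy := d (S φ) l
  have h1 := (((dx.pow 3).sub dx).mul hX.hasDerivAt).add
    ((((dy.pow 3).sub dy).const_mul P.γ).mul hY.hasDerivAt)
  have hR : HasDerivAt (fun r => P.R k l C S t φ r 0) _ 0 :=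
    (hY.hasDerivAt.const_mul (deriv C φ)).sub (hX.hasDerivAt.const_mul (deriv S φ))
  refine h1.congr_deriv ?_
  rw [PerturbedSystem.Z, hR.deriv]
  simp only [PerturbedSystem.Ro, PerturbedSystem.R, ← hc φ, hα,
    PerturbedSystem.PhiO, (hK.deriv_C φ).deriv, (hK.deriv_S φ).deriv,
    (hasDerivAt_transversality hK φ).deriv, Pi.sub_apply, Pi.pow_apply, mul_zero, add_zero]
  generalize deriv (fun r => P.X t (C φ + (C φ - k) * r) (S φ + (S φ - l) * r) 0) 0 = X'
  generalize deriv (fun r => P.Y t (C φ + (C φ - k) * r) (S φ + (S φ - l) * r) 0) 0 = Y'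
  generalize P.X t (C φ) (S φ) 0 = X
  generalize P.Y t (C φ) (S φ) 0 = Y
  have h3 : P.transversality k l C S φ = P.γ * (S φ ^ 3 - S φ) * (S φ - l) +
    (C φ - k) * (C φ ^ 3 - C φ) := rfl
  simp only [curvatureFun]
  generalize P.transversality k l C S φ = α at *
  push_cast
  field_simp
  linear_combination ((3 * C φ ^ 2 - 1) * (C φ - k) * X + P.γ * (3 * S φ ^ 2 - 1) * (S φ - l) * Y)
    * h3

/-- The average is linear. -/
theorem average_add_mul {T ω : ℝ} {u v : ℝ → ℝ → ℝ} (hu : Continuous (uncurry u))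
    (hv : Continuous (uncurry v)) (c : ℝ) :
    average T ω (fun t φ => u t φ + c * v t φ) = average T ω u + c * average T ω v := by
  have cu : ∀ φ, Continuous fun t => u t φ := fun φ => hu.comp (by fun_prop : Continuous fun t : ℝ => (t, φ))
  have cv : ∀ φ, Continuous fun t => v t φ := fun φ => hv.comp (by fun_prop : Continuous fun t : ℝ => (t, φ))
  have ci : ∀ {w : ℝ → ℝ → ℝ}, Continuous (uncurry w) → Continuous fun φ => ∫ t in (0 : ℝ)..T, w t φ :=
    fun {w} hw => by
      have : Continuous (uncurry fun φ t => w t φ) :=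
        hw.comp (by fun_prop : Continuous fun s : ℝ × ℝ => (s.2, s.1))
      exact intervalIntegral.continuous_parametric_intervalIntegral_of_continuous' this _ _
  have h1 : ∀ φ, (∫ t in (0 : ℝ)..T, (u t φ + c * v t φ)) =
      (∫ t in (0 : ℝ)..T, u t φ) + c * ∫ t in (0 : ℝ)..T, v t φ := fun φ => by
    rw [intervalIntegral.integral_add ((cu φ).intervalIntegrable _ _)
      (((cv φ).const_mul c).intervalIntegrable _ _), intervalIntegral.integral_const_mul]
  simp only [average, h1]
  rw [intervalIntegral.integral_add ((ci hu).intervalIntegrable _ _)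
    (((ci hv).const_mul c).intervalIntegrable _ _), intervalIntegral.integral_const_mul]
  ring

end NormalForm


/-! ### Generating functions of the averaging transformation -/

section Generators

open Filter Topology

variable {T ω : ℝ} {n : ℕ} {f v : ℝ → ℝ → ℝ}

theorem IsTorusC.of_le {m : ℕ} (h : IsTorusC T ω n f) (hm : m ≤ n) : IsTorusC T ω m f :=
  ((h.isPhaseC univ).of_le hm).isTorusC fun _ => trivial

theorem IsAngleC.integral (h : IsAngleC n f) {c : ℝ → ℝ} (hc : Continuous c) :
    IsAngleC n fun t φ => ∫ s in (0 : ℝ)..c t, f s φ := by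
  have h0 : ∀ {f : ℝ → ℝ → ℝ}, Continuous (uncurry f) →
      Continuous (uncurry fun t φ => ∫ s in (0 : ℝ)..c t, f s φ) := fun {f} hf => by
    have : Continuous (uncurry fun (p : ℝ × ℝ) s => f s p.2) :=
      hf.comp (by fun_prop : Continuous fun q : (ℝ × ℝ) × ℝ => (q.2, q.1.2))
    exact intervalIntegral.continuous_parametric_intervalIntegral_of_continuous this
      (hc.comp continuous_fst)
  induction n generalizing f with
  | zero => exact h0 h
  | succ n ih =>
    obtain ⟨hf, f', hf', h'⟩ := h
    have sw : ∀ {g : ℝ → ℝ → ℝ}, Continuous (uncurry g) → Continuous (uncurry fun φ s => g s φ) :=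
      fun hg => hg.comp (by fun_prop : Continuous fun q : ℝ × ℝ => (q.2, q.1))
    exact ⟨h0 hf, _, fun t φ => hasDerivAt_intervalIntegral_of_continuous (F := fun φ s => f s φ)
      (F' := fun φ s => f' s φ) (sw hf) (sw h'.continuous) (fun φ s => hf' s φ) 0 (c t) φ, ih h'⟩

/-- The generating functions for slow systems. -/
theorem exists_slow_generator (hT : 0 < T) (hω : 0 < ω) (hv : IsTorusC T ω 3 v)
    (hv0 : average T ω v = 0) : ∃ g K K' : ℝ → ℝ → ℝ, IsTorusC T ω 3 g ∧
      (∀ t φ, HasDerivAt (g t) (hatPart T ω v φ) φ) ∧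
      IsTorusC T ω 2 (fun _ φ => hatPart T ω v φ) ∧ IsTorusC T ω 3 K ∧
      (∀ t φ, HasDerivAt (K t) (K' t φ) φ) ∧ IsTorusC T ω 2 K' ∧
      ∀ ε t φ, HasDerivAt (fun τ => g τ (φ + ε * (τ - t)) + ε * K τ (φ + ε * (τ - t)))
        (ε * (v t φ + ε * K' t φ)) t := by
  have hmean : IsTorusC T ω 3 fun _ φ => hatPart T ω v φ := by
    have h1 : IsTorusC T ω 3 fun _ φ => ∫ t in (0 : ℝ)..T, v t φ :=
      ⟨hv.isAngleC.integral continuous_const, fun _ _ => rfl, fun _ φ => by simp only [hv.periodic_φ]⟩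
    exact ((isTorusC_const T ω 3 (1 / T)).mul h1).sub (isTorusC_const T ω 3 (average T ω v))
  have hw : ∀ φ, hatPart T ω v φ * T = ∫ t in (0 : ℝ)..T, v t φ := fun φ => by
    rw [hatPart, hv0, sub_zero]; field_simp
  set w := hatPart T ω v with hwdef
  have wc : Continuous w := hmean.continuous.comp (by fun_prop : Continuous fun φ : ℝ => ((0 : ℝ), φ))
  have wp : Periodic w ω := hmean.periodic_φ 0
  have hgd : ∀ φ, HasDerivAt (fun φ => ∫ s in (0 : ℝ)..φ, w s) (w φ) φ := fun φ =>
    (wc.integral_hasStrictDerivAt 0 φ).hasDerivAt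
  have hw0 : ∫ s in (0 : ℝ)..ω, w s = 0 := by
    have h1 : ∫ φ in (0 : ℝ)..ω, ∫ t in (0 : ℝ)..T, v t φ = 0 := by
      have : ω * T ≠ 0 := by positivity
      simpa [average, hω.ne', hT.ne'] using hv0
    simp only [← hw, intervalIntegral.integral_mul_const] at h1
    exact (mul_eq_zero.1 h1).resolve_right hT.ne'
  have hg : IsTorusC T ω 3 fun _ φ => ∫ s in (0 : ℝ)..φ, w s := by
    refine ⟨⟨?_, _, fun _ => hgd, (hmean.of_le (by norm_num : 2 ≤ 3)).isAngleC⟩, fun _ _ => rfl,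
      fun _ φ => ?_⟩
    · exact (continuous_iff_continuousAt.2 fun φ => (hgd φ).continuousAt).comp continuous_snd
    · rw [← intervalIntegral.integral_add_adjacent_intervals (wc.intervalIntegrable 0 φ)
        (wc.intervalIntegrable φ (φ + ω)), wp.intervalIntegral_add_eq φ 0, zero_add, hw0, add_zero]
  have hd := hv.sub hmean
  have dc : ∀ φ, Continuous fun s => v s φ - w φ := fun φ =>
    hd.continuous.comp (by fun_prop : Continuous fun s : ℝ => (s, φ))
  have hK : IsTorusC T ω 3 fun t φ => ∫ s in (0 : ℝ)..t, (v s φ - w φ) := by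
    refine ⟨hd.isAngleC.integral continuous_id, fun t φ => ?_, fun t φ => ?_⟩
    · have hp : Periodic (fun s => v s φ - w φ) T := fun s => by simp only [hv.periodic_t]
      have hz : ∫ s in (0 : ℝ)..T, (v s φ - w φ) = 0 := by
        have cv : Continuous fun s => v s φ :=
          hv.continuous.comp (by fun_prop : Continuous fun s : ℝ => (s, φ))
        rw [intervalIntegral.integral_sub (cv.intervalIntegrable _ _) (by simp), ← hw]
        simp [mul_comm]
      rw [← intervalIntegral.integral_add_adjacent_intervals ((dc φ).intervalIntegrable 0 t)
        ((dc φ).intervalIntegrable t (t + T)), hp.intervalIntegral_add_eq t 0, zero_add, hz, add_zero]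
    · simp only [hv.periodic_φ, wp φ]
  obtain ⟨K', hK', Kc⟩ := hK.exists_deriv
  refine ⟨_, _, K', hg, fun _ => hgd, hmean.of_le (by norm_num), hK, hK', Kc, fun ε t φ => ?_⟩
  have hu : HasDerivAt (fun τ : ℝ => φ + ε * (τ - t)) ε t := by
    simpa using (((hasDerivAt_id t).sub_const t).const_mul ε).const_add φ
  have hut : φ + ε * (t - t) = φ := by ring
  have h1 : HasDerivAt (fun τ : ℝ => ∫ s in (0 : ℝ)..(φ + ε * (τ - t)), w s) (w φ * ε) t :=
    HasDerivAt.comp (h₂ := fun φ => ∫ s in (0 : ℝ)..φ, w s) t (by rw [hut]; exact hgd φ) hu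
  have h2 := hasDerivAt_along_curve (e := 0) (d := fun t φ => v t φ - w φ) hK' Kc.continuous
    (u := fun τ : ℝ => φ + ε * (τ - t)) (t := t) (by
      simp only [zero_mul, add_zero, hut]
      exact ((dc φ).integral_hasStrictDerivAt 0 t).hasDerivAt) hu
  refine (h1.add (h2.const_mul ε)).congr_deriv ?_
  simp only [hut]
  ring

/-- The generating function for systems with a Diophantine ratio of frequencies. -/
theorem IsHomologicalSolution.generator {g : ℝ → ℝ → ℝ} (hg : IsHomologicalSolution T ω v g) :
    (∀ n, IsTorusC T ω n g) ∧ (∀ t φ, HasDerivAt (g t) (deriv (g t) φ) φ) ∧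
      IsTorusC T ω 2 (fun t φ => deriv (g t) φ) ∧
      ∀ t φ, HasDerivAt (fun τ => g τ (φ + 1 * (τ - t))) (v t φ) t := by
  have h1 : ∀ n, IsTorusC T ω n g := fun n =>
    ⟨hg.analytic.isAngleC n, hg.periodic_t, hg.periodic_φ⟩
  obtain ⟨g', hg', gc⟩ := (h1 3).exists_deriv
  have h2 : g' = fun t φ => deriv (g t) φ := funext fun t => funext fun φ => (hg' t φ).deriv.symm
  rw [h2] at gc
  refine ⟨h1, fun t φ => (hg' t φ).differentiableAt.hasDerivAt, gc, fun t φ => ?_⟩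
  have hF : HasFDerivAt (uncurry g) _ (t, φ) :=
    (hg.contDiff.differentiable one_ne_zero (t, φ)).hasFDerivAt
  have d1 : HasDerivAt (fun s => g s φ) _ t :=
    HasFDerivAt.comp_hasDerivAt (l := uncurry g) t hF ((hasDerivAt_id' t).prodMk (hasDerivAt_const t φ))
  have d2 : HasDerivAt (g t) _ φ :=
    HasFDerivAt.comp_hasDerivAt (l := uncurry g) φ hF ((hasDerivAt_const φ t).prodMk (hasDerivAt_id' φ))
  have hu : HasDerivAt (fun τ : ℝ => φ + 1 * (τ - t)) 1 t := by
    simpa using (((hasDerivAt_id t).sub_const t).const_mul 1).const_add φ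
  have hF' : HasFDerivAt (uncurry g) (fderiv ℝ (uncurry g) (t, φ)) (id t, φ + 1 * (t - t)) := by
    simpa using hF
  have d3 := hF'.comp_hasDerivAt t ((hasDerivAt_id t).prodMk hu)
  refine HasDerivAt.congr_deriv (f := fun τ => g τ (φ + 1 * (τ - t))) d3 ?_
  rw [← hg.equation t φ, d1.deriv, d2.deriv, ← map_add]
  simp

end Generators


/-! ### The invariant graph of the perturbed system -/

section PerturbedGraph

open Filter Topology

variable {P : PerturbedSystem} {k l : ℤ} {C S : ℝ → ℝ} {K : Set (ℝ × ℝ)}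

theorem energyRate_zero (hK : IsStarOrbit P.γ k l K C S) (t φ : ℝ) :
    P.energyRate k l C S t (φ, 0, 0) = P.Ro k l C S t φ := by
  simp only [PerturbedSystem.energyRate, PerturbedSystem.Ro, PerturbedSystem.R, rayCoord,
    mul_zero, add_zero, (hK.deriv_C φ).deriv, (hK.deriv_S φ).deriv]
  ring

theorem uniqueDiffOn_tube {r₀ ε₁ : ℝ} (hr₀ : 0 < r₀) (hε₁ : 0 < ε₁) :
    UniqueDiffOn ℝ (tube r₀ ε₁) := by
  rw [tube_eq]
  exact uniqueDiffOn_univ.prod ((uniqueDiffOn_Icc (by linarith)).prod (uniqueDiffOn_Icc hε₁))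

namespace PerturbedSystem

theorem exists_generator (hω : 0 < orbitPeriod C S)
    (hRo : IsTorusC P.T (orbitPeriod C S) 3 (P.Ro k l C S))
    (hgen : average P.T (orbitPeriod C S) (P.Ro k l C S) = 0)
    (hsieg : P.ν = 0 → Siegel P.T (orbitPeriod C S))
    (hana : P.ν = 0 → IsAnalyticInAngle (P.Ro k l C S)) :
    NonResonant P.T (orbitPeriod C S) (fun ε => ε ^ P.ν) ∧
    ∃ g g' K K' : ℝ → ℝ → ℝ, IsTorusC P.T (orbitPeriod C S) 2 g ∧
      (∀ t φ, HasDerivAt (g t) (g' t φ) φ) ∧ IsTorusC P.T (orbitPeriod C S) 2 g' ∧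
      IsTorusC P.T (orbitPeriod C S) 1 K ∧ (∀ t φ, HasDerivAt (K t) (K' t φ) φ) ∧
      IsTorusC P.T (orbitPeriod C S) 2 K' ∧
      (∀ ε t φ, HasDerivAt (fun τ => g τ (φ + ε ^ P.ν * (τ - t)) + ε * K τ (φ + ε ^ P.ν * (τ - t)))
        (ε ^ P.ν * (P.Ro k l C S t φ + ε * K' t φ)) t) ∧
      P.L k l C S = average P.T (orbitPeriod C S) (P.Z k l C S) -
        average P.T (orbitPeriod C S) (fun t φ => g' t φ * qFun P.γ k l C S φ) := by
  have hT := P.T_pos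
  rcases P.ν_eq with hν | hν
  · have hS := hsieg hν
    have hg : IsHomologicalSolution P.T (orbitPeriod C S) (P.Ro k l C S) (P.g0 k l C S) := by
      have h1 : P.g0 k l C S = homologicalSolution P.T (orbitPeriod C S) (P.Ro k l C S) := by
        simp only [g0, hgen, sub_zero]
      rw [h1]
      exact Classical.epsilon_spec
        (exists_isHomologicalSolution hT hω hS (hana hν) hRo.periodic_t hRo.periodic_φ hgen)
    obtain ⟨g1, g2, g3, g4⟩ := hg.generator
    simp only [hν, pow_zero]
    refine ⟨nonResonant_one hT hω hS, P.g0 k l C S, fun t φ => deriv (P.g0 k l C S t) φ,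
      fun _ _ => 0, fun _ _ => 0, g1 2, g2, g3, isTorusC_const _ _ _ _,
      fun _ φ => hasDerivAt_const φ 0, isTorusC_const _ _ _ _, fun ε t φ => ?_, by rw [L, if_pos hν]⟩
    simpa using g4 t φ
  · obtain ⟨g, K, K', h1, h2, h3, h4, h5, h6, h7⟩ := exists_slow_generator hT hω hRo hgen
    simp only [hν, pow_one]
    exact ⟨nonResonant_id hT hω, g, _, K, K', h1.of_le (by norm_num), h2, h3, h4.of_le (by norm_num),
      h5, h6, h7, by rw [L, if_neg (by omega)]⟩

theorem exists_invariant_graph {r₀ ε₁ b : ℝ} (hK : IsStarOrbit P.γ k l K C S)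
    (hk : (k : ℝ) ^ 3 = k) (hl : (l : ℝ) ^ 3 = l)
    (hadm : P.IsAdmissible k l b C S) (hana : P.ν = 0 → IsAnalyticInAngle (P.Ro k l C S))
    (hr₀ : 0 < r₀) (hr1 : r₀ < 1) (hε₁ : 0 < ε₁)
    (hmaps : ∀ p ∈ tube r₀ ε₁, (rayCoord k C p, rayCoord l S p, p.2.2) ∈
      perturbationDomain P.Mx P.My P.ε₀) :
    ∃ V₀ > 0, ∀ᶠ ε in 𝓝[>] (0 : ℝ), ∃ U : ℝ → ℝ → ℝ, ContDiff ℝ 1 (uncurry U) ∧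
      (∀ t φ, U (t + P.T) φ = U t φ) ∧ (∀ t φ, U t (φ + orbitPeriod C S) = U t φ) ∧
      (∀ t φ, |U t φ| ≤ V₀) ∧
      ∀ t₀ φ₀, ∃ u v : ℝ → ℝ, u t₀ = φ₀ ∧ (∀ t, v t = U t (u t)) ∧
        (∀ t, HasDerivAt u (ε ^ P.ν * P.angularField k l C S t (u t, ε * v t, ε)) t) ∧
        ∀ t, HasDerivAt v (ε ^ P.ν * ε⁻¹ * P.radialField k l C S t (u t, ε * v t, ε)) t := by
  have hω := hK.period_spec.1
  obtain ⟨cf, cρ, cR, ch, cX, cY⟩ := isPhaseC_fields hK hr1 hmaps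
  have h00 : ∀ φ : ℝ, ((φ, 0, 0) : ℝ × ℝ × ℝ) ∈ tube r₀ ε₁ := fun φ => by simp [tube, hr₀.le, hε₁.le]
  have hα0 : ∀ φ, P.transversality k l C S φ ≠ 0 := fun φ => hK.transversal _ (hK.mem φ)
  have hRo : IsTorusC P.T (orbitPeriod C S) 3 (P.Ro k l C S) := by
    have := cR.isTorusC h00
    simpa only [energyRate_zero hK] using this
  obtain ⟨hres, g, g', K₁, K', hg, hg', gc, hK₁, hK', Kc, hgK, hL⟩ :=
    exists_generator hω hRo hadm.generating hadm.siegel hana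
  obtain ⟨c, hc⟩ := exists_twist_const hK hk hl
  obtain ⟨-, f', hf', fc⟩ := id cf
  obtain ⟨-, R', hR', Rc⟩ := id cR
  obtain ⟨-, h', hh', hhc⟩ := id ch
  obtain ⟨-, X', hX', -⟩ := cX
  obtain ⟨-, Y', hY', -⟩ := cY
  have ef : ∀ t φ, f' t (φ, 0, 0) (0, 1, 0) = P.transversality k l C S φ * qFun P.γ k l C S φ :=
    fun t φ => (hasDerivAt_radial hr₀ hε₁ (hf' t _ (h00 φ))).unique
      (hasDerivAt_angularField hK hk hl t φ)
  have eR : ∀ t φ, R' t (φ, 0, 0) (0, 1, 0) =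
      P.transversality k l C S φ * (P.Z k l C S t φ + c * P.Ro k l C S t φ) := fun t φ =>
    (hasDerivAt_radial hr₀ hε₁ (hR' t _ (h00 φ))).unique (hasDerivAt_energyRate hK hc
      (hasDerivAt_radial hr₀ hε₁ (hX' t _ (h00 φ))).differentiableAt
      (hasDerivAt_radial hr₀ hε₁ (hY' t _ (h00 φ))).differentiableAt)
  have eh : ∀ t, ∀ p ∈ tube r₀ ε₁, fderiv ℝ (energyDefect P.γ k l C S) p = h' t p := fun t p hp =>
    (uniqueDiffOn_tube hr₀ hε₁ p hp).eq
      (energyDefect_deriv hK (v := 0)).1.hasFDerivAt.hasFDerivWithinAt (hh' t p hp)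
  have hh0 : ∀ φ, energyDefect P.γ k l C S (φ, 0, 0) = 0 := fun φ => by
    simp only [energyDefect, rayCoord, mul_zero, add_zero, energy_eq hK.deriv_C hK.deriv_S φ,
      sub_self, zero_mul]
  have hC : Continuous C := continuous_iff_continuousAt.2 fun φ => (hK.deriv_C φ).continuousAt
  have hS : Continuous S := continuous_iff_continuousAt.2 fun φ => (hK.deriv_S φ).continuousAt
  have cα : Continuous (P.transversality k l C S) := by unfold transversality; fun_prop
  have hLav : average P.T (orbitPeriod C S) (fun t φ => (P.transversality k l C S φ)⁻¹ *
      (R' t (φ, 0, 0) (0, 1, 0) - f' t (φ, 0, 0) (0, 1, 0) * g' t φ)) = P.L k l C S := by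
    have e1 : (fun t φ => (P.transversality k l C S φ)⁻¹ *
        (R' t (φ, 0, 0) (0, 1, 0) - f' t (φ, 0, 0) (0, 1, 0) * g' t φ)) = fun t φ =>
        (P.Z k l C S t φ + c * P.Ro k l C S t φ) + (-1) * (g' t φ * qFun P.γ k l C S φ) := by
      funext t φ
      rw [ef, eR]
      field_simp [hα0 φ]
      ring
    have cZ' : Continuous (uncurry fun t φ => P.Z k l C S t φ + c * P.Ro k l C S t φ) := by
      have h1 := ((cα.comp continuous_snd).inv₀ fun q : ℝ × ℝ => hα0 q.2).mul
        ((Rc (0, 1, 0)).isTorusC h00).continuous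
      refine h1.congr fun q => ?_
      simp only [eR]
      exact inv_mul_cancel_left₀ (hα0 q.2) _
    have cZ : Continuous (uncurry (P.Z k l C S)) :=
      (cZ'.sub (hRo.continuous.const_mul c)).congr fun q => by simp [uncurry]
    have cq : Continuous (uncurry fun t φ => g' t φ * qFun P.γ k l C S φ) := by
      refine gc.continuous.mul (Continuous.comp (g := qFun P.γ k l C S) ?_ continuous_snd)
      unfold qFun
      rw [show alphaFun k l C S = P.transversality k l C S from funext (alphaFun_eq hK)]
      exact ((cα.pow 2).inv₀ fun φ => pow_ne_zero 2 (hα0 φ)).mul (by fun_prop)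
    rw [e1, average_add_mul cZ' cq, average_add_mul cZ hRo.continuous, hadm.generating, hL]
    ring
  refine exists_invariant_graph_of_smooth P.T_pos hω hr₀ hε₁ ?_ hres
    (cf.of_le (by norm_num)) (cρ.of_le (by norm_num)) (ch.of_le (by norm_num)) hf' fc hR' Rc
    (fun p hp => (energyDefect_deriv hK (v := 0)).1.hasFDerivAt.hasFDerivWithinAt)
    (fun v => (hhc v).congr (fun p hp => tube_add hp) fun t p hp => by rw [eh t p hp])
    (angularField_zero hK) hα0 hh0 (fun φ => ?_) (fun φ => ?_) (fun t p hp => ?_) hg hg' gc hK₁ hK' Kc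
    (Eventually.of_forall fun ε t φ => by simpa only [energyRate_zero hK] using hgK ε t φ)
    (by rw [hLav]; exact hadm.dissipative)
  · filter_upwards [self_mem_nhdsWithin] with ε hε using pow_pos hε _
  · rw [(energyDefect_deriv hK).2]
    simp only [rayCoord, transversality]
    ring
  · rw [(energyDefect_deriv hK).2]
    simp
  · have hr : 1 + p.2.1 ≠ 0 := by linarith [(abs_le.1 hp.1).1]
    obtain ⟨s1, s2⟩ := angular_radial_spec t p (hα0 p.1) hr
    rw [(energyDefect_deriv hK).2]
    simp only
    rw [s1, s2, fieldX, fieldY, energyRate]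
    ring

end PerturbedSystem

end PerturbedGraph


/-! ### Invariant tori -/

section InvariantTori

open Filter Topology

/-- A doubly periodic function that separates the points of the torus is a homeomorphism of the
torus onto its range. -/
theorem exists_homeomorph_range_of_periodic {T ω : ℝ} (hT : 0 < T) (hω : 0 < ω) {Y : Type*}
    [TopologicalSpace Y] [T2Space Y] {f : ℝ × ℝ → Y} (hf : Continuous f)
    (hfT : ∀ t φ, f (t + T, φ) = f (t, φ)) (hfω : ∀ t φ, f (t, φ + ω) = f (t, φ))
    (hinj : ∀ t φ t' φ', f (t, φ) = f (t', φ') →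
      (t : AddCircle T) = t' ∧ (φ : AddCircle ω) = φ') :
    ∃ e : AddCircle T × AddCircle ω ≃ₜ range f, ∀ t φ : ℝ,
      (e ((t : AddCircle T), (φ : AddCircle ω)) : Y) = f (t, φ) := by
  have : Fact (0 < T) := ⟨hT⟩
  have : Fact (0 < ω) := ⟨hω⟩
  let π : ℝ × ℝ → AddCircle T × AddCircle ω := Prod.map (fun t => (t : AddCircle T)) fun φ => (φ : AddCircle ω)
  have hπ : IsOpenQuotientMap π :=
    QuotientAddGroup.isOpenQuotientMap_mk.prodMap QuotientAddGroup.isOpenQuotientMap_mk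
  have hdiff : ∀ {p x y : ℝ}, (x : AddCircle p) = y → ∃ n : ℤ, x = y + n • p := fun {p x y} h => by
    rw [← sub_eq_zero, ← AddCircle.coe_sub, AddCircle.coe_eq_zero_iff] at h
    obtain ⟨n, hn⟩ := h
    exact ⟨n, by rw [hn]; ring⟩
  have hfib : ∀ s s', π s = π s' → f s = f s' := by
    rintro ⟨t, φ⟩ ⟨t', φ'⟩ h
    obtain ⟨m, hm⟩ := hdiff (congrArg Prod.fst h)
    obtain ⟨n, hn⟩ := hdiff (congrArg Prod.snd h)
    have p1 : Periodic (fun t => f (t, φ)) T := fun t => hfT t φ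
    have p2 : Periodic (fun φ => f (t', φ)) ω := fun φ => hfω t' φ
    have e1 := p1.zsmul m t'
    have e2 := p2.zsmul n φ'
    simp only [← hm, ← hn] at e1 e2
    exact e1.trans e2
  let F : AddCircle T × AddCircle ω → range f := fun x => ⟨f (surjInv hπ.surjective x), _, rfl⟩
  have hF : ∀ s, (F (π s) : Y) = f s := fun s => hfib _ _ (surjInv_eq hπ.surjective (π s))
  have hFc : Continuous F := by
    refine hπ.continuous_comp_iff.1 (continuous_induced_rng.2 ?_)
    exact hf.congr fun s => (hF s).symm
  have hFb : Bijective F := by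
    constructor
    · intro x y hxy
      obtain ⟨⟨t, φ⟩, rfl⟩ := hπ.surjective x
      obtain ⟨⟨t', φ'⟩, rfl⟩ := hπ.surjective y
      have h1 := congrArg Subtype.val hxy
      rw [hF, hF] at h1
      obtain ⟨e1, e2⟩ := hinj _ _ _ _ h1
      exact Prod.ext e1 e2
    · rintro ⟨-, s, rfl⟩
      exact ⟨π s, Subtype.ext (hF s)⟩
  exact ⟨Continuous.homeoOfEquivCompactToT2 (f := Equiv.ofBijective F hFb) hFc,
    fun t φ => hF (t, φ)⟩

/-- Functions of class `C¹` in the phase variables are locally Lipschitz, locally uniformly in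
time. -/
theorem IsPhaseC.locally_lipschitz {T : ℝ} {τ : ℝ × ℝ × ℝ} {D : Set (ℝ × ℝ × ℝ)} (hD : Convex ℝ D)
    {Q : ℝ → ℝ × ℝ × ℝ → ℝ} (hQ : IsPhaseC T τ D 1 Q) (t₀ : ℝ) {p₀ : ℝ × ℝ × ℝ} (hp₀ : p₀ ∈ D) :
    ∃ K : NNReal, ∃ N ∈ 𝓝 p₀, ∀ᶠ t in 𝓝 t₀, LipschitzOnWith K (Q t) (N ∩ D) := by
  obtain ⟨-, Q', hQ', qc⟩ := hQ
  have hb : ∀ v, ∀ᶠ s in 𝓝[univ ×ˢ D] (t₀, p₀), |Q' s.1 s.2 v| < |Q' t₀ p₀ v| + 1 := fun v =>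
    ((qc v).isPeriodicCont.continuousOn (t₀, p₀) ⟨trivial, hp₀⟩).abs.eventually
      (gt_mem_nhds (by simp [uncurry]))
  set B := |Q' t₀ p₀ (1, 0, 0)| + 1 + (|Q' t₀ p₀ (0, 1, 0)| + 1) + (|Q' t₀ p₀ (0, 0, 1)| + 1) with hB
  have h1 : ∀ᶠ s in 𝓝[univ ×ˢ D] (t₀, p₀), ‖Q' s.1 s.2‖ ≤ B := by
    filter_upwards [hb (1, 0, 0), hb (0, 1, 0), hb (0, 0, 1)] with s a b c
    linarith [clm_norm_le (Q' s.1 s.2)]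
  rw [nhdsWithin_prod_eq, nhdsWithin_univ] at h1
  obtain ⟨pa, ha, pb, hb', hab⟩ := eventually_prod_iff.1 h1
  obtain ⟨δ, hδ, hδ'⟩ := Metric.mem_nhdsWithin_iff.1 hb'
  refine ⟨B.toNNReal, Metric.ball p₀ δ, Metric.ball_mem_nhds p₀ hδ, ?_⟩
  filter_upwards [ha] with t ht
  refine Convex.lipschitzOnWith_of_nnnorm_hasFDerivWithin_le
    (fun x hx => (hQ' t x hx.2).mono inter_subset_right) (fun x hx => ?_)
    ((convex_ball p₀ δ).inter hD)
  rw [← NNReal.coe_le_coe, coe_nnnorm]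
  exact (hab ht (hδ' hx)).trans (Real.le_coe_toNNReal B)

variable {P : PerturbedSystem} {k l : ℤ} {C S : ℝ → ℝ} {K : Set (ℝ × ℝ)}

namespace PerturbedSystem

theorem convex_perturbationDomain (Mx My ε₀ : ℝ) : Convex ℝ (perturbationDomain Mx My ε₀) := by
  have : perturbationDomain Mx My ε₀ = Ioo (-Mx) Mx ×ˢ Ioo (-My) My ×ˢ Ico 0 ε₀ := by
    ext p
    simp only [perturbationDomain, mem_ofPred_eq, mem_prod, mem_Ioo, mem_Ico, abs_lt]
  rw [this]
  exact (convex_Ioo _ _).prod ((convex_Ioo _ _).prod (convex_Ico _ _))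

theorem isPhaseC_field : IsPhaseC P.T 0 (perturbationDomain P.Mx P.My P.ε₀) 1
      (fun t p => P.fieldX t p.1 p.2.1 p.2.2 * p.2.2 ^ P.ν) ∧
    IsPhaseC P.T 0 (perturbationDomain P.Mx P.My P.ε₀) 1
      (fun t p => P.fieldY t p.1 p.2.1 p.2.2 * p.2.2 ^ P.ν) := by
  let D := perturbationDomain P.Mx P.My P.ε₀
  have c1 := isPhaseC_clm (T := P.T) (τ := 0) (D := D) 3 (ContinuousLinearMap.fst ℝ ℝ (ℝ × ℝ)) (by simp)
  have c2 := isPhaseC_clm (T := P.T) (τ := 0) (D := D) 3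
    ((ContinuousLinearMap.fst ℝ ℝ ℝ).comp (ContinuousLinearMap.snd ℝ ℝ (ℝ × ℝ))) (by simp)
  have c3 := isPhaseC_clm (T := P.T) (τ := 0) (D := D) 3
    ((ContinuousLinearMap.snd ℝ ℝ ℝ).comp (ContinuousLinearMap.snd ℝ ℝ (ℝ × ℝ))) (by simp)
  have cX := ((((isPhaseC_const 3 P.γ).mul ((c2.pow 3).sub c2)).add
    ((P.X_C3.isPhaseC P.X_periodic).mul c3)).mul (c3.pow P.ν)).of_le (show 1 ≤ 3 by norm_num)
  have cY := ((((c1.pow 3).sub c1).neg.add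
    ((P.Y_C3.isPhaseC P.Y_periodic).mul c3)).mul (c3.pow P.ν)).of_le (show 1 ≤ 3 by norm_num)
  exact ⟨cX, cY⟩

theorem locally_lipschitz_field {ε : ℝ} (hε : 0 ≤ ε) (hε₀ : ε < P.ε₀) (t₀ : ℝ) (p₀ : ℝ × ℝ)
    (hp₀ : p₀ ∈ {p : ℝ × ℝ | |p.1| < P.Mx ∧ |p.2| < P.My}) :
    ∃ K : NNReal, ∃ N ∈ 𝓝 p₀, ∀ᶠ t in 𝓝 t₀, LipschitzOnWith K (fun p : ℝ × ℝ =>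
      (P.fieldX t p.1 p.2 ε * ε ^ P.ν, P.fieldY t p.1 p.2 ε * ε ^ P.ν)) N := by
  let D := perturbationDomain P.Mx P.My P.ε₀
  obtain ⟨cX, cY⟩ := P.isPhaseC_field
  have hD := convex_perturbationDomain P.Mx P.My P.ε₀
  have hmem : (p₀.1, p₀.2, ε) ∈ D := ⟨hp₀.1, hp₀.2, hε, hε₀⟩
  obtain ⟨K₁, N₁, hN₁, h1⟩ := cX.locally_lipschitz hD t₀ hmem
  obtain ⟨K₂, N₂, hN₂, h2⟩ := cY.locally_lipschitz hD t₀ hmem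
  let ι : ℝ × ℝ → ℝ × ℝ × ℝ := fun p => (p.1, p.2, ε)
  have hι : LipschitzWith 1 ι := by
    have := LipschitzWith.prod_fst (α := ℝ) (β := ℝ) |>.prodMk
      ((LipschitzWith.prod_snd (α := ℝ) (β := ℝ)).prodMk (LipschitzWith.const ε))
    simpa using this
  have hΩ : IsOpen ({p | |p.1| < P.Mx} ∩ {p | |p.2| < P.My} : Set (ℝ × ℝ)) :=
    (isOpen_lt (by fun_prop) (by fun_prop)).inter (isOpen_lt (by fun_prop) (by fun_prop))
  set Ω : Set (ℝ × ℝ) := {p | |p.1| < P.Mx} ∩ {p | |p.2| < P.My}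
  have hmaps : ∀ p ∈ Ω, ι p ∈ D := fun p hp => ⟨hp.1, hp.2, hε, hε₀⟩
  have m₁ : MapsTo ι ((ι ⁻¹' N₁ ∩ ι ⁻¹' N₂) ∩ Ω) (N₁ ∩ D) := fun p hp => ⟨hp.1.1, hmaps p hp.2⟩
  have m₂ : MapsTo ι ((ι ⁻¹' N₁ ∩ ι ⁻¹' N₂) ∩ Ω) (N₂ ∩ D) := fun p hp => ⟨hp.1.2, hmaps p hp.2⟩
  refine ⟨max (K₁ * 1) (K₂ * 1), (ι ⁻¹' N₁ ∩ ι ⁻¹' N₂) ∩ Ω, inter_mem (inter_mem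
    (hι.continuous.continuousAt hN₁) (hι.continuous.continuousAt hN₂)) (hΩ.mem_nhds hp₀), ?_⟩
  filter_upwards [h1, h2] with t e1 e2
  have a₁ := e1.comp hι.lipschitzOnWith m₁
  have a₂ := e2.comp hι.lipschitzOnWith m₂
  exact a₁.prodMk a₂

/-- An invariant graph in the coordinates near the orbit is an invariant surface. -/
theorem isInvariant_surface {ε : ℝ} (hε : 0 < ε) (hε₀ : ε < P.ε₀)
    (hK : IsStarOrbit P.γ k l K C S) {U : ℝ → ℝ → ℝ}
    (hU : ∀ t φ, |ε * U t φ| < 1 ∧ |rayCoord k C (φ, ε * U t φ, ε)| < P.Mx ∧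
      |rayCoord l S (φ, ε * U t φ, ε)| < P.My)
    (hsol : ∀ t₀ φ₀, ∃ u v : ℝ → ℝ, u t₀ = φ₀ ∧ (∀ t, v t = U t (u t)) ∧
        (∀ t, HasDerivAt u (ε ^ P.ν * P.angularField k l C S t (u t, ε * v t, ε)) t) ∧
        ∀ t, HasDerivAt v (ε ^ P.ν * ε⁻¹ * P.radialField k l C S t (u t, ε * v t, ε)) t) :
    P.IsInvariant ε (surface k l C S fun t φ => ε * U t φ) := by
  have hex : ∀ m ∈ surface k l C S (fun t φ => ε * U t φ), ∃ x y : ℝ → ℝ,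
      P.IsSolutionOn ε univ x y ∧ x m.1 = m.2.1 ∧ y m.1 = m.2.2 ∧
      ∀ t, (t, x t, y t) ∈ surface k l C S (fun t φ => ε * U t φ) := by
    rintro - ⟨⟨t₀, φ₀⟩, rfl⟩
    obtain ⟨u, v, rfl, hv, hu, hv'⟩ := hsol t₀ φ₀
    have hpt : ∀ t, (rayCoord k C (u t, ε * v t, ε), rayCoord l S (u t, ε * v t, ε)) =
        surfacePoint k l C S (fun t φ => ε * U t φ) t (u t) := fun t => by
      simp only [rayCoord, surfacePoint, hv t]
      rw [mul_comm (C (u t) - k), mul_comm (S (u t) - l)]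
    refine ⟨fun t => rayCoord k C (u t, ε * v t, ε), fun t => rayCoord l S (u t, ε * v t, ε),
      fun t _ => ?_, ?_, ?_, fun t => ⟨(t, u t), ?_⟩⟩
    · obtain ⟨h1, h2, h3⟩ := hU t (u t)
      rw [← hv t] at h1 h2 h3
      have hr : 1 + ε * v t ≠ 0 := by linarith [(abs_lt.1 h1).1]
      obtain ⟨s1, s2⟩ := angular_radial_spec (P := P) (k := k) (l := l) (C := C) (S := S) t
        (u t, ε * v t, ε) (hK.transversal _ (hK.mem (u t))) hr
      have key : ∀ {c : ℝ → ℝ} {c' a : ℝ}, HasDerivAt c c' (u t) →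
          HasDerivAt (fun t => rayCoord a c (u t, ε * v t, ε)) (((1 + ε * v t) * c' *
            P.angularField k l C S t (u t, ε * v t, ε) + (c (u t) - a) *
            P.radialField k l C S t (u t, ε * v t, ε)) * ε ^ P.ν) t := fun {c c' a} hc => by
        have d1 := hc.comp t (hu t)
        refine (d1.add ((d1.sub_const a).mul ((hv' t).const_mul ε))).congr_deriv ?_
        simp only [comp_apply]
        field_simp
        ring
      refine ⟨h2, h3, (key (hK.deriv_C (u t))).congr_deriv ?_, (key (hK.deriv_S (u t))).congr_deriv ?_⟩
      · rw [s1, fieldX]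
      · rw [s2, fieldY]
    · exact congrArg Prod.fst (hpt t₀)
    · exact congrArg Prod.snd (hpt t₀)
    · exact congrArg (Prod.mk t) (hpt t).symm
  refine ⟨hex, fun J x y hJ hJc hxy t₀ ht₀ hm t ht => ?_⟩
  obtain ⟨x', y', hs, hx0, hy0, hmem⟩ := hex _ hm
  have h := eqOn_of_locally_lipschitz (v := fun t p =>
      (P.fieldX t p.1 p.2 ε * ε ^ P.ν, P.fieldY t p.1 p.2 ε * ε ^ P.ν))
    (Ω := {p : ℝ × ℝ | |p.1| < P.Mx ∧ |p.2| < P.My})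
    (fun t₀ p₀ hp₀ => locally_lipschitz_field hε.le hε₀ t₀ p₀ hp₀) hJ hJc.isPreconnected
    (f := fun t => (x t, y t)) (g := fun t => (x' t, y' t))
    (fun t ht => ⟨⟨(hxy t ht).1, (hxy t ht).2.1⟩, (hxy t ht).2.2.1.prodMk (hxy t ht).2.2.2⟩)
    (fun t _ => (hs t trivial).2.2.1.prodMk (hs t trivial).2.2.2) ht₀ (Prod.ext hx0.symm hy0.symm) t ht
  have h' := hmem t
  rwa [← h] at h'

end PerturbedSystem

end InvariantTori

theorem theorem1 (P : PerturbedSystem) (k l : ℤ) (b : ℝ) (C S : ℝ → ℝ)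
    (horbit : IsUnperturbedOrbit P.γ l b C S)
    (hadm : P.IsAdmissible k l b C S)
    (hanalytic : P.ν = 0 → IsAnalyticInAngle (P.Ro k l C S)) :
    (0 < orbitPeriod C S ∧ Function.Periodic C (orbitPeriod C S) ∧
      Function.Periodic S (orbitPeriod C S)) ∧
    ∃ ε₁ K : ℝ, 0 < ε₁ ∧ ε₁ ≤ P.ε₀ ∧ ∃ U : ℝ → ℝ → ℝ → ℝ,
      ∀ ε : ℝ, 0 < ε → ε < ε₁ →
        ContDiff ℝ 1 (Function.uncurry (U ε)) ∧
        (∀ t φ, U ε (t + P.T) φ = U ε t φ) ∧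
        (∀ t φ, U ε t (φ + orbitPeriod C S) = U ε t φ) ∧
        (∀ t φ, |U ε t φ| ≤ K * ε) ∧
        P.IsInvariant ε (surface k l C S (U ε)) ∧
        ∃ e : AddCircle P.T × AddCircle (orbitPeriod C S) ≃ₜ
            factoredSurface P.T k l C S (U ε),
          ∀ t φ : ℝ, (e ((t : AddCircle P.T), (φ : AddCircle (orbitPeriod C S))) :
              AddCircle P.T × ℝ × ℝ) = ((t : AddCircle P.T), surfacePoint k l C S (U ε) t φ) := by
  obtain ⟨Ks, hK, hb⟩ := P.exists_isStarOrbit horbit hadm.parameter hadm.classOne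
  obtain ⟨hω, hCp, hSp, hray⟩ := hK.period_spec
  refine ⟨⟨hω, hCp, hSp⟩, ?_⟩
  have hk : (k : ℝ) ^ 3 = k := by
    rcases hadm.parameter with ⟨rfl, -⟩ | ⟨rfl | rfl, -⟩ | ⟨rfl | rfl, -⟩ <;> norm_num
  have hl : (l : ℝ) ^ 3 = l := by
    rcases hadm.parameter with ⟨-, rfl, -⟩ | ⟨-, rfl, -⟩ | ⟨-, rfl | rfl, -⟩ <;> norm_num
  obtain ⟨r₀, ε₁, hr₀, hr1, hε₁, hmaps⟩ := PerturbedSystem.exists_tube hK hb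
  obtain ⟨V, hV, hgraph⟩ := PerturbedSystem.exists_invariant_graph hK hk hl hadm hanalytic hr₀ hr1
    hε₁ hmaps
  obtain ⟨ε₂, hε₂, hgraph⟩ := mem_nhdsGT_iff_exists_Ioo_subset.1 hgraph
  have hex : ∀ ε ∈ Ioo 0 ε₂, _ := fun ε hε => hgraph hε
  choose! U hU using hex
  have hε₂' : (0 : ℝ) < ε₂ := hε₂
  refine ⟨min (min ε₁ ε₂) (min P.ε₀ (r₀ / V)), V, ?_, (min_le_right _ _).trans (min_le_left _ _),
    fun ε t φ => ε * U ε t φ, fun ε hε hεlt => ?_⟩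
  · have := P.ε₀_pos
    positivity
  simp only [lt_min_iff, lt_div_iff₀ hV] at hεlt
  obtain ⟨⟨e1, e2⟩, e3, e4⟩ := hεlt
  obtain ⟨hsm, hT, hφ, hbd, hsol⟩ := hU ε ⟨hε, e2⟩
  have habs : ∀ t φ, |ε * U ε t φ| ≤ V * ε := fun t φ => by
    rw [abs_mul, abs_of_pos hε, mul_comm]
    exact mul_le_mul_of_nonneg_right (hbd t φ) hε.le
  have hlt : ∀ t φ, |ε * U ε t φ| < r₀ := fun t φ => (habs t φ).trans_lt (by linarith)
  have hpos : ∀ t φ, 0 < 1 + ε * U ε t φ := fun t φ => by linarith [(abs_lt.1 (hlt t φ)).1]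
  have hCc : Continuous C := continuous_iff_continuousAt.2 fun φ => (hK.deriv_C φ).continuousAt
  have hSc : Continuous S := continuous_iff_continuousAt.2 fun φ => (hK.deriv_S φ).continuousAt
  have hUc : Continuous fun s : ℝ × ℝ => U ε s.1 s.2 := hsm.continuous
  refine ⟨contDiff_const.mul hsm, fun t φ => congrArg (ε * ·) (hT t φ),
    fun t φ => congrArg (ε * ·) (hφ t φ), habs,
    PerturbedSystem.isInvariant_surface hε e3 hK (fun t φ => ?_) hsol, ?_⟩
  · obtain ⟨m1, m2, -⟩ := hmaps (φ, ε * U ε t φ, ε) ⟨(hlt t φ).le, hε.le, e1.le⟩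
    exact ⟨(hlt t φ).trans hr1, m1, m2⟩
  · refine exists_homeomorph_range_of_periodic P.T_pos hω (f := fun s : ℝ × ℝ =>
      ((s.1 : AddCircle P.T), surfacePoint k l C S (fun t φ => ε * U ε t φ) s.1 s.2)) ?_ ?_ ?_ ?_
    · refine ((AddCircle.continuous_mk' P.T).comp continuous_fst).prodMk ?_
      unfold surfacePoint
      fun_prop
    · intro t φ
      simp only [surfacePoint, hT, AddCircle.coe_add_period]
    · intro t φ
      simp only [surfacePoint, hφ, hCp φ, hSp φ]
    · intro t φ t' φ' h
      obtain ⟨h1, h2⟩ := Prod.ext_iff.1 h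
      obtain ⟨h3, h4⟩ := Prod.ext_iff.1 h2
      simp only [surfacePoint] at h1 h3 h4
      have hp := hpos t φ
      obtain ⟨n, hn⟩ := hray φ φ' ((1 + ε * U ε t' φ') / (1 + ε * U ε t φ)) (div_pos (hpos _ _) hp)
        (by field_simp; linarith) (by field_simp; linarith)
      refine ⟨h1, ?_⟩
      rw [hn, ← zsmul_eq_mul, AddCircle.coe_add, AddCircle.coe_zsmul, AddCircle.coe_period,
        smul_zero, add_zero]
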